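/- Let $M$ be a compact complex manifold with smooth boundary $\partial M$, of complex dimension $n\ge 2$, with a smooth Hermitian metric $\omega=\sqrt{-1}\,\omega_{\bar k j}\,dz^j\wedge d\bar z^k$ (all structures and holomorphic coordinates smooth up to the boundary). Let $\chi=\sqrt{-1}\,\chi_{\bar k j}\,dz^j\wedge d\bar z^k$ be a smooth real $(1,1)$-form and let $1\le p\le n$. For a real function $u$ put $g_{\bar k j}=\chi_{\bar k j}+u_{\bar k j}$, where $u_{\bar k j}=\partial_{\bar k}\partial_j u$, let $\lambda_1,\dots,\lambda_n$ be the eigenvalues of the endomorphism $g^i{}_j=\omega^{i\bar k}g_{\bar k j}$, and set $$\mathcal M_p(u)=\prod_{1\le i_1<\cdots<i_p\le n}(\lambda_{i_1}+\cdots+\lambda_{i_p}).$$ A $C^2$ function $u$ is called admissible if $\lambda_{i_1}+\cdots+\lambda_{i_p}>0$ for all $i_1<\cdots<i_p$ at every point of $M$. Let $\underline u\in C^\infty(M)$ be admissible, with boundary values $\varphi=\underline u|_{\partial M}$. Fix a $C^2$ norm on $M$ (defined by finitely many holomorphic charts) and constants $\Lambda\in\mathbb R$, $c_0>0$. **Proposition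 (boundary mixed normal–tangential estimate).** There is a constant $C$, depending only on $(M,\omega)$, $\chi$, $p$, $\underline u$, $\varphi$, $\Lambda$ and $c_0$ (and the choice of the $C^2$ norm), such that the following holds. Let $\psi\in C^\infty(M)$ satisfy $\psi\ge c_0$, $|\tilde\psi|_{C^2}\le\Lambda$ for $\tilde\psi=\psi^{1/\binom np}$, and $\mathcal M_p(\underline u)\ge\psi$ on $M$. Let $u\in C^4(M)$ (up to the boundary) be an admissible solution of the Dirichlet problem $$\mathcal M_p(u)=\psi\ \text{ in } M,\qquad u=\varphi\ \text{ on }\partial M,$$ and put $K=\sup_M|\nabla u|^2+1$, where $|\nabla u|^2=\omega^{j\bar k}u_ju_{\bar k}$. Let $x_0\in\partial M$, and let $z=(z^1,\dots,z^n)$, $z^i=x^i+\sqrt{-1}\,y^i$, be holomorphic coordinates on a neighbourhood of $x_0$ in $M$, with $x_0$ at the origin, $\omega_{\bar k j}(0)=\delta_{kj}$, and $\partial/\partial x^n$ in the direction of the inner normal at $x_0$; that is, there is a smooth function $\rho\le 0$ on the coordinate neighbourhood whose zero set is the part of $\partial M$ in it, with $d\rho\ne0$ on $\partial M$ and $\rho=-x^n+O(|z|^2)$.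 Then $$|g_{\bar n i}(0)|\le C\,K^{1/2}\qquad\text{for } i=1,\dots,n-1.$$ -/

import Mathlib

open Set
open scoped Manifold ContDiff Topology

noncomputable section

/-- The complex coordinate space `ℂⁿ` with its Euclidean norm. -/
abbrev Cn (n : ℕ) : Type := EuclideanSpace ℂ (Fin n)

namespace Cn

variable {n : ℕ}

/-- The coordinate vector `∂/∂xʲ` of `ℂⁿ`. -/
def dx (j : Fin n) : Cn n := EuclideanSpace.single j (1 : ℂ)

/-- The coordinate vector `∂/∂yʲ` of `ℂⁿ`, where `zʲ = xʲ + i yʲ`. -/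
def dy (j : Fin n) : Cn n := EuclideanSpace.single j Complex.I

/-- The Wirtinger derivative `∂f/∂zʲ = (∂f/∂xʲ - i ∂f/∂yʲ) / 2` of `f : ℂⁿ → ℂ`, with derivatives
taken within the set `s` (a coordinate domain, possibly with boundary). -/
def dz (s : Set (Cn n)) (j : Fin n) (f : Cn n → ℂ) (q : Cn n) : ℂ :=
  (1 / 2) * (fderivWithin ℝ f s q (dx j) - Complex.I * fderivWithin ℝ f s q (dy j))

/-- The Wirtinger derivative `∂f/∂z̄ʲ = (∂f/∂xʲ + i ∂f/∂yʲ) / 2`. -/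
def dzbar (s : Set (Cn n)) (j : Fin n) (f : Cn n → ℂ) (q : Cn n) : ℂ :=
  (1 / 2) * (fderivWithin ℝ f s q (dx j) + Complex.I * fderivWithin ℝ f s q (dy j))

/-- The complex Hessian `u_{k̄ j} = ∂²u / ∂z̄ᵏ∂zʲ` of a real function, with row `k` and column `j`. -/
def hess (s : Set (Cn n)) (u : Cn n → ℝ) (q : Cn n) : Matrix (Fin n) (Fin n) ℂ :=
  Matrix.of fun k j => dzbar s k (dz s j fun w => (u w : ℂ)) q

end Cn

/-! ### Eigenvalues, the cone `𝒫_p` and the Monge-Ampère type operator -/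

/-- The eigenvalues of a complex matrix, with algebraic multiplicity. The real part is taken only to
land in `ℝ`: the matrices `ω₀⁻¹ g` considered below are self-adjoint with respect to `ω₀`, so that their
eigenvalues are real. -/
def realEigenvalues {n : ℕ} (A : Matrix (Fin n) (Fin n) ℂ) : Multiset ℝ :=
  A.charpoly.roots.map Complex.re

/-- The tuple `l` lies in the cone `𝒫_p`: all sums of `p` of its entries, at distinct positions,
are positive. -/
def InCone (p : ℕ) (l : Multiset ℝ) : Prop :=
  ∀ t ∈ l.powersetCard p, 0 < t.sum

/-- The product of `λ_{i₁} + ⋯ + λ_{i_p}` over all `i₁ < ⋯ < i_p`. -/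
def sumProduct (p : ℕ) (l : Multiset ℝ) : ℝ :=
  ((l.powersetCard p).map Multiset.sum).prod

/-! ### Complex manifolds with boundary -/

section Manifold

variable {n : ℕ} [NeZero n] {M : Type*} [TopologicalSpace M]
  [ChartedSpace (EuclideanHalfSpace (2 * n)) M]

/-- The differential at `x` of a `ℂⁿ`-valued map on `M`. -/
def chartDeriv (z : M → Cn n) (x : M) : TangentSpace (𝓡∂ (2 * n)) x →L[ℝ] Cn n :=
  mfderiv (𝓡∂ (2 * n)) 𝓘(ℝ, Cn n) z x

/-- `z` is a holomorphic coordinate system on an open subset of a smooth manifold with boundary `M`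
of real dimension `2n`, with respect to the almost complex structure `J`: it is a diffeomorphism, up
to the boundary, of an open subset of `M` onto a subset of `ℂⁿ`, and `dz ∘ J = i dz`. At points of
`∂M`, the target is a one-sided neighbourhood with smooth (in general not flat) boundary. -/
structure IsHolomorphicChart
    (J : ∀ x : M, TangentSpace (𝓡∂ (2 * n)) x →L[ℝ] TangentSpace (𝓡∂ (2 * n)) x)
    (z : PartialEquiv M (Cn n)) : Prop where
  isOpen_source : IsOpen z.source
  contMDiffOn : ContMDiffOn (𝓡∂ (2 * n)) 𝓘(ℝ, Cn n) ∞ z z.source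
  contMDiffOn_symm : ContMDiffOn 𝓘(ℝ, Cn n) (𝓡∂ (2 * n)) ∞ z.symm z.target
  mfderiv_J : ∀ x ∈ z.source, ∀ v : TangentSpace (𝓡∂ (2 * n)) x,
    chartDeriv z x (J x v) = Complex.I • chartDeriv z x v

variable (n M) in
/-- A complex structure on a smooth manifold with boundary of real dimension `2n`: an almost complex
structure `J` that admits holomorphic coordinates, smooth up to the boundary, around every point. -/
structure ComplexStructure where
  /-- the almost complex structure -/
  J : ∀ x : M, TangentSpace (𝓡∂ (2 * n)) x →L[ℝ] TangentSpace (𝓡∂ (2 * n)) x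
  J_sq : ∀ (x : M) (v : TangentSpace (𝓡∂ (2 * n)) x), J x (J x v) = -v
  exists_chart : ∀ x : M, ∃ z : PartialEquiv M (Cn n), IsHolomorphicChart J z ∧ x ∈ z.source

/-- The pullback under `z⁻¹` of a bilinear form on the tangent spaces of `M` to the target of a
coordinate system `z`, at the point `q` and the vectors `v`, `w`. -/
def pullbackForm (b : ∀ x : M, TangentSpace (𝓡∂ (2 * n)) x →L[ℝ] TangentSpace (𝓡∂ (2 * n)) x →L[ℝ] ℝ)
    (z : PartialEquiv M (Cn n)) (q v w : Cn n) : ℝ :=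
  b (z.symm q) (mfderivWithin 𝓘(ℝ, Cn n) (𝓡∂ (2 * n)) z.symm z.target q v)
    (mfderivWithin 𝓘(ℝ, Cn n) (𝓡∂ (2 * n)) z.symm z.target q w)

/-- The components `b_{k̄ j}` (row `k`, column `j`) of a real `(1,1)`-form
`b = i ∑ b_{k̄ j} dzʲ ∧ dz̄ᵏ` in the coordinate system `z`, at the point `q` of its target. That is,
`b_{k̄ j} = -i b(∂/∂zʲ, ∂/∂z̄ᵏ)`, where `b` is extended complex bilinearly and
`∂/∂zʲ = (∂/∂xʲ - i ∂/∂yʲ) / 2`, `∂/∂z̄ᵏ = (∂/∂xᵏ + i ∂/∂yᵏ) / 2`. -/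
def formMatrix (b : ∀ x : M, TangentSpace (𝓡∂ (2 * n)) x →L[ℝ] TangentSpace (𝓡∂ (2 * n)) x →L[ℝ] ℝ)
    (z : PartialEquiv M (Cn n)) (q : Cn n) : Matrix (Fin n) (Fin n) ℂ :=
  Matrix.of fun k j => -Complex.I * ((1 / 4) *
    (((pullbackForm b z q (Cn.dx j) (Cn.dx k) + pullbackForm b z q (Cn.dy j) (Cn.dy k) : ℝ) : ℂ) +
      Complex.I *
        ((pullbackForm b z q (Cn.dx j) (Cn.dy k) - pullbackForm b z q (Cn.dy j) (Cn.dx k) : ℝ) : ℂ)))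

/-- A smooth real `(1,1)`-form: a `J`-invariant alternating real bilinear form on the tangent spaces
whose components in holomorphic coordinates are smooth (up to the boundary). -/
structure Real11Form (S : ComplexStructure n M) where
  /-- the values of the form -/
  toFun : ∀ x : M, TangentSpace (𝓡∂ (2 * n)) x →L[ℝ] TangentSpace (𝓡∂ (2 * n)) x →L[ℝ] ℝ
  alternating : ∀ (x : M) (v : TangentSpace (𝓡∂ (2 * n)) x), toFun x v v = 0
  invariant : ∀ (x : M) (v w : TangentSpace (𝓡∂ (2 * n)) x),
    toFun x (S.J x v) (S.J x w) = toFun x v w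
  smooth : ∀ z : PartialEquiv M (Cn n), IsHolomorphicChart S.J z → ∀ k j : Fin n,
    ContDiffOn ℝ ∞ (fun q => formMatrix toFun z q k j) z.target

/-- The `(1,1)`-form is positive, that is, the form of a Hermitian metric. -/
def Real11Form.IsHermitianMetric {S : ComplexStructure n M} (ω₀ : Real11Form S) : Prop :=
  ∀ (x : M) (v : TangentSpace (𝓡∂ (2 * n)) x), v ≠ 0 → 0 < ω₀.toFun x v (S.J x v)

variable {S : ComplexStructure n M}

/-- The components `g_{k̄ j} = χ_{k̄ j} + u_{k̄ j}` of `g = χ + i∂∂̄u` in the coordinates `z`. -/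
def gMatrix (χ : Real11Form S) (u : M → ℝ) (z : PartialEquiv M (Cn n)) (q : Cn n) :
    Matrix (Fin n) (Fin n) ℂ :=
  formMatrix χ.toFun z q + Cn.hess z.target (u ∘ z.symm) q

/-- The eigenvalues of `g = χ + i∂∂̄u` with respect to `ω₀`, that is, of the endomorphism
`gⁱ_j = ω₀^{i k̄} g_{k̄ j}`. -/
def gEigenvalues (ω₀ χ : Real11Form S) (u : M → ℝ) (z : PartialEquiv M (Cn n)) (q : Cn n) :
    Multiset ℝ :=
  realEigenvalues ((formMatrix ω₀.toFun z q)⁻¹ * gMatrix χ u z q)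

/-- `χ + i∂∂̄u ∈ P_p(M)`. -/
def IsAdmissible (p : ℕ) (ω₀ χ : Real11Form S) (u : M → ℝ) : Prop :=
  ∀ z : PartialEquiv M (Cn n), IsHolomorphicChart S.J z → ∀ q ∈ z.target,
    InCone p (gEigenvalues ω₀ χ u z q)

/-- `u` solves the equation `ℳ_p(u) = ψ` on `M`. -/
def IsSolution (p : ℕ) (ω₀ χ : Real11Form S) (ψ u : M → ℝ) : Prop :=
  ∀ z : PartialEquiv M (Cn n), IsHolomorphicChart S.J z → ∀ q ∈ z.target,
    sumProduct p (gEigenvalues ω₀ χ u z q) = ψ (z.symm q)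

/-- `u` satisfies the inequality `ℳ_p(u) ≥ ψ` on `M`. -/
def IsSubsolution (p : ℕ) (ω₀ χ : Real11Form S) (ψ u : M → ℝ) : Prop :=
  ∀ z : PartialEquiv M (Cn n), IsHolomorphicChart S.J z → ∀ q ∈ z.target,
    ψ (z.symm q) ≤ sumProduct p (gEigenvalues ω₀ χ u z q)

/-- `|∇u|² = ω₀^{j k̄} u_j u_{k̄}`, computed in the coordinates `z`. -/
def gradSq (ω₀ : Real11Form S) (u : M → ℝ) (z : PartialEquiv M (Cn n)) (q : Cn n) : ℝ :=
  (∑ j, ∑ k, (formMatrix ω₀.toFun z q)⁻¹ j k *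
    Cn.dz z.target j (fun w => (u (z.symm w) : ℂ)) q *
    Cn.dzbar z.target k (fun w => (u (z.symm w) : ℂ)) q).re

/-- `K = sup_M |∇u|² + 1`; as `|∇u|²` does not depend on the holomorphic coordinates, the supremum
may be taken over all of them. -/
def gradBound (ω₀ : Real11Form S) (u : M → ℝ) : ℝ :=
  sSup {r : ℝ | ∃ z : PartialEquiv M (Cn n), IsHolomorphicChart S.J z ∧
    ∃ q ∈ z.target, r = gradSq ω₀ u z q} + 1

/-- A finite cover of `M` by compact subsets of domains of holomorphic coordinates. It serves to
fix a `C²` norm on `M`; on a compact manifold the norms of any two covers are equivalent. -/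
structure FiniteChartCover (S : ComplexStructure n M) where
  /-- the number of coordinate systems -/
  size : ℕ
  /-- the coordinate systems -/
  chart : Fin size → PartialEquiv M (Cn n)
  /-- the compact sets -/
  core : Fin size → Set M
  isHolomorphicChart : ∀ a, IsHolomorphicChart S.J (chart a)
  isCompact_core : ∀ a, IsCompact (core a)
  core_subset : ∀ a, core a ⊆ (chart a).source
  cover : (⋃ a, core a) = univ

/-- The `C²` norm of a function on `M`, defined through a finite cover by charts: the supremum of
the norms of its coordinate derivatives of order at most two. -/
def FiniteChartCover.c2Norm (𝒰 : FiniteChartCover S) (f : M → ℝ) : ℝ :=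
  sSup {r : ℝ | ∃ a, ∃ x ∈ 𝒰.core a, ∃ m ≤ 2,
    r = ‖iteratedFDerivWithin ℝ m (f ∘ (𝒰.chart a).symm) (𝒰.chart a).target (𝒰.chart a x)‖}

variable (n) in
/-- The last coordinate index, written `n` in mathematical notation. -/
def lastIndex : Fin n := ⟨n - 1, Nat.sub_one_lt (NeZero.ne n)⟩

/-- Holomorphic coordinates `z` centred at the boundary point `x`, unitary for `ω₀` at `x`, together
with a defining function `ρ` of the boundary such that `ρ = -xⁿ + O(|z|²)`; thus `∂/∂xⁿ` is at `x`
the inner normal to the boundary. -/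
structure IsAdaptedBoundaryChart (ω₀ : Real11Form S) (x : M) (z : PartialEquiv M (Cn n))
    (ρ : Cn n → ℝ) : Prop where
  isHolomorphicChart : IsHolomorphicChart S.J z
  mem_boundary : x ∈ (𝓡∂ (2 * n)).boundary M
  mem_source : x ∈ z.source
  map_eq_zero : z x = 0
  unitary : formMatrix ω₀.toFun z 0 = 1
  smooth : ContDiffOn ℝ ∞ ρ z.target
  nonpos : ∀ q ∈ z.target, ρ q ≤ 0
  eq_zero_iff : ∀ q ∈ z.target, ρ q = 0 ↔ z.symm q ∈ (𝓡∂ (2 * n)).boundary M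
  deriv_ne_zero : ∀ q ∈ z.target, ρ q = 0 → fderivWithin ℝ ρ z.target q ≠ 0
  expansion : (fun q : Cn n => ρ q + (q (lastIndex n)).re) =O[𝓝[z.target] 0] fun q => ‖q‖ ^ 2

end Manifold

end

/-!
Write `v` for the subsolution and `w = u - v`. The estimate is a barrier argument near a boundary
point, preceded by global bounds for `v ≤ u ≤ v + c`.

The equation. Diagonalize `g` with respect to `ω` by a frame `e_i`, with eigenvalues `λ_i`. The
linearization of `log ℳ_p` is then `Lop F e`, with weights `F_i = ∑_{I ∋ i} 1 / λ_I`, where `λ_I` is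
the sum of the `λ_k`, `k ∈ I` (`wt`, `hasDerivAt_sumProd`). Three facts about it are used. By
Birkhoff's theorem and the arithmetic-geometric mean inequality, a solution minus a subsolution is a
supersolution (`IsEigenframe.Lop_nonpos`). Since `v` is admissible, `Lop w ≤ N₀ - ε ∑ F_i`
(`IsEigenframe.Lop_le`). If `∑ F_i` is bounded, then so are all `1 / λ_I`, and as the product of the
`λ_I` is bounded, the weights are bounded below (`exists_wt_lower_bound`).

Global bounds. A minimum of `w` inside `M` contradicts the strong maximum principle, so `v ≤ u` on
the connected components that meet the boundary (`le_of_isSolution`). For the upper bound there is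
no comparison function; instead, `i∂∂̄w` has trace bounded below, so if `max w` were unbounded the
functions `1 - w / max w` would be almost superharmonic, positive near the boundary, and zero
somewhere. Their positivity propagates along the component
(`AlmostSupersolutions.eventually_ge`, `IsPreconnected.eventually_ge`), a contradiction
(`exists_le_add`). The same trace bound makes `w` grow at most linearly from the boundary
(`RegionData.exists_linear_growth`).

The barrier. Let `d` be a defining function of the boundary, `ν` a transversal direction, and `T_b w`
the derivatives of `w` along a spanning family of vector fields tangential to the level sets of `d`;
they vanish on the boundary. Let `κ` bound the gradient. Differentiating the equation gives an
equation for `T_b w` with errors of two kinds: multiples of `∑ F_i |λ_i|`, and cross terms with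
second derivatives of `w`. A normal direction is, up to tangential ones, the image of a tangential
direction under the complex structure, so by the equation for the eigenframe the cross terms reduce
to tangential second derivatives and to eigenvalues (`exists_Gam_le`). Moreover all but one of the
`F_i λ_i²` are bounded by the squares of the tangential second derivatives, and the exceptional
eigenvalue is recovered from the identity `∑ F_i λ_i = n.choose p`
(`FrameBounds.exists_forall_ne`, `FrameBounds.sum_mul_abs_le`). These squares are produced with a
favourable sign by `κ⁻¹ ∑ (T_b w)²`, so that `κ⁻¹ ∑ (T_b w)² ± T_b w` satisfies an inequality with
error `κ (1 + ∑ F_i)` only (`exists_Lop_tangential_ge`). A large multiple of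
`κ (w + t d - N d² + |z - q|²)` dominates it (`exists_barrier_constants`,
`RegionData.exists_abs_tfunWithin_le`). With the linear growth of `w`, the normal derivatives of `T_b w`
at the boundary are `O(κ)`, and so are the second derivatives of `u` with one tangential direction
(`RegionData.exists_hessian_bound`).

Passage to adapted coordinates. The constants are uniform near a boundary point in a fixed chart,
where the `C²` norm controls `ψ` and its gradient, and `κ` is a multiple of `K^{1/2}`
(`exists_localSolution`). The form `g` is a tensor (`sesq_gMatrix_transition`), and unitary
coordinates at a point have bounded transition matrices to the chart, so the mixed entries in adapted
coordinates are controlled. Compactness of `M` makes the constant global.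
-/

noncomputable section

set_option maxSynthPendingDepth 3

/-! ### The weights of the linearized operator -/

open Finset in
/-- The weight `∑_{I ∋ i} 1 / λ_I`, where `I` runs over the `p`-element index sets and `λ_I` is the
sum of the `λ_k` with `k ∈ I`: this is `∂ log ℳ_p / ∂λ_i`. -/
def wt {n : ℕ} (p : ℕ) (l : Fin n → ℝ) (i : Fin n) : ℝ :=
  ∑ I ∈ powersetCard p univ, if i ∈ I then (∑ k ∈ I, l k)⁻¹ else 0

section LinearAlgebra

open Matrix Finset
open scoped ComplexOrder

variable {n : ℕ} {p : ℕ}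

theorem sum_wt_mul (l h : Fin n → ℝ) :
    ∑ i, wt p l i * h i
      = ∑ I ∈ powersetCard p univ, (∑ k ∈ I, h k) / (∑ k ∈ I, l k) := by
  simp only [wt, Finset.sum_mul]
  rw [Finset.sum_comm]
  refine Finset.sum_congr rfl fun I _ => ?_
  simp only [ite_mul, zero_mul]
  rw [← Finset.sum_filter, Finset.filter_mem_eq_inter, Finset.univ_inter, Finset.sum_div]
  exact Finset.sum_congr rfl fun i _ => by rw [div_eq_inv_mul]

theorem wt_nonneg {l : Fin n → ℝ} (hl : ∀ I ∈ powersetCard p univ, 0 < ∑ k ∈ I, l k) (i : Fin n) :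
    0 ≤ wt p l i :=
  Finset.sum_nonneg fun I hI => by
    split_ifs
    · exact inv_nonneg.2 (hl I hI).le
    · exact le_rfl

theorem sum_wt_mul_self {l : Fin n → ℝ} (hl : ∀ I ∈ powersetCard p univ, 0 < ∑ k ∈ I, l k) :
    ∑ i, wt p l i * l i = (n.choose p : ℝ) := by
  rw [sum_wt_mul, Finset.sum_congr rfl fun I hI => div_self (hl I hI).ne']
  simp

theorem sum_wt (l : Fin n → ℝ) :
    ∑ i, wt p l i = p * ∑ I ∈ powersetCard p univ, (∑ k ∈ I, l k)⁻¹ := by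
  have := sum_wt_mul (p := p) l (fun _ => 1)
  simp only [mul_one] at this
  rw [this, Finset.mul_sum]
  refine Finset.sum_congr rfl fun I hI => ?_
  rw [Finset.sum_const, (mem_powersetCard.1 hI).2, div_eq_mul_inv]
  simp

theorem inv_sum_le_wt {l : Fin n → ℝ} (hl : ∀ I ∈ powersetCard p univ, 0 < ∑ k ∈ I, l k)
    {I : Finset (Fin n)} (hI : I ∈ powersetCard p univ) {i : Fin n} (hi : i ∈ I) :
    (∑ k ∈ I, l k)⁻¹ ≤ wt p l i := by
  have := Finset.single_le_sum (f := fun I => if i ∈ I then (∑ k ∈ I, l k)⁻¹ else 0)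
    (fun J hJ => by
      split_ifs
      · exact inv_nonneg.2 (hl J hJ).le
      · exact le_rfl) hI
  simpa [hi, wt] using this

theorem exists_mem_powersetCard (hp : 1 ≤ p) (hpn : p ≤ n) (i : Fin n) :
    ∃ I ∈ powersetCard p (univ : Finset (Fin n)), i ∈ I := by
  obtain ⟨I, h1, -, h3⟩ := Finset.exists_subsuperset_card_eq (s := {i}) (t := univ) (n := p)
    (Finset.subset_univ _) (by simpa using hp) (by simpa using hpn)
  exact ⟨I, by simp [h3], h1 (by simp)⟩

/-- If the sum of the weights is bounded and the product of the `λ_I` is bounded above, then each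
`λ_I` is bounded below, hence also above, and the weights are bounded below. -/
theorem exists_wt_lower_bound (n p : ℕ) (hp : 1 ≤ p) (hpn : p ≤ n) (F₀ c₁ : ℝ) :
    ∃ c : ℝ, 0 < c ∧ ∀ l : Fin n → ℝ, (∀ I ∈ powersetCard p univ, 0 < ∑ k ∈ I, l k) →
      ∏ I ∈ powersetCard p univ, ∑ k ∈ I, l k ≤ c₁ → ∑ i, wt p l i ≤ F₀ → ∀ i, c ≤ wt p l i := by
  set N := (powersetCard p (univ : Finset (Fin n))).card with hN
  refine ⟨((max c₁ 1) * (max F₀ 1) ^ (N - 1))⁻¹, by positivity, fun l hl h1 h2 i => ?_⟩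
  obtain ⟨I, hI, hi⟩ := exists_mem_powersetCard hp hpn i
  refine le_trans ?_ (inv_sum_le_wt hl hI hi)
  refine inv_anti₀ (hl I hI) ?_
  have hp' : (1 : ℝ) ≤ p := by exact_mod_cast hp
  -- all the other `λ_J` are bounded below, so the bound on the product bounds `λ_I` above
  have h3 : ∀ J ∈ powersetCard p univ, (max F₀ 1)⁻¹ ≤ ∑ k ∈ J, l k := by
    intro J hJ
    rw [inv_le_comm₀ (by positivity) (hl J hJ)]
    have h4 : (∑ k ∈ J, l k)⁻¹ ≤ ∑ I ∈ powersetCard p univ, (∑ k ∈ I, l k)⁻¹ :=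
      Finset.single_le_sum (f := fun I => (∑ k ∈ I, l k)⁻¹)
        (fun J hJ => inv_nonneg.2 (hl J hJ).le) hJ
    rw [sum_wt] at h2
    have h5 : 0 ≤ ∑ I ∈ powersetCard p univ, (∑ k ∈ I, l k)⁻¹ :=
      Finset.sum_nonneg fun J hJ => inv_nonneg.2 (hl J hJ).le
    have := le_max_left F₀ 1
    nlinarith
  have h6 : (max F₀ 1)⁻¹ ^ (N - 1) ≤ ∏ J ∈ (powersetCard p univ).erase I, ∑ k ∈ J, l k := by
    rw [← Finset.card_erase_of_mem hI, ← Finset.prod_const]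
    exact Finset.prod_le_prod (fun _ _ => by positivity) fun J hJ => h3 J (Finset.mem_of_mem_erase hJ)
  rw [← Finset.mul_prod_erase _ _ hI] at h1
  have h7 : (∑ k ∈ I, l k) * (max F₀ 1)⁻¹ ^ (N - 1) ≤ max c₁ 1 :=
    (mul_le_mul_of_nonneg_left h6 (hl I hI).le).trans (h1.trans (le_max_left _ _))
  rw [inv_pow, ← div_eq_mul_inv, div_le_iff₀ (by positivity)] at h7
  exact h7

/-- Arithmetic-geometric mean inequality for the quotients `a i / b i`. -/
theorem card_le_sum_div {ι : Type*} (s : Finset ι) (a b : ι → ℝ) (ha : ∀ i ∈ s, 0 < a i)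
    (hb : ∀ i ∈ s, 0 < b i) (h : ∏ i ∈ s, b i ≤ ∏ i ∈ s, a i) :
    (s.card : ℝ) ≤ ∑ i ∈ s, a i / b i := by
  have h1 : ∀ i ∈ s, Real.log (a i / b i) ≤ a i / b i - 1 := fun i hi =>
    Real.log_le_sub_one_of_pos (div_pos (ha i hi) (hb i hi))
  have h2 := Finset.sum_le_sum h1
  rw [Finset.sum_sub_distrib, ← Real.log_prod (fun i hi => (div_pos (ha i hi) (hb i hi)).ne'),
    Finset.prod_div_distrib] at h2
  have h3 : 0 ≤ Real.log ((∏ i ∈ s, a i) / ∏ i ∈ s, b i) :=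
    Real.log_nonneg ((one_le_div (Finset.prod_pos hb)).2 h)
  simp at h2
  linarith

/-! ### Eigenvalues -/

/-- `sumProduct` over a general commutative semiring. -/
def sumProd {R : Type*} [CommSemiring R] (p : ℕ) (s : Multiset R) : R :=
  ((s.powersetCard p).map Multiset.sum).prod

theorem sumProd_map_univ {R : Type*} [CommSemiring R] (l : Fin n → R) :
    sumProd p (univ.val.map l) = ∏ I ∈ powersetCard p univ, ∑ k ∈ I, l k := by
  rw [sumProd, Multiset.powersetCard_map, ← Finset.map_val_val_powersetCard]
  simp only [Multiset.map_map]
  rfl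

theorem sumProduct_map_univ (l : Fin n → ℝ) :
    sumProduct p (univ.val.map l) = ∏ I ∈ powersetCard p univ, ∑ k ∈ I, l k :=
  sumProd_map_univ l

theorem inCone_map_univ (l : Fin n → ℝ) :
    InCone p (univ.val.map l) ↔ ∀ I ∈ powersetCard p univ, 0 < ∑ k ∈ I, l k := by
  rw [InCone, Multiset.powersetCard_map, ← Finset.map_val_val_powersetCard]
  simp only [Multiset.map_map, Multiset.mem_map, forall_exists_index, and_imp,
    forall_apply_eq_imp_iff₂]
  rfl

theorem roots_charpoly_diagonal (l : Fin n → ℂ) :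
    (diagonal l).charpoly.roots = univ.val.map l := by
  have h : univ.val.map (fun i => Polynomial.X - Polynomial.C (l i))
      = (univ.val.map l).map (fun a => Polynomial.X - Polynomial.C a) := by
    rw [Multiset.map_map]; rfl
  rw [charpoly_diagonal, ← Finset.prod_map_val, h]
  exact Polynomial.roots_multiset_prod_X_sub_C _

theorem realEigenvalues_congr {A B : Matrix (Fin n) (Fin n) ℂ} (h : A.charpoly = B.charpoly) :
    realEigenvalues A = realEigenvalues B := by
  rw [realEigenvalues, realEigenvalues, h]

theorem realEigenvalues_diagonal (l : Fin n → ℝ) :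
    realEigenvalues (diagonal fun i => (l i : ℂ)) = univ.val.map l := by
  rw [realEigenvalues, roots_charpoly_diagonal]
  simp [Function.comp_def]

theorem inv_eq_mul_conjTranspose {W P : Matrix (Fin n) (Fin n) ℂ} (hP : Pᴴ * W * P = 1) :
    W⁻¹ = P * Pᴴ := by
  have h1 : P * (Pᴴ * W) = 1 := mul_eq_one_comm.1 hP
  exact inv_eq_left_inv (by rw [Matrix.mul_assoc, h1])

theorem charpoly_inv_mul {W H P : Matrix (Fin n) (Fin n) ℂ} (hP : Pᴴ * W * P = 1) :
    (W⁻¹ * H).charpoly = (Pᴴ * H * P).charpoly := by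
  rw [inv_eq_mul_conjTranspose hP, Matrix.mul_assoc, charpoly_mul_comm]

/-- Simultaneous diagonalization of a Hermitian matrix with respect to a positive definite one. -/
theorem exists_simultaneous_diagonalization {W H : Matrix (Fin n) (Fin n) ℂ} (hW : W.PosDef)
    (hH : H.IsHermitian) : ∃ (P : Matrix (Fin n) (Fin n) ℂ) (l : Fin n → ℝ),
      Pᴴ * W * P = 1 ∧ Pᴴ * H * P = diagonal fun i => (l i : ℂ) := by
  have key : ∀ {A : Matrix (Fin n) (Fin n) ℂ} (hA : A.IsHermitian),
      ∃ U : Matrix (Fin n) (Fin n) ℂ, Uᴴ * U = 1 ∧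
        Uᴴ * A * U = diagonal fun i => (hA.eigenvalues i : ℂ) := by
    intro A hA
    have hU : (hA.eigenvectorUnitary : Matrix (Fin n) (Fin n) ℂ)ᴴ * hA.eigenvectorUnitary = 1 :=
      Unitary.coe_star_mul_self hA.eigenvectorUnitary
    refine ⟨hA.eigenvectorUnitary, hU, ?_⟩
    have h1 := hA.spectral_theorem
    rw [Unitary.conjStarAlgAut_apply, star_eq_conjTranspose] at h1
    generalize (hA.eigenvectorUnitary : Matrix (Fin n) (Fin n) ℂ) = V at h1 hU
    generalize hA.eigenvalues = μ at h1
    rw [h1]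
    simp only [← Matrix.mul_assoc, hU, Matrix.one_mul]
    rw [Matrix.mul_assoc, hU, Matrix.mul_one]
    rfl
  obtain ⟨U, hU, hUW⟩ := key hW.1
  set s : Fin n → ℂ := fun i => ((Real.sqrt (hW.1.eigenvalues i))⁻¹ : ℝ) with hs
  have hss : (diagonal s)ᴴ = diagonal s := by
    rw [diagonal_conjTranspose]; congr 1; ext i; simp [hs]
  set R := U * diagonal s with hR
  have hRW : Rᴴ * W * R = 1 := by
    have : Rᴴ * W * R = diagonal s * (Uᴴ * W * U) * diagonal s := by
      rw [hR, conjTranspose_mul, hss]; simp only [Matrix.mul_assoc]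
    rw [this, hUW, diagonal_mul_diagonal, diagonal_mul_diagonal, ← diagonal_one]
    congr 1
    ext i
    have h1 := hW.eigenvalues_pos i
    have h2 := Real.mul_self_sqrt h1.le
    have h3 : Real.sqrt (hW.1.eigenvalues i) ≠ 0 := (Real.sqrt_pos.2 h1).ne'
    simp only [hs]
    rw [← Complex.ofReal_mul, ← Complex.ofReal_mul, ← Complex.ofReal_one]
    congr 1
    field_simp
    linarith
  have hRH : (Rᴴ * H * R).IsHermitian := isHermitian_conjTranspose_mul_mul R hH
  obtain ⟨V, hV, hVH⟩ := key hRH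
  refine ⟨R * V, hRH.eigenvalues, ?_, ?_⟩
  · have : (R * V)ᴴ * W * (R * V) = Vᴴ * (Rᴴ * W * R) * V := by
      rw [conjTranspose_mul]; simp only [Matrix.mul_assoc]
    rw [this, hRW, Matrix.mul_one, hV]
  · have : (R * V)ᴴ * H * (R * V) = Vᴴ * (Rᴴ * H * R) * V := by
      rw [conjTranspose_mul]; simp only [Matrix.mul_assoc]
    rw [this, hVH]

theorem realEigenvalues_of_diagonalization {W H P : Matrix (Fin n) (Fin n) ℂ} {l : Fin n → ℝ}
    (hP : Pᴴ * W * P = 1) (hl : Pᴴ * H * P = diagonal fun i => (l i : ℂ)) :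
    realEigenvalues (W⁻¹ * H) = univ.val.map l := by
  rw [realEigenvalues_congr (charpoly_inv_mul hP), hl, realEigenvalues_diagonal]

theorem prod_sum_perm (l : Fin n → ℝ) (σ : Equiv.Perm (Fin n)) :
    ∏ I ∈ powersetCard p univ, ∑ k ∈ I, l (σ k) = ∏ I ∈ powersetCard p univ, ∑ k ∈ I, l k := by
  refine Finset.prod_bij' (fun I _ => I.map σ.toEmbedding) (fun I _ => I.map σ.symm.toEmbedding)
    ?_ ?_ ?_ ?_ ?_
  · intro I hI; simpa using hI
  · intro I hI; simpa using hI
  · intro I hI; ext; simp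
  · intro I hI; ext; simp
  · intro I hI; simp

/-- The diagonal of a Hermitian matrix `K` is the image of its eigenvalues under a doubly stochastic
matrix, hence, by Birkhoff's theorem, a convex combination of their permutations; `log ∏ λ_I` is
concave and symmetric. -/
theorem diag_of_inCone {K : Matrix (Fin n) (Fin n) ℂ} (hK : K.IsHermitian)
    (hcone : InCone p (realEigenvalues K)) :
    (∀ I ∈ powersetCard p univ, 0 < ∑ i ∈ I, (K i i).re) ∧
      sumProduct p (realEigenvalues K) ≤ ∏ I ∈ powersetCard p univ, ∑ i ∈ I, (K i i).re := by
  obtain ⟨U, μ, hUU, hUK⟩ := exists_simultaneous_diagonalization PosDef.one hK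
  rw [Matrix.mul_one] at hUU
  have hcp : realEigenvalues K = univ.val.map μ := by
    have := realEigenvalues_of_diagonalization (W := 1) (H := K) (P := U) (l := μ)
      (by rw [Matrix.mul_one, hUU]) hUK
    simpa using this
  rw [hcp, inCone_map_univ] at hcone
  have hUU' : U * Uᴴ = 1 := mul_eq_one_comm.1 hUU
  have hKU : K = U * diagonal (fun i => (μ i : ℂ)) * Uᴴ := by
    rw [← hUK]
    calc K = 1 * K * 1 := by simp
      _ = (U * Uᴴ) * K * (U * Uᴴ) := by rw [hUU']
      _ = _ := by simp only [Matrix.mul_assoc]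
  -- the squared moduli of the entries of a unitary matrix form a doubly stochastic matrix
  set D : Matrix (Fin n) (Fin n) ℝ := of fun i k => Complex.normSq (U i k) with hD
  have hDs : D ∈ doublyStochastic ℝ (Fin n) := by
    rw [mem_doublyStochastic_iff_sum]
    refine ⟨fun i j => Complex.normSq_nonneg _, fun i => ?_, fun j => ?_⟩
    · have := congrFun (congrFun hUU' i) i
      simp only [mul_apply, conjTranspose_apply, one_apply_eq] at this
      have h2 := congrArg Complex.re this
      simp only [Complex.re_sum, Complex.one_re] at h2
      rw [← h2]
      exact Finset.sum_congr rfl fun k _ => by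
        simp [hD, Complex.normSq_apply]
    · have := congrFun (congrFun hUU j) j
      simp only [mul_apply, conjTranspose_apply, one_apply_eq] at this
      have h2 := congrArg Complex.re this
      simp only [Complex.re_sum, Complex.one_re] at h2
      rw [← h2]
      exact Finset.sum_congr rfl fun k _ => by
        simp [hD, Complex.normSq_apply]
  have hdiag : ∀ i, (K i i).re = ∑ k, D i k * μ k := by
    intro i
    rw [hKU]
    rw [mul_apply]
    simp only [mul_diagonal, conjTranspose_apply, Complex.re_sum]
    refine Finset.sum_congr rfl fun k _ => ?_
    simp [hD, Complex.normSq_apply]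
    ring
  obtain ⟨w, hw0, hw1, hw⟩ := exists_eq_sum_perm_of_mem_doublyStochastic hDs
  have hI : ∀ I : Finset (Fin n), ∑ i ∈ I, (K i i).re = ∑ σ, w σ * ∑ i ∈ I, μ (σ i) := by
    intro I
    simp only [Finset.mul_sum]
    rw [Finset.sum_comm]
    refine Finset.sum_congr rfl fun i _ => ?_
    rw [hdiag, ← hw]
    simp only [Matrix.sum_apply, Matrix.smul_apply, smul_eq_mul, Finset.sum_mul]
    rw [Finset.sum_comm]
    refine Finset.sum_congr rfl fun σ _ => ?_
    simp [Equiv.Perm.permMatrix, PEquiv.toMatrix_apply, Equiv.toPEquiv_apply]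
  have hpos : ∀ σ : Equiv.Perm (Fin n), ∀ I ∈ powersetCard p univ, 0 < ∑ i ∈ I, μ (σ i) := by
    intro σ I hI
    have := hcone (I.map σ.toEmbedding) (by simpa using hI)
    simpa using this
  have hsum_pos : ∀ I ∈ powersetCard p univ, 0 < ∑ i ∈ I, (K i i).re := by
    intro I hI'
    rw [hI]
    obtain ⟨σ, -, hσ⟩ : ∃ σ ∈ Finset.univ, 0 < w σ := by
      by_contra! h
      have := Finset.sum_nonpos h
      linarith
    exact Finset.sum_pos' (fun σ _ => mul_nonneg (hw0 σ) (hpos σ I hI').le)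
      ⟨σ, Finset.mem_univ _, mul_pos hσ (hpos σ I hI')⟩
  refine ⟨hsum_pos, ?_⟩
  rw [hcp, sumProduct_map_univ]
  rw [← Real.log_le_log_iff (Finset.prod_pos hcone) (Finset.prod_pos hsum_pos),
    Real.log_prod (fun I hI' => (hsum_pos I hI').ne')]
  have hlog : ∀ I ∈ powersetCard p univ,
      ∑ σ, w σ * Real.log (∑ i ∈ I, μ (σ i)) ≤ Real.log (∑ i ∈ I, (K i i).re) := by
    intro I hI'
    rw [hI]
    exact strictConcaveOn_log_Ioi.concaveOn.le_map_sum (fun σ _ => hw0 σ) hw1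
      (fun σ _ => hpos σ I hI')
  refine le_trans (le_of_eq ?_) (Finset.sum_le_sum hlog)
  rw [Finset.sum_comm]
  simp only [← Finset.mul_sum]
  have : ∀ σ : Equiv.Perm (Fin n), ∑ I ∈ powersetCard p univ, Real.log (∑ i ∈ I, μ (σ i))
      = Real.log (∏ I ∈ powersetCard p univ, ∑ i ∈ I, μ i) := by
    intro σ
    rw [← prod_sum_perm μ σ, Real.log_prod (fun I hI' => (hpos σ I hI').ne')]
  simp only [this, ← Finset.sum_mul, hw1, one_mul]

/-! ### The derivative of the operator -/

theorem exists_sumProd_eq_eval (n p : ℕ) : ∃ q : MvPolynomial (Fin n) ℂ, ∀ s : Multiset ℂ,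
    s.card = n → sumProd p s = MvPolynomial.eval (fun i : Fin n => s.esymm ((i : ℕ) + 1)) q := by
  set r : MvPolynomial (Fin n) ℂ := ∏ I ∈ powersetCard p univ, ∑ k ∈ I, MvPolynomial.X k with hr
  have hsym : r ∈ MvPolynomial.symmetricSubalgebra (Fin n) ℂ := by
    intro σ
    rw [hr, map_prod]
    simp only [map_sum, MvPolynomial.rename_X]
    refine Finset.prod_bij' (fun I _ => I.map σ.toEmbedding) (fun I _ => I.map σ.symm.toEmbedding)
      ?_ ?_ ?_ ?_ ?_
    · intro I hI; simpa using hI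
    · intro I hI; simpa using hI
    · intro I hI; ext; simp
    · intro I hI; ext; simp
    · intro I hI; simp
  obtain ⟨q, hq⟩ := MvPolynomial.esymmAlgHom_surjective (σ := Fin n) (n := n) ℂ (by simp)
    ⟨r, hsym⟩
  refine ⟨q, fun s hs => ?_⟩
  obtain ⟨l, rfl⟩ : ∃ l : Fin n → ℂ, s = univ.val.map l := by
    subst hs
    refine ⟨fun i => s.toList.get (i.cast (by simp)), ?_⟩
    conv_lhs => rw [← Multiset.coe_toList s]
    rw [Fin.univ_val_map, Multiset.coe_eq_coe]
    refine List.Perm.of_eq ?_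
    apply List.ext_get <;> simp
  have h1 : MvPolynomial.aeval l r = sumProd p (univ.val.map l) := by
    rw [sumProd_map_univ, hr, map_prod]
    simp
  rw [← h1]
  have h2 : r = (MvPolynomial.esymmAlgHom (Fin n) ℂ n q : MvPolynomial (Fin n) ℂ) := by rw [hq]
  rw [h2]
  have h3 : (((MvPolynomial.aeval l).comp
      (MvPolynomial.symmetricSubalgebra (Fin n) ℂ).val).comp (MvPolynomial.esymmAlgHom (Fin n) ℂ n))
      = MvPolynomial.aeval (fun i : Fin n => (univ.val.map l).esymm (i + 1)) := by
    apply MvPolynomial.algHom_ext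
    intro i
    simpa [MvPolynomial.esymmAlgHom] using
      MvPolynomial.aeval_esymm_eq_multiset_esymm (Fin n) ℂ (i + 1) l
  have h4 := congrArg (fun f => f q) h3
  simpa [MvPolynomial.aeval_def] using h4

theorem exists_sumProd_charpoly_eq_eval (n p : ℕ) :
    ∃ Q : MvPolynomial (Fin n × Fin n) ℂ, ∀ A : Matrix (Fin n) (Fin n) ℂ,
      sumProd p A.charpoly.roots = MvPolynomial.eval (fun ij => A ij.1 ij.2) Q := by
  obtain ⟨q, hq⟩ := exists_sumProd_eq_eval n p
  refine ⟨MvPolynomial.bind₁ (fun i : Fin n => MvPolynomial.C ((-1) ^ ((i : ℕ) + 1)) *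
    (charpoly.univ ℂ (Fin n)).coeff (n - (i + 1))) q, fun A => ?_⟩
  have hdeg : A.charpoly.natDegree = n := by simp
  have hcard : A.charpoly.roots.card = A.charpoly.natDegree :=
    (IsAlgClosed.splits A.charpoly).natDegree_eq_card_roots.symm
  rw [hq _ (hcard.trans hdeg)]
  have h0 : ∀ g : MvPolynomial (Fin n × Fin n) ℂ, MvPolynomial.eval (fun ij => A ij.1 ij.2) g
      = MvPolynomial.aeval (fun ij : Fin n × Fin n => A ij.1 ij.2) g := fun g => by
    simp [MvPolynomial.aeval_def]
  have h0' : ∀ (f : Fin n → ℂ) (g : MvPolynomial (Fin n) ℂ), MvPolynomial.eval f g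
      = MvPolynomial.aeval f g := fun f g => by
    simp [MvPolynomial.aeval_def]
  rw [h0, MvPolynomial.aeval_bind₁, h0']
  congr 2
  ext i
  rw [map_mul, ← h0, ← h0]
  have h1 := charpoly.univ_coeff_eval₂Hom (Fin n) (RingHom.id ℂ) (fun ij => A ij.1 ij.2)
    (n - (i + 1))
  have h2 : MvPolynomial.eval (fun ij => A ij.1 ij.2) ((charpoly.univ ℂ (Fin n)).coeff (n - (i + 1)))
      = A.charpoly.coeff (n - (i + 1)) := h1
  rw [h2, Polynomial.coeff_eq_esymm_roots_of_card hcard (by rw [hdeg]; omega),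
    (charpoly_monic A).leadingCoeff, hdeg, show n - (n - (i + 1)) = i + 1 by omega]
  simp only [MvPolynomial.eval_C, one_mul]
  rw [← mul_assoc, ← mul_pow]
  simp

theorem hasDerivAt_mvPolynomial_eval {σ : Type*} [Fintype σ] (Q : MvPolynomial σ ℂ)
    {a : ℝ → σ → ℂ} {a' : σ → ℂ} {t : ℝ} (ha : ∀ i, HasDerivAt (fun s => a s i) (a' i) t) :
    HasDerivAt (fun s => MvPolynomial.eval (a s) Q)
      (∑ i, a' i * MvPolynomial.eval (a t) (MvPolynomial.pderiv i Q)) t := by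
  classical
  induction Q using MvPolynomial.induction_on with
  | C r => simpa using hasDerivAt_const t r
  | add f g hf hg =>
    simpa [mul_add, Finset.sum_add_distrib] using hf.fun_add hg
  | mul_X f i hf =>
    have := hf.mul (ha i)
    simp only [map_mul, MvPolynomial.eval_X, MvPolynomial.pderiv_mul, map_add,
      MvPolynomial.pderiv_X]
    convert! this using 1
    simp only [mul_add, Finset.sum_add_distrib, Finset.sum_mul]
    congr 1
    · exact Finset.sum_congr rfl fun j _ => by ring
    · rw [Finset.sum_eq_single i]
      · simp; ring
      · intro j _ hj; simp [hj.symm]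
      · simp

theorem charpoly_diagonal_add_single (l : Fin n → ℂ) {i j : Fin n} (hij : i ≠ j) (t : ℂ) :
    (diagonal l + Matrix.single i j t).charpoly = (diagonal l).charpoly := by
  have key : ∀ {i j : Fin n}, i < j →
      (diagonal l + Matrix.single i j t).charpoly = (diagonal l).charpoly := by
    intro i j hij
    rw [charpoly_diagonal, charpoly_of_isUpperTriangular]
    · refine Finset.prod_congr rfl fun k _ => ?_
      have : (Matrix.single i j t) k k = 0 := by
        rw [Matrix.single_apply]; grind
      simp [this]
    · intro a b hab
      have hab' : b < a := hab
      have : (Matrix.single i j t) a b = 0 := by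
        rw [Matrix.single_apply]; grind
      simp [this, diagonal_apply_ne _ hab'.ne']
  rcases lt_or_gt_of_ne hij with h | h
  · exact key h
  · rw [← charpoly_transpose, transpose_add, diagonal_transpose, transpose_single, key h]

/-- The derivative of `ℳ_p` along a curve of matrices, at a point where the matrix is
diagonalizable with eigenvalues `l` in the cone. The derivative is a linear functional of the
velocity. In an eigenbasis it vanishes on elementary matrices off the diagonal, since adding a multiple
of these does not change the characteristic polynomial; on the diagonal it is found by differentiating
the explicit product. -/
theorem hasDerivAt_sumProd {A : ℝ → Matrix (Fin n) (Fin n) ℂ} {A' : Matrix (Fin n) (Fin n) ℂ}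
    {t : ℝ} (hA : ∀ i j, HasDerivAt (fun s => A s i j) (A' i j) t)
    {P R : Matrix (Fin n) (Fin n) ℂ} (hPR : R * P = 1) {l : Fin n → ℝ}
    (hl : R * A t * P = diagonal fun i => (l i : ℂ))
    (hcone : ∀ I ∈ powersetCard p univ, 0 < ∑ k ∈ I, l k) :
    HasDerivAt (fun s => sumProd p (A s).charpoly.roots)
      ((∏ I ∈ powersetCard p univ, ∑ k ∈ I, l k : ℝ) * ∑ i, (wt p l i : ℂ) * (R * A' * P) i i) t := by
  obtain ⟨Q, hQ⟩ := exists_sumProd_charpoly_eq_eval n p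
  set e : Fin n × Fin n → ℂ := fun ij => diagonal (fun i => (l i : ℂ)) ij.1 ij.2 with he
  have hPR' : P * R = 1 := mul_eq_one_comm.1 hPR
  have hsim : ∀ B : Matrix (Fin n) (Fin n) ℂ, (R * B * P).charpoly = B.charpoly := fun B => by
    rw [charpoly_mul_comm, ← Matrix.mul_assoc, hPR', Matrix.one_mul]
  -- the partial derivatives of `Q` at the diagonal matrix
  have hsingle : ∀ (i j : Fin n), HasDerivAt
      (fun s : ℝ => sumProd p (diagonal (fun i => (l i : ℂ)) + Matrix.single i j (s : ℂ)).charpoly.roots)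
      (MvPolynomial.eval e (MvPolynomial.pderiv (i, j) Q)) 0 := by
    intro i j
    have h1 := hasDerivAt_mvPolynomial_eval (t := (0 : ℝ)) Q (a := fun s ab =>
      (diagonal (fun i => (l i : ℂ)) + Matrix.single i j (s : ℂ)) ab.1 ab.2)
      (a' := fun ab => if ab = (i, j) then 1 else 0) (by
        intro ab
        have h2 : HasDerivAt (fun s : ℝ => (s : ℂ)) 1 0 := Complex.ofRealCLM.hasDerivAt
        by_cases hab : ab = (i, j)
        · subst hab
          simpa using h2.const_add (diagonal (fun i => (l i : ℂ)) i j)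
        · have h3 : ∀ s : ℂ, Matrix.single i j s ab.1 ab.2 = 0 := fun s => by
            rw [Matrix.single_apply]
            have : ¬ (i = ab.1 ∧ j = ab.2) := fun h => hab (by rw [h.1, h.2])
            simp [this]
          simpa [h3, hab] using hasDerivAt_const (0 : ℝ)
            (diagonal (fun i => (l i : ℂ)) ab.1 ab.2))
    simp only [hQ]
    convert! h1 using 1
    simp [he]
  -- off the diagonal the characteristic polynomial is constant along the curve
  have hoff : ∀ i j, i ≠ j → MvPolynomial.eval e (MvPolynomial.pderiv (i, j) Q) = 0 := by
    intro i j hij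
    have h1 := hsingle i j
    simp only [charpoly_diagonal_add_single _ hij] at h1
    exact h1.unique (hasDerivAt_const _ _)
  have hdiag : ∀ i, MvPolynomial.eval e (MvPolynomial.pderiv (i, i) Q)
      = (∏ I ∈ powersetCard p univ, ∑ k ∈ I, l k : ℝ) * (wt p l i : ℂ) := by
    intro i
    have h1 := hsingle i i
    have h2 : ∀ s : ℝ, sumProd p
        (diagonal (fun i => (l i : ℂ)) + Matrix.single i i (s : ℂ)).charpoly.roots
        = ∏ I ∈ powersetCard p univ, ((∑ k ∈ I, (l k : ℂ)) + if i ∈ I then (s : ℂ) else 0) := by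
      intro s
      have : diagonal (fun i => (l i : ℂ)) + Matrix.single i i (s : ℂ)
          = diagonal (fun k => (l k : ℂ) + if i = k then (s : ℂ) else 0) := by
        rw [← diagonal_single, diagonal_add]
        congr 1
        ext k
        simp [Pi.single_apply, eq_comm]
      rw [this, roots_charpoly_diagonal, sumProd_map_univ]
      refine Finset.prod_congr rfl fun I _ => ?_
      rw [Finset.sum_add_distrib]
      simp
    simp only [h2] at h1
    refine h1.unique ?_
    have hne : ∀ I ∈ powersetCard p univ, (∑ k ∈ I, (l k : ℂ)) ≠ 0 := fun I hI => by
      rw [← Complex.ofReal_sum]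
      exact_mod_cast (hcone I hI).ne'
    have h3 := HasDerivAt.fun_finsetProd (u := powersetCard p (univ : Finset (Fin n))) (x := (0 : ℝ))
      (f := fun I (s : ℝ) => (∑ k ∈ I, (l k : ℂ)) + if i ∈ I then (s : ℂ) else 0)
      (f' := fun I => if i ∈ I then 1 else 0) (by
        intro I _
        have h2 : HasDerivAt (fun s : ℝ => (s : ℂ)) 1 0 := Complex.ofRealCLM.hasDerivAt
        by_cases hi : i ∈ I
        · simpa [hi] using h2.const_add (∑ k ∈ I, (l k : ℂ))
        · simpa [hi] using hasDerivAt_const (0 : ℝ) (∑ k ∈ I, (l k : ℂ)))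
    convert! h3 using 1
    rw [wt, Complex.ofReal_prod, Complex.ofReal_sum, Finset.mul_sum]
    refine Finset.sum_congr rfl fun I hI => ?_
    by_cases hi : i ∈ I
    · rw [← Finset.mul_prod_erase _ _ hI]
      have := hne I hI
      simp [hi]
      field_simp
    · simp [hi]
  have hB : ∀ i j, HasDerivAt (fun s => (R * A s * P) i j) ((R * A' * P) i j) t := by
    intro i j
    simp only [mul_apply]
    refine HasDerivAt.fun_sum fun a _ => ?_
    refine HasDerivAt.mul_const ?_ _
    refine HasDerivAt.fun_sum fun b _ => ?_
    exact (hA b a).const_mul _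
  have h1 := hasDerivAt_mvPolynomial_eval Q (a := fun s ab => (R * A s * P) ab.1 ab.2)
    (a' := fun ab => (R * A' * P) ab.1 ab.2) (fun ab => hB ab.1 ab.2)
  simp only [← hsim (A _), hQ]
  convert! h1 using 1
  have he' : (fun ab : Fin n × Fin n => (R * A t * P) ab.1 ab.2) = e := by
    rw [he, hl]
  rw [he', Fintype.sum_prod_type, Finset.mul_sum]
  refine Finset.sum_congr rfl fun i _ => ?_
  rw [Finset.sum_eq_single i]
  · rw [hdiag]; ring
  · intro j _ hj; rw [hoff i j hj.symm, mul_zero]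
  · simp

end LinearAlgebra

/-! ### Second derivatives -/

section Calculus

variable {n : ℕ} {f g : Cn n → ℝ} {y : Cn n}

/-- The second derivative of a real function. -/
abbrev D2 (f : Cn n → ℝ) (y : Cn n) : Cn n →L[ℝ] Cn n →L[ℝ] ℝ := fderiv ℝ (fderiv ℝ f) y

theorem ContDiffAt.differentiableAt_fderiv (hf : ContDiffAt ℝ 2 f y) :
    DifferentiableAt ℝ (fderiv ℝ f) y :=
  (hf.fderiv_right (m := 1) (by norm_num)).differentiableAt (by norm_num)

theorem ContDiffAt.fderiv_apply {m k : WithTop ℕ∞} (hf : ContDiffAt ℝ m f y) (hk : k + 1 ≤ m)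
    (ξ : Cn n) : ContDiffAt ℝ k (fun z => fderiv ℝ f z ξ) y :=
  (hf.fderiv_right (m := k) hk).clm_apply contDiffAt_const

theorem fderiv_fderiv_apply (hf : ContDiffAt ℝ 2 f y) (ξ a : Cn n) :
    fderiv ℝ (fun z => fderiv ℝ f z ξ) y a = D2 f y a ξ := by
  have h := hf.differentiableAt_fderiv.hasFDerivAt.clm_apply (hasFDerivAt_const ξ y)
  rw [h.fderiv]
  simp [D2]

theorem D2_symm (hf : ContDiffAt ℝ 2 f y) (a b : Cn n) : D2 f y a b = D2 f y b a :=
  (hf.isSymmSndFDerivAt (by simp)) a b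

theorem eventually_differentiableAt (hf : ContDiffAt ℝ 2 f y) :
    ∀ᶠ z in 𝓝 y, DifferentiableAt ℝ f z :=
  (hf.eventually (by simp)).mono fun _ h => h.differentiableAt (by norm_num)

theorem D2_add (hf : ContDiffAt ℝ 2 f y) (hg : ContDiffAt ℝ 2 g y) :
    D2 (fun z => f z + g z) y = D2 f y + D2 g y := by
  have h : fderiv ℝ (fun z => f z + g z) =ᶠ[𝓝 y] fun z => fderiv ℝ f z + fderiv ℝ g z := by
    filter_upwards [eventually_differentiableAt hf, eventually_differentiableAt hg] with z h1 h2
    exact fderiv_fun_add h1 h2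
  rw [D2, h.fderiv_eq, fderiv_fun_add hf.differentiableAt_fderiv hg.differentiableAt_fderiv]

theorem D2_const_mul (hf : ContDiffAt ℝ 2 f y) (c : ℝ) :
    D2 (fun z => c * f z) y = c • D2 f y := by
  have h : fderiv ℝ (fun z => c * f z) =ᶠ[𝓝 y] fun z => c • fderiv ℝ f z := by
    filter_upwards [eventually_differentiableAt hf] with z h1
    exact fderiv_const_mul h1 c
  rw [D2, h.fderiv_eq, fderiv_fun_const_smul hf.differentiableAt_fderiv]

theorem D2_sub (hf : ContDiffAt ℝ 2 f y) (hg : ContDiffAt ℝ 2 g y) :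
    D2 (fun z => f z - g z) y = D2 f y - D2 g y := by
  have h1 := D2_add hf (contDiffAt_const.mul hg : ContDiffAt ℝ 2 (fun z => (-1 : ℝ) * g z) y)
  rw [D2_const_mul hg] at h1
  have h2 : (fun z => f z - g z) = fun z => f z + -1 * g z := by ext z; ring
  rw [h2, h1]
  module

theorem D2_sum {ι : Type*} (s : Finset ι) {f : ι → Cn n → ℝ}
    (hf : ∀ i ∈ s, ContDiffAt ℝ 2 (f i) y) :
    D2 (fun z => ∑ i ∈ s, f i z) y = ∑ i ∈ s, D2 (f i) y := by
  classical
  induction s using Finset.induction_on with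
  | empty =>
    simp only [Finset.sum_empty, D2]
    rw [show fderiv ℝ (fun _ : Cn n => (0 : ℝ)) = fun _ => 0 from by ext; simp]
    simp
  | insert a s ha ih =>
    simp only [Finset.sum_insert ha]
    rw [D2_add (hf a (by simp)) (ContDiffAt.sum fun i hi => hf i (by simp [hi])),
      ih fun i hi => hf i (by simp [hi])]

theorem D2_mul (hf : ContDiffAt ℝ 2 f y) (hg : ContDiffAt ℝ 2 g y) (a b : Cn n) :
    D2 (fun z => f z * g z) y a b = f y * D2 g y a b + g y * D2 f y a b
      + fderiv ℝ f y a * fderiv ℝ g y b + fderiv ℝ g y a * fderiv ℝ f y b := by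
  have h : fderiv ℝ (fun z => f z * g z) =ᶠ[𝓝 y]
      fun z => f z • fderiv ℝ g z + g z • fderiv ℝ f z := by
    filter_upwards [eventually_differentiableAt hf, eventually_differentiableAt hg] with z h1 h2
    exact fderiv_fun_mul h1 h2
  have h1 := (hf.differentiableAt (by norm_num)).hasFDerivAt
  have h2 := (hg.differentiableAt (by norm_num)).hasFDerivAt
  have h3 := (h1.smul hg.differentiableAt_fderiv.hasFDerivAt).add
    (h2.smul hf.differentiableAt_fderiv.hasFDerivAt)
  have h4 : D2 (fun z => f z * g z) y = _ := h.fderiv_eq.trans h3.fderiv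
  rw [h4]
  simp [D2]
  ring

theorem D2_congr (h : f =ᶠ[𝓝 y] g) : D2 f y = D2 g y :=
  h.fderiv.fderiv_eq

/-- The necessary second order condition at a local minimum. -/
theorem D2_nonneg_of_isLocalMin (hf : ContDiffAt ℝ 2 f y) (hmin : IsLocalMin f y) (a : Cn n) :
    0 ≤ D2 f y a a := by
  by_contra! hneg
  set φ : ℝ → ℝ := fun t => f (y + t • a) with hφ
  have hline : ∀ t : ℝ, HasDerivAt (fun t : ℝ => y + t • a) a t := fun t => by
    simpa using ((hasDerivAt_id t).smul_const a).const_add y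
  have hcont : Filter.Tendsto (fun t : ℝ => y + t • a) (𝓝 0) (𝓝 y) := by
    have := (hline 0).continuousAt.tendsto
    simpa using this
  have h1 : deriv φ =ᶠ[𝓝 0] fun t => fderiv ℝ f (y + t • a) a := by
    filter_upwards [hcont.eventually (eventually_differentiableAt hf)] with t ht
    exact (ht.hasFDerivAt.comp_hasDerivAt t (hline t)).deriv
  have h2 : HasDerivAt (fun t : ℝ => fderiv ℝ f (y + t • a) a) (D2 f y a a) 0 := by
    have h3 : HasFDerivAt (fun z => fderiv ℝ f z a) (fderiv ℝ (fun z => fderiv ℝ f z a) y)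
        (y + (0 : ℝ) • a) := by
      simpa using ((hf.fderiv_apply (k := 1) (by norm_num) a).differentiableAt
        (by norm_num)).hasFDerivAt
    have h4 := h3.comp_hasDerivAt (0 : ℝ) (hline 0)
    rw [fderiv_fderiv_apply hf] at h4
    exact h4
  have hmin' : IsLocalMin φ 0 := by
    have : Filter.Tendsto (fun t : ℝ => y + t • a) (𝓝 0) (𝓝 (y + (0 : ℝ) • a)) := by
      simpa using hcont
    have h5 : IsLocalMin f (y + (0 : ℝ) • a) := by simpa using hmin
    exact this.eventually h5
  have hd2 : deriv (deriv φ) 0 < 0 := by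
    rw [h1.deriv_eq, h2.deriv]; exact hneg
  have hφc : ContinuousAt φ 0 := by
    have : ContinuousAt f (y + (0 : ℝ) • a) := by simpa using hf.continuousAt
    exact ContinuousAt.comp (f := fun t : ℝ => y + t • a) this (hline 0).continuousAt
  have hmax : IsLocalMax φ 0 := isLocalMax_of_deriv_deriv_neg hd2 hmin'.deriv_eq_zero hφc
  have hconst : φ =ᶠ[𝓝 0] fun _ => φ 0 := by
    filter_upwards [hmin', hmax] with t h3 h4
    exact le_antisymm h4 h3
  have h6 : deriv φ =ᶠ[𝓝 0] fun _ => 0 := by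
    have := hconst.deriv
    simpa using this
  rw [h6.deriv_eq] at hd2
  simp at hd2

end Calculus

/-! ### Second order operators in diagonal form -/

section Operators

variable {n : ℕ}

/-- The operator `∑ᵢ Fᵢ ∂_{eᵢ} ∂_{ēᵢ}`, applied to a function with second derivative `B`; here
`∂_e ∂_ē = (∂_e² + ∂_{ie}²) / 4` in terms of real directional derivatives. -/
def Lop (F : Fin n → ℝ) (e : Fin n → Cn n) (B : Cn n →L[ℝ] Cn n →L[ℝ] ℝ) : ℝ :=
  (1 / 4) * ∑ i, F i * (B (e i) (e i) + B (Complex.I • e i) (Complex.I • e i))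

/-- The polarized symbol of `Lop`, for two covectors. -/
def Gam (F : Fin n → ℝ) (e : Fin n → Cn n) (a b : Cn n →L[ℝ] ℝ) : ℝ :=
  (1 / 4) * ∑ i, F i * (a (e i) * b (e i) + a (Complex.I • e i) * b (Complex.I • e i))

variable {F : Fin n → ℝ} {e : Fin n → Cn n}

theorem Lop_add (A B : Cn n →L[ℝ] Cn n →L[ℝ] ℝ) : Lop F e (A + B) = Lop F e A + Lop F e B := by
  simp only [Lop, ← mul_add, ← Finset.sum_add_distrib]
  congr 1
  exact Finset.sum_congr rfl fun i _ => by
    simp only [add_apply]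
    ring

theorem Lop_smul (c : ℝ) (B : Cn n →L[ℝ] Cn n →L[ℝ] ℝ) : Lop F e (c • B) = c * Lop F e B := by
  simp only [Lop, Finset.mul_sum]
  exact Finset.sum_congr rfl fun i _ => by simp; ring

theorem Lop_sub (A B : Cn n →L[ℝ] Cn n →L[ℝ] ℝ) : Lop F e (A - B) = Lop F e A - Lop F e B := by
  have := Lop_add (F := F) (e := e) A ((-1 : ℝ) • B)
  rw [Lop_smul] at this
  rw [show A - B = A + (-1 : ℝ) • B by module, this]
  ring

theorem Lop_sum {ι : Type*} (s : Finset ι) (B : ι → Cn n →L[ℝ] Cn n →L[ℝ] ℝ) :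
    Lop F e (∑ i ∈ s, B i) = ∑ i ∈ s, Lop F e (B i) := by
  classical
  induction s using Finset.induction_on with
  | empty => simp [Lop]
  | insert a s ha ih => rw [Finset.sum_insert ha, Finset.sum_insert ha, Lop_add, ih]

theorem Lop_nonneg (hF : ∀ i, 0 ≤ F i) {B : Cn n →L[ℝ] Cn n →L[ℝ] ℝ} (hB : ∀ a, 0 ≤ B a a) :
    0 ≤ Lop F e B :=
  mul_nonneg (by norm_num) (Finset.sum_nonneg fun i _ => mul_nonneg (hF i) (add_nonneg (hB _) (hB _)))

theorem Gam_self_nonneg (hF : ∀ i, 0 ≤ F i) (a : Cn n →L[ℝ] ℝ) : 0 ≤ Gam F e a a :=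
  mul_nonneg (by norm_num) (Finset.sum_nonneg fun i _ => mul_nonneg (hF i)
    (add_nonneg (mul_self_nonneg _) (mul_self_nonneg _)))

theorem norm_I_smul (ξ : Cn n) : ‖Complex.I • ξ‖ = ‖ξ‖ := by rw [norm_smul]; simp

theorem abs_Lop_le (hF : ∀ i, 0 ≤ F i) {R C : ℝ} (he : ∀ i, ‖e i‖ ≤ R)
    {B : Cn n →L[ℝ] Cn n →L[ℝ] ℝ} (hB : ‖B‖ ≤ C) : |Lop F e B| ≤ C * R ^ 2 * ∑ i, F i := by
  have h0 : ∀ a : Cn n, ‖a‖ ≤ R → |B a a| ≤ C * R ^ 2 := by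
    intro a ha
    have h1 := B.le_opNorm₂ a a
    rw [Real.norm_eq_abs] at h1
    have hR : 0 ≤ R := (norm_nonneg a).trans ha
    calc |B a a| ≤ ‖B‖ * ‖a‖ * ‖a‖ := h1
      _ ≤ C * R * R := by gcongr; exact mul_nonneg ((norm_nonneg B).trans hB) hR; exact (norm_nonneg B).trans hB
      _ = C * R ^ 2 := by ring
  have h1 : |∑ i, F i * (B (e i) (e i) + B (Complex.I • e i) (Complex.I • e i))|
      ≤ ∑ i, F i * (2 * (C * R ^ 2)) := by
    refine (Finset.abs_sum_le_sum_abs _ _).trans (Finset.sum_le_sum fun i _ => ?_)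
    rw [abs_mul, abs_of_nonneg (hF i)]
    refine mul_le_mul_of_nonneg_left ?_ (hF i)
    refine (abs_add_le _ _).trans ?_
    have h2 := h0 _ (he i)
    have h3 := h0 (Complex.I • e i) (by rw [norm_I_smul]; exact he i)
    linarith
  rw [← Finset.sum_mul] at h1
  rw [Lop, abs_mul]
  norm_num
  have h2 : 0 ≤ (∑ i, F i) * (2 * (C * R ^ 2)) := (abs_nonneg _).trans h1
  linarith

theorem Lop_mul {f g : Cn n → ℝ} {y : Cn n} (hf : ContDiffAt ℝ 2 f y) (hg : ContDiffAt ℝ 2 g y) :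
    Lop F e (D2 (fun z => f z * g z) y) = f y * Lop F e (D2 g y) + g y * Lop F e (D2 f y)
      + 2 * Gam F e (fderiv ℝ f y) (fderiv ℝ g y) := by
  simp only [Lop, Gam, D2_mul hf hg, Finset.mul_sum, ← Finset.sum_add_distrib]
  exact Finset.sum_congr rfl fun i _ => by ring

/-- The matrix `B(∂/∂z̄ᵏ, ∂/∂zʲ)` of the complex bilinear extension of `B`. -/
def matForm (B : Cn n →L[ℝ] Cn n →L[ℝ] ℝ) : Matrix (Fin n) (Fin n) ℂ :=
  Matrix.of fun k j => (1 / 4) * (((B (Cn.dx k) (Cn.dx j) + B (Cn.dy k) (Cn.dy j) : ℝ) : ℂ)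
    + Complex.I * ((B (Cn.dy k) (Cn.dx j) - B (Cn.dx k) (Cn.dy j) : ℝ) : ℂ))

/-- The sesquilinear form `ξ* A η`. -/
def sesq (A : Matrix (Fin n) (Fin n) ℂ) (ξ η : Cn n) : ℂ :=
  ∑ k, ∑ j, (starRingEnd ℂ) (ξ k) * A k j * η j

theorem eq_sum_dx_dy (ξ : Cn n) : ξ = ∑ k, ((ξ k).re • Cn.dx k + (ξ k).im • Cn.dy k) := by
  ext j
  simp [Cn.dx, Cn.dy, Pi.single_apply, Finset.sum_add_distrib]

end Operators

/-! ### Hermitian forms and the differentiated equation -/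

section Forms

open Matrix
open scoped ComplexOrder

variable {n : ℕ}

theorem bilin_expand (B : Cn n →L[ℝ] Cn n →L[ℝ] ℝ) (ξ η : Cn n) :
    B ξ η = ∑ k, ∑ j, ((ξ k).re * (η j).re * B (Cn.dx k) (Cn.dx j)
      + (ξ k).re * (η j).im * B (Cn.dx k) (Cn.dy j) + (ξ k).im * (η j).re * B (Cn.dy k) (Cn.dx j)
      + (ξ k).im * (η j).im * B (Cn.dy k) (Cn.dy j)) := by
  conv_lhs => rw [eq_sum_dx_dy ξ, eq_sum_dx_dy η]
  simp only [map_sum, map_add, map_smul, _root_.sum_apply, _root_.add_apply, _root_.smul_apply,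
    smul_eq_mul]
  rw [Finset.sum_comm]
  refine Finset.sum_congr rfl fun k _ => ?_
  rw [Finset.mul_sum, Finset.mul_sum, ← Finset.sum_add_distrib]
  refine Finset.sum_congr rfl fun j _ => ?_
  ring

theorem sesq_matForm (B : Cn n →L[ℝ] Cn n →L[ℝ] ℝ) (ξ η : Cn n) :
    sesq (matForm B) ξ η = (1 / 4) * (((B ξ η + B (Complex.I • ξ) (Complex.I • η) : ℝ) : ℂ)
      + Complex.I * ((B (Complex.I • ξ) η - B ξ (Complex.I • η) : ℝ) : ℂ)) := by
  rw [bilin_expand B ξ η, bilin_expand B (Complex.I • ξ) (Complex.I • η),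
    bilin_expand B (Complex.I • ξ) η, bilin_expand B ξ (Complex.I • η), sesq]
  simp only [← Finset.sum_add_distrib, ← Finset.sum_sub_distrib, Complex.ofReal_sum,
    Finset.mul_sum]
  refine Finset.sum_congr rfl fun k _ => Finset.sum_congr rfl fun j _ => ?_
  apply Complex.ext
  · simp [matForm]; ring
  · simp [matForm]; ring

theorem sesq_add_right (A : Matrix (Fin n) (Fin n) ℂ) (ξ η ζ : Cn n) :
    sesq A ξ (η + ζ) = sesq A ξ η + sesq A ξ ζ := by
  simp [sesq, mul_add, Finset.sum_add_distrib]

theorem sesq_smul_right (A : Matrix (Fin n) (Fin n) ℂ) (ξ η : Cn n) (c : ℂ) :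
    sesq A ξ (c • η) = c * sesq A ξ η := by
  simp only [sesq, Finset.mul_sum]
  refine Finset.sum_congr rfl fun k _ => Finset.sum_congr rfl fun j _ => ?_
  simp; ring

theorem sesq_add (A B : Matrix (Fin n) (Fin n) ℂ) (ξ η : Cn n) :
    sesq (A + B) ξ η = sesq A ξ η + sesq B ξ η := by
  simp [sesq, mul_add, add_mul, Finset.sum_add_distrib]

theorem sesq_sub (A B : Matrix (Fin n) (Fin n) ℂ) (ξ η : Cn n) :
    sesq (A - B) ξ η = sesq A ξ η - sesq B ξ η := by
  simp [sesq, mul_sub, sub_mul]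

theorem norm_sesq_le {A : Matrix (Fin n) (Fin n) ℂ} {C : ℝ} (hA : ∀ k j, ‖A k j‖ ≤ C)
    (ξ η : Cn n) : ‖sesq A ξ η‖ ≤ n ^ 2 * C * ‖ξ‖ * ‖η‖ := by
  have h : ∀ k j, ‖(starRingEnd ℂ) (ξ k) * A k j * η j‖ ≤ C * ‖ξ‖ * ‖η‖ := by
    intro k j
    rw [norm_mul, norm_mul, RCLike.norm_conj]
    have h1 := PiLp.norm_apply_le ξ k
    have h2 := PiLp.norm_apply_le η j
    have h3 := hA k j
    have : 0 ≤ C := (norm_nonneg _).trans h3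
    calc ‖ξ k‖ * ‖A k j‖ * ‖η j‖ ≤ ‖ξ‖ * C * ‖η‖ := by gcongr
      _ = _ := by ring
  refine (norm_sum_le _ _).trans ?_
  calc ∑ k, ‖∑ j, (starRingEnd ℂ) (ξ k) * A k j * η j‖ ≤ ∑ k : Fin n, ∑ j : Fin n, C * ‖ξ‖ * ‖η‖ :=
        Finset.sum_le_sum fun k _ => (norm_sum_le _ _).trans (Finset.sum_le_sum fun j _ => h k j)
    _ = _ := by simp; ring

/-- The columns of a matrix, as vectors of `ℂⁿ`. -/
def colVec (P : Matrix (Fin n) (Fin n) ℂ) (i : Fin n) : Cn n := WithLp.toLp 2 fun k => P k i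

theorem conjTranspose_mul_mul_apply (A P : Matrix (Fin n) (Fin n) ℂ) (i j : Fin n) :
    (Pᴴ * A * P) i j = sesq A (colVec P i) (colVec P j) := by
  simp only [mul_apply, sesq, colVec, conjTranspose_apply, Finset.sum_mul]
  rw [Finset.sum_comm]
  rfl

theorem Lop_eq_sum_sesq (F : Fin n → ℝ) (e : Fin n → Cn n) (B : Cn n →L[ℝ] Cn n →L[ℝ] ℝ) :
    Lop F e B = ∑ i, F i * (sesq (matForm B) (e i) (e i)).re := by
  rw [Lop, Finset.mul_sum]
  refine Finset.sum_congr rfl fun i _ => ?_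
  rw [sesq_matForm]
  simp
  ring

theorem matForm_isHermitian {B : Cn n →L[ℝ] Cn n →L[ℝ] ℝ} (hB : ∀ a b, B a b = B b a) :
    (matForm B).IsHermitian := by
  ext k j
  simp only [conjTranspose_apply, matForm, of_apply]
  rw [hB (Cn.dx j) (Cn.dx k), hB (Cn.dy j) (Cn.dy k), hB (Cn.dy j), hB (Cn.dx j)]
  apply Complex.ext <;> simp

theorem matForm_sub (A B : Cn n →L[ℝ] Cn n →L[ℝ] ℝ) : matForm (A - B) = matForm A - matForm B := by
  ext k j
  simp [matForm]; ring

theorem differentiableAt_det {A : ℝ → Matrix (Fin n) (Fin n) ℂ} {t : ℝ}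
    (hA : ∀ i j, DifferentiableAt ℝ (fun s => A s i j) t) :
    DifferentiableAt ℝ (fun s => (A s).det) t := by
  simp only [det_apply]
  refine DifferentiableAt.fun_sum fun σ _ => ?_
  refine DifferentiableAt.const_smul ?_ _
  exact DifferentiableAt.fun_finsetProd fun i _ => hA _ _

theorem differentiableAt_matrix_inv {A : ℝ → Matrix (Fin n) (Fin n) ℂ} {t : ℝ}
    (hA : ∀ i j, DifferentiableAt ℝ (fun s => A s i j) t) (hdet : (A t).det ≠ 0) (i j : Fin n) :
    DifferentiableAt ℝ (fun s => (A s)⁻¹ i j) t := by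
  have h : ∀ s, (A s)⁻¹ i j = (A s).det⁻¹ * ((A s).updateRow j (Pi.single i 1)).det := by
    intro s
    rw [Matrix.inv_def, Ring.inverse_eq_inv', Matrix.smul_apply, adjugate_apply, smul_eq_mul]
  simp only [h]
  refine ((differentiableAt_det hA).inv hdet).mul (differentiableAt_det fun a b => ?_)
  simp only [updateRow_apply]
  split_ifs
  · exact differentiableAt_const _
  · exact hA a b

variable {p : ℕ}

theorem fderiv_D2_apply {u : Cn n → ℝ} {y : Cn n} (hu : ContDiffAt ℝ 3 u y) (ξ a b : Cn n) :
    fderiv ℝ (D2 u) y ξ a b = D2 (fun z => fderiv ℝ u z ξ) y a b := by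
  have hd : ContDiffAt ℝ 2 (fderiv ℝ u) y := hu.fderiv_right (by norm_num)
  have hdd : DifferentiableAt ℝ (D2 u) y :=
    (hd.fderiv_right (m := 1) (by norm_num)).differentiableAt (by norm_num)
  have hev : ∀ᶠ z in 𝓝 y, ContDiffAt ℝ 2 u z :=
    (hu.of_le (by norm_num) : ContDiffAt ℝ 2 u y).eventually (by simp)
  have h1 : (fun z => fderiv ℝ (fun z => fderiv ℝ u z ξ) z b) =ᶠ[𝓝 y] fun z => D2 u z ξ b := by
    filter_upwards [hev] with z hz
    rw [fderiv_fderiv_apply hz, D2_symm hz]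
  have h2 : ContDiffAt ℝ 2 (fun z => fderiv ℝ u z ξ) y := hd.clm_apply contDiffAt_const
  have h3 : D2 (fun z => fderiv ℝ u z ξ) y a b
      = fderiv ℝ (fun z => fderiv ℝ (fun z => fderiv ℝ u z ξ) z b) y a := by
    rw [fderiv_fderiv_apply h2]
  rw [h3, h1.fderiv_eq]
  have h4 : fderiv ℝ (fun z => D2 u z ξ b) y a = fderiv ℝ (D2 u) y a ξ b := by
    have := (hdd.hasFDerivAt.clm_apply (hasFDerivAt_const ξ y)).clm_apply (hasFDerivAt_const b y)
    rw [this.fderiv]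
    simp
  rw [h4]
  have h5 : IsSymmSndFDerivAt ℝ (fderiv ℝ u) y := hd.isSymmSndFDerivAt (by simp)
  have h6 := h5 ξ a
  exact congrArg (fun f => f b) h6

/-- The equation `ℳ_p = ψ`, differentiated in the direction `ξ`. -/
theorem Lop_fderiv_of_equation {W X : Cn n → Matrix (Fin n) (Fin n) ℂ} {u ψ : Cn n → ℝ} {y : Cn n}
    (hu : ContDiffAt ℝ 3 u y) {W' X' : Fin n → Fin n → (Cn n →L[ℝ] ℂ)}
    (hW' : ∀ k j, HasFDerivAt (fun z => W z k j) (W' k j) y)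
    (hX' : ∀ k j, HasFDerivAt (fun z => X z k j) (X' k j) y)
    (hψ : DifferentiableAt ℝ ψ y) (hψ0 : 0 < ψ y)
    (heq : ∀ᶠ z in 𝓝 y, sumProd p (((W z)⁻¹ * (X z + matForm (D2 u z))).charpoly.roots) = (ψ z : ℂ))
    {P : Matrix (Fin n) (Fin n) ℂ} {l : Fin n → ℝ} (hP : Pᴴ * W y * P = 1)
    (hl : Pᴴ * (X y + matForm (D2 u y)) * P = diagonal fun i => (l i : ℂ))
    (hcone : ∀ I ∈ Finset.powersetCard p Finset.univ, 0 < ∑ k ∈ I, l k) (ξ : Cn n) :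
    Lop (wt p l) (colVec P) (D2 (fun z => fderiv ℝ u z ξ) y) = fderiv ℝ ψ y ξ / ψ y
      - ∑ i, wt p l i * (sesq (of fun k j => X' k j ξ) (colVec P i) (colVec P i)).re
      + ∑ i, wt p l i * l i * (sesq (of fun k j => W' k j ξ) (colVec P i) (colVec P i)).re := by
  have hline : HasDerivAt (fun t : ℝ => y + t • ξ) ξ 0 := by
    simpa using ((hasDerivAt_id (0 : ℝ)).smul_const ξ).const_add y
  have h0 : y + (0 : ℝ) • ξ = y := by simp
  have hcont : Filter.Tendsto (fun t : ℝ => y + t • ξ) (𝓝 0) (𝓝 y) := by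
    have := hline.continuousAt.tendsto
    simpa using this
  have hcomp : ∀ {G : Type} [NormedAddCommGroup G] [NormedSpace ℝ G] {f : Cn n → G}
      {f' : Cn n →L[ℝ] G}, HasFDerivAt f f' y → HasDerivAt (fun t : ℝ => f (y + t • ξ)) (f' ξ) 0 := by
    intro G _ _ f f' hf
    rw [← h0] at hf
    exact hf.comp_hasDerivAt (0 : ℝ) hline
  have hdd : DifferentiableAt ℝ (D2 u) y :=
    ((hu.fderiv_right (m := 2) (by norm_num)).fderiv_right (m := 1) (by norm_num)).differentiableAt
      (by norm_num)
  set B' := D2 (fun z => fderiv ℝ u z ξ) y with hB'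
  have hH : ∀ k j, HasDerivAt (fun t : ℝ => matForm (D2 u (y + t • ξ)) k j) (matForm B' k j) 0 := by
    intro k j
    have h1 : ∀ a b, HasDerivAt (fun t : ℝ => D2 u (y + t • ξ) a b) (B' a b) 0 := by
      intro a b
      have h2 := (hdd.hasFDerivAt.clm_apply (hasFDerivAt_const a y)).clm_apply
        (hasFDerivAt_const b y)
      have h3 := hcomp h2
      rw [hB', ← fderiv_D2_apply hu]
      simpa using h3
    simp only [matForm, of_apply]
    exact ((((h1 _ _).add (h1 _ _)).ofReal_comp).add
      ((((h1 _ _).sub (h1 _ _)).ofReal_comp).const_mul _)).const_mul _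
  set A : ℝ → Matrix (Fin n) (Fin n) ℂ := fun t =>
    (W (y + t • ξ))⁻¹ * (X (y + t • ξ) + matForm (D2 u (y + t • ξ))) with hA
  have hWinv : IsUnit (W y).det := by
    have h1 := congrArg Matrix.det hP
    rw [det_mul, det_mul, det_one] at h1
    refine isUnit_iff_ne_zero.2 fun h => ?_
    simp [h] at h1
  have hWd : ∀ k j, HasDerivAt (fun t : ℝ => W (y + t • ξ) k j) (W' k j ξ) 0 := fun k j =>
    hcomp (hW' k j)
  have hXd : ∀ k j, HasDerivAt (fun t : ℝ => X (y + t • ξ) k j) (X' k j ξ) 0 := fun k j =>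
    hcomp (hX' k j)
  have hAd : ∀ i j, DifferentiableAt ℝ (fun t => A t i j) 0 := by
    intro i j
    simp only [hA, mul_apply]
    refine DifferentiableAt.fun_sum fun k _ => DifferentiableAt.mul ?_ ?_
    · exact differentiableAt_matrix_inv (A := fun t : ℝ => W (y + t • ξ))
        (fun a b => (hWd a b).differentiableAt) (by simpa using hWinv.ne_zero) i k
    · exact ((hXd k j).add (hH k j)).differentiableAt
  set A' : Matrix (Fin n) (Fin n) ℂ := of fun i j => deriv (fun t => A t i j) 0 with hA'
  set Wm : Matrix (Fin n) (Fin n) ℂ := of fun k j => W' k j ξ with hWm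
  set Xm : Matrix (Fin n) (Fin n) ℂ := of fun k j => X' k j ξ with hXm
  have hA0 : A 0 = (W y)⁻¹ * (X y + matForm (D2 u y)) := by simp [hA]
  -- differentiate `W A = X + matForm (D2 u)`
  have hprod : Wm * A 0 + W y * A' = Xm + matForm B' := by
    have hev : ∀ᶠ t : ℝ in 𝓝 0, IsUnit (W (y + t • ξ)).det := by
      have hc : ContinuousAt (fun t : ℝ => (W (y + t • ξ)).det) 0 :=
        (differentiableAt_det fun i j => (hWd i j).differentiableAt).continuousAt
      have : (W (y + (0 : ℝ) • ξ)).det ≠ 0 := by rw [h0]; exact hWinv.ne_zero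
      filter_upwards [hc.eventually_ne this] with t ht
      exact isUnit_iff_ne_zero.2 ht
    ext i j
    have h1 : HasDerivAt (fun t : ℝ => (W (y + t • ξ) * A t) i j) ((Wm * A 0 + W y * A') i j) 0 := by
      simp only [Matrix.add_apply, mul_apply, ← Finset.sum_add_distrib]
      refine HasDerivAt.fun_sum fun k _ => ?_
      have := (hWd i k).fun_mul (hAd k j).hasDerivAt
      simpa [h0, hWm, hA'] using this
    have h2 : HasDerivAt (fun t : ℝ => (X (y + t • ξ) + matForm (D2 u (y + t • ξ))) i j)
        ((Xm + matForm B') i j) 0 := (hXd i j).add (hH i j)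
    refine h1.unique (h2.congr_of_eventuallyEq ?_)
    filter_upwards [hev] with t ht
    rw [hA]
    simp only
    rw [← Matrix.mul_assoc, mul_nonsing_inv _ ht, Matrix.one_mul]
  have hR : Pᴴ * W y * A 0 * P = diagonal fun i => (l i : ℂ) := by
    rw [hA0, ← hl]
    simp only [Matrix.mul_assoc]
    rw [← Matrix.mul_assoc (W y), mul_nonsing_inv _ hWinv, Matrix.one_mul]
  have hAP : A 0 * P = P * diagonal fun i => (l i : ℂ) := by
    have h1 : P * (Pᴴ * W y) = 1 := mul_eq_one_comm.1 hP
    rw [← hR]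
    calc A 0 * P = (P * (Pᴴ * W y)) * (A 0 * P) := by rw [h1, Matrix.one_mul]
      _ = _ := by simp only [Matrix.mul_assoc]
  have hRA' : Pᴴ * W y * A' * P = Pᴴ * Xm * P + Pᴴ * matForm B' * P
      - Pᴴ * Wm * P * diagonal fun i => (l i : ℂ) := by
    have h1 : W y * A' = Xm + matForm B' - Wm * A 0 := by rw [← hprod]; abel
    have h2 : Pᴴ * W y * A' * P = Pᴴ * (W y * A') * P := by simp only [Matrix.mul_assoc]
    rw [h2, h1, Matrix.mul_sub, Matrix.sub_mul, Matrix.mul_add, Matrix.add_mul]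
    simp only [Matrix.mul_assoc]
    rw [hAP]
  have hder := hasDerivAt_sumProd (p := p) (A := A) (A' := A') (t := 0)
    (fun i j => (hAd i j).hasDerivAt) (P := P) (R := Pᴴ * W y) hP hR hcone
  have hψd : HasDerivAt (fun t : ℝ => ((ψ (y + t • ξ) : ℝ) : ℂ)) ((fderiv ℝ ψ y ξ : ℝ) : ℂ) 0 :=
    (hcomp hψ.hasFDerivAt).ofReal_comp
  have heq' : (fun t => sumProd p (A t).charpoly.roots) =ᶠ[𝓝 0]
      fun t : ℝ => ((ψ (y + t • ξ) : ℝ) : ℂ) := hcont.eventually heq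
  have hval := hder.unique (hψd.congr_of_eventuallyEq heq')
  have hprodψ : (∏ I ∈ Finset.powersetCard p Finset.univ, ∑ k ∈ I, l k) = ψ y := by
    have h1 := heq.self_of_nhds
    rw [charpoly_inv_mul hP, hl, roots_charpoly_diagonal, sumProd_map_univ] at h1
    exact_mod_cast h1
  rw [hprodψ, hRA'] at hval
  have hre := congrArg Complex.re hval
  rw [Complex.re_ofReal_mul, Complex.re_sum, Complex.ofReal_re] at hre
  rw [Lop_eq_sum_sesq, ← hre, mul_div_cancel_left₀ _ hψ0.ne', ← Finset.sum_sub_distrib,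
    ← Finset.sum_add_distrib]
  refine Finset.sum_congr rfl fun i _ => ?_
  rw [Matrix.sub_apply, Matrix.add_apply, mul_diagonal, conjTranspose_mul_mul_apply,
    conjTranspose_mul_mul_apply, conjTranspose_mul_mul_apply, Complex.re_ofReal_mul,
    Complex.sub_re, Complex.add_re, Complex.re_mul_ofReal]
  ring

end Forms

/-! ### Tangential second derivatives -/

section Tangential

variable {n : ℕ}

/-- The real coordinate vectors `∂/∂xᵏ`, `∂/∂yᵏ` of `ℂⁿ`. -/
def bas : Fin n ⊕ Fin n → Cn n := Sum.elim Cn.dx Cn.dy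

/-- The real coordinates of a vector of `ℂⁿ`. -/
def coord (ξ : Cn n) : Fin n ⊕ Fin n → ℝ := Sum.elim (fun k => (ξ k).re) fun k => (ξ k).im

theorem eq_sum_bas (ξ : Cn n) : ξ = ∑ b, coord ξ b • bas b := by
  rw [Fintype.sum_sum_type, ← Finset.sum_add_distrib]
  exact eq_sum_dx_dy ξ

theorem sum_coord_sq (ξ : Cn n) : ∑ b, coord ξ b ^ 2 = ‖ξ‖ ^ 2 := by
  rw [EuclideanSpace.norm_sq_eq, Fintype.sum_sum_type, ← Finset.sum_add_distrib]
  refine Finset.sum_congr rfl fun k _ => ?_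
  rw [← Complex.normSq_eq_norm_sq, Complex.normSq_apply]
  simp [coord]
  ring

theorem norm_bas (b : Fin n ⊕ Fin n) : ‖(bas b : Cn n)‖ = 1 := by
  rcases b with k | k <;> simp [bas, Cn.dx, Cn.dy]

/-- The vector `D(ν) ξ - D(ξ) ν`, which lies in the kernel of the functional `D`. For `D` the
differential of a boundary defining function it is tangential to the boundary. -/
def tvec (D : Cn n →L[ℝ] ℝ) (ν ξ : Cn n) : Cn n := D ν • ξ - D ξ • ν

/-- The symbol of the operator `Lop F e`, up to the factor `1/4`, on the covector `w₂(·, ξ)`. -/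
def qe (F : Fin n → ℝ) (e : Fin n → Cn n) (w₂ : Cn n →L[ℝ] Cn n →L[ℝ] ℝ) (ξ : Cn n) : ℝ :=
  ∑ i, F i * (w₂ (e i) ξ ^ 2 + w₂ (Complex.I • e i) ξ ^ 2)

/-- The sum of `qe` over the tangential vectors obtained from the coordinate vectors. -/
def Sw (F : Fin n → ℝ) (e : Fin n → Cn n) (w₂ : Cn n →L[ℝ] Cn n →L[ℝ] ℝ) (D : Cn n →L[ℝ] ℝ)
    (ν : Cn n) : ℝ := ∑ b, qe F e w₂ (tvec D ν (bas b))

/-- Bounds at a point for a frame `e`, orthonormal for `W`, in which `G + ∂∂̄w` is diagonal with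
eigenvalues `l` with respect to `W`; here `w₂` is the second derivative of `w`, and `D` is the
differential of a boundary defining function, transversal to `ν`. -/
structure FrameBounds (C : ℝ) (F l : Fin n → ℝ) (e : Fin n → Cn n)
    (W G : Matrix (Fin n) (Fin n) ℂ) (w₂ : Cn n →L[ℝ] Cn n →L[ℝ] ℝ) (D : Cn n →L[ℝ] ℝ)
    (ν : Cn n) : Prop where
  one_le : 1 ≤ C
  F_nonneg : ∀ i, 0 ≤ F i
  e_le : ∀ i, ‖e i‖ ≤ C
  orth : ∀ i j, sesq W (e i) (e j) = if i = j then 1 else 0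
  eig : ∀ i ζ, sesq (matForm w₂) (e i) ζ = l i * sesq W (e i) ζ - sesq G (e i) ζ
  W_le : ∀ i ζ, ‖sesq W (e i) ζ‖ ≤ C * ‖ζ‖
  G_le : ∀ i ζ, ‖sesq G (e i) ζ‖ ≤ C * ‖ζ‖
  D_le : ‖D‖ ≤ C
  ν_le : ‖ν‖ ≤ C
  ν_pos : 1 ≤ C * D ν
  sum_le : |∑ i, F i * l i| ≤ C

variable {C : ℝ} {F l : Fin n → ℝ} {e : Fin n → Cn n} {W G : Matrix (Fin n) (Fin n) ℂ}
  {w₂ : Cn n →L[ℝ] Cn n →L[ℝ] ℝ} {D : Cn n →L[ℝ] ℝ} {ν : Cn n}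

theorem qe_nonneg (hF : ∀ i, 0 ≤ F i) (ξ : Cn n) : 0 ≤ qe F e w₂ ξ :=
  Finset.sum_nonneg fun i _ => mul_nonneg (hF i) (by positivity)

theorem Sw_nonneg (hF : ∀ i, 0 ≤ F i) : 0 ≤ Sw F e w₂ D ν :=
  Finset.sum_nonneg fun _ _ => qe_nonneg hF _

theorem tvec_eq_sum (ξ : Cn n) : tvec D ν ξ = ∑ b, coord ξ b • tvec D ν (bas b) := by
  simp only [tvec, smul_sub, Finset.sum_sub_distrib]
  conv_lhs => rw [eq_sum_bas ξ]
  simp only [map_sum, map_smul, smul_eq_mul, Finset.sum_smul, Finset.smul_sum, smul_smul]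
  congr 1
  exact Finset.sum_congr rfl fun b _ => by rw [mul_comm]

theorem qe_tvec_le (hF : ∀ i, 0 ≤ F i) (ξ : Cn n) :
    qe F e w₂ (tvec D ν ξ) ≤ ‖ξ‖ ^ 2 * Sw F e w₂ D ν := by
  have h : ∀ a : Cn n, w₂ a (tvec D ν ξ) ^ 2 ≤ ‖ξ‖ ^ 2 * ∑ b, w₂ a (tvec D ν (bas b)) ^ 2 := by
    intro a
    rw [tvec_eq_sum, map_sum, ← sum_coord_sq]
    simp only [map_smul, smul_eq_mul]
    exact Finset.sum_mul_sq_le_sq_mul_sq _ _ _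
  have h2 : Sw F e w₂ D ν = ∑ i, F i * (∑ b, w₂ (e i) (tvec D ν (bas b)) ^ 2
      + ∑ b, w₂ (Complex.I • e i) (tvec D ν (bas b)) ^ 2) := by
    simp only [Sw, qe]
    rw [Finset.sum_comm]
    refine Finset.sum_congr rfl fun i _ => ?_
    rw [← Finset.mul_sum, Finset.sum_add_distrib]
  rw [h2, qe, Finset.mul_sum]
  refine Finset.sum_le_sum fun i _ => ?_
  have h3 := h (e i)
  have h4 := h (Complex.I • e i)
  have h5 := hF i
  nlinarith

theorem sesq_matForm_re (B : Cn n →L[ℝ] Cn n →L[ℝ] ℝ) (ξ η : Cn n) :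
    (sesq (matForm B) ξ η).re = (1 / 4) * (B ξ η + B (Complex.I • ξ) (Complex.I • η)) := by
  rw [sesq_matForm]; simp

theorem smul_I_I (ξ : Cn n) : Complex.I • Complex.I • ξ = -ξ := by
  rw [smul_smul, Complex.I_mul_I, neg_one_smul]

/-- At most one of the `F_i λ_i²` is not controlled by the tangential second derivatives. Let `ℓ` be
the complex linear functional `D - i D ∘ J`, whose kernel is the complex tangent space, and choose `r`
with `|ℓ(e_r)|` maximal. For `i ≠ r`, the vector `ζ = e_i - (ℓ(e_i) / ℓ(e_r)) e_r` is complex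
tangential and of bounded length, and the `W`-product of `e_i` and `ζ` is `1`. -/
theorem FrameBounds.exists_forall_ne [NeZero n] (h : FrameBounds C F l e W G w₂ D ν) :
    ∃ r, ∀ i, i ≠ r → F i * l i ^ 2 ≤ 16 * C ^ 4 * (Sw F e w₂ D ν + ∑ i, F i) := by
  have hC := h.one_le
  -- `L` is twice the complex linear part of `D`; its kernel consists of the complex tangential vectors
  set L : Cn n → ℂ := fun ξ => (D ξ : ℂ) - Complex.I * (D (Complex.I • ξ) : ℂ) with hL
  have hLsmul : ∀ (c : ℂ) (ξ : Cn n), L (c • ξ) = c * L ξ := by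
    intro c ξ
    have h1 : c • ξ = c.re • ξ + c.im • (Complex.I • ξ) := by
      conv_lhs => rw [← Complex.re_add_im c]
      rw [add_smul, mul_smul]
      rfl
    have h2 : Complex.I • c • ξ = c.re • (Complex.I • ξ) - c.im • ξ := by
      rw [h1, smul_add, smul_comm Complex.I c.re ξ, smul_comm Complex.I c.im, smul_I_I]
      simp [sub_eq_add_neg]
    simp only [hL]
    rw [h2, h1]
    simp only [map_add, map_sub, map_smul, smul_eq_mul]
    apply Complex.ext <;> simp <;> ring
  have hLsub : ∀ ξ η : Cn n, L (ξ - η) = L ξ - L η := by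
    intro ξ η
    simp only [hL, smul_sub, map_sub]
    push_cast
    ring
  -- for the index `r` with the most transversal frame vector, subtracting a multiple of `e r` from
  -- another `e i` yields a complex tangential `ζ` without changing the product with `e i`
  obtain ⟨r, hr⟩ := Finite.exists_max fun i => ‖L (e i)‖
  refine ⟨r, fun i hi => ?_⟩
  set c : ℂ := L (e i) / L (e r) with hc
  have hcn : ‖c‖ ≤ 1 := by
    rw [hc, norm_div]
    exact div_le_one_of_le₀ (hr i) (norm_nonneg _)
  set ζ : Cn n := e i - c • e r with hζ
  have hζL : L ζ = 0 := by
    rw [hζ, hLsub, hLsmul, hc]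
    by_cases h0 : L (e r) = 0
    · have : ‖L (e i)‖ ≤ 0 := by simpa [h0] using hr i
      rw [norm_le_zero_iff.1 this, h0]; simp
    · rw [div_mul_cancel₀ _ h0, sub_self]
  have hDζ : D ζ = 0 := by
    have := congrArg Complex.re hζL
    simpa [hL] using this
  have hDJζ : D (Complex.I • ζ) = 0 := by
    have := congrArg Complex.im hζL
    simpa [hL] using this
  have hζn : ‖ζ‖ ≤ 2 * C := by
    refine (norm_sub_le _ _).trans ?_
    rw [norm_smul]
    have h1 := h.e_le i
    have h2 := h.e_le r
    nlinarith [norm_nonneg (e r)]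
  have hWζ : sesq W (e i) ζ = 1 := by
    have h1 : ζ = e i + (-c) • e r := by rw [hζ, neg_smul, sub_eq_add_neg]
    rw [h1, sesq_add_right, sesq_smul_right, h.orth, h.orth]
    simp [hi]
  have hli : l i = (1 / 4) * (w₂ (e i) ζ + w₂ (Complex.I • e i) (Complex.I • ζ))
      + (sesq G (e i) ζ).re := by
    have h1 := congrArg Complex.re (h.eig i ζ)
    rw [hWζ, sesq_matForm_re] at h1
    simp at h1
    simp
    linarith
  have hG : |(sesq G (e i) ζ).re| ≤ 2 * C ^ 2 := by
    refine (Complex.abs_re_le_norm _).trans ((h.G_le i ζ).trans ?_)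
    nlinarith
  have hDν : 0 < D ν := by
    have := h.ν_pos
    by_contra! h0
    nlinarith
  -- `λ_i` is a combination of second derivatives of `w` in the tangential directions `ζ` and `iζ`
  have htζ : tvec D ν ζ = D ν • ζ := by simp [tvec, hDζ]
  have htJζ : tvec D ν (Complex.I • ζ) = D ν • (Complex.I • ζ) := by simp [tvec, hDJζ]
  have hq1 := qe_tvec_le (w₂ := w₂) (e := e) (D := D) (ν := ν) h.F_nonneg ζ
  have hq2 := qe_tvec_le (w₂ := w₂) (e := e) (D := D) (ν := ν) h.F_nonneg (Complex.I • ζ)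
  rw [norm_I_smul] at hq2
  have hSw : 0 ≤ Sw F e w₂ D ν := Sw_nonneg h.F_nonneg
  have hterm : ∀ ξ : Cn n, F i * (w₂ (e i) ξ ^ 2 + w₂ (Complex.I • e i) ξ ^ 2) ≤ qe F e w₂ ξ :=
    fun ξ => Finset.single_le_sum
      (f := fun i => F i * (w₂ (e i) ξ ^ 2 + w₂ (Complex.I • e i) ξ ^ 2))
      (fun j _ => mul_nonneg (h.F_nonneg j) (by positivity)) (Finset.mem_univ i)
  have ht1 := (hterm (tvec D ν ζ)).trans hq1
  have ht2 := (hterm (tvec D ν (Complex.I • ζ))).trans hq2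
  rw [htζ] at ht1
  rw [htJζ] at ht2
  simp only [map_smul, smul_eq_mul] at ht1 ht2
  set x := w₂ (e i) ζ
  set x' := w₂ (Complex.I • e i) (Complex.I • ζ)
  have hFi := h.F_nonneg i
  have hζ2 : ‖ζ‖ ^ 2 ≤ 4 * C ^ 2 := by nlinarith [norm_nonneg ζ]
  have hb1 : F i * x ^ 2 ≤ C ^ 2 * (4 * C ^ 2 * Sw F e w₂ D ν) := by
    have h1 : F i * (D ν * x) ^ 2 ≤ 4 * C ^ 2 * Sw F e w₂ D ν := by
      refine le_trans (mul_le_mul_of_nonneg_left ?_ hFi) (ht1.trans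
        (mul_le_mul_of_nonneg_right hζ2 hSw))
      exact le_add_of_nonneg_right (sq_nonneg _)
    have h2 : F i * x ^ 2 ≤ C ^ 2 * (F i * (D ν * x) ^ 2) := by
      have h3 : 1 ≤ (C * D ν) ^ 2 := one_le_pow₀ h.ν_pos
      have h4 : 0 ≤ F i * x ^ 2 := mul_nonneg hFi (sq_nonneg _)
      calc F i * x ^ 2 ≤ (C * D ν) ^ 2 * (F i * x ^ 2) := le_mul_of_one_le_left h4 h3
        _ = _ := by ring
    exact h2.trans (mul_le_mul_of_nonneg_left h1 (by positivity))
  have hb2 : F i * x' ^ 2 ≤ C ^ 2 * (4 * C ^ 2 * Sw F e w₂ D ν) := by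
    have h1 : F i * (D ν * x') ^ 2 ≤ 4 * C ^ 2 * Sw F e w₂ D ν := by
      refine le_trans (mul_le_mul_of_nonneg_left ?_ hFi) (ht2.trans
        (mul_le_mul_of_nonneg_right hζ2 hSw))
      exact le_add_of_nonneg_left (sq_nonneg _)
    have h2 : F i * x' ^ 2 ≤ C ^ 2 * (F i * (D ν * x') ^ 2) := by
      have h3 : 1 ≤ (C * D ν) ^ 2 := one_le_pow₀ h.ν_pos
      have h4 : 0 ≤ F i * x' ^ 2 := mul_nonneg hFi (sq_nonneg _)
      calc F i * x' ^ 2 ≤ (C * D ν) ^ 2 * (F i * x' ^ 2) := le_mul_of_one_le_left h4 h3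
        _ = _ := by ring
    exact h2.trans (mul_le_mul_of_nonneg_left h1 (by positivity))
  have hFs : F i ≤ ∑ i, F i := Finset.single_le_sum (fun j _ => h.F_nonneg j) (Finset.mem_univ i)
  have hS0 : 0 ≤ ∑ i, F i := hFi.trans hFs
  set g := (sesq G (e i) ζ).re
  have hg2 : g ^ 2 ≤ 4 * C ^ 4 := by
    rw [← sq_abs]; nlinarith [abs_nonneg g]
  have hl2 : l i ^ 2 ≤ 3 * ((1 / 16) * x ^ 2 + (1 / 16) * x' ^ 2 + g ^ 2) := by
    rw [hli]
    nlinarith [sq_nonneg (x / 4 - x' / 4), sq_nonneg (x / 4 - g), sq_nonneg (x' / 4 - g)]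
  have h6 : F i * g ^ 2 ≤ 4 * C ^ 4 * ∑ i, F i := by
    calc F i * g ^ 2 ≤ (∑ i, F i) * (4 * C ^ 4) := by gcongr
      _ = _ := by ring
  have hC4 : 0 ≤ C ^ 4 * Sw F e w₂ D ν := by positivity
  have hC4' : 0 ≤ C ^ 4 * ∑ i, F i := by positivity
  calc F i * l i ^ 2 ≤ F i * (3 * ((1 / 16) * x ^ 2 + (1 / 16) * x' ^ 2 + g ^ 2)) := by gcongr
    _ = (3 / 16) * (F i * x ^ 2) + (3 / 16) * (F i * x' ^ 2) + 3 * (F i * g ^ 2) := by ring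
    _ ≤ _ := by linarith

/-- Since `∑ F_i λ_i` is bounded, the exceptional index of `exists_forall_ne` does no harm to a
bound that is linear in the eigenvalues. -/
theorem FrameBounds.sum_mul_abs_le [NeZero n] (h : FrameBounds C F l e W G w₂ D ν) {κ θ : ℝ}
    (hκ : 1 ≤ κ) (hθ : 0 < θ) (hθ1 : θ ≤ 1) :
    ∑ i, F i * |l i| ≤ θ * κ⁻¹ * Sw F e w₂ D ν
      + (16 * n + 2) * C ^ 4 / θ * κ * (1 + ∑ i, F i) := by
  have hC := h.one_le
  obtain ⟨r, hr⟩ := h.exists_forall_ne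
  have hn : (1 : ℝ) ≤ n := by exact_mod_cast NeZero.one_le
  have hS : 0 ≤ Sw F e w₂ D ν := Sw_nonneg h.F_nonneg
  have hF : 0 ≤ ∑ i, F i := Finset.sum_nonneg fun i _ => h.F_nonneg i
  -- chosen so that the sum of the `n` quadratic terms is half of the admissible multiple of `Sw`
  set τ : ℝ := θ / (32 * n * C ^ 4 * κ) with hτ
  have hτ0 : 0 < τ := by positivity
  have hrest : ∀ i ∈ Finset.univ.erase r, F i * |l i| ≤
      τ * (16 * C ^ 4 * (Sw F e w₂ D ν + ∑ i, F i)) + F i * (1 / (4 * τ)) := by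
    intro i hi
    have h1 := hr i (Finset.ne_of_mem_erase hi)
    have h2 : |l i| ≤ τ * l i ^ 2 + 1 / (4 * τ) := by
      have h3 : 0 ≤ τ * (|l i| - 1 / (2 * τ)) ^ 2 := by positivity
      have h4 : τ * (|l i| - 1 / (2 * τ)) ^ 2 = τ * |l i| ^ 2 - |l i| + 1 / (4 * τ) := by
        field_simp; ring
      rw [sq_abs] at h4
      linarith
    calc F i * |l i| ≤ F i * (τ * l i ^ 2 + 1 / (4 * τ)) :=
          mul_le_mul_of_nonneg_left h2 (h.F_nonneg i)
      _ = τ * (F i * l i ^ 2) + F i * (1 / (4 * τ)) := by ring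
      _ ≤ _ := by gcongr
  have hsum : ∑ i ∈ Finset.univ.erase r, F i * |l i| ≤
      n * (τ * (16 * C ^ 4 * (Sw F e w₂ D ν + ∑ i, F i))) + (∑ i, F i) * (1 / (4 * τ)) := by
    refine (Finset.sum_le_sum hrest).trans ?_
    rw [Finset.sum_add_distrib, Finset.sum_const, nsmul_eq_mul, ← Finset.sum_mul]
    have h1 : ((Finset.univ.erase r).card : ℝ) ≤ n := by
      exact_mod_cast (Finset.card_le_univ _).trans (by simp)
    have h2 : ∑ i ∈ Finset.univ.erase r, F i ≤ ∑ i, F i :=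
      Finset.sum_le_sum_of_subset_of_nonneg (Finset.erase_subset _ _) fun i _ _ => h.F_nonneg i
    gcongr
  -- the exceptional term is recovered from the bound on `∑ F_i λ_i`
  have hr1 : F r * |l r| ≤ C + ∑ i ∈ Finset.univ.erase r, F i * |l i| := by
    have h1 : F r * l r = ∑ i, F i * l i - ∑ i ∈ Finset.univ.erase r, F i * l i := by
      rw [← Finset.add_sum_erase _ _ (Finset.mem_univ r)]; ring
    have h2 : |∑ i ∈ Finset.univ.erase r, F i * l i| ≤ ∑ i ∈ Finset.univ.erase r, F i * |l i| := by
      refine (Finset.abs_sum_le_sum_abs _ _).trans (le_of_eq ?_)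
      exact Finset.sum_congr rfl fun i _ => by rw [abs_mul, abs_of_nonneg (h.F_nonneg i)]
    have h3 : F r * |l r| = |F r * l r| := by rw [abs_mul, abs_of_nonneg (h.F_nonneg r)]
    rw [h3, h1]
    exact (abs_sub _ _).trans (add_le_add h.sum_le h2)
  rw [← Finset.add_sum_erase _ _ (Finset.mem_univ r)]
  have e1 : 2 * (n * (τ * (16 * C ^ 4 * (Sw F e w₂ D ν + ∑ i, F i))))
      = θ * κ⁻¹ * (Sw F e w₂ D ν + ∑ i, F i) := by
    rw [hτ]; field_simp; norm_num
  have e2 : 2 * ((∑ i, F i) * (1 / (4 * τ))) = 16 * n * C ^ 4 / θ * κ * ∑ i, F i := by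
    rw [hτ]; field_simp; ring
  have hκi : κ⁻¹ ≤ 1 := inv_le_one_of_one_le₀ hκ
  have e3 : θ * κ⁻¹ * ∑ i, F i ≤ C ^ 4 / θ * κ * ∑ i, F i := by
    refine mul_le_mul_of_nonneg_right ?_ hF
    have h1 : θ * κ⁻¹ ≤ 1 := mul_le_one₀ hθ1 (by positivity) hκi
    have h2 : 1 ≤ C ^ 4 / θ := (one_le_div hθ).2 (hθ1.trans (one_le_pow₀ hC))
    nlinarith
  have e4 : C ≤ C ^ 4 / θ * κ := by
    have h2 : C ≤ C ^ 4 / θ := by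
      rw [le_div_iff₀ hθ]
      nlinarith [le_self_pow₀ hC (show 4 ≠ 0 by norm_num)]
    have : 0 ≤ C ^ 4 / θ := by positivity
    nlinarith
  have e5 : 0 ≤ 16 * n * C ^ 4 / θ * κ := by positivity
  have e6 : (16 * n + 2) * C ^ 4 / θ * κ * (1 + ∑ i, F i)
      = 16 * n * C ^ 4 / θ * κ * (∑ i, F i) + 16 * n * C ^ 4 / θ * κ + 2 * (C ^ 4 / θ * κ)
        + 2 * (C ^ 4 / θ * κ * ∑ i, F i) := by ring
  have e7 : 0 ≤ C ^ 4 / θ * κ * ∑ i, F i := by positivity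
  have e8 : 0 ≤ C ^ 4 / θ * κ := by positivity
  linarith

/-- Tangential second derivatives, in linear form. -/
theorem FrameBounds.sum_tvec_le (h : FrameBounds C F l e W G w₂ D ν) {κ θ M R : ℝ}
    (hκ : 1 ≤ κ) (hθ : 0 < θ) (hM : 0 < M) (hR : 0 < R) {ξ : Cn n} (hξ : ‖ξ‖ ≤ R) :
    M * ∑ i, F i * (|w₂ (e i) (tvec D ν ξ)| + |w₂ (Complex.I • e i) (tvec D ν ξ)|)
      ≤ θ * κ⁻¹ * Sw F e w₂ D ν + M ^ 2 * R ^ 2 / θ * κ * ∑ i, F i := by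
  have hS : 0 ≤ Sw F e w₂ D ν := Sw_nonneg h.F_nonneg
  set τ : ℝ := θ / (R ^ 2 * M * κ) with hτ
  have hτ0 : 0 < τ := by positivity
  have hy : ∀ x : ℝ, |x| ≤ τ * x ^ 2 + 1 / (4 * τ) := by
    intro x
    have h3 : 0 ≤ τ * (|x| - 1 / (2 * τ)) ^ 2 := by positivity
    have h4 : τ * (|x| - 1 / (2 * τ)) ^ 2 = τ * |x| ^ 2 - |x| + 1 / (4 * τ) := by
      field_simp; ring
    rw [sq_abs] at h4
    linarith
  have h1 : ∑ i, F i * (|w₂ (e i) (tvec D ν ξ)| + |w₂ (Complex.I • e i) (tvec D ν ξ)|)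
      ≤ τ * qe F e w₂ (tvec D ν ξ) + (∑ i, F i) * (1 / (2 * τ)) := by
    rw [qe, Finset.mul_sum, Finset.sum_mul, ← Finset.sum_add_distrib]
    refine Finset.sum_le_sum fun i _ => ?_
    have h2 := hy (w₂ (e i) (tvec D ν ξ))
    have h3 := hy (w₂ (Complex.I • e i) (tvec D ν ξ))
    have h4 := h.F_nonneg i
    have h5 : 1 / (2 * τ) = 1 / (4 * τ) + 1 / (4 * τ) := by field_simp; norm_num
    rw [h5]
    nlinarith
  have h2 : qe F e w₂ (tvec D ν ξ) ≤ R ^ 2 * Sw F e w₂ D ν :=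
    (qe_tvec_le h.F_nonneg ξ).trans (by gcongr)
  have hF : 0 ≤ ∑ i, F i := Finset.sum_nonneg fun i _ => h.F_nonneg i
  calc _ ≤ M * (τ * (R ^ 2 * Sw F e w₂ D ν) + (∑ i, F i) * (1 / (2 * τ))) := by gcongr; exact h1.trans (by gcongr)
    _ = θ * κ⁻¹ * Sw F e w₂ D ν + (1 / 2) * (M ^ 2 * R ^ 2 / θ * κ * ∑ i, F i) := by
      rw [hτ]; field_simp
    _ ≤ _ := by
      have : 0 ≤ M ^ 2 * R ^ 2 / θ * κ * ∑ i, F i := by positivity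
      linarith

/-- The complex Hessian paired with a frame vector is controlled by the eigenvalue, because the frame
is an eigenframe. -/
theorem FrameBounds.abs_mixed_le (h : FrameBounds C F l e W G w₂ D ν) (i : Fin n) (η : Cn n) :
    |w₂ (e i) η + w₂ (Complex.I • e i) (Complex.I • η)| ≤ 4 * C * (|l i| + 1) * ‖η‖ := by
  have h1 : w₂ (e i) η + w₂ (Complex.I • e i) (Complex.I • η)
      = 4 * (sesq (matForm w₂) (e i) η).re := by rw [sesq_matForm_re]; ring
  have h2 : ‖sesq (matForm w₂) (e i) η‖ ≤ C * (|l i| + 1) * ‖η‖ := by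
    rw [h.eig]
    refine (norm_sub_le _ _).trans ?_
    rw [norm_mul, Complex.norm_real, Real.norm_eq_abs]
    have := mul_le_mul_of_nonneg_left (h.W_le i η) (abs_nonneg (l i))
    have := h.G_le i η
    nlinarith
  rw [h1, abs_mul, abs_of_pos (by norm_num : (0 : ℝ) < 4)]
  have := (Complex.abs_re_le_norm (sesq (matForm w₂) (e i) η)).trans h2
  linarith

/-- An arbitrary second derivative, in terms of tangential ones and of the complex Hessian: the
normal direction is the image of a tangential one under the complex structure, up to a tangential
vector. -/
theorem FrameBounds.abs_apply_le (h : FrameBounds C F l e W G w₂ D ν) (a ξ : Cn n) {m : ℝ}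
    (hm : |w₂ a (Complex.I • tvec D ν (Complex.I • ν))
      + w₂ (Complex.I • a) (Complex.I • Complex.I • tvec D ν (Complex.I • ν))| ≤ m) :
    |w₂ a ξ| ≤ C * |w₂ a (tvec D ν ξ)| + C ^ 6 * ‖ξ‖ * (m
      + |w₂ (Complex.I • a) (tvec D ν (Complex.I • ν))| + |w₂ a (tvec D ν (Complex.I • ν))|) := by
  have hC := h.one_le
  set τ := tvec D ν (Complex.I • ν) with hτ
  have hDν : 1 ≤ C * D ν := h.ν_pos
  have hDν0 : 0 < D ν := by by_contra! h0; nlinarith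
  set A := D ν with hA
  set B := D (Complex.I • ν) with hB
  have hAle : |A| ≤ C ^ 2 := by
    refine (D.le_opNorm ν).trans ?_
    calc ‖D‖ * ‖ν‖ ≤ C * C := mul_le_mul h.D_le h.ν_le (norm_nonneg _) (by linarith)
      _ = C ^ 2 := by ring
  have hBle : |B| ≤ C ^ 2 := by
    refine (D.le_opNorm _).trans ?_
    rw [norm_I_smul]
    calc ‖D‖ * ‖ν‖ ≤ C * C := mul_le_mul h.D_le h.ν_le (norm_nonneg _) (by linarith)
      _ = C ^ 2 := by ring
  have hτ1 : w₂ a τ = A * w₂ a (Complex.I • ν) - B * w₂ a ν := by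
    rw [hτ, tvec]; simp [hA, hB]
  have hτ2 : w₂ a (Complex.I • τ) = -A * w₂ a ν - B * w₂ a (Complex.I • ν) := by
    have : Complex.I • τ = -A • ν - B • (Complex.I • ν) := by
      rw [hτ, tvec, smul_sub, smul_comm Complex.I (D ν), smul_comm Complex.I (D (Complex.I • ν)),
        smul_I_I]
      simp [hA, hB]
    rw [this]; simp
  have hkey : (A ^ 2 + B ^ 2) * w₂ a ν = -A * w₂ a (Complex.I • τ) - B * w₂ a τ := by
    rw [hτ1, hτ2]; ring
  have hH : w₂ a (Complex.I • τ) = (w₂ a (Complex.I • τ)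
      + w₂ (Complex.I • a) (Complex.I • Complex.I • τ)) + w₂ (Complex.I • a) τ := by
    rw [smul_I_I]; simp
  set t1 := |w₂ (Complex.I • a) τ|
  set t2 := |w₂ a τ|
  have hJτ : |w₂ a (Complex.I • τ)| ≤ m + t1 := by
    rw [hH]; exact (abs_add_le _ _).trans (add_le_add hm le_rfl)
  have hm0 : 0 ≤ m := (abs_nonneg _).trans hm
  have hν : |w₂ a ν| ≤ C ^ 4 * (m + t1 + t2) := by
    have h1 : |(A ^ 2 + B ^ 2) * w₂ a ν| ≤ C ^ 2 * (m + t1 + t2) := by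
      rw [hkey]
      refine (abs_sub _ _).trans ?_
      rw [abs_mul, abs_mul, abs_neg]
      have h2 : |A| * |w₂ a (Complex.I • τ)| ≤ C ^ 2 * (m + t1) :=
        mul_le_mul hAle hJτ (abs_nonneg _) (by positivity)
      have h3 : |B| * |w₂ a τ| ≤ C ^ 2 * t2 := mul_le_mul_of_nonneg_right hBle (abs_nonneg _)
      linarith
    rw [abs_mul, abs_of_nonneg (by positivity)] at h1
    have h2 : 1 ≤ C ^ 2 * (A ^ 2 + B ^ 2) := by
      have : 1 ≤ (C * A) ^ 2 := one_le_pow₀ hDν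
      nlinarith [sq_nonneg (C * B)]
    have h3 : |w₂ a ν| ≤ C ^ 2 * ((A ^ 2 + B ^ 2) * |w₂ a ν|) := by
      nlinarith [abs_nonneg (w₂ a ν)]
    refine h3.trans ?_
    calc C ^ 2 * ((A ^ 2 + B ^ 2) * |w₂ a ν|) ≤ C ^ 2 * (C ^ 2 * (m + t1 + t2)) := by gcongr
      _ = _ := by ring
  have hξ : A * w₂ a ξ = w₂ a (tvec D ν ξ) + D ξ * w₂ a ν := by
    rw [tvec]; simp [hA]
  have hDξ : |D ξ| ≤ C * ‖ξ‖ := (D.le_opNorm ξ).trans (by gcongr; exact h.D_le)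
  have h4 : A * |w₂ a ξ| ≤ |w₂ a (tvec D ν ξ)| + C * ‖ξ‖ * (C ^ 4 * (m + t1 + t2)) := by
    rw [← abs_of_pos hDν0, ← abs_mul, hξ]
    refine (abs_add_le _ _).trans ?_
    rw [abs_mul (D ξ)]
    gcongr
  have h5 : |w₂ a ξ| ≤ C * (A * |w₂ a ξ|) := by nlinarith [abs_nonneg (w₂ a ξ)]
  refine h5.trans ?_
  calc C * (A * |w₂ a ξ|) ≤ C * (|w₂ a (tvec D ν ξ)| + C * ‖ξ‖ * (C ^ 4 * (m + t1 + t2))) := by gcongr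
    _ = _ := by ring

/-- The cross terms between a bounded covector and a general second derivative of `w`. -/
theorem exists_Gam_le (n : ℕ) [NeZero n] (C : ℝ) : ∃ K : ℝ, 0 < K ∧ ∀ (F l : Fin n → ℝ)
    (e : Fin n → Cn n) (W G : Matrix (Fin n) (Fin n) ℂ) (w₂ : Cn n →L[ℝ] Cn n →L[ℝ] ℝ)
    (D : Cn n →L[ℝ] ℝ) (ν : Cn n), FrameBounds C F l e W G w₂ D ν →
    ∀ (κ θ : ℝ), 1 ≤ κ → 0 < θ → θ ≤ 1 → ∀ (b : Cn n →L[ℝ] ℝ) (ξ : Cn n), ‖b‖ ≤ C ^ 2 → ‖ξ‖ ≤ C →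
    |Gam F e b (w₂.flip ξ)| ≤ θ * κ⁻¹ * Sw F e w₂ D ν + K / θ * κ * (1 + ∑ i, F i) := by
  refine ⟨64 * ((C ^ 4) ^ 2 * C ^ 2 + (C ^ 10) ^ 2 * C ^ 2) + 64 * C ^ 14 * (64 * C ^ 14) * ((16 * n + 2) * C ^ 4)
    + 64 * C ^ 14 + 1, by positivity, ?_⟩
  intro F l e W G w₂ D ν h κ θ hκ hθ hθ1 b ξ hb hξ
  have hC := h.one_le
  have hC0 : 0 < C := by linarith
  have hS : 0 ≤ Sw F e w₂ D ν := Sw_nonneg h.F_nonneg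
  have hF : 0 ≤ ∑ i, F i := Finset.sum_nonneg fun i _ => h.F_nonneg i
  -- `τ` is the tangential part of `iν`: a normal derivative is exchanged for one along `τ` at the cost
  -- of a multiple of `λ_i`
  set τ := tvec D ν (Complex.I • ν) with hτ
  have hτn : ‖Complex.I • τ‖ ≤ 2 * C ^ 3 := by
    rw [norm_I_smul, hτ, tvec]
    refine (norm_sub_le _ _).trans ?_
    rw [norm_smul (D ν), norm_smul (D (Complex.I • ν)), norm_I_smul]
    have h1 : ‖D ν‖ ≤ C * C := (D.le_opNorm _).trans (mul_le_mul h.D_le h.ν_le (norm_nonneg _) hC0.le)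
    have h2 : ‖D (Complex.I • ν)‖ ≤ C * C :=
      (D.le_opNorm _).trans (mul_le_mul h.D_le (by rw [norm_I_smul]; exact h.ν_le) (norm_nonneg _) hC0.le)
    have h3 := mul_le_mul h1 h.ν_le (norm_nonneg _) (by positivity)
    have h4 := mul_le_mul h2 h.ν_le (norm_nonneg _) (by positivity)
    linarith
  have hm1 : ∀ i, |w₂ (e i) (Complex.I • τ) + w₂ (Complex.I • e i) (Complex.I • Complex.I • τ)|
      ≤ 8 * C ^ 4 * (|l i| + 1) := by
    intro i
    refine (h.abs_mixed_le i _).trans ?_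
    calc 4 * C * (|l i| + 1) * ‖Complex.I • τ‖ ≤ 4 * C * (|l i| + 1) * (2 * C ^ 3) := by gcongr
      _ = _ := by ring
  have hm2 : ∀ i, |w₂ (Complex.I • e i) (Complex.I • τ)
      + w₂ (Complex.I • Complex.I • e i) (Complex.I • Complex.I • τ)| ≤ 8 * C ^ 4 * (|l i| + 1) := by
    intro i
    have h1 := h.abs_mixed_le i (Complex.I • Complex.I • τ)
    have h2 : w₂ (Complex.I • e i) (Complex.I • τ)
        + w₂ (Complex.I • Complex.I • e i) (Complex.I • Complex.I • τ)
        = -(w₂ (e i) (Complex.I • Complex.I • τ)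
          + w₂ (Complex.I • e i) (Complex.I • Complex.I • Complex.I • τ)) := by
      simp only [smul_I_I]
      simp
    rw [h2, abs_neg]
    refine h1.trans ?_
    rw [norm_I_smul (Complex.I • τ)]
    calc 4 * C * (|l i| + 1) * ‖Complex.I • τ‖ ≤ 4 * C * (|l i| + 1) * (2 * C ^ 3) := by gcongr
      _ = _ := by ring
  have hbe : ∀ a : Cn n, ‖a‖ ≤ C → |b a| ≤ C ^ 3 := by
    intro a ha
    refine (b.le_opNorm a).trans ?_
    calc ‖b‖ * ‖a‖ ≤ C ^ 2 * C := mul_le_mul hb ha (norm_nonneg _) (by positivity)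
      _ = C ^ 3 := by ring
  set x : Fin n → ℝ := fun i => |w₂ (e i) (tvec D ν ξ)| + |w₂ (Complex.I • e i) (tvec D ν ξ)| with hx
  set t : Fin n → ℝ := fun i => |w₂ (e i) τ| + |w₂ (Complex.I • e i) τ| with ht
  have hterm : ∀ i, |b (e i) * w₂.flip ξ (e i) + b (Complex.I • e i) * w₂.flip ξ (Complex.I • e i)|
      ≤ C ^ 4 * x i + 16 * C ^ 14 * (|l i| + 1) + 2 * C ^ 10 * t i := by
    intro i
    have h1 := h.abs_apply_le (e i) ξ (hm1 i)
    have h2 := h.abs_apply_le (Complex.I • e i) ξ (hm2 i)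
    rw [smul_I_I, map_neg, _root_.neg_apply, abs_neg] at h2
    have h3 := hbe (e i) (h.e_le i)
    have h4 := hbe (Complex.I • e i) (by rw [norm_I_smul]; exact h.e_le i)
    simp only [ContinuousLinearMap.flip_apply]
    refine (abs_add_le _ _).trans ?_
    rw [abs_mul, abs_mul]
    have h5 : |b (e i)| * |w₂ (e i) ξ| ≤ C ^ 3 * (C * |w₂ (e i) (tvec D ν ξ)| + C ^ 6 * C *
        (8 * C ^ 4 * (|l i| + 1) + |w₂ (Complex.I • e i) τ| + |w₂ (e i) τ|)) := by
      refine mul_le_mul h3 (h1.trans ?_) (abs_nonneg _) (by positivity)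
      gcongr
    have h6 : |b (Complex.I • e i)| * |w₂ (Complex.I • e i) ξ| ≤
        C ^ 3 * (C * |w₂ (Complex.I • e i) (tvec D ν ξ)| + C ^ 6 * C *
        (8 * C ^ 4 * (|l i| + 1) + |w₂ (e i) τ| + |w₂ (Complex.I • e i) τ|)) := by
      refine mul_le_mul h4 (h2.trans ?_) (abs_nonneg _) (by positivity)
      gcongr
    refine (add_le_add h5 h6).trans (le_of_eq ?_)
    simp only [hx, ht]
    ring
  have hsum : |Gam F e b (w₂.flip ξ)| ≤ C ^ 4 * ∑ i, F i * x i + 16 * C ^ 14 * ∑ i, F i * |l i|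
      + 16 * C ^ 14 * ∑ i, F i + 2 * C ^ 10 * ∑ i, F i * t i := by
    have h1 : |∑ i, F i * (b (e i) * w₂.flip ξ (e i)
        + b (Complex.I • e i) * w₂.flip ξ (Complex.I • e i))|
        ≤ ∑ i, F i * (C ^ 4 * x i + 16 * C ^ 14 * (|l i| + 1) + 2 * C ^ 10 * t i) := by
      refine (Finset.abs_sum_le_sum_abs _ _).trans (Finset.sum_le_sum fun i _ => ?_)
      rw [abs_mul, abs_of_nonneg (h.F_nonneg i)]
      exact mul_le_mul_of_nonneg_left (hterm i) (h.F_nonneg i)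
    have h2 : ∑ i, F i * (C ^ 4 * x i + 16 * C ^ 14 * (|l i| + 1) + 2 * C ^ 10 * t i)
        = C ^ 4 * ∑ i, F i * x i + 16 * C ^ 14 * ∑ i, F i * |l i|
      + 16 * C ^ 14 * ∑ i, F i + 2 * C ^ 10 * ∑ i, F i * t i := by
      simp only [Finset.mul_sum, ← Finset.sum_add_distrib]
      exact Finset.sum_congr rfl fun i _ => by ring
    rw [h2] at h1
    rw [Gam, abs_mul, abs_of_pos (by norm_num : (0 : ℝ) < 1 / 4)]
    have h3 := abs_nonneg (∑ i, F i * (b (e i) * w₂.flip ξ (e i)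
        + b (Complex.I • e i) * w₂.flip ξ (Complex.I • e i)))
    linarith
  have hθ4 : 0 < θ / 4 := by linarith
  have h1 := h.sum_tvec_le hκ hθ4 (M := C ^ 4) (by positivity) hC0 hξ
  have h2 := h.sum_tvec_le hκ hθ4 (M := 2 * C ^ 10) (by positivity) hC0
    (ξ := Complex.I • ν) (by rw [norm_I_smul]; exact h.ν_le)
  have hθ' : 0 < θ / (64 * C ^ 14) := by positivity
  have hC14 : 1 ≤ C ^ 14 := one_le_pow₀ hC
  have h3 := h.sum_mul_abs_le hκ hθ' ((div_le_one (by positivity)).2 (by linarith))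
  have h4 : 16 * C ^ 14 * ∑ i, F i * |l i| ≤ θ / 4 * κ⁻¹ * Sw F e w₂ D ν
      + 16 * C ^ 14 * (64 * C ^ 14) * ((16 * n + 2) * C ^ 4) / θ * κ * (1 + ∑ i, F i) := by
    have := mul_le_mul_of_nonneg_left h3 (show 0 ≤ 16 * C ^ 14 by positivity)
    refine this.trans (le_of_eq ?_)
    field_simp
    ring
  have h5 : 16 * C ^ 14 * ∑ i, F i ≤ 16 * C ^ 14 / θ * κ * (1 + ∑ i, F i) := by
    have h6 : 1 ≤ 1 / θ * κ := by
      have : 1 ≤ 1 / θ := (one_le_div hθ).2 hθ1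
      nlinarith
    have h7 : 0 ≤ 16 * C ^ 14 * ∑ i, F i := by positivity
    have h8 : 16 * C ^ 14 / θ * κ * (1 + ∑ i, F i)
      = (1 / θ * κ) * (16 * C ^ 14 * ∑ i, F i) + (1 / θ * κ) * (16 * C ^ 14) := by ring
    have h9 : 0 ≤ (1 / θ * κ) * (16 * C ^ 14) := by positivity
    nlinarith
  refine hsum.trans ?_
  have e1 : (C ^ 4) ^ 2 * C ^ 2 / (θ / 4) * κ * ∑ i, F i
      = 4 * ((C ^ 4) ^ 2 * C ^ 2) * (1 / θ * κ * ∑ i, F i) := by field_simp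
  have e2 : (2 * C ^ 10) ^ 2 * C ^ 2 / (θ / 4) * κ * ∑ i, F i
      = 16 * ((C ^ 10) ^ 2 * C ^ 2) * (1 / θ * κ * ∑ i, F i) := by field_simp; ring
  rw [e1] at h1
  rw [e2] at h2
  set Y := 1 / θ * κ with hY
  have hY0 : 0 < Y := by positivity
  have e3 : 16 * C ^ 14 * (64 * C ^ 14) * ((16 * n + 2) * C ^ 4) / θ * κ * (1 + ∑ i, F i)
    = 16 * C ^ 14 * (64 * C ^ 14) * ((16 * n + 2) * C ^ 4) * (Y * (1 + ∑ i, F i)) := by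
    rw [hY]; ring
  have e4 : 16 * C ^ 14 / θ * κ * (1 + ∑ i, F i) = 16 * C ^ 14 * (Y * (1 + ∑ i, F i)) := by
    rw [hY]; ring
  rw [e3] at h4
  rw [e4] at h5
  have e5 : ∀ K : ℝ, K / θ * κ * (1 + ∑ i, F i) = K * (Y * (1 + ∑ i, F i)) := fun K => by
    rw [hY]; ring
  rw [e5]
  have hZ : Y * ∑ i, F i ≤ Y * (1 + ∑ i, F i) := by gcongr; linarith
  have hZ0 : 0 ≤ Y * (1 + ∑ i, F i) := by positivity
  set Z := Y * (1 + ∑ i, F i)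
  have f1 : 4 * ((C ^ 4) ^ 2 * C ^ 2) * (Y * ∑ i, F i) ≤ 4 * ((C ^ 4) ^ 2 * C ^ 2) * Z := by gcongr
  have f2 : 16 * ((C ^ 10) ^ 2 * C ^ 2) * (Y * ∑ i, F i) ≤ 16 * ((C ^ 10) ^ 2 * C ^ 2) * Z := by gcongr
  have g1 : 0 ≤ (C ^ 4) ^ 2 * C ^ 2 * Z := by positivity
  have g2 : 0 ≤ (C ^ 10) ^ 2 * C ^ 2 * Z := by positivity
  have g3 : 0 ≤ C ^ 14 * (64 * C ^ 14) * ((16 * n + 2) * C ^ 4) * Z := by positivity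
  have g4 : 0 ≤ C ^ 14 * Z := by positivity
  have g5 : 0 ≤ θ * κ⁻¹ * Sw F e w₂ D ν := by positivity
  have g6 : θ / 4 * κ⁻¹ * Sw F e w₂ D ν = (1 / 4) * (θ * κ⁻¹ * Sw F e w₂ D ν) := by ring
  rw [g6] at h1 h2 h4
  linarith

end Tangential

/-! ### The equation for the tangential derivatives -/

section TangentialFunctions

variable {n : ℕ}

/-- The derivative of `w` along the vector field `tvec (∂d) ν ξ`, which is tangential to the level
sets of `d`. -/
def tfun (d w : Cn n → ℝ) (ν ξ : Cn n) (z : Cn n) : ℝ :=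
  fderiv ℝ d z ν * fderiv ℝ w z ξ - fderiv ℝ d z ξ * fderiv ℝ w z ν

theorem contDiffAt_tfun {d w : Cn n → ℝ} {y : Cn n} (hd : ContDiffAt ℝ 3 d y)
    (hw : ContDiffAt ℝ 3 w y) (ν ξ : Cn n) : ContDiffAt ℝ 2 (tfun d w ν ξ) y :=
  ((hd.fderiv_apply (by norm_num) ν).mul (hw.fderiv_apply (by norm_num) ξ)).sub
    ((hd.fderiv_apply (by norm_num) ξ).mul (hw.fderiv_apply (by norm_num) ν))

/-- Bounds at a point for the tangential derivatives of a function `w` with third derivatives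
controlled by a differentiated equation; `κ` is the size of the gradient of `w`. -/
structure TangentialBounds (C κ : ℝ) (F l : Fin n → ℝ) (e : Fin n → Cn n)
    (W G : Matrix (Fin n) (Fin n) ℂ) (d w : Cn n → ℝ) (y ν : Cn n) : Prop where
  frame : FrameBounds C F l e W G (D2 w y) (fderiv ℝ d y) ν
  contDiff_d : ContDiffAt ℝ 3 d y
  contDiff_w : ContDiffAt ℝ 3 w y
  one_le : 1 ≤ κ
  ν_le_one : ‖ν‖ ≤ 1
  d₂_le : ‖D2 d y‖ ≤ C
  d₃_le : ∀ ξ, ‖ξ‖ ≤ 1 → |Lop F e (D2 (fun z => fderiv ℝ d z ξ) y)| ≤ C * ∑ i, F i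
  w₁_le : ‖fderiv ℝ w y‖ ≤ C * κ
  w₃_le : ∀ ξ, ‖ξ‖ ≤ 1 → |Lop F e (D2 (fun z => fderiv ℝ w z ξ) y)|
    ≤ C * (1 + ∑ i, F i + ∑ i, F i * |l i|)

theorem fderiv_fderiv_apply_eq_flip {f : Cn n → ℝ} {y : Cn n} (hf : ContDiffAt ℝ 2 f y)
    (ξ : Cn n) : fderiv ℝ (fun z => fderiv ℝ f z ξ) y = (D2 f y).flip ξ := by
  ext a
  rw [fderiv_fderiv_apply hf, ContinuousLinearMap.flip_apply]

/-- The equation for a tangential derivative of `w`, up to a small multiple of the sum `Sw` of squares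
of tangential second derivatives. The error stems from the third derivatives of `w`, bounded through
the differentiated equation, and from the cross terms with derivatives of the coefficients. -/
theorem exists_abs_Lop_tfun_le (n : ℕ) [NeZero n] (C : ℝ) : ∃ K : ℝ, 0 < K ∧
    ∀ (κ : ℝ) (F l : Fin n → ℝ) (e : Fin n → Cn n) (W G : Matrix (Fin n) (Fin n) ℂ)
      (d w : Cn n → ℝ) (y ν : Cn n), TangentialBounds C κ F l e W G d w y ν →
    ∀ θ : ℝ, 0 < θ → θ ≤ 1 → ∀ ξ : Cn n, ‖ξ‖ ≤ 1 → |Lop F e (D2 (tfun d w ν ξ) y)|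
      ≤ θ * κ⁻¹ * Sw F e (D2 w y) (fderiv ℝ d y) ν + K / θ * κ * (1 + ∑ i, F i) := by
  obtain ⟨K, hK, hGam⟩ := exists_Gam_le n C
  refine ⟨32 * K + 8 * C ^ 6 * ((16 * n + 2) * C ^ 4) + 4 * C ^ 4 + 1, by positivity, ?_⟩
  intro κ F l e W G d w y ν h θ hθ hθ1 ξ hξ1
  have hC := h.frame.one_le
  have hC0 : 0 < C := by linarith
  have hκ := h.one_le
  have hκ0 : 0 < κ := by linarith
  set S := Sw F e (D2 w y) (fderiv ℝ d y) ν with hS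
  have hS0 : 0 ≤ S := Sw_nonneg h.frame.F_nonneg
  set 𝓕 := ∑ i, F i with h𝓕
  have hF0 : 0 ≤ 𝓕 := Finset.sum_nonneg fun i _ => h.frame.F_nonneg i
  have hν := h.frame.ν_le
  have hν1 := h.ν_le_one
  have hξ : ‖ξ‖ ≤ C := hξ1.trans hC
  have hd2 : ContDiffAt ℝ 2 d y := h.contDiff_d.of_le (by norm_num)
  have hw2 : ContDiffAt ℝ 2 w y := h.contDiff_w.of_le (by norm_num)
  have hdc : ∀ ζ, ContDiffAt ℝ 2 (fun z => fderiv ℝ d z ζ) y :=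
    fun ζ => h.contDiff_d.fderiv_apply (by norm_num) ζ
  have hwc : ∀ ζ, ContDiffAt ℝ 2 (fun z => fderiv ℝ w z ζ) y :=
    fun ζ => h.contDiff_w.fderiv_apply (by norm_num) ζ
  have hexp : Lop F e (D2 (tfun d w ν ξ) y)
      = fderiv ℝ d y ν * Lop F e (D2 (fun z => fderiv ℝ w z ξ) y)
        + fderiv ℝ w y ξ * Lop F e (D2 (fun z => fderiv ℝ d z ν) y)
        + 2 * Gam F e ((D2 d y).flip ν) ((D2 w y).flip ξ)
        - (fderiv ℝ d y ξ * Lop F e (D2 (fun z => fderiv ℝ w z ν) y)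
        + fderiv ℝ w y ν * Lop F e (D2 (fun z => fderiv ℝ d z ξ) y)
        + 2 * Gam F e ((D2 d y).flip ξ) ((D2 w y).flip ν)) := by
    have h1 : tfun d w ν ξ = fun z => (fderiv ℝ d z ν * fderiv ℝ w z ξ)
      - (fderiv ℝ d z ξ * fderiv ℝ w z ν) := rfl
    rw [h1, D2_sub ((hdc ν).mul (hwc ξ)) ((hdc ξ).mul (hwc ν)), Lop_sub,
      Lop_mul (hdc ν) (hwc ξ), Lop_mul (hdc ξ) (hwc ν),
      fderiv_fderiv_apply_eq_flip hd2, fderiv_fderiv_apply_eq_flip hd2,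
      fderiv_fderiv_apply_eq_flip hw2, fderiv_fderiv_apply_eq_flip hw2]
  have hD : ∀ ζ, ‖ζ‖ ≤ C → |fderiv ℝ d y ζ| ≤ C ^ 2 := fun ζ hζ => by
    refine ((fderiv ℝ d y).le_opNorm ζ).trans ?_
    calc ‖fderiv ℝ d y‖ * ‖ζ‖ ≤ C * C := mul_le_mul h.frame.D_le hζ (norm_nonneg _) hC0.le
      _ = C ^ 2 := by ring
  have hw : ∀ ζ, ‖ζ‖ ≤ C → |fderiv ℝ w y ζ| ≤ C ^ 2 * κ := fun ζ hζ => by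
    refine ((fderiv ℝ w y).le_opNorm ζ).trans ?_
    calc ‖fderiv ℝ w y‖ * ‖ζ‖ ≤ (C * κ) * C := mul_le_mul h.w₁_le hζ (norm_nonneg _) (by positivity)
      _ = C ^ 2 * κ := by ring
  have hfl : ∀ ζ, ‖ζ‖ ≤ C → ‖(D2 d y).flip ζ‖ ≤ C ^ 2 := fun ζ hζ => by
    refine ((D2 d y).flip.le_opNorm ζ).trans ?_
    rw [ContinuousLinearMap.opNorm_flip]
    calc ‖D2 d y‖ * ‖ζ‖ ≤ C * C := mul_le_mul h.d₂_le hζ (norm_nonneg _) hC0.le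
      _ = C ^ 2 := by ring
  set Y := κ * (1 + 𝓕) with hY
  have hθ8 : 0 < θ / 8 := by linarith
  have g1 := hGam F l e W G (D2 w y) (fderiv ℝ d y) ν h.frame κ (θ / 8) hκ hθ8 (by linarith)
    _ ξ (hfl ν hν) hξ
  have g2 := hGam F l e W G (D2 w y) (fderiv ℝ d y) ν h.frame κ (θ / 8) hκ hθ8 (by linarith)
    _ ν (hfl ξ hξ) hν
  have hC3 : 1 ≤ C ^ 3 := one_le_pow₀ hC
  have hθ' : 0 < θ / (4 * C ^ 3) := by positivity
  have s1 := h.frame.sum_mul_abs_le hκ hθ' ((div_le_one (by positivity)).2 (by linarith))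
  set Λl := ∑ i, F i * |l i| with hΛl
  have hΛ0 : 0 ≤ Λl := Finset.sum_nonneg fun i _ => mul_nonneg (h.frame.F_nonneg i) (abs_nonneg _)
  have a1 : |fderiv ℝ d y ν * Lop F e (D2 (fun z => fderiv ℝ w z ξ) y)| ≤ C ^ 2 * (C * (1 + 𝓕 + Λl)) := by
    rw [abs_mul]; exact mul_le_mul (hD ν hν) (h.w₃_le ξ hξ1) (abs_nonneg _) (by positivity)
  have a2 : |fderiv ℝ d y ξ * Lop F e (D2 (fun z => fderiv ℝ w z ν) y)| ≤ C ^ 2 * (C * (1 + 𝓕 + Λl)) := by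
    rw [abs_mul]; exact mul_le_mul (hD ξ hξ) (h.w₃_le ν hν1) (abs_nonneg _) (by positivity)
  have a3 : |fderiv ℝ w y ξ * Lop F e (D2 (fun z => fderiv ℝ d z ν) y)| ≤ C ^ 2 * κ * (C * 𝓕) := by
    rw [abs_mul]; exact mul_le_mul (hw ξ hξ) (h.d₃_le ν hν1) (abs_nonneg _) (by positivity)
  have a4 : |fderiv ℝ w y ν * Lop F e (D2 (fun z => fderiv ℝ d z ξ) y)| ≤ C ^ 2 * κ * (C * 𝓕) := by
    rw [abs_mul]; exact mul_le_mul (hw ν hν) (h.d₃_le ξ hξ1) (abs_nonneg _) (by positivity)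
  have htot : |Lop F e (D2 (tfun d w ν ξ) y)| ≤ 2 * (C ^ 2 * (C * (1 + 𝓕 + Λl)))
      + 2 * (C ^ 2 * κ * (C * 𝓕)) + 4 * (θ / 8 * κ⁻¹ * S + K / (θ / 8) * κ * (1 + 𝓕)) := by
    rw [hexp]
    rw [abs_le] at a1 a2 a3 a4 g1 g2 ⊢
    constructor <;> linarith
  refine htot.trans ?_
  have hZ0 : 0 ≤ 1 / θ * Y := by positivity
  have e1 : 4 * (θ / 8 * κ⁻¹ * S + K / (θ / 8) * κ * (1 + 𝓕))
      = (1 / 2) * (θ * κ⁻¹ * S) + 32 * K * (1 / θ * Y) := by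
    rw [hY]; field_simp; ring
  have e2 : 2 * C ^ 3 * Λl ≤ (1 / 2) * (θ * κ⁻¹ * S)
      + 8 * C ^ 6 * ((16 * n + 2) * C ^ 4) * (1 / θ * Y) := by
    refine (mul_le_mul_of_nonneg_left s1 (by positivity)).trans (le_of_eq ?_)
    rw [hY]; field_simp; ring
  have hY0 : 0 ≤ Y := by positivity
  have hYθ : Y ≤ 1 / θ * Y := le_mul_of_one_le_left hY0 ((one_le_div hθ).2 hθ1)
  have e3 : 1 + 𝓕 ≤ 1 / θ * Y :=
    (le_mul_of_one_le_left (by positivity : (0 : ℝ) ≤ 1 + 𝓕) hκ).trans hYθ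
  have e4 : κ * 𝓕 ≤ 1 / θ * Y :=
    (mul_le_mul_of_nonneg_left (by linarith) hκ0.le : κ * 𝓕 ≤ κ * (1 + 𝓕)).trans hYθ
  have e5 : ∀ B : ℝ, B / θ * κ * (1 + 𝓕) = B * (1 / θ * Y) := fun B => by rw [hY]; ring
  rw [e5, e1]
  have hC34 : C ^ 3 ≤ C ^ 4 := pow_le_pow_right₀ hC (by norm_num)
  have e6 : C ^ 3 * (1 + 𝓕) ≤ C ^ 4 * (1 / θ * Y) := mul_le_mul hC34 e3 (by positivity) (by positivity)
  have e7 : C ^ 3 * (κ * 𝓕) ≤ C ^ 4 * (1 / θ * Y) := mul_le_mul hC34 e4 (by positivity) (by positivity)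
  linarith

/-- The sum `Sw` is produced, up to lower order terms, when the linearized operator is applied to the
squares of the tangential derivatives. -/
theorem Sw_le_sum_Gam {C κ : ℝ} {F l : Fin n → ℝ} {e : Fin n → Cn n}
    {W G : Matrix (Fin n) (Fin n) ℂ} {d w : Cn n → ℝ} {y ν : Cn n}
    (h : TangentialBounds C κ F l e W G d w y ν) :
    Sw F e (D2 w y) (fderiv ℝ d y) ν ≤
      8 * ∑ b, Gam F e (fderiv ℝ (tfun d w ν (bas b)) y) (fderiv ℝ (tfun d w ν (bas b)) y)
        + 32 * n * C ^ 10 * κ ^ 2 * ∑ i, F i := by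
  have hC := h.frame.one_le
  have hC0 : 0 < C := by linarith
  have hκ0 : 0 < κ := by linarith [h.one_le]
  have hd2 : ContDiffAt ℝ 2 d y := h.contDiff_d.of_le (by norm_num)
  have hw2 : ContDiffAt ℝ 2 w y := h.contDiff_w.of_le (by norm_num)
  have hder : ∀ ξ a, fderiv ℝ (tfun d w ν ξ) y a = D2 w y a (tvec (fderiv ℝ d y) ν ξ)
      + (D2 d y a ν * fderiv ℝ w y ξ - D2 d y a ξ * fderiv ℝ w y ν) := by
    intro ξ a
    have hd' : ∀ ζ, HasFDerivAt (fun z => fderiv ℝ d z ζ) ((D2 d y).flip ζ) y := fun ζ => by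
      rw [← fderiv_fderiv_apply_eq_flip hd2]
      exact ((h.contDiff_d.fderiv_apply (k := 2) (by norm_num) ζ).differentiableAt
        (by norm_num)).hasFDerivAt
    have hw' : ∀ ζ, HasFDerivAt (fun z => fderiv ℝ w z ζ) ((D2 w y).flip ζ) y := fun ζ => by
      rw [← fderiv_fderiv_apply_eq_flip hw2]
      exact ((h.contDiff_w.fderiv_apply (k := 2) (by norm_num) ζ).differentiableAt
        (by norm_num)).hasFDerivAt
    have h1 := ((hd' ν).mul (hw' ξ)).sub ((hd' ξ).mul (hw' ν))
    have h2 : fderiv ℝ (tfun d w ν ξ) y = _ := h1.fderiv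
    rw [h2]
    simp [tvec]
    ring
  have hr : ∀ b : Fin n ⊕ Fin n, ∀ a : Cn n, ‖a‖ ≤ C →
      D2 w y a (tvec (fderiv ℝ d y) ν (bas b)) ^ 2
        ≤ 2 * fderiv ℝ (tfun d w ν (bas b)) y a ^ 2 + 8 * C ^ 10 * κ ^ 2 := by
    intro b a ha
    have h1 : ∀ ζ ζ' : Cn n, ‖ζ‖ ≤ C → ‖ζ'‖ ≤ C → |D2 d y a ζ * fderiv ℝ w y ζ'| ≤ C ^ 5 * κ := by
      intro ζ ζ' hζ hζ'
      rw [abs_mul]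
      have h2 : |D2 d y a ζ| ≤ C * C * C := by
        refine ((D2 d y).le_opNorm₂ a ζ).trans ?_
        have := h.d₂_le
        gcongr
      have h3 : |fderiv ℝ w y ζ'| ≤ C * κ * C := by
        refine ((fderiv ℝ w y).le_opNorm ζ').trans ?_
        have := h.w₁_le
        gcongr
      calc |D2 d y a ζ| * |fderiv ℝ w y ζ'| ≤ (C * C * C) * (C * κ * C) :=
            mul_le_mul h2 h3 (abs_nonneg _) (by positivity)
        _ = _ := by ring
    have hb : ‖(bas b : Cn n)‖ ≤ C := by rw [norm_bas]; exact hC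
    have h2 := h1 ν (bas b) h.frame.ν_le hb
    have h3 := h1 (bas b) ν hb h.frame.ν_le
    have h4 := hder (bas b) a
    set r := D2 d y a ν * fderiv ℝ w y (bas b) - D2 d y a (bas b) * fderiv ℝ w y ν with hrr
    have h5 : |r| ≤ 2 * (C ^ 5 * κ) := (abs_sub _ _).trans (by linarith)
    have h6 : r ^ 2 ≤ (2 * (C ^ 5 * κ)) ^ 2 := by
      rw [← sq_abs]; exact pow_le_pow_left₀ (abs_nonneg _) h5 2
    have h7 : D2 w y a (tvec (fderiv ℝ d y) ν (bas b))
      = fderiv ℝ (tfun d w ν (bas b)) y a - r := by linarith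
    rw [h7]
    nlinarith [sq_nonneg (fderiv ℝ (tfun d w ν (bas b)) y a + r)]
  have hq : ∀ b : Fin n ⊕ Fin n, qe F e (D2 w y) (tvec (fderiv ℝ d y) ν (bas b)) ≤
      8 * Gam F e (fderiv ℝ (tfun d w ν (bas b)) y) (fderiv ℝ (tfun d w ν (bas b)) y)
        + 16 * C ^ 10 * κ ^ 2 * ∑ i, F i := by
    intro b
    have h0 : 8 * Gam F e (fderiv ℝ (tfun d w ν (bas b)) y) (fderiv ℝ (tfun d w ν (bas b)) y)
        + 16 * C ^ 10 * κ ^ 2 * ∑ i, F i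
        = ∑ i, F i * ((2 * fderiv ℝ (tfun d w ν (bas b)) y (e i) ^ 2 + 8 * C ^ 10 * κ ^ 2)
          + (2 * fderiv ℝ (tfun d w ν (bas b)) y (Complex.I • e i) ^ 2 + 8 * C ^ 10 * κ ^ 2)) := by
      rw [Gam]
      simp only [Finset.mul_sum, ← Finset.sum_add_distrib]
      exact Finset.sum_congr rfl fun i _ => by ring
    rw [h0, qe]
    refine Finset.sum_le_sum fun i _ => mul_le_mul_of_nonneg_left ?_ (h.frame.F_nonneg i)
    exact add_le_add (hr b _ (h.frame.e_le i)) (hr b _ (by rw [norm_I_smul]; exact h.frame.e_le i))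
  refine (Finset.sum_le_sum fun b _ => hq b).trans (le_of_eq ?_)
  rw [Finset.sum_add_distrib, ← Finset.mul_sum, Finset.sum_const]
  simp
  ring

/-- The quadratic term in the tangential derivatives absorbs the error in the equation for each of
them. -/
theorem exists_Lop_tangential_ge (n : ℕ) [NeZero n] (C : ℝ) : ∃ K : ℝ, 0 < K ∧
    ∀ (κ : ℝ) (F l : Fin n → ℝ) (e : Fin n → Cn n) (W G : Matrix (Fin n) (Fin n) ℂ)
      (d w : Cn n → ℝ) (y ν : Cn n), TangentialBounds C κ F l e W G d w y ν →
    ∀ (σ : ℝ) (b₀ : Fin n ⊕ Fin n), |σ| ≤ 1 →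
      -(K * κ * (1 + ∑ i, F i)) ≤ Lop F e (D2 (fun z => κ⁻¹ * (∑ b, tfun d w ν (bas b) z
        * tfun d w ν (bas b) z) + σ * tfun d w ν (bas b₀) z) y) := by
  obtain ⟨K₁, hK₁, hT⟩ := exists_abs_Lop_tfun_le n C
  set m : ℝ := 8 * n * (|C| ^ 3) + 1 with hm
  have hm1 : 1 ≤ m := by rw [hm]; have : 0 ≤ 8 * (n : ℝ) * |C| ^ 3 := by positivity
                         linarith
  refine ⟨32 * n * C ^ 10 + m * (K₁ * (8 * m)) + 1, by positivity, ?_⟩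
  intro κ F l e W G d w y ν h σ b₀ hσ
  have hC := h.frame.one_le
  have hC0 : 0 < C := by linarith
  rw [abs_of_pos hC0] at hm
  have hκ := h.one_le
  have hκ0 : 0 < κ := by linarith
  set S := Sw F e (D2 w y) (fderiv ℝ d y) ν with hS
  set 𝓕 := ∑ i, F i with h𝓕
  have hF0 : 0 ≤ 𝓕 := Finset.sum_nonneg fun i _ => h.frame.F_nonneg i
  set T : Fin n ⊕ Fin n → Cn n → ℝ := fun b => tfun d w ν (bas b) with hTdef
  have hTc : ∀ b, ContDiffAt ℝ 2 (T b) y := fun b => contDiffAt_tfun h.contDiff_d h.contDiff_w _ _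
  have hTT : ∀ b, ContDiffAt ℝ 2 (fun z => T b z * T b z) y := fun b => (hTc b).mul (hTc b)
  have hsum : ContDiffAt ℝ 2 (fun z => ∑ b, T b z * T b z) y := ContDiffAt.sum fun b _ => hTT b
  have hexp : Lop F e (D2 (fun z => κ⁻¹ * (∑ b, T b z * T b z) + σ * T b₀ z) y)
      = κ⁻¹ * (∑ b, (2 * (T b y * Lop F e (D2 (T b) y))
        + 2 * Gam F e (fderiv ℝ (T b) y) (fderiv ℝ (T b) y))) + σ * Lop F e (D2 (T b₀) y) := by
    rw [D2_add (contDiffAt_const.mul hsum) (contDiffAt_const.mul (hTc b₀)), Lop_add,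
      D2_const_mul hsum, D2_const_mul (hTc b₀), Lop_smul, Lop_smul,
      D2_sum _ (fun b _ => hTT b), Lop_sum]
    congr 2
    refine Finset.sum_congr rfl fun b _ => ?_
    rw [Lop_mul (hTc b) (hTc b)]
    ring
  -- with `θ = 1 / (8 m)` the `m` error terms use up at most an eighth of `κ⁻¹ Sw`
  have hθ : 0 < 1 / (8 * m) := by positivity
  have hL : ∀ b, |Lop F e (D2 (T b) y)| ≤ 1 / (8 * m) * κ⁻¹ * S + K₁ / (1 / (8 * m)) * κ * (1 + 𝓕) :=
    fun b => hT κ F l e W G d w y ν h _ hθ ((div_le_one (by positivity)).2 (by linarith)) (bas b)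
      (norm_bas b).le
  set L := 1 / (8 * m) * κ⁻¹ * S + K₁ / (1 / (8 * m)) * κ * (1 + 𝓕) with hLdef
  have hL0 : 0 ≤ L := (abs_nonneg _).trans (hL b₀)
  have hTy : ∀ b, |T b y| ≤ 2 * C ^ 3 * κ := by
    intro b
    have h1 : |fderiv ℝ d y ν * fderiv ℝ w y (bas b)| ≤ (C * C) * (C * κ * 1) := by
      rw [abs_mul]
      refine mul_le_mul (((fderiv ℝ d y).le_opNorm _).trans ?_)
        (((fderiv ℝ w y).le_opNorm _).trans ?_) (abs_nonneg _) (by positivity)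
      · exact mul_le_mul h.frame.D_le h.frame.ν_le (norm_nonneg _) hC0.le
      · rw [norm_bas]; exact mul_le_mul_of_nonneg_right h.w₁_le zero_le_one
    have h2 : |fderiv ℝ d y (bas b) * fderiv ℝ w y ν| ≤ (C * 1) * (C * κ * C) := by
      rw [abs_mul]
      refine mul_le_mul (((fderiv ℝ d y).le_opNorm _).trans ?_)
        (((fderiv ℝ w y).le_opNorm _).trans ?_) (abs_nonneg _) (by positivity)
      · rw [norm_bas]; exact mul_le_mul_of_nonneg_right h.frame.D_le zero_le_one
      · exact mul_le_mul h.w₁_le h.frame.ν_le (norm_nonneg _) (by positivity)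
    refine (abs_sub _ _).trans ?_
    linarith
  have hterm : ∀ b, -(2 * (2 * C ^ 3 * κ) * L) ≤ 2 * (T b y * Lop F e (D2 (T b) y)) := by
    intro b
    have h1 : |T b y * Lop F e (D2 (T b) y)| ≤ 2 * C ^ 3 * κ * L := by
      rw [abs_mul]; exact mul_le_mul (hTy b) (hL b) (abs_nonneg _) (by positivity)
    have := neg_abs_le (T b y * Lop F e (D2 (T b) y))
    linarith
  have hσL : -L ≤ σ * Lop F e (D2 (T b₀) y) := by
    have h1 : |σ * Lop F e (D2 (T b₀) y)| ≤ 1 * L := by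
      rw [abs_mul]; exact mul_le_mul hσ (hL b₀) (abs_nonneg _) zero_le_one
    have := neg_abs_le (σ * Lop F e (D2 (T b₀) y))
    linarith
  set Q := ∑ b, Gam F e (fderiv ℝ (T b) y) (fderiv ℝ (T b) y) with hQ
  have hSQ : S ≤ 8 * Q + 32 * n * C ^ 10 * κ ^ 2 * 𝓕 := Sw_le_sum_Gam h
  have hQ0 : 0 ≤ Q := Finset.sum_nonneg fun b _ => Gam_self_nonneg h.frame.F_nonneg _
  have hsum2 : -(2 * n * (2 * (2 * C ^ 3 * κ) * L)) + 2 * Q ≤ ∑ b, (2 * (T b y * Lop F e (D2 (T b) y))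
        + 2 * Gam F e (fderiv ℝ (T b) y) (fderiv ℝ (T b) y)) := by
    rw [Finset.sum_add_distrib, ← Finset.mul_sum (f := fun b => Gam F e (fderiv ℝ (T b) y) (fderiv ℝ (T b) y))]
    have := Finset.sum_le_sum fun b (_ : b ∈ (Finset.univ : Finset (Fin n ⊕ Fin n))) => hterm b
    rw [Finset.sum_const, nsmul_eq_mul, Finset.card_univ, Fintype.card_sum, Fintype.card_fin] at this
    push_cast at this
    linarith
  show -(_ * κ * (1 + 𝓕)) ≤ Lop F e (D2 (fun z => κ⁻¹ * (∑ b, T b z * T b z) + σ * T b₀ z) y)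
  rw [hexp]
  have h1 := mul_le_mul_of_nonneg_left hsum2 (inv_nonneg.2 hκ0.le)
  have h2 : κ⁻¹ * (-(2 * n * (2 * (2 * C ^ 3 * κ) * L)) + 2 * Q)
      = -(8 * n * C ^ 3 * L) + 2 * (κ⁻¹ * Q) := by field_simp; ring
  rw [h2] at h1
  have h3 : m * L = (1 / 8) * (κ⁻¹ * S) + m * (K₁ * (8 * m)) * (κ * (1 + 𝓕)) := by
    rw [hLdef]; field_simp
  have h4 : κ⁻¹ * S ≤ 8 * (κ⁻¹ * Q) + 32 * n * C ^ 10 * (κ * 𝓕) := by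
    refine (mul_le_mul_of_nonneg_left hSQ (inv_nonneg.2 hκ0.le)).trans (le_of_eq ?_)
    field_simp
  have h5 : 0 ≤ κ⁻¹ * Q := by positivity
  have h6 : 0 ≤ κ * 𝓕 := by positivity
  have h7 : 32 * n * C ^ 10 * (κ * 𝓕) ≤ 32 * n * C ^ 10 * (κ * (1 + 𝓕)) := by gcongr; linarith
  have h8 : 0 ≤ 32 * n * C ^ 10 * (κ * (1 + 𝓕)) := by positivity
  have h9 : 0 ≤ κ * (1 + 𝓕) := by positivity
  have h10 : m * L = 8 * n * C ^ 3 * L + L := by rw [hm]; ring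
  linarith

end TangentialFunctions

/-! ### Barriers -/

section Barriers

variable {n : ℕ}

/-- The maximum principle in the form used for barriers: a function that is a strict supersolution,
at a point and for an operator that may depend on it, wherever it is negative is nonnegative. -/
theorem nonneg_of_barrier {K : Set (Cn n)} (hK : IsCompact K) {Ψ : Cn n → ℝ}
    (hc : ContinuousOn Ψ K) (h : ∀ y ∈ K, Ψ y < 0 → K ∈ 𝓝 y ∧ ContDiffAt ℝ 2 Ψ y ∧
      ∃ (F : Fin n → ℝ) (e : Fin n → Cn n), (∀ i, 0 ≤ F i) ∧ Lop F e (D2 Ψ y) < 0) :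
    ∀ y ∈ K, 0 ≤ Ψ y := by
  intro y hy
  obtain ⟨x, hx, hmin⟩ := hK.exists_isMinOn ⟨y, hy⟩ hc
  by_contra! hneg
  have hx0 : Ψ x < 0 := (hmin hy).trans_lt hneg
  obtain ⟨hnhds, hd, F, e, hF, hL⟩ := h x hx hx0
  have hloc : IsLocalMin Ψ x := by filter_upwards [hnhds] with z hz using hmin hz
  exact absurd hL (not_lt.2 (Lop_nonneg hF fun a => D2_nonneg_of_isLocalMin hd hloc a))

/-- The real coordinates as continuous linear functionals. -/
def coordL : Fin n ⊕ Fin n → Cn n →L[ℝ] ℝ :=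
  Sum.elim (fun k => Complex.reCLM.comp ((EuclideanSpace.proj k : Cn n →L[ℂ] ℂ).restrictScalars ℝ))
    fun k => Complex.imCLM.comp ((EuclideanSpace.proj k : Cn n →L[ℂ] ℂ).restrictScalars ℝ)

theorem coordL_apply (b : Fin n ⊕ Fin n) (ξ : Cn n) : coordL b ξ = coord ξ b := by
  rcases b with k | k <;> rfl

/-- The squared distance from `q`, as a sum of squares of real coordinates. -/
def distSq (q z : Cn n) : ℝ := ∑ b, (coordL b z - coordL b q) * (coordL b z - coordL b q)

theorem distSq_eq (q z : Cn n) : distSq q z = ‖z - q‖ ^ 2 := by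
  rw [← sum_coord_sq, distSq]
  refine Finset.sum_congr rfl fun b _ => ?_
  rw [← map_sub, coordL_apply, sq]

theorem contDiff_distSq (q : Cn n) : ContDiff ℝ ∞ (distSq q) := by
  unfold distSq
  fun_prop

theorem D2_distSq (q y ξ : Cn n) : D2 (distSq q) y ξ ξ = 2 * ‖ξ‖ ^ 2 := by
  have hc : ∀ b : Fin n ⊕ Fin n, ContDiffAt ℝ 2 (fun z => coordL b z - coordL b q) y :=
    fun b => by fun_prop
  have hf : ∀ b : Fin n ⊕ Fin n, fderiv ℝ (fun z => coordL b z - coordL b q) = fun _ => coordL b := by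
    intro b; funext z; rw [fderiv_sub_const]; exact (coordL b).fderiv
  have h1 : D2 (distSq q) y = ∑ b, D2 (fun z => (coordL b z - coordL b q) * (coordL b z - coordL b q)) y :=
    D2_sum _ fun b _ => (hc b).mul (hc b)
  rw [h1, _root_.sum_apply, _root_.sum_apply, ← sum_coord_sq, Finset.mul_sum]
  refine Finset.sum_congr rfl fun b _ => ?_
  rw [D2_mul (hc b) (hc b)]
  have h0 : D2 (fun z => coordL b z - coordL b q) y = 0 := by
    rw [D2, hf]; exact (hasFDerivAt_const _ _).fderiv
  rw [h0, hf b, ← coordL_apply]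
  simp
  ring

theorem Lop_distSq (F : Fin n → ℝ) (e : Fin n → Cn n) (q y : Cn n) :
    Lop F e (D2 (distSq q) y) = ∑ i, F i * ‖e i‖ ^ 2 := by
  rw [Lop, Finset.mul_sum]
  refine Finset.sum_congr rfl fun i _ => ?_
  rw [D2_distSq, D2_distSq, norm_I_smul]
  ring

open Matrix in
/-- A vector in terms of a `W`-orthonormal frame. -/
theorem sum_sesq_smul_colVec {W P : Matrix (Fin n) (Fin n) ℂ} (hP : Pᴴ * W * P = 1) (ζ : Cn n) :
    ∑ i, sesq W (colVec P i) ζ • colVec P i = ζ := by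
  have h1 : P * (Pᴴ * W) = 1 := mul_eq_one_comm.1 hP
  ext j
  have h2 : ∀ i, sesq W (colVec P i) ζ = ∑ k, (Pᴴ * W) i k * ζ k := by
    intro i
    simp only [sesq, colVec, mul_apply, conjTranspose_apply, Finset.sum_mul]
    rw [Finset.sum_comm]
    rfl
  have h3 : (∑ i, sesq W (colVec P i) ζ • colVec P i) j = ∑ k, (P * (Pᴴ * W)) j k * ζ k := by
    have h4 : (∑ i, sesq W (colVec P i) ζ • colVec P i) j = ∑ i, sesq W (colVec P i) ζ * P j i := by
      simp only [WithLp.ofLp_sum, WithLp.ofLp_smul, Finset.sum_apply, Pi.smul_apply, smul_eq_mul]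
      rfl
    rw [h4]
    simp only [h2, Finset.sum_mul, mul_apply (M := P)]
    rw [Finset.sum_comm]
    exact Finset.sum_congr rfl fun k _ => Finset.sum_congr rfl fun i _ => by ring
  rw [h3, h1]
  simp [Matrix.one_apply]

open Matrix in
/-- If all `F_i` are at least `c`, the gradient term of a function that increases along a bounded
vector `ν` is bounded below by a multiple of `c`. -/
theorem Gam_self_ge {W P : Matrix (Fin n) (Fin n) ℂ} (hP : Pᴴ * W * P = 1) {C c : ℝ} (hC : 1 ≤ C)
    (hW : ∀ i ζ, ‖sesq W (colVec P i) ζ‖ ≤ C * ‖ζ‖) {D : Cn n →L[ℝ] ℝ} {ν : Cn n} (hν : ‖ν‖ ≤ C)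
    (hD : 1 ≤ C * D ν) {F : Fin n → ℝ} (hc : 0 ≤ c) (hF : ∀ i, c ≤ F i) :
    c ≤ 8 * n * C ^ 6 * Gam F (colVec P) D D := by
  set e := colVec P
  set a : Fin n → ℂ := fun i => sesq W (e i) ν with ha
  have hν' : ν = ∑ i, ((a i).re • e i + (a i).im • (Complex.I • e i)) := by
    conv_lhs => rw [← sum_sesq_smul_colVec hP ν]
    refine Finset.sum_congr rfl fun i _ => ?_
    show a i • e i = _
    conv_lhs => rw [← Complex.re_add_im (a i), add_smul, mul_smul]
    rfl
  have hDν : D ν = ∑ i, ((a i).re * D (e i) + (a i).im * D (Complex.I • e i)) := by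
    conv_lhs => rw [hν']
    simp
  have hai : ∀ i, ‖a i‖ ≤ C ^ 2 := fun i => (hW i ν).trans (by nlinarith)
  set Q := ∑ i, (D (e i) ^ 2 + D (Complex.I • e i) ^ 2) with hQ
  have h1 : D ν ^ 2 ≤ n * (C ^ 4 * Q) := by
    rw [hDν]
    refine (sq_sum_le_card_mul_sum_sq).trans ?_
    rw [Finset.card_univ, Fintype.card_fin]
    refine mul_le_mul_of_nonneg_left ?_ (Nat.cast_nonneg n)
    rw [hQ, Finset.mul_sum]
    refine Finset.sum_le_sum fun i _ => ?_
    have h2 : (a i).re ^ 2 + (a i).im ^ 2 ≤ C ^ 4 := by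
      have : (a i).re ^ 2 + (a i).im ^ 2 = ‖a i‖ ^ 2 := by
        rw [← Complex.normSq_eq_norm_sq, Complex.normSq_apply]; ring
      rw [this]
      calc ‖a i‖ ^ 2 ≤ (C ^ 2) ^ 2 := pow_le_pow_left₀ (norm_nonneg _) (hai i) 2
        _ = C ^ 4 := by ring
    have h3 : ((a i).re * D (e i) + (a i).im * D (Complex.I • e i)) ^ 2
        ≤ ((a i).re ^ 2 + (a i).im ^ 2) * (D (e i) ^ 2 + D (Complex.I • e i) ^ 2) := by
      nlinarith [sq_nonneg ((a i).re * D (Complex.I • e i) - (a i).im * D (e i))]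
    exact h3.trans (mul_le_mul_of_nonneg_right h2 (by positivity))
  have h2 : 1 ≤ C ^ 2 * D ν ^ 2 := by
    have := one_le_pow₀ hD (n := 2)
    linarith [mul_pow C (D ν) 2]
  have h3 : c * Q ≤ 4 * Gam F e D D := by
    rw [Gam, hQ, Finset.mul_sum, ← mul_assoc, show (4 : ℝ) * (1 / 4) = 1 by norm_num, one_mul]
    refine Finset.sum_le_sum fun i _ => ?_
    have := hF i
    calc c * (D (e i) ^ 2 + D (Complex.I • e i) ^ 2)
        ≤ F i * (D (e i) ^ 2 + D (Complex.I • e i) ^ 2) := by gcongr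
      _ = _ := by ring
  have hG : 0 ≤ Gam F e D D := Gam_self_nonneg (fun i => hc.trans (hF i)) D
  have h4 : 1 ≤ C ^ 2 * (n * (C ^ 4 * Q)) := h2.trans (by gcongr)
  calc c ≤ c * (C ^ 2 * (n * (C ^ 4 * Q))) := le_mul_of_one_le_right hc h4
    _ = n * C ^ 6 * (c * Q) := by ring
    _ ≤ n * C ^ 6 * (4 * Gam F e D D) := by gcongr
    _ ≤ 8 * n * C ^ 6 * Gam F e D D := by
      have : 0 ≤ n * C ^ 6 * Gam F e D D := by positivity
      linarith

open Matrix in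
/-- The function `t d - N d²` of a boundary defining function `d`: where `∑ F_i` is large, its image
is dominated by `ε ∑ F_i`; where `∑ F_i` is bounded, all `F_i` are bounded below and the term `-N d²`
makes the image as negative as desired. -/
theorem exists_barrier_constants {C ε N₀ : ℝ} (hn : 0 < n) (hC : 1 ≤ C) (hε : 0 < ε) (hN₀ : 0 ≤ N₀)
    (𝒞 : Set (Fin n → ℝ)) (h0 : ∀ F ∈ 𝒞, ∀ i, 0 ≤ F i)
    (hc : ∀ F₀ : ℝ, ∃ c : ℝ, 0 < c ∧ ∀ F ∈ 𝒞, ∑ i, F i ≤ F₀ → ∀ i, c ≤ F i) :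
    ∃ t N δ ε₁ : ℝ, 0 < t ∧ 0 < N ∧ 0 < δ ∧ 0 < ε₁ ∧ N * δ ≤ t ∧
      ∀ F ∈ 𝒞, ∀ (W P : Matrix (Fin n) (Fin n) ℂ) (d : Cn n → ℝ) (y ν : Cn n), Pᴴ * W * P = 1 →
        (∀ i, ‖colVec P i‖ ≤ C) → (∀ i ζ, ‖sesq W (colVec P i) ζ‖ ≤ C * ‖ζ‖) → ‖ν‖ ≤ C →
        ContDiffAt ℝ 2 d y → ‖D2 d y‖ ≤ C → 1 ≤ C * fderiv ℝ d y ν → 0 ≤ d y → d y ≤ δ →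
        Lop F (colVec P) (D2 (fun z => t * d z - N * (d z * d z)) y) + (N₀ - ε * ∑ i, F i)
          ≤ -(ε₁ * (1 + ∑ i, F i)) := by
  -- beyond the threshold `F₀` half of `ε ∑ F_i` outweighs `N₀`; below it the weights are bounded
  -- below, and `N` is taken large; finally `δ` makes the first order coefficient `t - 2 N d` small
  set F₀ : ℝ := 2 * N₀ / ε + 1 with hF₀
  have hF₀1 : 1 ≤ F₀ := by rw [hF₀]; have : 0 ≤ 2 * N₀ / ε := by positivity
                           linarith
  obtain ⟨c, hc0, hcF⟩ := hc F₀
  have hn' : (0 : ℝ) < n := by exact_mod_cast hn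
  set g : ℝ := 8 * n * C ^ 6 with hg
  have hg0 : 0 < g := by positivity
  set N : ℝ := (N₀ + 1) * g / (2 * c) with hN
  have hN0 : 0 < N := by positivity
  set δ : ℝ := ε / (12 * N * C ^ 3) with hδ
  have hδ0 : 0 < δ := by positivity
  refine ⟨N * δ, N, δ, min (ε / 4) (1 / (1 + F₀)), by positivity, hN0, hδ0, by positivity, le_rfl, ?_⟩
  intro F hF W P d y ν hP he hW hν hd hd2 hDν hdy hdδ
  have hF0 := h0 F hF
  set 𝓕 := ∑ i, F i with h𝓕
  have h𝓕0 : 0 ≤ 𝓕 := Finset.sum_nonneg fun i _ => hF0 i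
  set e := colVec P
  have hdd : ContDiffAt ℝ 2 (fun z => d z * d z) y := hd.mul hd
  have hexp : Lop F e (D2 (fun z => N * δ * d z - N * (d z * d z)) y)
      = (N * δ - 2 * N * d y) * Lop F e (D2 d y) - 2 * N * Gam F e (fderiv ℝ d y) (fderiv ℝ d y) := by
    rw [D2_sub (contDiffAt_const.mul hd) (contDiffAt_const.mul hdd), Lop_sub, D2_const_mul hd,
      D2_const_mul hdd, Lop_smul, Lop_smul, Lop_mul hd hd]
    ring
  have hLd : |Lop F e (D2 d y)| ≤ C ^ 3 * 𝓕 := by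
    refine (abs_Lop_le hF0 he hd2).trans (le_of_eq (by ring))
  have hco : |N * δ - 2 * N * d y| ≤ 3 * N * δ := by
    rw [abs_le]; constructor <;> nlinarith
  have h1 : (N * δ - 2 * N * d y) * Lop F e (D2 d y) ≤ ε / 4 * 𝓕 := by
    refine (le_abs_self _).trans ?_
    rw [abs_mul]
    refine (mul_le_mul hco hLd (abs_nonneg _) (by positivity)).trans (le_of_eq ?_)
    rw [hδ]; field_simp; ring
  have hG : 0 ≤ Gam F e (fderiv ℝ d y) (fderiv ℝ d y) := Gam_self_nonneg hF0 _
  have hm1 : min (ε / 4) (1 / (1 + F₀)) * (1 + 𝓕) ≤ ε / 4 * (1 + 𝓕) :=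
    mul_le_mul_of_nonneg_right (min_le_left _ _) (by linarith)
  have hm2 : min (ε / 4) (1 / (1 + F₀)) * (1 + 𝓕) ≤ 1 / (1 + F₀) * (1 + 𝓕) :=
    mul_le_mul_of_nonneg_right (min_le_right _ _) (by linarith)
  rw [hexp]
  rcases le_total F₀ 𝓕 with h | h
  · have h2 : N₀ + ε / 2 ≤ ε / 2 * 𝓕 := by
      have h3 : ε / 2 * F₀ = N₀ + ε / 2 := by rw [hF₀]; field_simp
      rw [← h3]; gcongr
    have h4 : 0 ≤ 2 * N * Gam F e (fderiv ℝ d y) (fderiv ℝ d y) := by positivity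
    linarith
  · have h2 := Gam_self_ge hP hC hW hν hDν hc0.le (hcF F hF h)
    have h3 : N₀ + 1 ≤ 2 * N * Gam F e (fderiv ℝ d y) (fderiv ℝ d y) := by
      have h4 : 2 * N * Gam F e (fderiv ℝ d y) (fderiv ℝ d y)
          = (N₀ + 1) * ((g * Gam F e (fderiv ℝ d y) (fderiv ℝ d y)) / c) := by
        rw [hN]; field_simp
      rw [h4]
      exact le_mul_of_one_le_right (by linarith) ((one_le_div hc0).2 h2)
    have h5 : 1 / (1 + F₀) * (1 + 𝓕) ≤ 1 := by
      rw [one_div, inv_mul_le_one₀ (by linarith)]; linarith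
    have h6 : ε / 4 * 𝓕 ≤ ε * 𝓕 := by gcongr; linarith
    linarith

/-! ### Uniform bounds for frames on compact sets -/

open Matrix
open scoped ComplexOrder

theorem continuousOn_sesq {α : Type*} [TopologicalSpace α] {s : Set α}
    {A : α → Matrix (Fin n) (Fin n) ℂ} {ξ η : α → Cn n} (hA : ∀ k j, ContinuousOn (fun x => A x k j) s)
    (hξ : ContinuousOn ξ s) (hη : ContinuousOn η s) :
    ContinuousOn (fun x => sesq (A x) (ξ x) (η x)) s := by
  unfold sesq
  refine continuousOn_finsetSum _ fun k _ => continuousOn_finsetSum _ fun j _ => ?_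
  have h1 : ∀ k, ContinuousOn (fun x => ξ x k) s := fun k =>
    (EuclideanSpace.proj k : Cn n →L[ℂ] ℂ).continuous.comp_continuousOn hξ
  have h2 : ∀ k, ContinuousOn (fun x => η x k) s := fun k =>
    (EuclideanSpace.proj k : Cn n →L[ℂ] ℂ).continuous.comp_continuousOn hη
  exact ((Complex.continuous_conj.comp_continuousOn (h1 k)).mul (hA k j)).mul (h2 j)

theorem sesq_self_re_pos {A : Matrix (Fin n) (Fin n) ℂ} (hA : A.PosDef) {ξ : Cn n} (hξ : ξ ≠ 0) :
    0 < (sesq A ξ ξ).re := by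
  have h1 : sesq A ξ ξ = star (ξ : Fin n → ℂ) ⬝ᵥ (A *ᵥ (ξ : Fin n → ℂ)) := by
    simp only [sesq, dotProduct, mulVec, Finset.mul_sum]
    exact Finset.sum_congr rfl fun k _ => Finset.sum_congr rfl fun j _ => by
      simp [mul_assoc]
  rw [h1]
  exact hA.re_dotProduct_pos (x := (ξ : Fin n → ℂ)) (fun h => hξ (by ext k; simp [h]))

theorem sesq_smul_smul (A : Matrix (Fin n) (Fin n) ℂ) (c : ℝ) (ξ : Cn n) :
    sesq A (c • ξ) (c • ξ) = c ^ 2 * sesq A ξ ξ := by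
  simp only [sesq, Finset.mul_sum]
  refine Finset.sum_congr rfl fun k _ => Finset.sum_congr rfl fun j _ => ?_
  simp
  ring

theorem exists_sesq_lower_bound {K : Set (Cn n)} (hK : IsCompact K)
    {W : Cn n → Matrix (Fin n) (Fin n) ℂ} (hW : ∀ k j, ContinuousOn (fun z => W z k j) K)
    (hpos : ∀ y ∈ K, (W y).PosDef) :
    ∃ c : ℝ, 0 < c ∧ ∀ y ∈ K, ∀ ξ, c * ‖ξ‖ ^ 2 ≤ (sesq (W y) ξ ξ).re := by
  have hcpt : IsCompact (K ×ˢ Metric.sphere (0 : Cn n) 1) := hK.prod (isCompact_sphere _ _)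
  have hcont : ContinuousOn (fun x : Cn n × Cn n => (sesq (W x.1) x.2 x.2).re)
      (K ×ˢ Metric.sphere (0 : Cn n) 1) := by
    refine Complex.continuous_re.comp_continuousOn (continuousOn_sesq (fun k j => ?_)
      continuousOn_snd continuousOn_snd)
    exact (hW k j).comp continuousOn_fst fun x hx => hx.1
  have hmain : ∃ c : ℝ, 0 < c ∧ ∀ x ∈ K ×ˢ Metric.sphere (0 : Cn n) 1,
      c ≤ (sesq (W x.1) x.2 x.2).re := by
    rcases (K ×ˢ Metric.sphere (0 : Cn n) 1).eq_empty_or_nonempty with h | h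
    · exact ⟨1, one_pos, by simp [h]⟩
    · obtain ⟨x, hx, hmin⟩ := hcpt.exists_isMinOn h hcont
      refine ⟨_, sesq_self_re_pos (hpos x.1 hx.1) ?_, fun y hy => hmin hy⟩
      intro h0
      have := hx.2
      simp [h0] at this
  obtain ⟨c, hc, h⟩ := hmain
  refine ⟨c, hc, fun y hy ξ => ?_⟩
  by_cases hξ : ξ = 0
  · simp [hξ, sesq]
  have hn : 0 < ‖ξ‖ := norm_pos_iff.2 hξ
  have h1 := h (y, ‖ξ‖⁻¹ • ξ) ⟨hy, by simp [norm_smul, hn.ne']⟩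
  simp only [sesq_smul_smul] at h1
  rw [← Complex.ofReal_pow, Complex.re_ofReal_mul] at h1
  calc c * ‖ξ‖ ^ 2 ≤ (‖ξ‖⁻¹ ^ 2 * (sesq (W y) ξ ξ).re) * ‖ξ‖ ^ 2 := by gcongr
    _ = _ := by field_simp

theorem exists_norm_le_of_continuousOn {α E : Type*} [TopologicalSpace α] [SeminormedAddCommGroup E]
    {K : Set α} (hK : IsCompact K) {f : α → E} (hf : ContinuousOn f K) :
    ∃ C : ℝ, 1 ≤ C ∧ ∀ x ∈ K, ‖f x‖ ≤ C := by
  obtain ⟨C, hC⟩ := hK.exists_bound_of_continuousOn hf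
  exact ⟨max C 1, le_max_right _ _, fun x hx => (hC x hx).trans (le_max_left _ _)⟩

theorem exists_entries_bound {K : Set (Cn n)} (hK : IsCompact K)
    {A : Cn n → Matrix (Fin n) (Fin n) ℂ} (hA : ∀ k j, ContinuousOn (fun z => A z k j) K) :
    ∃ C : ℝ, 1 ≤ C ∧ ∀ y ∈ K, ∀ k j, ‖A y k j‖ ≤ C := by
  obtain ⟨C, hC1, hC⟩ := exists_norm_le_of_continuousOn hK (f := fun z (kj : Fin n × Fin n) => A z kj.1 kj.2)
    (continuousOn_pi.2 fun kj => hA kj.1 kj.2)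
  exact ⟨C, hC1, fun y hy k j => (norm_le_pi_norm (fun kj : Fin n × Fin n => A y kj.1 kj.2) (k, j)).trans
    (hC y hy)⟩

/-- The frames orthonormal for `W` are uniformly bounded over a compact set. -/
theorem exists_frame_bound {K : Set (Cn n)} (hK : IsCompact K)
    {W : Cn n → Matrix (Fin n) (Fin n) ℂ} (hW : ∀ k j, ContinuousOn (fun z => W z k j) K)
    (hpos : ∀ y ∈ K, (W y).PosDef) : ∃ C : ℝ, 1 ≤ C ∧ ∀ y ∈ K,
      ∀ P : Matrix (Fin n) (Fin n) ℂ, Pᴴ * W y * P = 1 → ∀ i, ‖colVec P i‖ ≤ C := by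
  obtain ⟨c, hc, h⟩ := exists_sesq_lower_bound hK hW hpos
  refine ⟨max 1 c⁻¹, le_max_left _ _, fun y hy P hP i => ?_⟩
  have h1 := h y hy (colVec P i)
  rw [← conjTranspose_mul_mul_apply, hP] at h1
  simp only [one_apply_eq, Complex.one_re] at h1
  have h2 : ‖colVec P i‖ ^ 2 ≤ c⁻¹ := by
    rw [← one_div, le_div_iff₀ hc]; linarith
  have h3 : c⁻¹ ≤ max 1 c⁻¹ := le_max_right _ _
  have h4 : 1 ≤ max 1 c⁻¹ := le_max_left _ _
  by_contra! h5
  nlinarith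

/-- Strict positivity of the `p`-dimensional traces of a form in the cone, uniformly over a compact
set and over all orthonormal frames. -/
theorem exists_trace_lower_bound {p : ℕ} {K : Set (Cn n)} (hK : IsCompact K)
    {W G : Cn n → Matrix (Fin n) (Fin n) ℂ} (hW : ∀ k j, ContinuousOn (fun z => W z k j) K)
    (hG : ∀ k j, ContinuousOn (fun z => G z k j) K) (hpos : ∀ y ∈ K, (W y).PosDef)
    (hherm : ∀ y ∈ K, (G y).IsHermitian)
    (hcone : ∀ y ∈ K, InCone p (realEigenvalues ((W y)⁻¹ * G y))) :
    ∃ ε : ℝ, 0 < ε ∧ ∀ y ∈ K, ∀ P : Matrix (Fin n) (Fin n) ℂ, Pᴴ * W y * P = 1 →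
      ∀ I ∈ Finset.powersetCard p Finset.univ, ε ≤ ∑ i ∈ I, (sesq (G y) (colVec P i) (colVec P i)).re := by
  obtain ⟨R, hR1, hR⟩ := exists_frame_bound hK hW hpos
  set B : Set (Matrix (Fin n) (Fin n) ℂ) :=
    Set.pi univ fun _ => Set.pi univ fun _ => Metric.closedBall (0 : ℂ) R with hB
  have hBc : IsCompact B := isCompact_univ_pi fun _ => isCompact_univ_pi fun _ => isCompact_closedBall _ _
  have hcol : ∀ i, Continuous fun P : Matrix (Fin n) (Fin n) ℂ => colVec P i := fun i =>
    (PiLp.continuous_toLp 2 _).comp (continuous_pi fun k => (continuous_apply_apply k i))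
  set Z : Set (Cn n × Matrix (Fin n) (Fin n) ℂ) := {x ∈ K ×ˢ B | ∀ i j,
    sesq (W x.1) (colVec x.2 i) (colVec x.2 j) = (1 : Matrix (Fin n) (Fin n) ℂ) i j} with hZ
  have hsW : ∀ i j, ContinuousOn (fun x : Cn n × Matrix (Fin n) (Fin n) ℂ =>
      sesq (W x.1) (colVec x.2 i) (colVec x.2 j)) (K ×ˢ B) := fun i j =>
    continuousOn_sesq (fun k j => (hW k j).comp continuousOn_fst fun x hx => hx.1)
      ((hcol i).comp continuous_snd).continuousOn ((hcol j).comp continuous_snd).continuousOn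
  have hsG : ∀ i j, ContinuousOn (fun x : Cn n × Matrix (Fin n) (Fin n) ℂ =>
      sesq (G x.1) (colVec x.2 i) (colVec x.2 j)) (K ×ˢ B) := fun i j =>
    continuousOn_sesq (fun k j => (hG k j).comp continuousOn_fst fun x hx => hx.1)
      ((hcol i).comp continuous_snd).continuousOn ((hcol j).comp continuous_snd).continuousOn
  have hZc : IsCompact Z := by
    have hg : ContinuousOn (fun (x : Cn n × Matrix (Fin n) (Fin n) ℂ) (i j : Fin n) =>
        sesq (W x.1) (colVec x.2 i) (colVec x.2 j)) (K ×ˢ B) :=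
      continuousOn_pi.2 fun i => continuousOn_pi.2 fun j => hsW i j
    have h1 : Z = (K ×ˢ B) ∩ (fun (x : Cn n × Matrix (Fin n) (Fin n) ℂ) (i j : Fin n) =>
        sesq (W x.1) (colVec x.2 i) (colVec x.2 j)) ⁻¹' {fun i j => (1 : Matrix (Fin n) (Fin n) ℂ) i j} := by
      ext x
      simp only [hZ, Set.mem_ofPred_eq, Set.mem_inter_iff, Set.mem_preimage, Set.mem_singleton_iff,
        funext_iff]
    rw [h1]
    exact (hK.prod hBc).of_isClosed_subset (hg.preimage_isClosed_of_isClosed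
      (hK.prod hBc).isClosed isClosed_singleton) Set.inter_subset_left
  have hmemZ : ∀ y ∈ K, ∀ P : Matrix (Fin n) (Fin n) ℂ, Pᴴ * W y * P = 1 → (y, P) ∈ Z := by
    intro y hy P hP
    refine ⟨⟨hy, fun i _ j _ => mem_closedBall_zero_iff.2 ?_⟩, fun i j => ?_⟩
    · exact (PiLp.norm_apply_le (colVec P j) i).trans (hR y hy P hP j)
    · rw [← conjTranspose_mul_mul_apply, hP]
  have hposI : ∀ x ∈ Z, ∀ I ∈ Finset.powersetCard p Finset.univ,
      0 < ∑ i ∈ I, (sesq (G x.1) (colVec x.2 i) (colVec x.2 i)).re := by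
    intro x hx I hI
    have hP : (x.2)ᴴ * W x.1 * x.2 = 1 := by
      ext i j
      rw [conjTranspose_mul_mul_apply]
      exact hx.2 i j
    have h1 := (diag_of_inCone (p := p) (isHermitian_conjTranspose_mul_mul x.2 (hherm x.1 hx.1.1))
      (by rw [← realEigenvalues_congr (charpoly_inv_mul (H := G x.1) hP)]; exact hcone x.1 hx.1.1)).1 I hI
    simpa only [conjTranspose_mul_mul_apply] using h1
  have hI : ∀ I ∈ Finset.powersetCard p (Finset.univ : Finset (Fin n)), ∃ ε : ℝ, 0 < ε ∧ ∀ x ∈ Z,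
      ε ≤ ∑ i ∈ I, (sesq (G x.1) (colVec x.2 i) (colVec x.2 i)).re := by
    intro I hI
    rcases Z.eq_empty_or_nonempty with h | h
    · exact ⟨1, one_pos, by simp [h]⟩
    · obtain ⟨x, hx, hmin⟩ := hZc.exists_isMinOn h (f := fun x => ∑ i ∈ I,
        (sesq (G x.1) (colVec x.2 i) (colVec x.2 i)).re) (continuousOn_finsetSum _ fun i _ =>
          Complex.continuous_re.comp_continuousOn ((hsG i i).mono fun x hx => hx.1))
      exact ⟨_, hposI x hx I hI, fun y hy => hmin hy⟩
  choose! ε hε0 hε using hI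
  rcases (Finset.powersetCard p (Finset.univ : Finset (Fin n))).eq_empty_or_nonempty with h | h
  · exact ⟨1, one_pos, by simp [h]⟩
  · refine ⟨Finset.inf' _ h ε, (Finset.lt_inf'_iff h).2 hε0, fun y hy P hP I hI => ?_⟩
    exact (Finset.inf'_le _ hI).trans (hε I hI (y, P) (hmemZ y hy P hP))

end Barriers

/-! ### Estimates near a boundary point in coordinates -/

section Within

variable {n : ℕ} {E : Type*} [NormedAddCommGroup E] [NormedSpace ℝ E]

/-- The second derivative within a set. -/
abbrev D2w (Ω : Set (Cn n)) (f : Cn n → ℝ) : Cn n → Cn n →L[ℝ] Cn n →L[ℝ] ℝ :=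
  fderivWithin ℝ (fderivWithin ℝ f Ω) Ω

variable {Ω : Set (Cn n)} {y : Cn n}

theorem fderivWithin_eventuallyEq (h : Ω ∈ 𝓝 y) (f : Cn n → E) :
    fderivWithin ℝ f Ω =ᶠ[𝓝 y] fderiv ℝ f := by
  filter_upwards [eventually_mem_nhds_iff.2 h] with z hz using fderivWithin_of_mem_nhds hz

theorem D2w_eventuallyEq (h : Ω ∈ 𝓝 y) (f : Cn n → ℝ) : D2w Ω f =ᶠ[𝓝 y] D2 f := by
  filter_upwards [eventually_mem_nhds_iff.2 h] with z hz
  rw [D2w, fderivWithin_of_mem_nhds hz, (fderivWithin_eventuallyEq hz f).fderiv_eq]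

theorem D2w_eq (h : Ω ∈ 𝓝 y) (f : Cn n → ℝ) : D2w Ω f y = D2 f y := (D2w_eventuallyEq h f).eq_of_nhds

theorem fderivWithin_D2w_eq (h : Ω ∈ 𝓝 y) (f : Cn n → ℝ) :
    fderivWithin ℝ (D2w Ω f) Ω y = fderiv ℝ (D2 f) y := by
  rw [fderivWithin_of_mem_nhds h, (D2w_eventuallyEq h f).fderiv_eq]

theorem contDiffOn_D2w (hΩ : UniqueDiffOn ℝ Ω) {f : Cn n → ℝ} {m k : WithTop ℕ∞}
    (hf : ContDiffOn ℝ m f Ω) (hk : k + 1 + 1 ≤ m) : ContDiffOn ℝ k (D2w Ω f) Ω :=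
  (hf.fderivWithin hΩ hk).fderivWithin hΩ le_rfl

/-- Bounds on a compact set for the derivatives, of order at most three, of a smooth function. -/
theorem exists_deriv_bound (hΩ : UniqueDiffOn ℝ Ω) {f : Cn n → ℝ} (hf : ContDiffOn ℝ ∞ f Ω)
    {K : Set (Cn n)} (hK : IsCompact K) (hKΩ : K ⊆ Ω) : ∃ C : ℝ, 1 ≤ C ∧ ∀ y ∈ K,
      ‖fderivWithin ℝ f Ω y‖ ≤ C ∧ ‖D2w Ω f y‖ ≤ C ∧ ‖fderivWithin ℝ (D2w Ω f) Ω y‖ ≤ C := by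
  have h1 : ContDiffOn ℝ ∞ (fderivWithin ℝ f Ω) Ω := hf.fderivWithin hΩ (by simp)
  have h2 : ContDiffOn ℝ ∞ (D2w Ω f) Ω := h1.fderivWithin hΩ (by simp)
  have h3 : ContDiffOn ℝ ∞ (fderivWithin ℝ (D2w Ω f) Ω) Ω := h2.fderivWithin hΩ (by simp)
  obtain ⟨C₁, hC₁, h1'⟩ := exists_norm_le_of_continuousOn hK (h1.continuousOn.mono hKΩ)
  obtain ⟨C₂, hC₂, h2'⟩ := exists_norm_le_of_continuousOn hK (h2.continuousOn.mono hKΩ)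
  obtain ⟨C₃, hC₃, h3'⟩ := exists_norm_le_of_continuousOn hK (h3.continuousOn.mono hKΩ)
  refine ⟨C₁ + C₂ + C₃, by linarith, fun y hy => ⟨?_, ?_, ?_⟩⟩
  · linarith [h1' y hy]
  · linarith [h2' y hy]
  · linarith [h3' y hy]

end Within

section Boundary

variable {n : ℕ}

open Matrix
open scoped ComplexOrder

/-- A region of `ℂⁿ` with smooth boundary, the boundary being contained in the region. The function
`d` is a defining function: positive in the interior and zero, with nonzero derivative, at the
boundary points. The half-space of inner directions at a boundary point enters through the first
order condition for a minimum. -/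
structure BoundaryRegion (Ω : Set (Cn n)) (d : Cn n → ℝ) : Prop where
  uniqueDiffOn : UniqueDiffOn ℝ Ω
  contDiffOn : ContDiffOn ℝ ∞ d Ω
  nonneg : ∀ y ∈ Ω, 0 ≤ d y
  mem_nhds : ∀ y ∈ Ω, 0 < d y → Ω ∈ 𝓝 y
  deriv_nonneg : ∀ q ∈ Ω, d q = 0 → ∀ (f : Cn n → ℝ) (f' : Cn n →L[ℝ] ℝ),
    HasFDerivWithinAt f f' Ω q → IsLocalMinOn f Ω q →
      ∀ ξ, 0 ≤ fderivWithin ℝ d Ω q ξ → 0 ≤ f' ξ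
  exists_deriv_pos : ∀ q ∈ Ω, d q = 0 → ∃ ν, 0 < fderivWithin ℝ d Ω q ν
  locallyCompact : ∀ q ∈ Ω, ∃ r : ℝ, 0 < r ∧ IsCompact (Ω ∩ Metric.closedBall q r)

/-- Bounds, over the part of `Ω` in a ball, on the geometry of a region with a Hermitian metric
`W`: its orthonormal frames, the defining function, and a transversal vector `ν`. -/
structure RegionBounds (Ω : Set (Cn n)) (d : Cn n → ℝ) (W : Cn n → Matrix (Fin n) (Fin n) ℂ)
    (q₀ : Cn n) (r C : ℝ) (ν : Cn n) : Prop where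
  one_le : 1 ≤ C
  isCompact : IsCompact (Ω ∩ Metric.closedBall q₀ r)
  ν_le : ‖ν‖ ≤ 1
  ν_pos : ∀ y ∈ Ω ∩ Metric.closedBall q₀ r, 1 ≤ C * fderivWithin ℝ d Ω y ν
  d_le : ∀ y ∈ Ω ∩ Metric.closedBall q₀ r, ‖fderivWithin ℝ d Ω y‖ ≤ C ∧ ‖D2w Ω d y‖ ≤ C ∧
    ‖fderivWithin ℝ (D2w Ω d) Ω y‖ ≤ C
  frame_le : ∀ y ∈ Ω ∩ Metric.closedBall q₀ r, ∀ P : Matrix (Fin n) (Fin n) ℂ, Pᴴ * W y * P = 1 →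
    ∀ i, ‖colVec P i‖ ≤ C
  metric_le : ∀ y ∈ Ω ∩ Metric.closedBall q₀ r, ∀ P : Matrix (Fin n) (Fin n) ℂ, Pᴴ * W y * P = 1 →
    ∀ i ζ, ‖sesq (W y) (colVec P i) ζ‖ ≤ C * ‖ζ‖

variable {Ω : Set (Cn n)} {d : Cn n → ℝ} {W : Cn n → Matrix (Fin n) (Fin n) ℂ} {q₀ ν : Cn n} {r C : ℝ}

theorem RegionBounds.mono (h : RegionBounds Ω d W q₀ r C ν) {C' : ℝ} (hC : C ≤ C') :
    RegionBounds Ω d W q₀ r C' ν where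
  one_le := h.one_le.trans hC
  isCompact := h.isCompact
  ν_le := h.ν_le
  ν_pos y hy := by
    have h1 := h.ν_pos y hy
    have h2 : 0 < fderivWithin ℝ d Ω y ν := by
      by_contra! h3
      nlinarith [h.one_le]
    nlinarith
  d_le y hy := ⟨(h.d_le y hy).1.trans hC, (h.d_le y hy).2.1.trans hC, (h.d_le y hy).2.2.trans hC⟩
  frame_le y hy P hP i := (h.frame_le y hy P hP i).trans hC
  metric_le y hy P hP i ζ := (h.metric_le y hy P hP i ζ).trans (by gcongr)

theorem exists_sesq_colVec_bound {K : Set (Cn n)} (hK : IsCompact K)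
    {A : Cn n → Matrix (Fin n) (Fin n) ℂ} (hA : ∀ k j, ContinuousOn (fun z => A z k j) K) {R : ℝ}
    (hR : 0 ≤ R) : ∃ C : ℝ, 1 ≤ C ∧ ∀ y ∈ K, ∀ ξ ζ : Cn n, ‖ξ‖ ≤ R → ‖sesq (A y) ξ ζ‖ ≤ C * ‖ζ‖ := by
  obtain ⟨C, hC1, hC⟩ := exists_entries_bound hK hA
  refine ⟨n ^ 2 * C * R + 1, by
    have : 0 ≤ n ^ 2 * C * R := by positivity
    linarith, fun y hy ξ ζ hξ => (norm_sesq_le (hC y hy) ξ ζ).trans ?_⟩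
  have h1 : n ^ 2 * C * ‖ξ‖ * ‖ζ‖ ≤ n ^ 2 * C * R * ‖ζ‖ := by gcongr
  have h2 := norm_nonneg ζ
  linarith

/-- Near a boundary point the geometry is bounded, by continuity and local compactness. -/
theorem BoundaryRegion.exists_bounds (hΩ : BoundaryRegion Ω d)
    (hW : ∀ k j, ContinuousOn (fun z => W z k j) Ω) (hpos : ∀ y ∈ Ω, (W y).PosDef)
    (hq₀ : q₀ ∈ Ω) (hd : d q₀ = 0) : ∃ (ν : Cn n) (r C : ℝ), 0 < r ∧ RegionBounds Ω d W q₀ r C ν := by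
  obtain ⟨ν, hν, hν1⟩ : ∃ ν, 0 < fderivWithin ℝ d Ω q₀ ν ∧ ‖ν‖ ≤ 1 := by
    obtain ⟨ν, hν⟩ := hΩ.exists_deriv_pos q₀ hq₀ hd
    have h0 : 0 < ‖ν‖ := norm_pos_iff.2 fun h => by simp [h] at hν
    exact ⟨‖ν‖⁻¹ • ν, by rw [map_smul]; exact mul_pos (inv_pos.2 h0) hν,
      by rw [norm_smul, norm_inv, norm_norm, inv_mul_cancel₀ h0.ne']⟩
  obtain ⟨r₀, hr₀, hcpt⟩ := hΩ.locallyCompact q₀ hq₀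
  have hcont : ContinuousOn (fun y => fderivWithin ℝ d Ω y ν) Ω :=
    ((hΩ.contDiffOn.fderivWithin hΩ.uniqueDiffOn (m := ∞) (by simp)).continuousOn).clm_apply
      continuousOn_const
  set c := fderivWithin ℝ d Ω q₀ ν / 2 with hc
  have hc0 : 0 < c := by positivity
  have hev : ∀ᶠ y in 𝓝[Ω] q₀, c < fderivWithin ℝ d Ω y ν :=
    (hcont q₀ hq₀).eventually (lt_mem_nhds (by rw [hc]; linarith))
  obtain ⟨r₁, hr₁, hsub⟩ := Metric.mem_nhdsWithin_iff.1 hev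
  set r := min r₀ (r₁ / 2) with hr
  have hrpos : 0 < r := by positivity
  have hK : IsCompact (Ω ∩ Metric.closedBall q₀ r) := by
    have : Ω ∩ Metric.closedBall q₀ r = (Ω ∩ Metric.closedBall q₀ r₀) ∩ Metric.closedBall q₀ r := by
      rw [inter_assoc, inter_eq_self_of_subset_right (Metric.closedBall_subset_closedBall (min_le_left _ _))]
    rw [this]
    exact hcpt.inter_right Metric.isClosed_closedBall
  have hKΩ : Ω ∩ Metric.closedBall q₀ r ⊆ Ω := inter_subset_left
  obtain ⟨C₁, hC₁, h1⟩ := exists_deriv_bound hΩ.uniqueDiffOn hΩ.contDiffOn hK hKΩ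
  obtain ⟨C₂, hC₂, h2⟩ := exists_frame_bound hK (fun k j => (hW k j).mono hKΩ)
    fun y hy => hpos y (hKΩ hy)
  obtain ⟨C₃, hC₃, h3⟩ := exists_sesq_colVec_bound hK (fun k j => (hW k j).mono hKΩ)
    (R := C₂) (by linarith)
  set C := C₁ + C₂ + C₃ + c⁻¹ with hC
  have hci : 0 < c⁻¹ := by positivity
  refine ⟨ν, r, C, hrpos, by linarith, hK, hν1, fun y hy => ?_, fun y hy => ?_,
    fun y hy P hP i => ?_, fun y hy P hP i ζ => ?_⟩
  · have h4 : c < fderivWithin ℝ d Ω y ν := hsub ⟨by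
      have h5 : dist y q₀ ≤ r := hy.2
      have h6 : r ≤ r₁ / 2 := min_le_right _ _
      exact Metric.mem_ball.2 (by linarith), hy.1⟩
    have h5 : c⁻¹ ≤ C := by linarith
    calc (1 : ℝ) = c⁻¹ * c := by field_simp
      _ ≤ C * fderivWithin ℝ d Ω y ν := by gcongr
  · obtain ⟨h4, h5, h6⟩ := h1 y hy
    exact ⟨by linarith, by linarith, by linarith⟩
  · have := h2 y hy P hP i
    linarith
  · refine (h3 y hy _ ζ (h2 y hy P hP i)).trans ?_
    gcongr
    linarith

/-- Smallness of the defining function near a boundary point. -/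
theorem BoundaryRegion.exists_radius (hΩ : BoundaryRegion Ω d) (hq₀ : q₀ ∈ Ω) (hd : d q₀ = 0)
    (hr : 0 < r) {δ : ℝ} (hδ : 0 < δ) : ∃ s : ℝ, 0 < s ∧ ∀ q ∈ Metric.closedBall q₀ s,
      ∀ y ∈ Metric.closedBall q s, y ∈ Metric.closedBall q₀ r ∧ (y ∈ Ω → d y ≤ δ) := by
  have hev : ∀ᶠ y in 𝓝[Ω] q₀, d y < δ :=
    (hΩ.contDiffOn.continuousOn q₀ hq₀).eventually (gt_mem_nhds (by rw [hd]; exact hδ))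
  obtain ⟨r₁, hr₁, hsub⟩ := Metric.mem_nhdsWithin_iff.1 hev
  refine ⟨min (r / 2) (r₁ / 3), by positivity, fun q hq y hy => ?_⟩
  have h1 : dist y q₀ ≤ 2 * min (r / 2) (r₁ / 3) := by
    have h2 : dist q q₀ ≤ min (r / 2) (r₁ / 3) := hq
    have h3 : dist y q ≤ min (r / 2) (r₁ / 3) := hy
    linarith [dist_triangle y q q₀]
  have h2 : min (r / 2) (r₁ / 3) ≤ r / 2 := min_le_left _ _
  have h3 : min (r / 2) (r₁ / 3) ≤ r₁ / 3 := min_le_right _ _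
  exact ⟨Metric.mem_closedBall.2 (by linarith), fun hyΩ => le_of_lt (hsub ⟨Metric.mem_ball.2 (by linarith), hyΩ⟩)⟩

theorem isCompact_inter_closedBall_of_subset {q : Cn n} {s : ℝ}
    (h : IsCompact (Ω ∩ Metric.closedBall q₀ r)) (hsub : Metric.closedBall q s ⊆ Metric.closedBall q₀ r) :
    IsCompact (Ω ∩ Metric.closedBall q s) := by
  have : Ω ∩ Metric.closedBall q s = (Ω ∩ Metric.closedBall q₀ r) ∩ Metric.closedBall q s := by
    rw [inter_assoc, inter_eq_self_of_subset_right hsub]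
  rw [this]
  exact h.inter_right Metric.isClosed_closedBall

theorem mem_nhds_of_dist_lt {y q : Cn n} {s : ℝ} (h : Ω ∈ 𝓝 y) (hy : dist y q < s) :
    Ω ∩ Metric.closedBall q s ∈ 𝓝 y :=
  Filter.inter_mem h (Filter.mem_of_superset (Metric.isOpen_ball.mem_nhds hy) Metric.ball_subset_closedBall)

/-- Functions with Laplacian bounded below and nonpositive boundary values grow at most linearly from
the boundary. -/
theorem BoundaryRegion.exists_upper_barrier [NeZero n] (hΩ : BoundaryRegion Ω d)
    (hW : ∀ k j, ContinuousOn (fun z => W z k j) Ω) (hpos : ∀ y ∈ Ω, (W y).PosDef)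
    (hq₀ : q₀ ∈ Ω) (hd : d q₀ = 0) {r₁ : ℝ} (hr₁ : 0 < r₁) : ∃ r : ℝ, 0 < r ∧ ∀ C₁ : ℝ, 0 ≤ C₁ → ∃ C : ℝ, 0 < C ∧
      ∀ (w : Cn n → ℝ) (m : ℝ), ContDiffOn ℝ 2 w Ω → 0 ≤ m → (∀ y ∈ Ω, w y ≤ m) →
        (∀ y ∈ Ω, d y = 0 → w y ≤ 0) →
        (∀ y ∈ Ω ∩ Metric.closedBall q₀ r₁, 0 < d y → ∃ P : Matrix (Fin n) (Fin n) ℂ, Pᴴ * W y * P = 1 ∧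
          -C₁ ≤ Lop (fun _ => 1) (colVec P) (D2 w y)) →
        ∀ q ∈ Ω ∩ Metric.closedBall q₀ r, d q = 0 → ∀ y ∈ Ω ∩ Metric.closedBall q r,
          w y ≤ C * (m + 1) * (d y + ‖y - q‖ ^ 2) := by
  obtain ⟨ν, r₀, C₀, hr₀, hb⟩ := hΩ.exists_bounds hW hpos hq₀ hd
  have hn : 0 < n := Nat.pos_of_ne_zero (NeZero.ne n)
  obtain ⟨t, N, δ, ε₁, ht, hN, hδ, hε₁, hNδ, hbar⟩ := exists_barrier_constants (n := n) (ε := 1)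
    (N₀ := n + 1) hn hb.one_le one_pos (by positivity) {fun _ => 1}
    (by simp) (fun _ => ⟨1, one_pos, by simp⟩)
  obtain ⟨r, hr, hrad'⟩ := hΩ.exists_radius hq₀ hd (lt_min hr₀ hr₁) hδ
  have hrad : ∀ q ∈ Metric.closedBall q₀ r, ∀ y ∈ Metric.closedBall q r,
      y ∈ Metric.closedBall q₀ r₀ ∧ (y ∈ Ω → d y ≤ δ) := fun q hq y hy =>
    ⟨Metric.closedBall_subset_closedBall (min_le_left _ _) (hrad' q hq y hy).1, (hrad' q hq y hy).2⟩
  refine ⟨r, hr, fun C₁ hC₁ => ?_⟩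
  have hC₀ := hb.one_le
  refine ⟨(C₀ ^ 2 * n / r ^ 2 + C₁ + 1) * t + 1 / r ^ 2, by positivity, ?_⟩
  intro w m hw hm hwm hw0 hL q hq hdq
  -- `B |z - q|²` dominates `w` on the sphere, and `A` compensates its Laplacian
  set B := m / r ^ 2 with hB
  set A := B * C₀ ^ 2 * n + C₁ + 1 with hA
  have hB0 : 0 ≤ B := by positivity
  have hA0 : 0 < A := by positivity
  set K := Ω ∩ Metric.closedBall q r with hK
  have hKc : IsCompact K := isCompact_inter_closedBall_of_subset hb.isCompact
    fun y hy => (hrad q hq.2 y hy).1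
  have hKΩ : K ⊆ Ω := inter_subset_left
  have hΨ : ∀ y ∈ K, 0 ≤ A * (t * d y - N * (d y * d y)) + (B * distSq q y - w y) := by
    refine nonneg_of_barrier hKc ?_ fun y hy hneg => ?_
    · have h1 := hΩ.contDiffOn.continuousOn.mono hKΩ
      have h2 := hw.continuousOn.mono hKΩ
      have h3 := (contDiff_distSq q).continuous.continuousOn (s := K)
      exact (continuousOn_const.mul ((continuousOn_const.mul h1).sub
        (continuousOn_const.mul (h1.mul h1)))).add ((continuousOn_const.mul h3).sub h2)
    have hdδ := (hrad q hq.2 y hy.2).2 hy.1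
    have hd0 := hΩ.nonneg y hy.1
    have h1 : 0 ≤ t * d y - N * (d y * d y) := by
      have h0 : 0 ≤ (t - N * d y) * d y :=
        mul_nonneg (by linarith [mul_le_mul_of_nonneg_left hdδ hN.le]) hd0
      linarith
    have h1' := mul_nonneg hA0.le h1
    have hdist : 0 ≤ distSq q y := by rw [distSq_eq]; positivity
    -- negative values occur neither on the boundary nor on the sphere
    have hy1 : 0 < d y := by
      refine lt_of_le_of_ne hd0 fun h0 => ?_
      have := hw0 y hy.1 h0.symm
      have := mul_nonneg hB0 hdist
      linarith
    have hy2 : dist y q < r := by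
      refine lt_of_le_of_ne hy.2 fun h0 => ?_
      have h3 : B * distSq q y = m := by
        rw [distSq_eq, ← dist_eq_norm, h0, hB]; field_simp
      have := hwm y hy.1
      linarith
    have hΩy := hΩ.mem_nhds y hy.1 hy1
    have hdc : ContDiffAt ℝ 2 d y := (hΩ.contDiffOn.contDiffAt hΩy).of_le (by norm_cast)
    have hwc : ContDiffAt ℝ 2 w y := hw.contDiffAt hΩy
    have hqc : ContDiffAt ℝ 2 (distSq q) y := (contDiff_distSq q).contDiffAt.of_le (by norm_cast)
    have hyK := And.intro hy.1 (hrad q hq.2 y hy.2).1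
    obtain ⟨P, hP, hLw⟩ := hL y ⟨hy.1, Metric.closedBall_subset_closedBall (min_le_right _ _)
      (hrad' q hq.2 y hy.2).1⟩ hy1
    have hc1 : ContDiffAt ℝ 2 (fun z => t * d z - N * (d z * d z)) y :=
      (contDiffAt_const.mul hdc).sub (contDiffAt_const.mul (hdc.mul hdc))
    have hc2 : ContDiffAt ℝ 2 (fun z => B * distSq q z - w z) y := (contDiffAt_const.mul hqc).sub hwc
    refine ⟨mem_nhds_of_dist_lt hΩy hy2, (contDiffAt_const.mul hc1).add hc2, fun _ => 1, colVec P,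
      by simp, ?_⟩
    have h2 := hbar (fun _ => 1) rfl (W y) P d y ν hP (hb.frame_le y hyK P hP) (hb.metric_le y hyK P hP)
      (hb.ν_le.trans hb.one_le) hdc (by rw [← D2w_eq hΩy]; exact (hb.d_le y hyK).2.1)
      (by rw [← fderivWithin_of_mem_nhds hΩy]; exact hb.ν_pos y hyK) hd0 hdδ
    simp only [Finset.sum_const, Finset.card_univ, Fintype.card_fin, nsmul_eq_mul, mul_one] at h2
    have h3 : Lop (fun _ => 1) (colVec P) (D2 (fun z => t * d z - N * (d z * d z)) y) ≤ -1 := by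
      have : 0 ≤ ε₁ * (1 + (n : ℝ)) := by positivity
      linarith
    have h4 : Lop (fun _ => 1) (colVec P) (D2 (distSq q) y) ≤ C₀ ^ 2 * n := by
      rw [Lop_distSq]
      calc ∑ i, 1 * ‖colVec P i‖ ^ 2 ≤ ∑ _i : Fin n, C₀ ^ 2 :=
            Finset.sum_le_sum fun i _ => by
              rw [one_mul]; exact pow_le_pow_left₀ (norm_nonneg _) (hb.frame_le y hyK P hP i) 2
        _ = C₀ ^ 2 * n := by simp [mul_comm]
    rw [D2_add (contDiffAt_const.mul hc1) hc2, Lop_add, D2_const_mul hc1, Lop_smul,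
      D2_sub (contDiffAt_const.mul hqc) hwc, Lop_sub, D2_const_mul hqc, Lop_smul]
    have h5 := mul_le_mul_of_nonneg_left h3 hA0.le
    have h6 := mul_le_mul_of_nonneg_left h4 hB0
    have h7 : A = B * (C₀ ^ 2 * n) + C₁ + 1 := by rw [hA]; ring
    linarith
  intro y hy
  have h1 := hΨ y hy
  rw [distSq_eq] at h1
  have hd0 := hΩ.nonneg y hy.1
  have h2 : 0 ≤ A * (N * (d y * d y)) := by positivity
  have h3 : w y ≤ A * t * d y + B * ‖y - q‖ ^ 2 := by linarith
  refine h3.trans ?_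
  have hX : 0 ≤ ‖y - q‖ ^ 2 := by positivity
  have h4 : B ≤ ((C₀ ^ 2 * n / r ^ 2 + C₁ + 1) * t + 1 / r ^ 2) * (m + 1) := by
    have : 0 ≤ (C₀ ^ 2 * n / r ^ 2 + C₁ + 1) * t * (m + 1) + 1 / r ^ 2 := by positivity
    have h5 : B = 1 / r ^ 2 * m := by rw [hB]; ring
    linarith
  have h5 : A * t ≤ ((C₀ ^ 2 * n / r ^ 2 + C₁ + 1) * t + 1 / r ^ 2) * (m + 1) := by
    have h6 : A ≤ (C₀ ^ 2 * n / r ^ 2 + C₁ + 1) * (m + 1) := by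
      have h7 : A = C₀ ^ 2 * n / r ^ 2 * m + C₁ + 1 := by rw [hA, hB]; ring
      have : 0 ≤ C₀ ^ 2 * n / r ^ 2 + C₁ * m + m := by positivity
      linarith
    have h7 : A * t ≤ (C₀ ^ 2 * n / r ^ 2 + C₁ + 1) * (m + 1) * t := by gcongr
    have h8 : 0 ≤ 1 / r ^ 2 * (m + 1) := by positivity
    linarith
  rw [mul_add]
  exact add_le_add (mul_le_mul_of_nonneg_right h5 hd0) (mul_le_mul_of_nonneg_right h4 hX)

end Boundary

/-! ### The equation in a coordinate region -/

section RegionEquation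

variable {n p : ℕ}

open Matrix
open scoped ComplexOrder

/-- If all sums of `p` eigenvalues are positive, so are the sums of more than `p`: a positive
multiple of such a sum is the total of the sums with one term fewer. -/
theorem sum_pos_of_cone {l : Fin n → ℝ} (hp : 1 ≤ p)
    (hl : ∀ I ∈ Finset.powersetCard p Finset.univ, 0 < ∑ k ∈ I, l k) {J : Finset (Fin n)}
    (hJ : p ≤ J.card) : 0 < ∑ k ∈ J, l k := by
  induction h : J.card - p generalizing J with
  | zero => exact hl J (Finset.mem_powersetCard.2 ⟨Finset.subset_univ _, by omega⟩)
  | succ m ih =>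
    have hpos : 0 < ∑ i ∈ J, ∑ k ∈ J.erase i, l k := by
      refine Finset.sum_pos (fun i hi => ?_) (Finset.card_pos.1 (by omega))
      have hc := Finset.card_erase_of_mem hi
      exact ih (by omega) (by omega)
    have h1 : ∑ i ∈ J, ∑ k ∈ J.erase i, l k = (J.card - 1 : ℝ) * ∑ k ∈ J, l k := by
      rw [sub_mul, one_mul]
      conv_rhs => rw [← nsmul_eq_mul, ← Finset.sum_const, ← Finset.sum_sub_distrib]
      exact Finset.sum_congr rfl fun i hi => by rw [← Finset.add_sum_erase J l hi]; ring
    rw [h1] at hpos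
    have h2 : (1 : ℝ) < J.card := by exact_mod_cast (by omega : 1 < J.card)
    exact (pos_iff_pos_of_mul_pos hpos).1 (by linarith)

/-- A frame that is orthonormal for `W` and diagonalizes `H`, with the eigenvalues of `W⁻¹ H`. -/
structure IsEigenframe (p : ℕ) (W H P : Matrix (Fin n) (Fin n) ℂ) (l : Fin n → ℝ) : Prop where
  orth : Pᴴ * W * P = 1
  diag : Pᴴ * H * P = diagonal fun i => (l i : ℂ)
  pos : ∀ I ∈ Finset.powersetCard p Finset.univ, 0 < ∑ k ∈ I, l k

theorem exists_isEigenframe {W H : Matrix (Fin n) (Fin n) ℂ} (hW : W.PosDef) (hH : H.IsHermitian)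
    (hc : InCone p (realEigenvalues (W⁻¹ * H))) : ∃ P l, IsEigenframe p W H P l := by
  obtain ⟨P, l, h1, h2⟩ := exists_simultaneous_diagonalization hW hH
  rw [realEigenvalues_of_diagonalization h1 h2, inCone_map_univ] at hc
  exact ⟨P, l, h1, h2, hc⟩

variable {W H G P : Matrix (Fin n) (Fin n) ℂ} {l : Fin n → ℝ}

theorem IsEigenframe.sumProduct_eq (h : IsEigenframe p W H P l) :
    sumProduct p (realEigenvalues (W⁻¹ * H)) = ∏ I ∈ Finset.powersetCard p Finset.univ, ∑ k ∈ I, l k := by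
  rw [realEigenvalues_of_diagonalization h.orth h.diag, sumProduct_map_univ]

theorem sumProd_roots_eq (hW : W.PosDef) (hH : H.IsHermitian) :
    sumProd p ((W⁻¹ * H).charpoly.roots) = (sumProduct p (realEigenvalues (W⁻¹ * H)) : ℂ) := by
  obtain ⟨P, l, h1, h2⟩ := exists_simultaneous_diagonalization hW hH
  rw [realEigenvalues_of_diagonalization h1 h2, sumProduct_map_univ, charpoly_inv_mul h1, h2,
    roots_charpoly_diagonal, sumProd_map_univ]
  push_cast
  rfl

theorem IsEigenframe.sesq_eq (h : IsEigenframe p W H P l) (i : Fin n) (ζ : Cn n) :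
    sesq H (colVec P i) ζ = l i * sesq W (colVec P i) ζ := by
  have h1 : P * (Pᴴ * W) = 1 := mul_eq_one_comm.1 h.orth
  have h2 : Pᴴ * H = diagonal (fun i => (l i : ℂ)) * (Pᴴ * W) := by
    rw [← h.diag, Matrix.mul_assoc, h1, Matrix.mul_one]
  have h3 : ∀ A : Matrix (Fin n) (Fin n) ℂ, sesq A (colVec P i) ζ = ∑ k, (Pᴴ * A) i k * ζ k := by
    intro A
    simp only [sesq, colVec, mul_apply, conjTranspose_apply, Finset.sum_mul]
    rw [Finset.sum_comm]
    rfl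
  rw [h3, h3, h2, Finset.mul_sum]
  simp only [diagonal_mul, mul_assoc]

theorem IsEigenframe.sesq_self (h : IsEigenframe p W H P l) (i : Fin n) :
    (sesq H (colVec P i) (colVec P i)).re = l i := by
  rw [← conjTranspose_mul_mul_apply, h.diag]
  simp

theorem IsEigenframe.Lop_eq (h : IsEigenframe p W H P l) (F : Fin n → ℝ)
    {B : Cn n →L[ℝ] Cn n →L[ℝ] ℝ} (hB : matForm B = H - G) :
    Lop F (colVec P) B = ∑ i, F i * l i - ∑ i, F i * (sesq G (colVec P i) (colVec P i)).re := by
  rw [Lop_eq_sum_sesq, hB, ← Finset.sum_sub_distrib]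
  refine Finset.sum_congr rfl fun i _ => ?_
  rw [sesq_sub, Complex.sub_re, h.sesq_self]
  ring

/-- The linearized operator applied to the difference of a solution and a function whose form `G` has
`p`-traces at least `ε`. -/
theorem IsEigenframe.Lop_le (h : IsEigenframe p W H P l) (hp : 1 ≤ p) {ε : ℝ}
    {B : Cn n →L[ℝ] Cn n →L[ℝ] ℝ} (hB : matForm B = H - G)
    (hG : ∀ I ∈ Finset.powersetCard p Finset.univ,
      ε ≤ ∑ i ∈ I, (sesq G (colVec P i) (colVec P i)).re) :
    Lop (wt p l) (colVec P) B ≤ n.choose p - ε / p * ∑ i, wt p l i := by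
  rw [h.Lop_eq _ hB, sum_wt_mul_self h.pos, sum_wt_mul, sum_wt]
  have hp' : (0 : ℝ) < p := by exact_mod_cast hp
  have : ε / p * (p * ∑ I ∈ Finset.powersetCard p Finset.univ, (∑ k ∈ I, l k)⁻¹)
      ≤ ∑ I ∈ Finset.powersetCard p Finset.univ,
        (∑ k ∈ I, (sesq G (colVec P k) (colVec P k)).re) / ∑ k ∈ I, l k := by
    rw [← mul_assoc, div_mul_cancel₀ _ hp'.ne', Finset.mul_sum]
    refine Finset.sum_le_sum fun I hI => ?_
    rw [div_eq_mul_inv]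
    exact mul_le_mul_of_nonneg_right (hG I hI) (inv_nonneg.2 (h.pos I hI).le)
  linarith

/-- Concavity of the equation, in the form of the arithmetic-geometric mean inequality: a solution
minus a subsolution is a supersolution of the linearized operator. -/
theorem IsEigenframe.Lop_nonpos (h : IsEigenframe p W H P l) (hG : G.IsHermitian)
    (hcone : InCone p (realEigenvalues (W⁻¹ * G)))
    (hle : sumProduct p (realEigenvalues (W⁻¹ * H)) ≤ sumProduct p (realEigenvalues (W⁻¹ * G)))
    {B : Cn n →L[ℝ] Cn n →L[ℝ] ℝ} (hB : matForm B = H - G) :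
    Lop (wt p l) (colVec P) B ≤ 0 := by
  rw [h.Lop_eq _ hB, sum_wt_mul_self h.pos, sum_wt_mul, sub_nonpos]
  have h0 := charpoly_inv_mul (H := G) h.orth
  have h1 := diag_of_inCone (p := p) (isHermitian_conjTranspose_mul_mul P hG)
    (by rw [← realEigenvalues_congr h0]; exact hcone)
  rw [← realEigenvalues_congr h0] at h1
  simp only [conjTranspose_mul_mul_apply] at h1
  have h2 := card_le_sum_div (Finset.powersetCard p (Finset.univ : Finset (Fin n)))
    (fun I => ∑ k ∈ I, (sesq G (colVec P k) (colVec P k)).re) (fun I => ∑ k ∈ I, l k) h1.1 h.pos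
    (by rw [← h.sumProduct_eq]; exact hle.trans h1.2)
  simpa using h2

/-- The matrix `X + i∂∂̄f` in coordinates. -/
def gForm (Ω : Set (Cn n)) (X : Cn n → Matrix (Fin n) (Fin n) ℂ) (f : Cn n → ℝ) (y : Cn n) :
    Matrix (Fin n) (Fin n) ℂ := X y + matForm (D2w Ω f y)

/-- The data of the Dirichlet problem in a coordinate region: the metric `W`, the background form
`X` and the admissible function `v`. -/
structure RegionData (p : ℕ) (Ω : Set (Cn n)) (d : Cn n → ℝ) (W X : Cn n → Matrix (Fin n) (Fin n) ℂ)
    (v : Cn n → ℝ) : Prop extends BoundaryRegion Ω d where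
  contDiffOn_W : ∀ k j, ContDiffOn ℝ ∞ (fun z => W z k j) Ω
  posDef : ∀ y ∈ Ω, (W y).PosDef
  contDiffOn_X : ∀ k j, ContDiffOn ℝ ∞ (fun z => X z k j) Ω
  isHermitian : ∀ y ∈ Ω, (X y).IsHermitian
  contDiffOn_v : ContDiffOn ℝ ∞ v Ω
  cone : ∀ y ∈ Ω, InCone p (realEigenvalues ((W y)⁻¹ * gForm Ω X v y))

/-- A solution `u` of the Dirichlet problem in a coordinate region, with gradient bounded by `κ` and
all other relevant quantities bounded by `c`. -/
structure LocalSolution (p : ℕ) (Ω : Set (Cn n)) (d : Cn n → ℝ) (W X : Cn n → Matrix (Fin n) (Fin n) ℂ)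
    (v : Cn n → ℝ) (c κ : ℝ) (u ψ : Cn n → ℝ) : Prop where
  contDiffOn : ContDiffOn ℝ 4 u Ω
  cone : ∀ y ∈ Ω, InCone p (realEigenvalues ((W y)⁻¹ * gForm Ω X u y))
  equation : ∀ y ∈ Ω, sumProduct p (realEigenvalues ((W y)⁻¹ * gForm Ω X u y)) = ψ y
  differentiableOn : DifferentiableOn ℝ ψ Ω
  pos : ∀ y ∈ Ω, 0 < ψ y
  inv_le : ∀ y ∈ Ω, (ψ y)⁻¹ ≤ c
  le_c : ∀ y ∈ Ω, ψ y ≤ c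
  deriv_le : ∀ y ∈ Ω, ‖fderivWithin ℝ ψ Ω y‖ ≤ c
  one_le : 1 ≤ κ
  grad_le : ∀ y ∈ Ω, ‖fderivWithin ℝ u Ω y‖ ≤ κ
  le : ∀ y ∈ Ω, v y ≤ u y
  eq_of_boundary : ∀ y ∈ Ω, d y = 0 → u y = v y
  le_add : ∀ y ∈ Ω, u y ≤ v y + c

/-- Bounds for the data in a ball. -/
structure DataBounds (p : ℕ) (Ω : Set (Cn n)) (d : Cn n → ℝ) (W X : Cn n → Matrix (Fin n) (Fin n) ℂ)
    (v : Cn n → ℝ) (q₀ : Cn n) (r C : ℝ) (ν : Cn n) : Prop extends RegionBounds Ω d W q₀ r C ν where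
  v_le : ∀ y ∈ Ω ∩ Metric.closedBall q₀ r, ‖fderivWithin ℝ v Ω y‖ ≤ C ∧ ‖D2w Ω v y‖ ≤ C ∧
    ‖fderivWithin ℝ (D2w Ω v) Ω y‖ ≤ C
  G_le : ∀ y ∈ Ω ∩ Metric.closedBall q₀ r, ∀ P : Matrix (Fin n) (Fin n) ℂ, Pᴴ * W y * P = 1 →
    ∀ i ζ, ‖sesq (gForm Ω X v y) (colVec P i) ζ‖ ≤ C * ‖ζ‖
  W'_le : ∀ y ∈ Ω ∩ Metric.closedBall q₀ r, ∀ k j, ‖fderivWithin ℝ (fun z => W z k j) Ω y‖ ≤ C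
  X'_le : ∀ y ∈ Ω ∩ Metric.closedBall q₀ r, ∀ k j, ‖fderivWithin ℝ (fun z => X z k j) Ω y‖ ≤ C
  sq_le : (n : ℝ) ^ 2 ≤ C
  choose_le : (n.choose p : ℝ) ≤ C

variable {Ω : Set (Cn n)} {d : Cn n → ℝ} {W X : Cn n → Matrix (Fin n) (Fin n) ℂ} {v : Cn n → ℝ}
  {q₀ ν : Cn n} {r C : ℝ}

/-- Every point of a region is in the closure of its interior. -/
theorem BoundaryRegion.subset_closure_interior (h : BoundaryRegion Ω d) : Ω ⊆ closure (interior Ω) := by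
  intro q hq
  by_contra hcl
  have hev : ∀ᶠ y in 𝓝[Ω] q, d y = 0 := by
    have h1 : (closure (interior Ω))ᶜ ∈ 𝓝 q := isClosed_closure.isOpen_compl.mem_nhds hcl
    filter_upwards [mem_nhdsWithin_of_mem_nhds h1, self_mem_nhdsWithin] with y hy hyΩ
    by_contra h0
    exact hy (subset_closure (mem_interior_iff_mem_nhds.2
      (h.mem_nhds y hyΩ (lt_of_le_of_ne (h.nonneg y hyΩ) (Ne.symm h0)))))
  have hq0 : d q = 0 := hev.self_of_nhdsWithin hq
  obtain ⟨ν, hν⟩ := h.exists_deriv_pos q hq hq0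
  have h2 : fderivWithin ℝ d Ω q = fderivWithin ℝ (fun _ => (0 : ℝ)) Ω q :=
    Filter.EventuallyEq.fderivWithin_eq hev hq0
  rw [h2] at hν
  simp at hν

theorem BoundaryRegion.D2w_symm (h : BoundaryRegion Ω d) {f : Cn n → ℝ} (hf : ContDiffOn ℝ 2 f Ω)
    {y : Cn n} (hy : y ∈ Ω) (a b : Cn n) : D2w Ω f y a b = D2w Ω f y b a :=
  ((hf y hy).isSymmSndFDerivWithinAt (by simp) h.uniqueDiffOn
    (h.subset_closure_interior hy) hy).eq a b

theorem D2w_sub (hΩ : UniqueDiffOn ℝ Ω) {f g : Cn n → ℝ} (hf : ContDiffOn ℝ 2 f Ω)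
    (hg : ContDiffOn ℝ 2 g Ω) {y : Cn n} (hy : y ∈ Ω) :
    D2w Ω (fun z => f z - g z) y = D2w Ω f y - D2w Ω g y := by
  have h1 : ∀ z ∈ Ω, fderivWithin ℝ (fun z => f z - g z) Ω z
      = fderivWithin ℝ f Ω z - fderivWithin ℝ g Ω z := fun z hz =>
    fderivWithin_fun_sub (hΩ z hz) (hf.differentiableOn (by norm_num) z hz)
      (hg.differentiableOn (by norm_num) z hz)
  rw [D2w, fderivWithin_congr h1 (h1 y hy)]
  exact fderivWithin_fun_sub (hΩ y hy)
    ((hf.fderivWithin hΩ (m := 1) (by norm_num)).differentiableOn (by norm_num) y hy)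
    ((hg.fderivWithin hΩ (m := 1) (by norm_num)).differentiableOn (by norm_num) y hy)

theorem BoundaryRegion.gForm_isHermitian (h : BoundaryRegion Ω d) {y : Cn n} (hy : y ∈ Ω)
    (hX : (X y).IsHermitian) {f : Cn n → ℝ} (hf : ContDiffOn ℝ 2 f Ω) : (gForm Ω X f y).IsHermitian :=
  hX.add (matForm_isHermitian (h.D2w_symm hf hy))

theorem continuousOn_gForm (hΩ : UniqueDiffOn ℝ Ω) (hX : ∀ k j, ContinuousOn (fun z => X z k j) Ω)
    {f : Cn n → ℝ} (hf : ContDiffOn ℝ 2 f Ω) (k j : Fin n) :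
    ContinuousOn (fun z => gForm Ω X f z k j) Ω := by
  have h1 : ContinuousOn (D2w Ω f) Ω := (contDiffOn_D2w hΩ hf (k := 0) (by norm_num)).continuousOn
  have h2 : ∀ a b, ContinuousOn (fun z => D2w Ω f z a b) Ω := fun a b =>
    (h1.clm_apply continuousOn_const).clm_apply continuousOn_const
  simp only [gForm, Matrix.add_apply, matForm, of_apply]
  refine (hX k j).add (continuousOn_const.mul (ContinuousOn.add ?_ (continuousOn_const.mul ?_)))
  · exact Complex.continuous_ofReal.comp_continuousOn ((h2 _ _).add (h2 _ _))
  · exact Complex.continuous_ofReal.comp_continuousOn ((h2 _ _).sub (h2 _ _))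

theorem exists_entries_deriv_bound (hΩ : UniqueDiffOn ℝ Ω) {A : Cn n → Matrix (Fin n) (Fin n) ℂ}
    (hA : ∀ k j, ContDiffOn ℝ ∞ (fun z => A z k j) Ω) {K : Set (Cn n)} (hK : IsCompact K)
    (hKΩ : K ⊆ Ω) :
    ∃ C : ℝ, 1 ≤ C ∧ ∀ y ∈ K, ∀ k j, ‖fderivWithin ℝ (fun z => A z k j) Ω y‖ ≤ C := by
  obtain ⟨C, hC1, hC⟩ := exists_norm_le_of_continuousOn hK
    (f := fun z (kj : Fin n × Fin n) => fderivWithin ℝ (fun z => A z kj.1 kj.2) Ω z)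
    (continuousOn_pi.2 fun kj => (((hA kj.1 kj.2).fderivWithin hΩ (m := ∞) (by simp)).continuousOn).mono hKΩ)
  exact ⟨C, hC1, fun y hy k j => (norm_le_pi_norm
    (fun kj : Fin n × Fin n => fderivWithin ℝ (fun z => A z kj.1 kj.2) Ω y) (k, j)).trans (hC y hy)⟩

theorem RegionData.exists_bounds (h : RegionData p Ω d W X v) (hq₀ : q₀ ∈ Ω) (hd : d q₀ = 0) (c : ℝ) :
    ∃ (ν : Cn n) (r C : ℝ), 0 < r ∧ DataBounds p Ω d W X v q₀ r C ν ∧ c ≤ C := by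
  obtain ⟨ν, r, C₁, hr, hb⟩ := h.toBoundaryRegion.exists_bounds
    (fun k j => (h.contDiffOn_W k j).continuousOn) h.posDef hq₀ hd
  have hK := hb.isCompact
  have hKΩ : Ω ∩ Metric.closedBall q₀ r ⊆ Ω := inter_subset_left
  obtain ⟨C₂, hC₂, h2⟩ := exists_deriv_bound h.uniqueDiffOn h.contDiffOn_v hK hKΩ
  obtain ⟨C₃, hC₃, h3⟩ := exists_sesq_colVec_bound hK (A := gForm Ω X v) (fun k j =>
    (continuousOn_gForm h.uniqueDiffOn (fun k j => (h.contDiffOn_X k j).continuousOn)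
      (h.contDiffOn_v.of_le (by norm_cast)) k j).mono hKΩ) (R := C₁) (by linarith [hb.one_le])
  obtain ⟨C₄, hC₄, h4⟩ := exists_entries_deriv_bound h.uniqueDiffOn h.contDiffOn_W hK hKΩ
  obtain ⟨C₅, hC₅, h5⟩ := exists_entries_deriv_bound h.uniqueDiffOn h.contDiffOn_X hK hKΩ
  set C := C₁ + C₂ + C₃ + C₄ + C₅ + (n : ℝ) ^ 2 + n.choose p + |c| with hC
  have hC₁ := hb.one_le
  have hn : 0 ≤ (n : ℝ) ^ 2 := by positivity
  have hch : 0 ≤ (n.choose p : ℝ) := by positivity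
  have hc := abs_nonneg c
  refine ⟨ν, r, C, hr, ⟨hb.mono (by linarith), fun y hy => ?_, fun y hy P hP i ζ => ?_,
    fun y hy k j => ?_, fun y hy k j => ?_, by linarith, by linarith⟩, by linarith [le_abs_self c]⟩
  · obtain ⟨ha, hb, hc⟩ := h2 y hy
    exact ⟨by linarith, by linarith, by linarith⟩
  · refine (h3 y hy _ ζ (hb.frame_le y hy P hP i)).trans ?_
    gcongr
    linarith
  · linarith [h4 y hy k j]
  · linarith [h5 y hy k j]

end RegionEquation

/-! ### Tangential derivatives of a solution -/

section HessianBound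

variable {n p : ℕ}

open Matrix
open scoped ComplexOrder

theorem abs_Lop_D2_fderiv_le {F : Fin n → ℝ} {e : Fin n → Cn n} (hF : ∀ i, 0 ≤ F i) {f : Cn n → ℝ}
    {y : Cn n} (hf : ContDiffAt ℝ 3 f y) {C : ℝ} (he : ∀ i, ‖e i‖ ≤ C) (h3 : ‖fderiv ℝ (D2 f) y‖ ≤ C)
    {ξ : Cn n} (hξ : ‖ξ‖ ≤ 1) :
    |Lop F e (D2 (fun z => fderiv ℝ f z ξ) y)| ≤ C ^ 3 * ∑ i, F i := by
  have h1 : D2 (fun z => fderiv ℝ f z ξ) y = fderiv ℝ (D2 f) y ξ := by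
    ext a b; rw [fderiv_D2_apply hf]
  have h2 : ‖fderiv ℝ (D2 f) y ξ‖ ≤ C := by
    refine (ContinuousLinearMap.le_opNorm _ _).trans ?_
    nlinarith [norm_nonneg (fderiv ℝ (D2 f) y)]
  rw [h1]
  exact (abs_Lop_le hF he h2).trans (le_of_eq (by ring))

theorem abs_sum_mul_sesq_le {F : Fin n → ℝ} {e : Fin n → Cn n} {C : ℝ} (hC : 0 ≤ C)
    (hn : (n : ℝ) ^ 2 ≤ C) (he : ∀ i, ‖e i‖ ≤ C) {A : Matrix (Fin n) (Fin n) ℂ}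
    (hA : ∀ k j, ‖A k j‖ ≤ C) : |∑ i, F i * (sesq A (e i) (e i)).re| ≤ C ^ 4 * ∑ i, |F i| := by
  refine (Finset.abs_sum_le_sum_abs _ _).trans ?_
  rw [Finset.mul_sum]
  refine Finset.sum_le_sum fun i _ => ?_
  rw [abs_mul, mul_comm]
  refine mul_le_mul_of_nonneg_right ?_ (abs_nonneg _)
  refine ((Complex.abs_re_le_norm _).trans (norm_sesq_le hA _ _)).trans ?_
  calc n ^ 2 * C * ‖e i‖ * ‖e i‖ ≤ C * C * C * C := by gcongr <;> exact he i
    _ = C ^ 4 := by ring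

variable {Ω : Set (Cn n)} {d : Cn n → ℝ} {W X : Cn n → Matrix (Fin n) (Fin n) ℂ} {v : Cn n → ℝ}
  {q₀ ν : Cn n} {r C c κ : ℝ} {u ψ : Cn n → ℝ}

/-- At interior points the difference `w = u - v` of a solution and the subsolution satisfies the
hypotheses of the tangential estimate. -/
theorem LocalSolution.tangentialBounds (hu : LocalSolution p Ω d W X v c κ u ψ)
    (h : RegionData p Ω d W X v) (hb : DataBounds p Ω d W X v q₀ r C ν) (hc : c ≤ C) {y : Cn n}
    (hy : y ∈ Ω ∩ Metric.closedBall q₀ r) (hdy : 0 < d y) {P : Matrix (Fin n) (Fin n) ℂ}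
    {l : Fin n → ℝ} (hP : IsEigenframe p (W y) (gForm Ω X u y) P l) :
    TangentialBounds (4 * C ^ 4) κ (wt p l) l (colVec P) (W y) (gForm Ω X v y) d (fun z => u z - v z) y ν := by
  have hΩy := h.mem_nhds y hy.1 hdy
  have hC := hb.one_le
  have hC0 : 0 < C := by linarith
  have hu4 : ContDiffAt ℝ 4 u y := hu.contDiffOn.contDiffAt hΩy
  have hu3 : ContDiffAt ℝ 3 u y := hu4.of_le (by norm_num)
  have hv3 : ContDiffAt ℝ 3 v y := (h.contDiffOn_v.contDiffAt hΩy).of_le (by norm_cast)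
  have hd3 : ContDiffAt ℝ 3 d y := (h.contDiffOn.contDiffAt hΩy).of_le (by norm_cast)
  have hF := wt_nonneg hP.pos
  set F := wt p l with hFdef
  have h𝓕 : 0 ≤ ∑ i, F i := Finset.sum_nonneg fun i _ => hF i
  have hFl : 0 ≤ ∑ i, F i * |l i| := Finset.sum_nonneg fun i _ => mul_nonneg (hF i) (abs_nonneg _)
  have hsub := D2w_sub h.uniqueDiffOn (hu.contDiffOn.of_le (by norm_num))
    (h.contDiffOn_v.of_le (by norm_cast)) hy.1
  have hmat : matForm (D2 (fun z => u z - v z) y) = gForm Ω X u y - gForm Ω X v y := by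
    rw [← D2w_eq hΩy, hsub, matForm_sub, gForm, gForm]
    abel
  have hpow1 : C ≤ C ^ 4 := le_self_pow₀ hC (by norm_num)
  have hpow2 : C ^ 2 ≤ C ^ 4 := pow_le_pow_right₀ hC (by norm_num)
  have hpow3 : C ^ 3 ≤ C ^ 4 := pow_le_pow_right₀ hC (by norm_num)
  have hCC : C ≤ 4 * C ^ 4 := by linarith
  have hψy := hu.pos y hy.1
  refine ⟨⟨by linarith, hF, fun i => (hb.frame_le y hy P hP.orth i).trans hCC, fun i j => ?_,
    fun i ζ => ?_, fun i ζ => (hb.metric_le y hy P hP.orth i ζ).trans (by gcongr),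
    fun i ζ => (hb.G_le y hy P hP.orth i ζ).trans (by gcongr), ?_, (hb.ν_le.trans hC).trans hCC, ?_, ?_⟩,
    hd3, hu3.sub hv3, hu.one_le, hb.ν_le, ?_, fun ξ hξ => ?_, ?_, fun ξ hξ => ?_⟩
  · rw [← conjTranspose_mul_mul_apply, hP.orth, one_apply]
  · rw [hmat, sesq_sub, hP.sesq_eq]
  · rw [← fderivWithin_of_mem_nhds hΩy]
    exact (hb.d_le y hy).1.trans hCC
  · rw [← fderivWithin_of_mem_nhds hΩy]
    refine ((hb.mono hCC).ν_pos y hy)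
  · rw [sum_wt_mul_self hP.pos, abs_of_nonneg (by positivity)]
    exact hb.choose_le.trans hCC
  · rw [← D2w_eq hΩy]
    exact (hb.d_le y hy).2.1.trans hCC
  · refine (abs_Lop_D2_fderiv_le hF hd3 (hb.frame_le y hy P hP.orth) ?_ hξ).trans ?_
    · rw [← fderivWithin_D2w_eq hΩy]
      exact (hb.d_le y hy).2.2
    · gcongr
      linarith
  · rw [fderiv_fun_sub (hu3.differentiableAt (by norm_num)) (hv3.differentiableAt (by norm_num)),
      ← fderivWithin_of_mem_nhds hΩy, ← fderivWithin_of_mem_nhds hΩy]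
    refine (norm_sub_le _ _).trans ?_
    have h1 := hu.grad_le y hy.1
    have h2 := (hb.v_le y hy).1
    have h3 := hu.one_le
    nlinarith
  · have hev : (fun z => fderiv ℝ (fun z => u z - v z) z ξ)
        =ᶠ[𝓝 y] fun z => fderiv ℝ u z ξ - fderiv ℝ v z ξ := by
      filter_upwards [eventually_differentiableAt (hu3.of_le (by norm_num)),
        eventually_differentiableAt (hv3.of_le (by norm_num))] with z h1 h2
      rw [fderiv_fun_sub h1 h2, _root_.sub_apply]
    rw [D2_congr hev, D2_sub (hu3.fderiv_apply (by norm_num) ξ) (hv3.fderiv_apply (by norm_num) ξ),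
      Lop_sub]
    have hv' : |Lop F (colVec P) (D2 (fun z => fderiv ℝ v z ξ) y)| ≤ C ^ 3 * ∑ i, F i :=
      abs_Lop_D2_fderiv_le hF hv3 (hb.frame_le y hy P hP.orth)
        (by rw [← fderivWithin_D2w_eq hΩy]; exact (hb.v_le y hy).2.2) hξ
    have hent : ∀ {A : Cn n → Matrix (Fin n) (Fin n) ℂ}, (∀ k j, ContDiffOn ℝ ∞ (fun z => A z k j) Ω) →
        ∀ k j, HasFDerivAt (fun z => A z k j) (fderivWithin ℝ (fun z => A z k j) Ω y) y := by
      intro A hA k j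
      rw [fderivWithin_of_mem_nhds hΩy]
      exact (((hA k j).contDiffAt hΩy).differentiableAt (by simp)).hasFDerivAt
    have heq : ∀ᶠ z in 𝓝 y, sumProd p (((W z)⁻¹ * (X z + matForm (D2 u z))).charpoly.roots) = (ψ z : ℂ) := by
      filter_upwards [eventually_mem_nhds_iff.2 hΩy] with z hz
      have hzΩ := mem_of_mem_nhds hz
      have h1 := hu.equation z hzΩ
      have h2 := sumProd_roots_eq (p := p) (h.posDef z hzΩ)
        (h.gForm_isHermitian hzΩ (h.isHermitian z hzΩ) (hu.contDiffOn.of_le (by norm_num)))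
      rw [h1, gForm, D2w_eq hz] at h2
      exact h2
    have hdiag := hP.diag
    rw [gForm, D2w_eq hΩy] at hdiag
    rw [Lop_fderiv_of_equation hu3 (hent h.contDiffOn_W) (hent h.contDiffOn_X)
      ((hu.differentiableOn y hy.1).differentiableAt hΩy) hψy heq hP.orth hdiag hP.pos ξ]
    have hξent : ∀ {A : Cn n → Matrix (Fin n) (Fin n) ℂ},
        (∀ k j, ‖fderivWithin ℝ (fun z => A z k j) Ω y‖ ≤ C) →
        ∀ k j, ‖(of fun k j => fderivWithin ℝ (fun z => A z k j) Ω y ξ : Matrix (Fin n) (Fin n) ℂ) k j‖ ≤ C := by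
      intro A hA k j
      refine (ContinuousLinearMap.le_opNorm _ _).trans ?_
      have h1 := hA k j
      have h2 := norm_nonneg (fderivWithin ℝ (fun z => A z k j) Ω y)
      nlinarith
    have hX := abs_sum_mul_sesq_le (F := F) hC0.le hb.sq_le (hb.frame_le y hy P hP.orth)
      (hξent (A := X) (hb.X'_le y hy))
    have hW := abs_sum_mul_sesq_le (F := fun i => F i * l i) hC0.le hb.sq_le
      (hb.frame_le y hy P hP.orth) (hξent (A := W) (hb.W'_le y hy))
    have hF1 : ∑ i, |F i| = ∑ i, F i := Finset.sum_congr rfl fun i _ => abs_of_nonneg (hF i)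
    have hF2 : ∑ i, |F i * l i| = ∑ i, F i * |l i| := Finset.sum_congr rfl fun i _ => by
      rw [abs_mul, abs_of_nonneg (hF i)]
    rw [hF1] at hX
    rw [hF2] at hW
    have hψ1 : |fderiv ℝ ψ y ξ / ψ y| ≤ C ^ 2 := by
      rw [abs_div, abs_of_pos hψy, div_eq_mul_inv, ← fderivWithin_of_mem_nhds hΩy, sq]
      refine mul_le_mul ?_ ((hu.inv_le y hy.1).trans hc) (inv_nonneg.2 hψy.le) hC0.le
      rw [← Real.norm_eq_abs]
      refine (ContinuousLinearMap.le_opNorm _ _).trans ?_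
      have h1 := hu.deriv_le y hy.1
      have h2 := norm_nonneg (fderivWithin ℝ ψ Ω y)
      nlinarith
    rw [abs_le] at hX hW hψ1 hv'
    have h1 : C ^ 3 * ∑ i, F i ≤ C ^ 4 * ∑ i, F i := by gcongr
    have h2 : 0 ≤ C ^ 4 * ∑ i, F i := by positivity
    have h3 : 0 ≤ C ^ 4 * ∑ i, F i * |l i| := by positivity
    rw [abs_le]
    constructor <;> nlinarith

/-- The derivative, within a region, of `w` along the vector field `tvec (∂d) ν ξ`. -/
def tfunWithin (Ω : Set (Cn n)) (d w : Cn n → ℝ) (ν ξ : Cn n) (z : Cn n) : ℝ :=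
  fderivWithin ℝ d Ω z ν * fderivWithin ℝ w Ω z ξ - fderivWithin ℝ d Ω z ξ * fderivWithin ℝ w Ω z ν

theorem contDiffOn_tfunWithin (hΩ : UniqueDiffOn ℝ Ω) {w : Cn n → ℝ} (hd : ContDiffOn ℝ 3 d Ω)
    (hw : ContDiffOn ℝ 3 w Ω) (ν ξ : Cn n) : ContDiffOn ℝ 2 (tfunWithin Ω d w ν ξ) Ω := by
  have h1 : ∀ {f : Cn n → ℝ}, ContDiffOn ℝ 3 f Ω → ∀ ζ,
      ContDiffOn ℝ 2 (fun z => fderivWithin ℝ f Ω z ζ) Ω := fun hf ζ =>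
    (hf.fderivWithin hΩ (by norm_num)).clm_apply contDiffOn_const
  exact ((h1 hd ν).mul (h1 hw ξ)).sub ((h1 hd ξ).mul (h1 hw ν))

theorem tfunWithin_eventuallyEq {y : Cn n} (h : Ω ∈ 𝓝 y) (w : Cn n → ℝ) (ξ : Cn n) :
    tfunWithin Ω d w ν ξ =ᶠ[𝓝 y] tfun d w ν ξ := by
  filter_upwards [fderivWithin_eventuallyEq h d, fderivWithin_eventuallyEq h w] with z h1 h2
  rw [tfunWithin, tfun, h1, h2]

/-- At a boundary minimum, the derivatives tangential to the boundary vanish. -/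
theorem BoundaryRegion.fderivWithin_eq_zero (h : BoundaryRegion Ω d) {q : Cn n} (hq : q ∈ Ω)
    (hdq : d q = 0) {w : Cn n → ℝ} (hw : DifferentiableOn ℝ w Ω) (hmin : IsLocalMinOn w Ω q) {ξ : Cn n}
    (hξ : fderivWithin ℝ d Ω q ξ = 0) : fderivWithin ℝ w Ω q ξ = 0 := by
  have h1 := h.deriv_nonneg q hq hdq w _ (hw q hq).hasFDerivWithinAt hmin
  refine le_antisymm ?_ (h1 ξ hξ.ge)
  have h2 := h1 (-ξ) (by rw [map_neg, hξ, neg_zero])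
  rw [map_neg] at h2
  linarith

theorem BoundaryRegion.tfunWithin_eq_zero (h : BoundaryRegion Ω d) {q : Cn n} (hq : q ∈ Ω)
    (hdq : d q = 0) {w : Cn n → ℝ} (hw : DifferentiableOn ℝ w Ω) (hmin : IsLocalMinOn w Ω q) (ν ξ : Cn n) :
    tfunWithin Ω d w ν ξ q = 0 := by
  have h1 := h.fderivWithin_eq_zero hq hdq hw hmin (ξ := fderivWithin ℝ d Ω q ν • ξ
    - fderivWithin ℝ d Ω q ξ • ν) (by simp; ring)
  rw [map_sub, map_smul, map_smul, smul_eq_mul, smul_eq_mul] at h1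
  exact h1

/-- If `|f| ≤ A (d + |y - q|²)` near a boundary point `q` with `f q = 0`, then the derivative of `f` at
`q` is bounded by `A` times that of `d`. -/
theorem BoundaryRegion.abs_fderivWithin_le (h : BoundaryRegion Ω d) {q : Cn n} (hq : q ∈ Ω)
    (hdq : d q = 0) {f : Cn n → ℝ} (hf : DifferentiableOn ℝ f Ω) (hfq : f q = 0) {A s : ℝ} (hs : 0 < s)
    (hA : ∀ y ∈ Ω ∩ Metric.closedBall q s, |f y| ≤ A * (d y + distSq q y)) (ξ : Cn n) :
    |fderivWithin ℝ f Ω q ξ| ≤ A * |fderivWithin ℝ d Ω q ξ| := by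
  have hq' : HasFDerivAt (distSq q) (0 : Cn n →L[ℝ] ℝ) q := by
    have h1 : DifferentiableAt ℝ (distSq q) q := (contDiff_distSq q).differentiable (by simp) q
    have h2 : IsLocalMin (distSq q) q := Filter.Eventually.of_forall fun y => by
      simp [distSq_eq]
    rw [← h2.fderiv_eq_zero]
    exact h1.hasFDerivAt
  have hball : Ω ∩ Metric.closedBall q s ∈ 𝓝[Ω] q :=
    Filter.inter_mem self_mem_nhdsWithin (mem_nhdsWithin_of_mem_nhds (Metric.closedBall_mem_nhds q hs))
  have key : ∀ σ : ℝ, (∀ y ∈ Ω ∩ Metric.closedBall q s, 0 ≤ A * (d y + distSq q y) + σ * f y) →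
      ∀ ξ, 0 ≤ fderivWithin ℝ d Ω q ξ → 0 ≤ A * fderivWithin ℝ d Ω q ξ + σ * fderivWithin ℝ f Ω q ξ := by
    intro σ hσ ξ hξ
    have hD : HasFDerivWithinAt (fun y => A * (d y + distSq q y) + σ * f y)
        (A • (fderivWithin ℝ d Ω q + 0) + σ • fderivWithin ℝ f Ω q) Ω q :=
      ((((h.contDiffOn.differentiableOn (by simp) q hq).hasFDerivWithinAt.add
        hq'.hasFDerivWithinAt).const_mul A)).add ((hf q hq).hasFDerivWithinAt.const_mul σ)
    have h3 := h.deriv_nonneg q hq hdq _ _ hD (by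
      filter_upwards [hball] with y hy
      have h4 : distSq q q = 0 := by rw [distSq_eq]; simp
      rw [hdq, hfq, h4]
      simpa using hσ y hy) ξ hξ
    simpa using h3
  have hpos : ∀ ξ, 0 ≤ fderivWithin ℝ d Ω q ξ →
      |fderivWithin ℝ f Ω q ξ| ≤ A * fderivWithin ℝ d Ω q ξ := by
    intro ξ hξ
    have h1 := key 1 (fun y hy => by linarith [(abs_le.1 (hA y hy)).1]) ξ hξ
    have h2 := key (-1) (fun y hy => by linarith [(abs_le.1 (hA y hy)).2]) ξ hξ
    rw [abs_le]
    constructor <;> linarith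
  rcases le_total 0 (fderivWithin ℝ d Ω q ξ) with h0 | h0
  · rw [abs_of_nonneg h0]
    exact hpos ξ h0
  · have h1 := hpos (-ξ) (by rw [map_neg]; linarith)
    rw [map_neg, map_neg, abs_neg] at h1
    rw [abs_of_nonpos h0]
    exact h1

theorem hasFDerivWithinAt_tfunWithin (hΩ : UniqueDiffOn ℝ Ω) {w : Cn n → ℝ} (hd : ContDiffOn ℝ 2 d Ω)
    (hw : ContDiffOn ℝ 2 w Ω) {q : Cn n} (hq : q ∈ Ω) (ν ξ η : Cn n) :
    fderivWithin ℝ (tfunWithin Ω d w ν ξ) Ω q η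
      = fderivWithin ℝ d Ω q ν * D2w Ω w q η ξ + fderivWithin ℝ w Ω q ξ * D2w Ω d q η ν
        - (fderivWithin ℝ d Ω q ξ * D2w Ω w q η ν + fderivWithin ℝ w Ω q ν * D2w Ω d q η ξ) := by
  have h1 : ∀ {f : Cn n → ℝ}, ContDiffOn ℝ 2 f Ω → ∀ ζ,
      HasFDerivWithinAt (fun z => fderivWithin ℝ f Ω z ζ) ((D2w Ω f q).flip ζ) Ω q := by
    intro f hf ζ
    have h2 : DifferentiableWithinAt ℝ (fderivWithin ℝ f Ω) Ω q :=
      (hf.fderivWithin hΩ (m := 1) (by norm_num)).differentiableOn (by norm_num) q hq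
    have h3 := h2.hasFDerivWithinAt.clm_apply (hasFDerivWithinAt_const ζ q Ω)
    simpa using h3
  have h2 := ((h1 hd ν).mul (h1 hw ξ)).sub ((h1 hd ξ).mul (h1 hw ν))
  have h3 := h2.fderivWithin (hΩ q hq)
  have h4 : tfunWithin Ω d w ν ξ = (fun z => fderivWithin ℝ d Ω z ν) * (fun z => fderivWithin ℝ w Ω z ξ)
      - (fun z => fderivWithin ℝ d Ω z ξ) * fun z => fderivWithin ℝ w Ω z ν := rfl
  rw [h4, h3]
  simp

end HessianBound

/-! ### The Hessian at the boundary -/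

section HessianBound

variable {n p : ℕ}

open Matrix
open scoped ComplexOrder

variable {Ω : Set (Cn n)} {d : Cn n → ℝ} {W X : Cn n → Matrix (Fin n) (Fin n) ℂ} {v : Cn n → ℝ}
  {q₀ ν : Cn n} {r C c κ : ℝ} {u ψ : Cn n → ℝ}

theorem RegionData.matForm_sub_eq (h : RegionData p Ω d W X v) (hu : ContDiffOn ℝ 2 u Ω) {y : Cn n}
    (hy : y ∈ Ω) (hΩy : Ω ∈ 𝓝 y) :
    matForm (D2 (fun z => u z - v z) y) = gForm Ω X u y - gForm Ω X v y := by
  rw [← D2w_eq hΩy, D2w_sub h.uniqueDiffOn hu (h.contDiffOn_v.of_le (by norm_cast)) hy, matForm_sub,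
    gForm, gForm]
  abel

theorem RegionData.exists_isEigenframe (h : RegionData p Ω d W X v) (hu : ContDiffOn ℝ 2 u Ω) {y : Cn n}
    (hy : y ∈ Ω) (hc : InCone p (realEigenvalues ((W y)⁻¹ * gForm Ω X u y))) :
    ∃ P l, IsEigenframe p (W y) (gForm Ω X u y) P l :=
  _root_.exists_isEigenframe (h.posDef y hy) (h.gForm_isHermitian hy (h.isHermitian y hy) hu) hc

/-- For admissible `u` the trace of `i∂∂̄(u - v)` is bounded below: the eigenvalues of `u` have
positive sum. -/
theorem RegionData.exists_Lop_one_ge (h : RegionData p Ω d W X v) (hp : 1 ≤ p) (hpn : p ≤ n)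
    {K : Set (Cn n)} (hK : IsCompact K) (hKΩ : K ⊆ Ω) : ∃ C : ℝ, 0 ≤ C ∧ ∀ u : Cn n → ℝ,
      ContDiffOn ℝ 2 u Ω → (∀ y ∈ Ω, InCone p (realEigenvalues ((W y)⁻¹ * gForm Ω X u y))) →
        ∀ y ∈ K, Ω ∈ 𝓝 y → ∃ P : Matrix (Fin n) (Fin n) ℂ, Pᴴ * W y * P = 1 ∧
          -C ≤ Lop (fun _ => 1) (colVec P) (D2 (fun z => u z - v z) y) := by
  obtain ⟨C₁, hC₁, h1⟩ := exists_frame_bound hK (fun k j => (h.contDiffOn_W k j).continuousOn.mono hKΩ)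
    fun y hy => h.posDef y (hKΩ hy)
  obtain ⟨C₂, hC₂, h2⟩ := exists_sesq_colVec_bound hK (A := gForm Ω X v) (fun k j =>
    (continuousOn_gForm h.uniqueDiffOn (fun k j => (h.contDiffOn_X k j).continuousOn)
      (h.contDiffOn_v.of_le (by norm_cast)) k j).mono hKΩ) (R := C₁) (by linarith)
  refine ⟨n * (C₂ * C₁), by positivity, fun u hu hcone y hy hΩy => ?_⟩
  obtain ⟨P, l, hP⟩ := h.exists_isEigenframe hu (hKΩ hy) (hcone y (hKΩ hy))
  refine ⟨P, hP.orth, ?_⟩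
  rw [hP.Lop_eq _ (h.matForm_sub_eq hu (hKΩ hy) hΩy)]
  simp only [one_mul]
  have h3 : 0 < ∑ i, l i := sum_pos_of_cone hp hP.pos (by simpa using hpn)
  have h4 : ∑ i, (sesq (gForm Ω X v y) (colVec P i) (colVec P i)).re ≤ ∑ _i : Fin n, C₂ * C₁ := by
    refine Finset.sum_le_sum fun i _ => ((le_abs_self _).trans (Complex.abs_re_le_norm _)).trans ?_
    refine (h2 y hy _ _ (h1 y hy P hP.orth i)).trans ?_
    gcongr
    exact h1 y hy P hP.orth i
  simp only [Finset.sum_const, Finset.card_univ, Fintype.card_fin, nsmul_eq_mul] at h4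
  linarith

/-- The difference of an admissible function and `v` grows at most linearly from the boundary. -/
theorem RegionData.exists_linear_growth [NeZero n] (h : RegionData p Ω d W X v) (hp : 1 ≤ p) (hpn : p ≤ n)
    (hq₀ : q₀ ∈ Ω) (hd : d q₀ = 0) : ∃ s : ℝ, 0 < s ∧ ∃ C : ℝ, 0 < C ∧ ∀ (u : Cn n → ℝ) (m : ℝ),
      ContDiffOn ℝ 2 u Ω → (∀ y ∈ Ω, InCone p (realEigenvalues ((W y)⁻¹ * gForm Ω X u y))) → 0 ≤ m →
      (∀ y ∈ Ω, u y ≤ v y + m) → (∀ y ∈ Ω, d y = 0 → u y = v y) →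
        ∀ q ∈ Ω ∩ Metric.closedBall q₀ s, d q = 0 → ∀ y ∈ Ω ∩ Metric.closedBall q s,
          u y - v y ≤ C * (m + 1) * (d y + ‖y - q‖ ^ 2) := by
  obtain ⟨r, hr, hrK⟩ := h.locallyCompact q₀ hq₀
  obtain ⟨C₁, hC₁, hLop⟩ := h.exists_Lop_one_ge hp hpn hrK inter_subset_left
  obtain ⟨s, hs, hmain⟩ := h.toBoundaryRegion.exists_upper_barrier
    (fun k j => (h.contDiffOn_W k j).continuousOn) h.posDef hq₀ hd hr
  obtain ⟨C, hC, hw⟩ := hmain C₁ hC₁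
  refine ⟨s, hs, C, hC, fun u m hu hcone hm hle hbd => ?_⟩
  refine hw (fun z => u z - v z) m (hu.sub (h.contDiffOn_v.of_le (by norm_cast))) hm
    (fun y hy => ?_) (fun y hy hdy => ?_) (fun y hy hdy => ?_)
  · linarith [hle y hy]
  · rw [hbd y hy hdy, sub_self]
  · exact hLop u hu hcone y hy (h.mem_nhds y hy.1 hdy)

/-- The barrier argument for the tangential derivatives of `u - v` at the boundary. The barrier is a
multiple of `u - v + t d - N d²`, corrected by the squares of the tangential derivatives: these
produce the good terms that control the third order commutators. -/
theorem RegionData.exists_abs_tfunWithin_le [NeZero n] (h : RegionData p Ω d W X v) (hp : 1 ≤ p)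
    (hpn : p ≤ n) (hq₀ : q₀ ∈ Ω) (hd : d q₀ = 0) (c : ℝ) (hb : DataBounds p Ω d W X v q₀ r C ν)
    (hr : 0 < r) (hc : c ≤ C) : ∃ s : ℝ, 0 < s ∧ ∃ A : ℝ, 0 < A ∧
      ∀ (κ : ℝ) (u ψ : Cn n → ℝ), LocalSolution p Ω d W X v c κ u ψ →
        ∀ q ∈ Ω ∩ Metric.closedBall q₀ s, d q = 0 → ∀ y ∈ Ω ∩ Metric.closedBall q s,
          ∀ b, |tfunWithin Ω d (fun z => u z - v z) ν (bas b) y|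
            ≤ A * κ * (u y - v y + d y + distSq q y) := by
  have hC := hb.one_le
  have hC0 : 0 < C := by linarith
  have hn : 0 < n := Nat.pos_of_ne_zero (NeZero.ne n)
  have hp' : (0 : ℝ) < p := by exact_mod_cast hp
  have hv2 : ContDiffOn ℝ 2 v Ω := h.contDiffOn_v.of_le (by norm_cast)
  obtain ⟨ε, hε, htr⟩ := exists_trace_lower_bound (p := p) hb.isCompact (W := W) (G := gForm Ω X v)
    (fun k j => ((h.contDiffOn_W k j).continuousOn).mono inter_subset_left)
    (fun k j => (continuousOn_gForm h.uniqueDiffOn (fun k j => (h.contDiffOn_X k j).continuousOn)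
      hv2 k j).mono inter_subset_left)
    (fun y hy => h.posDef y hy.1)
    (fun y hy => h.gForm_isHermitian hy.1 (h.isHermitian y hy.1) hv2) (fun y hy => h.cone y hy.1)
  obtain ⟨K, hK, htan⟩ := exists_Lop_tangential_ge n (4 * C ^ 4)
  obtain ⟨t, N, δ, ε₁, ht, hN, hδ, hε₁, hNδ, hbar⟩ := exists_barrier_constants (n := n) (ε := ε / p)
    (N₀ := n.choose p) hn hC (by positivity) (by positivity)
    {F | ∃ l : Fin n → ℝ, (∀ I ∈ Finset.powersetCard p Finset.univ, 0 < ∑ k ∈ I, l k) ∧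
      ∏ I ∈ Finset.powersetCard p Finset.univ, ∑ k ∈ I, l k ≤ c ∧ F = wt p l}
    (by rintro F ⟨l, hl, -, rfl⟩ i; exact wt_nonneg hl i)
    (fun F₀ => by
      obtain ⟨c', hc', hwt⟩ := exists_wt_lower_bound n p hp hpn F₀ c
      exact ⟨c', hc', by rintro F ⟨l, hl, hl', rfl⟩ hF; exact hwt l hl hl' hF⟩)
  obtain ⟨s, hs, hrad⟩ := h.exists_radius hq₀ hd hr hδ
  -- `B` makes the barrier win on the sphere around `q`, `A` absorbs the bounded errors inside
  set B := (32 * n * C ^ 4 + 4 * C ^ 2) / s ^ 2 with hB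
  have hB0 : 0 < B := by positivity
  set A := (B * C ^ 2 + K + 1) / ε₁ with hA
  have hA0 : 0 < A := by positivity
  refine ⟨s, hs, A + A * t + B, by positivity, ?_⟩
  intro κ u ψ hu q hq hdq
  have hκ := hu.one_le
  have hκ0 : 0 < κ := by linarith
  set w : Cn n → ℝ := fun z => u z - v z with hw
  have hw4 : ContDiffOn ℝ 4 w Ω := hu.contDiffOn.sub (h.contDiffOn_v.of_le (by norm_cast))
  have hwd : DifferentiableOn ℝ w Ω := hw4.differentiableOn (by norm_num)
  have hd3 : ContDiffOn ℝ 3 d Ω := h.contDiffOn.of_le (by norm_cast)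
  have hw0 : ∀ y ∈ Ω, 0 ≤ w y := fun y hy => sub_nonneg.2 (hu.le y hy)
  set T : Fin n ⊕ Fin n → Cn n → ℝ := fun b => tfunWithin Ω d w ν (bas b) with hT
  have hTc : ∀ b, ContDiffOn ℝ 2 (T b) Ω := fun b =>
    contDiffOn_tfunWithin h.uniqueDiffOn hd3 (hw4.of_le (by norm_num)) ν (bas b)
  have hKsub : ∀ y ∈ Metric.closedBall q s, y ∈ Metric.closedBall q₀ r := fun y hy => (hrad q hq.2 y hy).1
  have hTb : ∀ y ∈ Ω ∩ Metric.closedBall q s, ∀ b, |T b y| ≤ 4 * C ^ 2 * κ := by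
    intro y hy b
    have hyK : y ∈ Ω ∩ Metric.closedBall q₀ r := ⟨hy.1, hKsub y hy.2⟩
    have h1 : ∀ ζ : Cn n, ‖ζ‖ ≤ 1 → |fderivWithin ℝ d Ω y ζ| ≤ C := fun ζ hζ => by
      rw [← Real.norm_eq_abs]
      exact (ContinuousLinearMap.le_of_opNorm_le _ (hb.d_le y hyK).1 ζ).trans
        (mul_le_of_le_one_right hC0.le hζ)
    have h2 : ∀ ζ : Cn n, ‖ζ‖ ≤ 1 → |fderivWithin ℝ w Ω y ζ| ≤ 2 * C * κ := fun ζ hζ => by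
      have h3 : ‖fderivWithin ℝ w Ω y‖ ≤ 2 * C * κ := by
        rw [hw, fderivWithin_fun_sub (h.uniqueDiffOn y hy.1)
          (hu.contDiffOn.differentiableOn (by norm_num) y hy.1)
          (h.contDiffOn_v.differentiableOn (by simp) y hy.1)]
        refine (norm_sub_le _ _).trans ?_
        have h4 := hu.grad_le y hy.1
        have h5 := (hb.v_le y hyK).1
        nlinarith
      rw [← Real.norm_eq_abs]
      exact (ContinuousLinearMap.le_of_opNorm_le _ h3 ζ).trans
        (mul_le_of_le_one_right (by positivity) hζ)
    have hbb : ‖(bas b : Cn n)‖ ≤ 1 := (norm_bas b).le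
    refine (abs_sub _ _).trans ?_
    rw [abs_mul, abs_mul]
    have h5 := mul_le_mul (h1 ν hb.ν_le) (h2 (bas b) hbb) (abs_nonneg _) hC0.le
    have h6 := mul_le_mul (h1 (bas b) hbb) (h2 ν hb.ν_le) (abs_nonneg _) hC0.le
    linarith
  have hmain : ∀ (σ : ℝ) (b₀ : Fin n ⊕ Fin n), |σ| ≤ 1 → ∀ y ∈ Ω ∩ Metric.closedBall q s,
      0 ≤ A * κ * (w y + (t * d y - N * (d y * d y))) + (B * κ * distSq q y
        - (κ⁻¹ * (∑ b, T b y * T b y) + σ * T b₀ y)) := by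
    intro σ b₀ hσ
    have hKc : IsCompact (Ω ∩ Metric.closedBall q s) :=
      isCompact_inter_closedBall_of_subset hb.isCompact hKsub
    have hAκ : 0 < A * κ := by positivity
    have hBκ : 0 < B * κ := by positivity
    refine nonneg_of_barrier hKc ?_ fun y hy hneg => ?_
    · have h1 : ContinuousOn d (Ω ∩ Metric.closedBall q s) :=
        h.contDiffOn.continuousOn.mono inter_subset_left
      have h2 : ContinuousOn w (Ω ∩ Metric.closedBall q s) := hw4.continuousOn.mono inter_subset_left
      have h3 := (contDiff_distSq q).continuous.continuousOn (s := Ω ∩ Metric.closedBall q s)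
      have h4 : ∀ b, ContinuousOn (T b) (Ω ∩ Metric.closedBall q s) := fun b =>
        (hTc b).continuousOn.mono inter_subset_left
      exact (continuousOn_const.mul (h2.add ((continuousOn_const.mul h1).sub
        (continuousOn_const.mul (h1.mul h1))))).add ((continuousOn_const.mul h3).sub
        ((continuousOn_const.mul (continuousOn_finsetSum _ fun b _ => (h4 b).mul (h4 b))).add
          (continuousOn_const.mul (h4 b₀))))
    have hdδ := (hrad q hq.2 y hy.2).2 hy.1
    have hd0 := h.nonneg y hy.1
    have hwy := hw0 y hy.1
    have h1 : 0 ≤ t * d y - N * (d y * d y) := by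
      have h0 : 0 ≤ (t - N * d y) * d y :=
        mul_nonneg (by linarith [mul_le_mul_of_nonneg_left hdδ hN.le]) hd0
      linarith
    have h1' : 0 ≤ A * κ * (w y + (t * d y - N * (d y * d y))) := by positivity
    have hdist : 0 ≤ distSq q y := by rw [distSq_eq]; positivity
    -- on the boundary `u - v` and its tangential derivatives vanish
    have hy1 : 0 < d y := by
      refine lt_of_le_of_ne hd0 fun h0 => ?_
      have hwy0 : w y = 0 := sub_eq_zero.2 (hu.eq_of_boundary y hy.1 h0.symm)
      have hTy : ∀ b, T b y = 0 := fun b => h.tfunWithin_eq_zero hy.1 h0.symm hwd (by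
        filter_upwards [self_mem_nhdsWithin] with z hz
        rw [hwy0]; exact hw0 z hz) ν (bas b)
      have h2 : 0 ≤ B * κ * distSq q y := by positivity
      simp only [hTy, mul_zero, Finset.sum_const_zero, add_zero, sub_zero] at hneg
      linarith
    -- on the sphere the term `B κ |z - q|²` exceeds the bounds for the tangential derivatives
    have hy2 : dist y q < s := by
      refine lt_of_le_of_ne hy.2 fun h0 => ?_
      have h3 : B * κ * distSq q y = (32 * n * C ^ 4 + 4 * C ^ 2) * κ := by
        rw [distSq_eq, ← dist_eq_norm, h0, hB]; field_simp
      have h4 : κ⁻¹ * (∑ b, T b y * T b y) ≤ 32 * n * C ^ 4 * κ := by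
        have h5 : ∑ b, T b y * T b y ≤ ∑ _b : Fin n ⊕ Fin n, (4 * C ^ 2 * κ) ^ 2 :=
          Finset.sum_le_sum fun b _ => by
            rw [← sq, ← sq_abs]; exact pow_le_pow_left₀ (abs_nonneg _) (hTb y hy b) 2
        simp only [Finset.sum_const, Finset.card_univ, Fintype.card_sum, Fintype.card_fin,
          nsmul_eq_mul] at h5
        push_cast at h5
        calc κ⁻¹ * (∑ b, T b y * T b y) ≤ κ⁻¹ * ((n + n) * (4 * C ^ 2 * κ) ^ 2) := by gcongr
          _ = 32 * n * C ^ 4 * κ := by field_simp; ring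
      have h5 : σ * T b₀ y ≤ 4 * C ^ 2 * κ := by
        refine (le_abs_self _).trans ?_
        rw [abs_mul]
        exact (mul_le_of_le_one_left (abs_nonneg _) hσ).trans (hTb y hy b₀)
      linarith
    have hΩy := h.mem_nhds y hy.1 hy1
    have hyK : y ∈ Ω ∩ Metric.closedBall q₀ r := ⟨hy.1, hKsub y hy.2⟩
    have hdc : ContDiffAt ℝ 2 d y := (h.contDiffOn.contDiffAt hΩy).of_le (by norm_cast)
    have hwc : ContDiffAt ℝ 2 w y := (hw4.contDiffAt hΩy).of_le (by norm_num)
    have hqc : ContDiffAt ℝ 2 (distSq q) y := (contDiff_distSq q).contDiffAt.of_le (by norm_cast)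
    have hTcy : ∀ b, ContDiffAt ℝ 2 (T b) y := fun b => (hTc b).contDiffAt hΩy
    have hc1 : ContDiffAt ℝ 2 (fun z => t * d z - N * (d z * d z)) y :=
      (contDiffAt_const.mul hdc).sub (contDiffAt_const.mul (hdc.mul hdc))
    have hc2 : ContDiffAt ℝ 2 (fun z => w z + (t * d z - N * (d z * d z))) y := hwc.add hc1
    have hc3 : ContDiffAt ℝ 2 (fun z => κ⁻¹ * (∑ b, T b z * T b z) + σ * T b₀ z) y :=
      (contDiffAt_const.mul (ContDiffAt.sum fun b _ => (hTcy b).mul (hTcy b))).add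
        (contDiffAt_const.mul (hTcy b₀))
    have hc4 : ContDiffAt ℝ 2 (fun z => B * κ * distSq q z
        - (κ⁻¹ * (∑ b, T b z * T b z) + σ * T b₀ z)) y := (contDiffAt_const.mul hqc).sub hc3
    obtain ⟨P, l, hP⟩ := h.exists_isEigenframe (hu.contDiffOn.of_le (by norm_num)) hy.1 (hu.cone y hy.1)
    have hF := wt_nonneg hP.pos
    have h𝓕 : 0 ≤ ∑ i, wt p l i := Finset.sum_nonneg fun i _ => hF i
    refine ⟨mem_nhds_of_dist_lt hΩy hy2, (contDiffAt_const.mul hc2).add hc4, wt p l, colVec P, hF, ?_⟩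
    have h2 := hbar (wt p l) ⟨l, hP.pos, by
        rw [← hP.sumProduct_eq, hu.equation y hy.1]; exact hu.le_c y hy.1, rfl⟩
      (W y) P d y ν hP.orth (hb.frame_le y hyK P hP.orth) (hb.metric_le y hyK P hP.orth)
      (hb.ν_le.trans hC) hdc (by rw [← D2w_eq hΩy]; exact (hb.d_le y hyK).2.1)
      (by rw [← fderivWithin_of_mem_nhds hΩy]; exact hb.ν_pos y hyK) hd0 hdδ
    -- `h3` and `h2` add up to a bound for `u - v + t d - N d²`, `h5` treats the tangential derivatives
    have h3 := hP.Lop_le hp (h.matForm_sub_eq (hu.contDiffOn.of_le (by norm_num)) hy.1 hΩy) (htr y hyK P hP.orth)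
    have h4 : Lop (wt p l) (colVec P) (D2 (distSq q) y) ≤ C ^ 2 * ∑ i, wt p l i := by
      rw [Lop_distSq, Finset.mul_sum]
      refine Finset.sum_le_sum fun i _ => ?_
      rw [mul_comm]
      exact mul_le_mul_of_nonneg_right
        (pow_le_pow_left₀ (norm_nonneg _) (hb.frame_le y hyK P hP.orth i) 2) (hF i)
    have h5 := htan κ (wt p l) l (colVec P) (W y) (gForm Ω X v y) d w y ν
      (hu.tangentialBounds h hb hc hyK hy1 hP) σ b₀ hσ
    have hTev : ∀ b, T b =ᶠ[𝓝 y] tfun d w ν (bas b) := fun b => tfunWithin_eventuallyEq hΩy w (bas b)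
    have h6 : (fun z => κ⁻¹ * (∑ b, T b z * T b z) + σ * T b₀ z) =ᶠ[𝓝 y]
        fun z => κ⁻¹ * (∑ b, tfun d w ν (bas b) z * tfun d w ν (bas b) z) + σ * tfun d w ν (bas b₀) z := by
      filter_upwards [Filter.eventually_all.2 hTev] with z hz
      simp only [hz]
    rw [← D2_congr h6] at h5
    rw [D2_add (contDiffAt_const.mul hc2) hc4, Lop_add, D2_const_mul hc2, Lop_smul,
      D2_add hwc hc1, Lop_add, D2_sub (contDiffAt_const.mul hqc) hc3, Lop_sub, D2_const_mul hqc, Lop_smul]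
    set 𝓕 := ∑ i, wt p l i
    have h7 : Lop (wt p l) (colVec P) (D2 w y)
        + Lop (wt p l) (colVec P) (D2 (fun z => t * d z - N * (d z * d z)) y) ≤ -(ε₁ * (1 + 𝓕)) := by
      linarith
    have h8 := mul_le_mul_of_nonneg_left h7 hAκ.le
    have h9 := mul_le_mul_of_nonneg_left h4 hBκ.le
    have h10 : A * κ * -(ε₁ * (1 + 𝓕)) = -((B * C ^ 2 + K + 1) * κ * (1 + 𝓕)) := by
      rw [hA]; field_simp
    have h11 : 0 < κ * (1 + 𝓕) := by positivity
    have h12 : 0 ≤ B * κ * C ^ 2 := by positivity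
    linarith
  intro y hy b
  have hd0 := h.nonneg y hy.1
  have hwy := hw0 y hy.1
  have hdist : 0 ≤ distSq q y := by rw [distSq_eq]; positivity
  have hS : 0 ≤ κ⁻¹ * (∑ b, T b y * T b y) :=
    mul_nonneg (by positivity) (Finset.sum_nonneg fun b _ => mul_self_nonneg _)
  have h1 := hmain 1 b (by simp) y hy
  have h2 := hmain (-1) b (by simp) y hy
  have h3 : 0 ≤ A * κ * (N * (d y * d y)) := by positivity
  have h4 : A * κ * (w y + t * d y) + B * κ * distSq q y
      ≤ (A + A * t + B) * κ * (u y - v y + d y + distSq q y) := by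
    have e1 : 0 ≤ A * κ * d y := by positivity
    have e2 : 0 ≤ A * κ * distSq q y := by positivity
    have e3 : 0 ≤ A * t * κ * w y := by positivity
    have e4 : 0 ≤ A * t * κ * distSq q y := by positivity
    have e5 : 0 ≤ B * κ * w y := by positivity
    have e6 : 0 ≤ B * κ * d y := by positivity
    have e7 : w y = u y - v y := rfl
    rw [← e7]
    linarith
  show |T b y| ≤ _
  rw [abs_le]
  constructor <;> linarith

/-- The mixed second derivatives of a solution at the boundary, in a direction tangential to the
boundary and an arbitrary one, are bounded by the size of the gradient. -/
theorem RegionData.exists_hessian_bound [NeZero n] (h : RegionData p Ω d W X v) (hp : 1 ≤ p)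
    (hpn : p ≤ n) (hq₀ : q₀ ∈ Ω) (hd : d q₀ = 0) (c : ℝ) : ∃ s : ℝ, 0 < s ∧ ∃ M : ℝ, 0 < M ∧
      ∀ (κ : ℝ) (u ψ : Cn n → ℝ), LocalSolution p Ω d W X v c κ u ψ →
        ∀ q ∈ Ω ∩ Metric.closedBall q₀ s, d q = 0 → ∀ ξ η, fderivWithin ℝ d Ω q ξ = 0 →
          |D2w Ω u q η ξ| ≤ M * κ * ‖ξ‖ * ‖η‖ := by
  obtain ⟨ν, r, C, hr, hb, hc⟩ := h.exists_bounds hq₀ hd c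
  have hC := hb.one_le
  have hC0 : 0 < C := by linarith
  obtain ⟨s₁, hs₁, A, hA, hT⟩ := h.exists_abs_tfunWithin_le hp hpn hq₀ hd c hb hr hc
  obtain ⟨s₂, hs₂, A₀, hA₀, hgrow⟩ := h.exists_linear_growth hp hpn hq₀ hd
  set A' := A₀ * (max c 0 + 1) with hA'_def
  have hA' : 0 < A' := by positivity
  set s := min r (min s₁ s₂) with hs
  have hs0 : 0 < s := by positivity
  have hsr : s ≤ r := min_le_left _ _
  have hss₁ : s ≤ s₁ := (min_le_right _ _).trans (min_le_left _ _)
  have hss₂ : s ≤ s₂ := (min_le_right _ _).trans (min_le_right _ _)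
  refine ⟨s, hs0, C * (2 * n * (A * (A' + 1) * C) + 4 * C ^ 2) + C, by positivity, ?_⟩
  intro κ u ψ hu q hq hdq ξ η hξ
  have hqr : q ∈ Ω ∩ Metric.closedBall q₀ r := ⟨hq.1, Metric.closedBall_subset_closedBall hsr hq.2⟩
  have hκ := hu.one_le
  have hκ0 : 0 < κ := by linarith
  set w : Cn n → ℝ := fun z => u z - v z with hw
  have hw4 : ContDiffOn ℝ 4 w Ω := hu.contDiffOn.sub (h.contDiffOn_v.of_le (by norm_cast))
  have hwd : DifferentiableOn ℝ w Ω := hw4.differentiableOn (by norm_num)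
  have hd3 : ContDiffOn ℝ 3 d Ω := h.contDiffOn.of_le (by norm_cast)
  have hwmin : IsLocalMinOn w Ω q := by
    filter_upwards [self_mem_nhdsWithin] with z hz
    show u q - v q ≤ u z - v z
    rw [hu.eq_of_boundary q hq.1 hdq, sub_self]
    exact sub_nonneg.2 (hu.le z hz)
  have hTd : ∀ b, |fderivWithin ℝ (tfunWithin Ω d w ν (bas b)) Ω q η|
      ≤ A * (A' + 1) * C * κ * ‖η‖ := by
    intro b
    have h1 := h.abs_fderivWithin_le hq.1 hdq
      ((contDiffOn_tfunWithin h.uniqueDiffOn hd3 (hw4.of_le (by norm_num)) ν (bas b)).differentiableOn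
        (by norm_num)) (h.tfunWithin_eq_zero hq.1 hdq hwd hwmin ν (bas b)) hs0
      (A := A * κ * (A' + 1)) (fun y hy => ?_) η
    · have h2 : |fderivWithin ℝ d Ω q η| ≤ C * ‖η‖ :=
        ContinuousLinearMap.le_of_opNorm_le _ (hb.d_le q hqr).1 η
      calc _ ≤ _ := h1
        _ ≤ A * κ * (A' + 1) * (C * ‖η‖) := by gcongr
        _ = _ := by ring
    · have h2 := hT κ u ψ hu q ⟨hq.1, Metric.closedBall_subset_closedBall hss₁ hq.2⟩ hdq y
        ⟨hy.1, Metric.closedBall_subset_closedBall hss₁ hy.2⟩ b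
      have h3 := hgrow u (max c 0) (hu.contDiffOn.of_le (by norm_num)) hu.cone (le_max_right _ _)
        (fun y hy => (hu.le_add y hy).trans (by gcongr; exact le_max_left _ _)) hu.eq_of_boundary q ⟨hq.1, Metric.closedBall_subset_closedBall hss₂ hq.2⟩ hdq y
        ⟨hy.1, Metric.closedBall_subset_closedBall hss₂ hy.2⟩
      rw [← distSq_eq] at h3
      calc _ ≤ _ := h2
        _ ≤ A * κ * (A' * (d y + distSq q y) + d y + distSq q y) := by gcongr
        _ = _ := by ring
  set D := fderivWithin ℝ d Ω q with hD
  -- differentiating the tangential derivatives recovers the Hessian, up to first order terms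
  have hexp : D ν * D2w Ω w q η ξ = ∑ b, coord ξ b * fderivWithin ℝ (tfunWithin Ω d w ν (bas b)) Ω q η
      - fderivWithin ℝ w Ω q ξ * D2w Ω d q η ν + fderivWithin ℝ w Ω q ν * D2w Ω d q η ξ := by
    have h1 : ∀ L : Cn n →L[ℝ] ℝ, L ξ = ∑ b, coord ξ b * L (bas b) := by
      intro L
      conv_lhs => rw [eq_sum_bas ξ]
      simp
    have h2 : ∑ b, coord ξ b * fderivWithin ℝ (tfunWithin Ω d w ν (bas b)) Ω q η
        = D ν * (∑ b, coord ξ b * D2w Ω w q η (bas b))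
          + (∑ b, coord ξ b * fderivWithin ℝ w Ω q (bas b)) * D2w Ω d q η ν
          - ((∑ b, coord ξ b * D (bas b)) * D2w Ω w q η ν
            + fderivWithin ℝ w Ω q ν * ∑ b, coord ξ b * D2w Ω d q η (bas b)) := by
      simp only [Finset.mul_sum, Finset.sum_mul, ← Finset.sum_add_distrib, ← Finset.sum_sub_distrib]
      refine Finset.sum_congr rfl fun b _ => ?_
      rw [hasFDerivWithinAt_tfunWithin h.uniqueDiffOn (hd3.of_le (by norm_num))
        (hw4.of_le (by norm_num)) hq.1]
      ring
    rw [h2, ← h1, ← h1, ← h1, ← h1, hξ]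
    ring
  have hcoord : ∀ b, |coord ξ b| ≤ ‖ξ‖ := fun b => by
    have h1 : coord ξ b ^ 2 ≤ ‖ξ‖ ^ 2 := by
      rw [← sum_coord_sq]
      exact Finset.single_le_sum (f := fun b => coord ξ b ^ 2) (fun b _ => sq_nonneg _) (Finset.mem_univ b)
    exact abs_le_of_sq_le_sq h1 (norm_nonneg _)
  have hsum : |∑ b, coord ξ b * fderivWithin ℝ (tfunWithin Ω d w ν (bas b)) Ω q η|
      ≤ 2 * n * (A * (A' + 1) * C) * κ * ‖ξ‖ * ‖η‖ := by
    refine (Finset.abs_sum_le_sum_abs _ _).trans ?_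
    calc _ ≤ ∑ _b : Fin n ⊕ Fin n, ‖ξ‖ * (A * (A' + 1) * C * κ * ‖η‖) :=
          Finset.sum_le_sum fun b _ => by
            rw [abs_mul]; exact mul_le_mul (hcoord b) (hTd b) (abs_nonneg _) (norm_nonneg _)
      _ = _ := by
        simp only [Finset.sum_const, Finset.card_univ, Fintype.card_sum, Fintype.card_fin, nsmul_eq_mul]
        push_cast
        ring
  have hw1 : ∀ ζ, |fderivWithin ℝ w Ω q ζ| ≤ 2 * C * κ * ‖ζ‖ := fun ζ => by
    refine ContinuousLinearMap.le_of_opNorm_le (fderivWithin ℝ w Ω q) ?_ ζ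
    rw [hw, fderivWithin_fun_sub (h.uniqueDiffOn q hq.1)
      (hu.contDiffOn.differentiableOn (by norm_num) q hq.1)
      (h.contDiffOn_v.differentiableOn (by simp) q hq.1)]
    refine (norm_sub_le _ _).trans ?_
    have h4 := hu.grad_le q hq.1
    have h5 := (hb.v_le q hqr).1
    nlinarith
  have hd2 : ∀ ζ, |D2w Ω d q η ζ| ≤ C * ‖η‖ * ‖ζ‖ := fun ζ =>
    ((D2w Ω d q).le_opNorm₂ η ζ).trans (by gcongr; exact (hb.d_le q hqr).2.1)
  have hν := hb.ν_le
  have ht1 : |fderivWithin ℝ w Ω q ξ * D2w Ω d q η ν| ≤ 2 * C ^ 2 * κ * ‖ξ‖ * ‖η‖ := by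
    rw [abs_mul]
    calc _ ≤ (2 * C * κ * ‖ξ‖) * (C * ‖η‖ * ‖ν‖) := by gcongr; exacts [hw1 ξ, hd2 ν]
      _ ≤ (2 * C * κ * ‖ξ‖) * (C * ‖η‖ * 1) := by gcongr
      _ = _ := by ring
  have ht2 : |fderivWithin ℝ w Ω q ν * D2w Ω d q η ξ| ≤ 2 * C ^ 2 * κ * ‖ξ‖ * ‖η‖ := by
    rw [abs_mul]
    calc _ ≤ (2 * C * κ * ‖ν‖) * (C * ‖η‖ * ‖ξ‖) := by gcongr; exacts [hw1 ν, hd2 ξ]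
      _ ≤ (2 * C * κ * 1) * (C * ‖η‖ * ‖ξ‖) := by gcongr
      _ = _ := by ring
  have hDw : D ν * |D2w Ω w q η ξ| ≤ (2 * n * (A * (A' + 1) * C) + 4 * C ^ 2) * κ * ‖ξ‖ * ‖η‖ := by
    have h0 : D ν * |D2w Ω w q η ξ| ≤ |D ν * D2w Ω w q η ξ| := by
      rw [abs_mul]; gcongr; exact le_abs_self _
    refine h0.trans ?_
    rw [hexp]
    refine (abs_add_le _ _).trans ?_
    have := abs_sub (∑ b, coord ξ b * fderivWithin ℝ (tfunWithin Ω d w ν (bas b)) Ω q η)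
      (fderivWithin ℝ w Ω q ξ * D2w Ω d q η ν)
    linarith
  have hw2 : |D2w Ω w q η ξ| ≤ C * (2 * n * (A * (A' + 1) * C) + 4 * C ^ 2) * κ * ‖ξ‖ * ‖η‖ := by
    have h1 := hb.ν_pos q hqr
    calc |D2w Ω w q η ξ| ≤ (C * D ν) * |D2w Ω w q η ξ| :=
          le_mul_of_one_le_left (abs_nonneg _) h1
      _ = C * (D ν * |D2w Ω w q η ξ|) := by ring
      _ ≤ C * ((2 * n * (A * (A' + 1) * C) + 4 * C ^ 2) * κ * ‖ξ‖ * ‖η‖) := by gcongr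
      _ = _ := by ring
  have hv2 : |D2w Ω v q η ξ| ≤ C * κ * ‖ξ‖ * ‖η‖ := by
    refine ((D2w Ω v q).le_opNorm₂ η ξ).trans ?_
    calc ‖D2w Ω v q‖ * ‖η‖ * ‖ξ‖ ≤ C * ‖η‖ * ‖ξ‖ := by gcongr; exact (hb.v_le q hqr).2.1
      _ = C * 1 * ‖ξ‖ * ‖η‖ := by ring
      _ ≤ C * κ * ‖ξ‖ * ‖η‖ := by gcongr
  have hsub := D2w_sub h.uniqueDiffOn (hu.contDiffOn.of_le (by norm_num))
    (h.contDiffOn_v.of_le (by norm_cast)) hq.1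
  have h3 : D2w Ω u q η ξ = D2w Ω w q η ξ + D2w Ω v q η ξ := by
    rw [hw, hsub]; simp
  rw [h3]
  refine (abs_add_le _ _).trans ?_
  linarith

end HessianBound

/-! ### Propagation of positivity -/

section Propagation

variable {n : ℕ}

open Matrix
open scoped ComplexOrder

theorem Lop_exp_neg {F : Fin n → ℝ} {e : Fin n → Cn n} {q : Cn n → ℝ} {y : Cn n} (α : ℝ)
    (hq : ContDiffAt ℝ 2 q y) :
    Lop F e (D2 (fun z => Real.exp (-α * q z)) y) = Real.exp (-α * q y)
      * (α ^ 2 * Gam F e (fderiv ℝ q y) (fderiv ℝ q y) - α * Lop F e (D2 q y)) := by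
  have h1 : fderiv ℝ (fun z => Real.exp (-α * q z)) =ᶠ[𝓝 y]
      fun z => Real.exp (-α * q z) • (-α) • fderiv ℝ q z := by
    filter_upwards [eventually_differentiableAt hq] with z hz
    exact ((hz.hasFDerivAt.const_mul (-α)).exp).fderiv
  have hqd := (hq.differentiableAt (by norm_num)).hasFDerivAt
  have h2 := ((hqd.const_mul (-α)).exp).smul
    ((hq.differentiableAt_fderiv.hasFDerivAt).const_smul (-α))
  have h3 : ∀ a, D2 (fun z => Real.exp (-α * q z)) y a a = Real.exp (-α * q y)
      * (α ^ 2 * (fderiv ℝ q y a * fderiv ℝ q y a) - α * D2 q y a a) := by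
    intro a
    have h4 : D2 (fun z => Real.exp (-α * q z)) y = _ := h1.fderiv_eq.trans h2.fderiv
    rw [h4]
    simp
    ring
  simp only [Lop, Gam, h3, Finset.mul_sum, ← Finset.sum_sub_distrib]
  exact Finset.sum_congr rfl fun i _ => by ring

/-- A nonnegative function that is almost a supersolution and is bounded below in a small ball is
bounded below in a large ball. -/
theorem exists_propagation {ρ s a A : ℝ} (hρ : 0 < ρ) (ha : 0 < a) (hA : 0 ≤ A) :
    ∃ c η : ℝ, 0 < c ∧ 0 < η ∧ ∀ (f : Cn n → ℝ) (b : Cn n) (m : ℝ), 0 < m →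
      (∀ y ∈ Metric.closedBall b (2 * ρ), ContDiffAt ℝ 2 f y ∧ 0 ≤ f y) →
      (∀ y ∈ Metric.closedBall b s, y ∈ Metric.closedBall b (2 * ρ) → m ≤ f y) →
      (∀ y ∈ Metric.closedBall b (2 * ρ), s < dist y b → ∃ (F : Fin n → ℝ) (e : Fin n → Cn n),
        (∀ i, 0 ≤ F i) ∧ a ≤ Gam F e (fderiv ℝ (distSq b) y) (fderiv ℝ (distSq b) y) ∧
        ∑ i, F i * ‖e i‖ ^ 2 ≤ A ∧ Lop F e (D2 f y) ≤ η * m) →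
      ∀ y ∈ Metric.closedBall b ρ, c * m ≤ f y := by
  -- for this `α` the function `exp (-α |z - b|²)` is a strict subsolution outside the small ball
  set α := (A + 1) / a with hα
  have hα0 : 0 < α := by positivity
  refine ⟨Real.exp (-α * ρ ^ 2) - Real.exp (-α * (2 * ρ) ^ 2), Real.exp (-α * (2 * ρ) ^ 2) * α / 2,
    ?_, by positivity, ?_⟩
  · rw [sub_pos, Real.exp_lt_exp]
    nlinarith [mul_pos hα0 (pow_pos hρ 2)]
  intro f b m hm hf hfs hL
  set E := Real.exp (-α * (2 * ρ) ^ 2) with hE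
  have hE0 : 0 < E := Real.exp_pos _
  have hqc : ∀ y, ContDiffAt ℝ 2 (distSq b) y := fun y =>
    ((contDiff_distSq b).of_le (by norm_cast)).contDiffAt
  have hhc : ∀ y, ContDiffAt ℝ 2 (fun z => Real.exp (-α * distSq b z)) y := fun y =>
    (contDiffAt_const.mul (hqc y)).exp
  have hΨc : ∀ y ∈ Metric.closedBall b (2 * ρ),
      ContDiffAt ℝ 2 (fun z => f z - m * (Real.exp (-α * distSq b z) - E)) y := fun y hy =>
    (hf y hy).1.sub (contDiffAt_const.mul ((hhc y).sub contDiffAt_const))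
  have hmain := nonneg_of_barrier (isCompact_closedBall b (2 * ρ))
    (Ψ := fun z => f z - m * (Real.exp (-α * distSq b z) - E))
    (fun y hy => (hΨc y hy).continuousAt.continuousWithinAt) (fun y hy hneg => by
      have hfy := (hf y hy).2
      have hys : s < dist y b := by
        by_contra! h0
        have h1 := hfs y h0 hy
        have h2 : Real.exp (-α * distSq b y) ≤ 1 := Real.exp_le_one_iff.2 (by
          rw [distSq_eq]; nlinarith [mul_nonneg hα0.le (sq_nonneg ‖y - b‖)])
        have h3 : m * (Real.exp (-α * distSq b y) - E) ≤ m * 1 := by gcongr; linarith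
        linarith
      have hy2 : dist y b < 2 * ρ := by
        refine lt_of_le_of_ne hy fun h0 => ?_
        have h1 : Real.exp (-α * distSq b y) = E := by rw [distSq_eq, ← dist_eq_norm, h0]
        rw [h1] at hneg
        linarith
      obtain ⟨F, e, hF, hG, hs, hLf⟩ := hL y hy hys
      refine ⟨Metric.closedBall_mem_nhds_of_mem hy2, hΨc y hy, F, e, hF, ?_⟩
      rw [D2_sub (hf y hy).1 (contDiffAt_const.mul ((hhc y).sub contDiffAt_const)), Lop_sub,
        D2_const_mul ((hhc y).sub contDiffAt_const), Lop_smul]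
      have h0 : D2 (fun z => Real.exp (-α * distSq b z) - E) y
          = D2 (fun z => Real.exp (-α * distSq b z)) y := by
        have h6 : fderiv ℝ (fun z => Real.exp (-α * distSq b z) - E)
            = fderiv ℝ (fun z => Real.exp (-α * distSq b z)) := funext fun z => fderiv_sub_const E
        rw [D2, h6]
      rw [h0, Lop_exp_neg α (hqc y), Lop_distSq]
      have h1 : E ≤ Real.exp (-α * distSq b y) := by
        rw [hE, Real.exp_le_exp, distSq_eq]
        have h2 : ‖y - b‖ ^ 2 ≤ (2 * ρ) ^ 2 :=
          pow_le_pow_left₀ (norm_nonneg _) (by rw [← dist_eq_norm]; exact hy2.le) 2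
        nlinarith
      have h2 : α ≤ α ^ 2 * Gam F e (fderiv ℝ (distSq b) y) (fderiv ℝ (distSq b) y)
          - α * ∑ i, F i * ‖e i‖ ^ 2 := by
        have h3 : α * a = A + 1 := by rw [hα]; field_simp
        have h4 : α ^ 2 * a ≤ α ^ 2 * Gam F e (fderiv ℝ (distSq b) y) (fderiv ℝ (distSq b) y) := by gcongr
        have h5 : α * ∑ i, F i * ‖e i‖ ^ 2 ≤ α * A := by gcongr
        have h6 : α ^ 2 * a = α * A + α := by rw [sq, mul_assoc, h3]; ring
        linarith
      have h3 := mul_le_mul h1 h2 hα0.le (Real.exp_pos _).le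
      have h4 := mul_le_mul_of_nonneg_left h3 hm.le
      have h5 : 0 < m * (E * α) := by positivity
      linarith)
  intro y hy
  have h1 := hmain y (Metric.closedBall_subset_closedBall (by linarith) hy)
  have h2 : Real.exp (-α * ρ ^ 2) ≤ Real.exp (-α * distSq b y) := by
    rw [Real.exp_le_exp, distSq_eq]
    have h3 : ‖y - b‖ ^ 2 ≤ ρ ^ 2 :=
      pow_le_pow_left₀ (norm_nonneg _) (by rw [← dist_eq_norm]; exact hy) 2
    nlinarith
  nlinarith

theorem fderiv_distSq_apply_self (b y : Cn n) : fderiv ℝ (distSq b) y (y - b) = 2 * ‖y - b‖ ^ 2 := by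
  have h1 : ∀ c : Fin n ⊕ Fin n, HasFDerivAt (fun z => (coordL c z - coordL c b) * (coordL c z - coordL c b))
      ((coordL c y - coordL c b) • coordL c + (coordL c y - coordL c b) • coordL c) y := fun c =>
    ((coordL c).hasFDerivAt.sub_const _).mul ((coordL c).hasFDerivAt.sub_const _)
  have h2 : HasFDerivAt (distSq b) _ y := HasFDerivAt.fun_sum fun c (_ : c ∈ Finset.univ) => h1 c
  rw [h2.fderiv, ← distSq_eq, distSq, _root_.sum_apply, Finset.mul_sum]
  refine Finset.sum_congr rfl fun c _ => ?_
  simp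
  ring

/-- A family of functions on a ball that are almost supersolutions, with errors `ε` tending to zero
along a filter, of operators that are uniformly elliptic. -/
structure AlmostSupersolutions {ι : Type*} (f : ι → Cn n → ℝ) (ε : ι → ℝ) (p₀ : Cn n) (R : ℝ)
    (W : Cn n → Matrix (Fin n) (Fin n) ℂ) (c₀ C₀ : ℝ) : Prop where
  pos : 0 < c₀
  posDef : ∀ y ∈ Metric.closedBall p₀ R, (W y).PosDef
  continuousOn : ∀ k j, ContinuousOn (fun z => W z k j) (Metric.closedBall p₀ R)
  contDiffAt : ∀ i, ∀ y ∈ Metric.closedBall p₀ R, ContDiffAt ℝ 2 (f i) y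
  nonneg : ∀ i, ∀ y ∈ Metric.closedBall p₀ R, 0 ≤ f i y
  Lop_le : ∀ i, ∀ y ∈ Metric.closedBall p₀ R, ∃ (P : Matrix (Fin n) (Fin n) ℂ) (F : Fin n → ℝ),
    Pᴴ * W y * P = 1 ∧ (∀ k, c₀ ≤ F k ∧ F k ≤ C₀) ∧ Lop F (colVec P) (D2 (f i) y) ≤ ε i

/-- A positive lower bound near a point `b` spreads to a ball around `b` whose radius does not depend
on `b`. -/
theorem AlmostSupersolutions.eventually_ge [NeZero n] {ι : Type*} {lf : Filter ι} {f : ι → Cn n → ℝ}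
    {ε : ι → ℝ} {p₀ : Cn n} {ρ : ℝ} {W : Cn n → Matrix (Fin n) (Fin n) ℂ} {c₀ C₀ : ℝ} (hρ : 0 < ρ)
    (h : AlmostSupersolutions f ε p₀ (3 * ρ) W c₀ C₀) (hε : Filter.Tendsto ε lf (𝓝 0)) {b : Cn n}
    (hb : b ∈ Metric.ball p₀ ρ) {s m : ℝ} (hs : 0 < s) (hm : 0 < m)
    (hf : ∀ᶠ i in lf, ∀ y ∈ Metric.closedBall b s, m ≤ f i y) :
    ∃ c : ℝ, 0 < c ∧ ∀ᶠ i in lf, ∀ y ∈ Metric.closedBall b ρ, c ≤ f i y := by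
  have hsub : Metric.closedBall b (2 * ρ) ⊆ Metric.closedBall p₀ (3 * ρ) := by
    intro y hy
    have h1 : dist y b ≤ 2 * ρ := hy
    have h2 : dist b p₀ < ρ := hb
    exact Metric.mem_closedBall.2 (by linarith [dist_triangle y b p₀])
  have hK := isCompact_closedBall p₀ (3 * ρ)
  obtain ⟨C₁, hC₁, h1⟩ := exists_frame_bound hK h.continuousOn h.posDef
  obtain ⟨C₂, hC₂, h2⟩ := exists_sesq_colVec_bound hK h.continuousOn (R := C₁) (by linarith)
  set C := C₁ + C₂ + 2 * ρ + 1 / (2 * s ^ 2) with hC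
  have hs2 : 0 < 1 / (2 * s ^ 2) := by positivity
  have hC1 : 1 ≤ C := by linarith
  have hC0 : 0 < C := by linarith
  have hn : 0 < (n : ℝ) := by exact_mod_cast Nat.pos_of_ne_zero (NeZero.ne n)
  have hc₀ := h.pos
  obtain ⟨c, η, hc, hη, hprop⟩ := exists_propagation (n := n) (s := s) (a := c₀ / (8 * n * C ^ 6))
    (A := n * (|C₀| * C ^ 2)) hρ (by positivity) (by positivity)
  refine ⟨c * m, by positivity, ?_⟩
  have hev : ∀ᶠ i in lf, ε i < η * m := hε.eventually (gt_mem_nhds (by positivity))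
  filter_upwards [hf, hev] with i hfi hεi
  refine hprop (f i) b m hm (fun y hy => ⟨h.contDiffAt i y (hsub hy), h.nonneg i y (hsub hy)⟩)
    (fun y hy _ => hfi y hy) fun y hy hys => ?_
  obtain ⟨P, F, hP, hF, hL⟩ := h.Lop_le i y (hsub hy)
  have hfr := h1 y (hsub hy) P hP
  have hfrC : ∀ k, ‖colVec P k‖ ≤ C := fun k => (hfr k).trans (by linarith)
  refine ⟨F, colVec P, fun k => hc₀.le.trans (hF k).1, ?_, ?_, hL.trans hεi.le⟩
  · have hyb : ‖y - b‖ ≤ C := by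
      rw [← dist_eq_norm]
      have : dist y b ≤ 2 * ρ := hy
      linarith
    have h3 := Gam_self_ge hP hC1 (fun k ζ => (h2 y (hsub hy) _ ζ (hfr k)).trans (by gcongr; linarith))
      hyb (D := fderiv ℝ (distSq b) y) (by
        rw [fderiv_distSq_apply_self]
        have h4 : s ^ 2 ≤ ‖y - b‖ ^ 2 := pow_le_pow_left₀ hs.le (by rw [← dist_eq_norm]; exact hys.le) 2
        calc (1 : ℝ) = 1 / (2 * s ^ 2) * (2 * s ^ 2) := by field_simp
          _ ≤ C * (2 * ‖y - b‖ ^ 2) := by gcongr; linarith) hc₀.le (fun k => (hF k).1)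
    rw [div_le_iff₀ (by positivity)]
    linarith
  · calc ∑ k, F k * ‖colVec P k‖ ^ 2 ≤ ∑ _k : Fin n, |C₀| * C ^ 2 :=
          Finset.sum_le_sum fun k _ => mul_le_mul ((hF k).2.trans (le_abs_self _))
            (pow_le_pow_left₀ (norm_nonneg _) (hfrC k) 2) (by positivity) (abs_nonneg _)
      _ = _ := by simp

end Propagation

/-! ### Regions modelled on a half-space -/

section HalfSpace

variable {n : ℕ} [NeZero n]

/-- A region of `ℂⁿ` identified with a relatively open subset `V` of the half-space `{y | 0 ≤ y 0}`
by a diffeomorphism `Φ` with inverse `Θ`, both smooth up to the boundary. -/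
structure HalfSpaceModel (Ω : Set (Cn n)) (V : Set (EuclideanSpace ℝ (Fin (2 * n))))
    (Φ : Cn n → EuclideanSpace ℝ (Fin (2 * n))) (Θ : EuclideanSpace ℝ (Fin (2 * n)) → Cn n) : Prop where
  subset : V ⊆ {y | 0 ≤ y 0}
  mem_nhdsWithin : ∀ y ∈ V, V ∈ 𝓝[{y | 0 ≤ y 0}] y
  contDiffOn : ContDiffOn ℝ ∞ Φ Ω
  contDiffOn_inv : ContDiffOn ℝ ∞ Θ V
  mapsTo : MapsTo Φ Ω V
  mapsTo_inv : MapsTo Θ V Ω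
  left_inv : ∀ q ∈ Ω, Θ (Φ q) = q
  right_inv : ∀ y ∈ V, Φ (Θ y) = y

variable {Ω : Set (Cn n)} {V : Set (EuclideanSpace ℝ (Fin (2 * n)))}
    {Φ : Cn n → EuclideanSpace ℝ (Fin (2 * n))} {Θ : EuclideanSpace ℝ (Fin (2 * n)) → Cn n}

theorem uniqueDiffOn_halfSpace (m : ℕ) [NeZero m] :
    UniqueDiffOn ℝ {y : EuclideanSpace ℝ (Fin m) | 0 ≤ y 0} := by
  rw [← range_modelWithCornersEuclideanHalfSpace]
  exact (𝓡∂ m).uniqueDiffOn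

theorem finrank_Cn_eq : Module.finrank ℝ (EuclideanSpace ℝ (Fin (2 * n))) = Module.finrank ℝ (Cn n) := by
  rw [finrank_euclideanSpace, Fintype.card_fin, ← Module.finrank_mul_finrank ℝ ℂ (Cn n),
    Complex.finrank_real_complex, finrank_euclideanSpace, Fintype.card_fin]

namespace HalfSpaceModel

variable (h : HalfSpaceModel Ω V Φ Θ)
include h

theorem uniqueDiffOn_V : UniqueDiffOn ℝ V := fun y hy =>
  (uniqueDiffOn_halfSpace (2 * n) y (h.subset hy)).mono_nhds
    (nhdsWithin_le_of_mem (h.mem_nhdsWithin y hy))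

theorem comp_eq_id {q : Cn n} (hq : q ∈ Ω) :
    (fderivWithin ℝ Φ Ω q).comp (fderivWithin ℝ Θ V (Φ q)) = ContinuousLinearMap.id ℝ _ := by
  have hy := h.mapsTo hq
  have h1 : HasFDerivWithinAt Θ (fderivWithin ℝ Θ V (Φ q)) V (Φ q) :=
    (h.contDiffOn_inv.differentiableOn (by simp) _ hy).hasFDerivWithinAt
  have h2 : HasFDerivWithinAt Φ (fderivWithin ℝ Φ Ω q) Ω (Θ (Φ q)) := by
    rw [h.left_inv q hq]
    exact (h.contDiffOn.differentiableOn (by simp) q hq).hasFDerivWithinAt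
  have h3 := h2.comp (Φ q) h1 h.mapsTo_inv
  have h4 : HasFDerivWithinAt (Φ ∘ Θ) (ContinuousLinearMap.id ℝ _) V (Φ q) :=
    (hasFDerivWithinAt_id (Φ q) V).congr (fun y hy => h.right_inv y hy) (h.right_inv _ hy)
  exact (h.uniqueDiffOn_V (Φ q) hy).eq h3 h4

theorem comp_eq_id' {q : Cn n} (hq : q ∈ Ω) :
    (fderivWithin ℝ Θ V (Φ q)).comp (fderivWithin ℝ Φ Ω q) = ContinuousLinearMap.id ℝ _ := by
  have h1 := h.comp_eq_id hq
  have hinj : Function.Injective (fderivWithin ℝ Θ V (Φ q)) := by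
    intro a b hab
    have h2 := congrArg (fderivWithin ℝ Φ Ω q) hab
    rw [← ContinuousLinearMap.comp_apply, ← ContinuousLinearMap.comp_apply, h1] at h2
    exact h2
  have hsurj : Function.Surjective (fderivWithin ℝ Θ V (Φ q)) :=
    (LinearMap.injective_iff_surjective_of_finrank_eq_finrank
      (f := (fderivWithin ℝ Θ V (Φ q) : EuclideanSpace ℝ (Fin (2 * n)) →ₗ[ℝ] Cn n)) finrank_Cn_eq).1 hinj
  ext1 ξ
  obtain ⟨η, rfl⟩ := hsurj ξ
  have h2 : fderivWithin ℝ Φ Ω q (fderivWithin ℝ Θ V (Φ q) η) = η := by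
    rw [← ContinuousLinearMap.comp_apply, h1]; rfl
  simp [h2]

theorem image_eq : Θ '' V = Ω := by
  ext q
  constructor
  · rintro ⟨y, hy, rfl⟩
    exact h.mapsTo_inv hy
  · exact fun hq => ⟨Φ q, h.mapsTo hq, h.left_inv q hq⟩

theorem surjective_deriv {q : Cn n} (hq : q ∈ Ω) :
    Function.Surjective (fderivWithin ℝ Θ V (Φ q)) := fun ξ =>
  ⟨fderivWithin ℝ Φ Ω q ξ, by rw [← ContinuousLinearMap.comp_apply, h.comp_eq_id' hq]; rfl⟩

theorem uniqueDiffOn : UniqueDiffOn ℝ Ω := by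
  intro q hq
  have hy := h.mapsTo hq
  have h1 : HasFDerivWithinAt Θ (fderivWithin ℝ Θ V (Φ q)) V (Φ q) :=
    (h.contDiffOn_inv.differentiableOn (by simp) _ hy).hasFDerivWithinAt
  have h2 := h1.uniqueDiffWithinAt (h.uniqueDiffOn_V _ hy) (h.surjective_deriv hq).denseRange
  rwa [h.image_eq, h.left_inv q hq] at h2

theorem fderivWithin_coord {q : Cn n} (hq : q ∈ Ω) (ξ : Cn n) :
    fderivWithin ℝ (fun z => Φ z 0) Ω q ξ = (fderivWithin ℝ Φ Ω q ξ) 0 := by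
  have h1 : HasFDerivWithinAt Φ (fderivWithin ℝ Φ Ω q) Ω q :=
    (h.contDiffOn.differentiableOn (by simp) q hq).hasFDerivWithinAt
  have h2 := (EuclideanSpace.proj (0 : Fin (2 * n)) : EuclideanSpace ℝ (Fin (2 * n)) →L[ℝ] ℝ).hasFDerivAt.comp_hasFDerivWithinAt
    q h1
  have h3 := h2.fderivWithin (h.uniqueDiffOn q hq)
  exact congrArg (fun L => L ξ) h3

/-- A region modelled on a half-space has a smooth boundary, with the first coordinate of the
half-space as defining function. -/
theorem boundaryRegion : BoundaryRegion Ω (fun q => Φ q 0) where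
  uniqueDiffOn := h.uniqueDiffOn
  contDiffOn := (EuclideanSpace.proj (0 : Fin (2 * n)) :
    EuclideanSpace ℝ (Fin (2 * n)) →L[ℝ] ℝ).contDiff.comp_contDiffOn h.contDiffOn
  nonneg q hq := h.subset (h.mapsTo hq)
  mem_nhds q hq hd := by
    have hy := h.mapsTo hq
    have hVy : V ∈ 𝓝 (Φ q) := by
      have h1 : {y : EuclideanSpace ℝ (Fin (2 * n)) | 0 ≤ y 0} ∈ 𝓝 (Φ q) := by
        rw [← range_modelWithCornersEuclideanHalfSpace]
        refine mem_interior_iff_mem_nhds.1 ?_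
        rw [interior_range_modelWithCornersEuclideanHalfSpace]
        exact hd
      have h2 := h.mem_nhdsWithin _ hy
      rwa [nhdsWithin_eq_nhds.2 h1] at h2
    have h3 : HasStrictFDerivAt Θ (fderivWithin ℝ Θ V (Φ q)) (Φ q) := by
      rw [fderivWithin_of_mem_nhds hVy]
      exact (h.contDiffOn_inv.contDiffAt hVy).hasStrictFDerivAt (by simp)
    have h4 := h3.map_nhds_eq_of_surj (LinearMap.range_eq_top.2 (h.surjective_deriv hq))
    rw [h.left_inv q hq] at h4
    rw [← h4, ← h.image_eq]
    exact Filter.image_mem_map hVy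
  deriv_nonneg q hq hd f f' hf hmin ξ hξ := by
    have hy := h.mapsTo hq
    rw [h.fderivWithin_coord hq] at hξ
    set η := fderivWithin ℝ Φ Ω q ξ with hη
    have h1 : HasFDerivWithinAt Θ (fderivWithin ℝ Θ V (Φ q)) V (Φ q) :=
      (h.contDiffOn_inv.differentiableOn (by simp) _ hy).hasFDerivWithinAt
    have h2 : HasFDerivWithinAt f f' Ω (Θ (Φ q)) := by rwa [h.left_inv q hq]
    have h3 := h2.comp (Φ q) h1 h.mapsTo_inv
    have h4 : IsLocalMinOn (f ∘ Θ) V (Φ q) := by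
      have h5 : IsLocalMinOn f Ω (Θ (Φ q)) := by rwa [h.left_inv q hq]
      exact h5.comp_tendsto (h1.continuousWithinAt.tendsto_nhdsWithin h.mapsTo_inv)
    have h5 : η ∈ posTangentConeAt V (Φ q) := by
      refine mem_posTangentConeAt_of_frequently_mem (Filter.Eventually.frequently ?_)
      have h6 : Filter.Tendsto (fun t : ℝ => Φ q + t • η) (𝓝[>] 0) (𝓝[{y | 0 ≤ y 0}] (Φ q)) := by
        refine tendsto_nhdsWithin_iff.2 ⟨?_, ?_⟩
        · have : Continuous fun t : ℝ => Φ q + t • η := by fun_prop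
          have h7 := this.tendsto 0
          simp only [zero_smul, add_zero] at h7
          exact h7.mono_left nhdsWithin_le_nhds
        · filter_upwards [self_mem_nhdsWithin] with t ht
          show 0 ≤ (Φ q + t • η) 0
          simp only [PiLp.add_apply, PiLp.smul_apply, smul_eq_mul]
          have : Φ q 0 = 0 := hd
          rw [this, zero_add]
          exact mul_nonneg (le_of_lt ht) hξ
      exact h6.eventually (h.mem_nhdsWithin _ hy)
    have h6 := h4.hasFDerivWithinAt_nonneg h3 h5
    have h7 : fderivWithin ℝ Θ V (Φ q) η = ξ := by
      rw [hη, ← ContinuousLinearMap.comp_apply, h.comp_eq_id' hq]; rfl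
    rwa [ContinuousLinearMap.comp_apply, h7] at h6
  exists_deriv_pos q hq _ := by
    refine ⟨fderivWithin ℝ Θ V (Φ q) (EuclideanSpace.single 0 1), ?_⟩
    rw [h.fderivWithin_coord hq, ← ContinuousLinearMap.comp_apply, h.comp_eq_id hq]
    simp
  locallyCompact q hq := by
    have hy := h.mapsTo hq
    obtain ⟨ε, hε, hεV⟩ := Metric.mem_nhdsWithin_iff.1 (h.mem_nhdsWithin _ hy)
    have hcl : IsClosed {y : EuclideanSpace ℝ (Fin (2 * n)) | 0 ≤ y 0} := by
      rw [← range_modelWithCornersEuclideanHalfSpace]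
      exact (𝓡∂ (2 * n)).isClosed_range
    set K := Metric.closedBall (Φ q) (ε / 2) ∩ {y : EuclideanSpace ℝ (Fin (2 * n)) | 0 ≤ y 0} with hK
    have hKc : IsCompact K := (isCompact_closedBall _ _).inter_right hcl
    have hKV : K ⊆ V := fun y hy => hεV ⟨Metric.closedBall_subset_ball (by linarith) hy.1, hy.2⟩
    have hcont := h.contDiffOn.continuousOn q hq
    obtain ⟨r, hr, hrΩ⟩ := Metric.mem_nhdsWithin_iff.1
      (hcont.eventually (Metric.closedBall_mem_nhds (Φ q) (half_pos hε)))
    refine ⟨r / 2, by positivity, ?_⟩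
    have h1 : Ω ∩ Metric.closedBall q (r / 2) = Θ '' K ∩ Metric.closedBall q (r / 2) := by
      ext z
      constructor
      · rintro ⟨hz, hzr⟩
        exact ⟨⟨Φ z, ⟨hrΩ ⟨Metric.closedBall_subset_ball (by linarith) hzr, hz⟩, h.subset (h.mapsTo hz)⟩,
          h.left_inv z hz⟩, hzr⟩
      · rintro ⟨⟨y, hy, rfl⟩, hzr⟩
        exact ⟨h.mapsTo_inv (hKV hy), hzr⟩
    rw [h1]
    exact (hKc.image_of_continuousOn (h.contDiffOn_inv.continuousOn.mono hKV)).inter_right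
      Metric.isClosed_closedBall

end HalfSpaceModel

end HalfSpace

/-! ### Holomorphic charts -/

section Charts

variable {n : ℕ} [NeZero n] {M : Type*} [TopologicalSpace M]
  [ChartedSpace (EuclideanHalfSpace (2 * n)) M]
  {J : ∀ x : M, TangentSpace (𝓡∂ (2 * n)) x →L[ℝ] TangentSpace (𝓡∂ (2 * n)) x}
  {z : PartialEquiv M (Cn n)}

/-- The restriction of a coordinate system to an open subset. -/
theorem IsHolomorphicChart.restr (hz : IsHolomorphicChart J z) {s : Set M} (hs : IsOpen s) :
    IsHolomorphicChart J (z.restr s) where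
  isOpen_source := hz.isOpen_source.inter hs
  contMDiffOn := hz.contMDiffOn.mono inter_subset_left
  contMDiffOn_symm := hz.contMDiffOn_symm.mono inter_subset_left
  mfderiv_J x hx v := hz.mfderiv_J x hx.1 v

variable [IsManifold (𝓡∂ (2 * n)) ∞ M]

/-- A coordinate system, restricted to the domain of a chart of the smooth structure, identifies its
target with part of a half-space. -/
theorem IsHolomorphicChart.halfSpaceModel (hz : IsHolomorphicChart J z) (x₀ : M)
    (hsub : z.source ⊆ (chartAt (EuclideanHalfSpace (2 * n)) x₀).source) :
    HalfSpaceModel z.target ((extChartAt (𝓡∂ (2 * n)) x₀).target ∩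
        (extChartAt (𝓡∂ (2 * n)) x₀).symm ⁻¹' z.source)
      (extChartAt (𝓡∂ (2 * n)) x₀ ∘ z.symm) (z ∘ (extChartAt (𝓡∂ (2 * n)) x₀).symm) := by
  have hsub' : z.source ⊆ (extChartAt (𝓡∂ (2 * n)) x₀).source := by rwa [extChartAt_source]
  set e := extChartAt (𝓡∂ (2 * n)) x₀ with he
  refine ⟨?_, ?_, ?_, ?_, ?_, ?_, ?_, ?_⟩
  · rw [← range_modelWithCornersEuclideanHalfSpace]
    exact inter_subset_left.trans (extChartAt_target_subset_range x₀)
  · intro y hy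
    rw [← range_modelWithCornersEuclideanHalfSpace]
    have h1 := extChartAt_target_mem_nhdsWithin_of_mem hy.1
    have h2 : ContinuousWithinAt e.symm (range (𝓡∂ (2 * n))) y :=
      (continuousOn_extChartAt_symm x₀ y hy.1).mono_of_mem_nhdsWithin h1
    exact Filter.inter_mem h1 (h2.preimage_mem_nhdsWithin (hz.isOpen_source.mem_nhds hy.2))
  · rw [← contMDiffOn_iff_contDiffOn]
    exact (contMDiffOn_extChartAt (x := x₀)).comp hz.contMDiffOn_symm
      fun q hq => hsub (z.map_target hq)
  · rw [← contMDiffOn_iff_contDiffOn]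
    exact hz.contMDiffOn.comp ((contMDiffOn_extChartAt_symm x₀).mono inter_subset_left)
      fun y hy => hy.2
  · intro q hq
    have h1 := hsub' (z.map_target hq)
    refine ⟨e.map_source h1, ?_⟩
    show e.symm (e (z.symm q)) ∈ z.source
    rw [e.left_inv h1]
    exact z.map_target hq
  · exact fun y hy => z.map_source hy.2
  · intro q hq
    show z (e.symm (e (z.symm q))) = q
    rw [e.left_inv (hsub' (z.map_target hq)), z.right_inv hq]
  · intro y hy
    show e (z.symm (z (e.symm y))) = y
    rw [z.left_inv hy.2, e.right_inv hy.1]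

theorem isBoundaryPoint_iff_coord (x₀ : M) {x : M}
    (hx : x ∈ (chartAt (EuclideanHalfSpace (2 * n)) x₀).source) :
    x ∈ (𝓡∂ (2 * n)).boundary M ↔ extChartAt (𝓡∂ (2 * n)) x₀ x 0 = 0 := by
  have h1 := ModelWithCorners.isInteriorPoint_iff_of_mem_atlas (I := 𝓡∂ (2 * n)) (n := ∞) (by simp)
    (chart_mem_atlas (EuclideanHalfSpace (2 * n)) x₀) hx
  have h2 : (𝓡∂ (2 * n)).IsInteriorPoint x ↔ 0 < extChartAt (𝓡∂ (2 * n)) x₀ x 0 := by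
    have h3 : extChartAt (𝓡∂ (2 * n)) x₀ x ∈ interior (range (𝓡∂ (2 * n)))
        ↔ 0 < extChartAt (𝓡∂ (2 * n)) x₀ x 0 := by
      rw [interior_range_modelWithCornersEuclideanHalfSpace]; rfl
    rw [h1, ← h3]
    exact ⟨fun h => OpenPartialHomeomorph.interior_extend_target_subset_interior_range _ h,
      fun h => OpenPartialHomeomorph.mem_interior_extend_target _
        ((chartAt (EuclideanHalfSpace (2 * n)) x₀).map_source hx) h⟩
  have h4 : 0 ≤ extChartAt (𝓡∂ (2 * n)) x₀ x 0 := by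
    have h5 : extChartAt (𝓡∂ (2 * n)) x₀ x ∈ range (𝓡∂ (2 * n)) := mem_range_self _
    rw [range_modelWithCornersEuclideanHalfSpace] at h5
    exact h5
  show (𝓡∂ (2 * n)).IsBoundaryPoint x ↔ _
  rw [ModelWithCorners.isBoundaryPoint_iff_not_isInteriorPoint, h2, not_lt]
  exact ⟨fun h => le_antisymm h h4, fun h => h.le⟩

end Charts

/-! ### Forms and metrics in holomorphic charts -/

section Forms

theorem I_smul_dx {n : ℕ} (k : Fin n) : Complex.I • (Cn.dx k : Cn n) = Cn.dy k := by
  ext j; simp [Cn.dx, Cn.dy]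

theorem I_smul_dy {n : ℕ} (k : Fin n) : Complex.I • (Cn.dy k : Cn n) = -Cn.dx k := by
  rw [← I_smul_dx, smul_I_I]

variable {n : ℕ} [NeZero n] {M : Type*} [TopologicalSpace M]
  [ChartedSpace (EuclideanHalfSpace (2 * n)) M]
  {J : ∀ x : M, TangentSpace (𝓡∂ (2 * n)) x →L[ℝ] TangentSpace (𝓡∂ (2 * n)) x}
  {z : PartialEquiv M (Cn n)}

/-- The differential of the inverse of a coordinate system. -/
def symmDeriv (z : PartialEquiv M (Cn n)) (q : Cn n) : Cn n →L[ℝ] EuclideanSpace ℝ (Fin (2 * n)) :=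
  mfderivWithin 𝓘(ℝ, Cn n) (𝓡∂ (2 * n)) z.symm z.target q

/-- The bilinear form on `ℂⁿ` associated with the components of a `(1,1)`-form in coordinates. -/
def formB (b : ∀ x : M, TangentSpace (𝓡∂ (2 * n)) x →L[ℝ] TangentSpace (𝓡∂ (2 * n)) x →L[ℝ] ℝ)
    (z : PartialEquiv M (Cn n)) (q : Cn n) : Cn n →L[ℝ] Cn n →L[ℝ] ℝ :=
  (ContinuousLinearMap.bilinearComp
    (b (z.symm q) : EuclideanSpace ℝ (Fin (2 * n)) →L[ℝ] EuclideanSpace ℝ (Fin (2 * n)) →L[ℝ] ℝ)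
    (symmDeriv z q) (symmDeriv z q)).flip.comp
    ((Complex.I • ContinuousLinearMap.id ℂ (Cn n)).restrictScalars ℝ)

theorem formB_apply (b : ∀ x : M, TangentSpace (𝓡∂ (2 * n)) x →L[ℝ] TangentSpace (𝓡∂ (2 * n)) x →L[ℝ] ℝ)
    (z : PartialEquiv M (Cn n)) (q ξ η : Cn n) :
    formB b z q ξ η = b (z.symm q) (symmDeriv z q η) (symmDeriv z q (Complex.I • ξ)) := rfl

theorem formMatrix_eq (b : ∀ x : M, TangentSpace (𝓡∂ (2 * n)) x →L[ℝ] TangentSpace (𝓡∂ (2 * n)) x →L[ℝ] ℝ)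
    (z : PartialEquiv M (Cn n)) (q : Cn n) : formMatrix b z q = matForm (formB b z q) := by
  ext k j
  obtain ⟨B, hB⟩ : ∃ B : EuclideanSpace ℝ (Fin (2 * n)) →L[ℝ] EuclideanSpace ℝ (Fin (2 * n)) →L[ℝ] ℝ,
    B = b (z.symm q) := ⟨_, rfl⟩
  have hp : ∀ v w, pullbackForm b z q v w = B (symmDeriv z q v) (symmDeriv z q w) := fun v w => by
    rw [hB]; rfl
  have hf : ∀ ξ η, formB b z q ξ η = B (symmDeriv z q η) (symmDeriv z q (Complex.I • ξ)) :=
    fun ξ η => by rw [hB]; rfl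
  simp only [formMatrix, matForm, Matrix.of_apply, hp, hf, I_smul_dx, I_smul_dy, map_neg]
  apply Complex.ext <;> simp <;> ring

theorem IsHolomorphicChart.continuousOn (hz : IsHolomorphicChart J z) : ContinuousOn z z.source :=
  hz.contMDiffOn.continuousOn

theorem IsHolomorphicChart.continuousOn_symm (hz : IsHolomorphicChart J z) :
    ContinuousOn z.symm z.target :=
  hz.contMDiffOn_symm.continuousOn

theorem IsHolomorphicChart.mdifferentiableAt (hz : IsHolomorphicChart J z) {x : M} (hx : x ∈ z.source) :
    MDifferentiableAt (𝓡∂ (2 * n)) 𝓘(ℝ, Cn n) z x :=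
  (hz.contMDiffOn.contMDiffAt (hz.isOpen_source.mem_nhds hx)).mdifferentiableAt (by simp)

theorem IsHolomorphicChart.mdifferentiableWithinAt_symm (hz : IsHolomorphicChart J z) {q : Cn n}
    (hq : q ∈ z.target) :
    MDifferentiableWithinAt 𝓘(ℝ, Cn n) (𝓡∂ (2 * n)) z.symm z.target q :=
  (hz.contMDiffOn_symm q hq).mdifferentiableWithinAt (by simp)

variable [IsManifold (𝓡∂ (2 * n)) ∞ M]

theorem IsHolomorphicChart.uniqueDiffOn (hz : IsHolomorphicChart J z) : UniqueDiffOn ℝ z.target := by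
  intro q hq
  have h1 := (hz.restr (chartAt (EuclideanHalfSpace (2 * n)) (z.symm q)).open_source).halfSpaceModel
    (z.symm q) inter_subset_right
  exact (h1.uniqueDiffOn q ⟨hq, mem_chart_source _ _⟩).mono inter_subset_left

theorem IsHolomorphicChart.chartDeriv_symmDeriv (hz : IsHolomorphicChart J z) {q : Cn n}
    (hq : q ∈ z.target) (ξ : Cn n) : chartDeriv z (z.symm q) (symmDeriv z q ξ) = ξ := by
  have hu : UniqueMDiffWithinAt 𝓘(ℝ, Cn n) z.target q := (hz.uniqueDiffOn q hq).uniqueMDiffWithinAt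
  have h1 := mfderiv_comp_mfderivWithin q (hz.mdifferentiableAt (z.map_target hq))
    (hz.mdifferentiableWithinAt_symm hq) hu
  have h2 : mfderivWithin 𝓘(ℝ, Cn n) 𝓘(ℝ, Cn n) (z ∘ z.symm) z.target q
      = mfderivWithin 𝓘(ℝ, Cn n) 𝓘(ℝ, Cn n) id z.target q :=
    mfderivWithin_congr (fun y hy => z.right_inv hy) (z.right_inv hq)
  rw [mfderivWithin_id hu] at h2
  rw [h2] at h1
  exact (congrArg (fun L => L ξ) h1).symm

theorem IsHolomorphicChart.symmDeriv_chartDeriv (hz : IsHolomorphicChart J z) {q : Cn n}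
    (hq : q ∈ z.target) (v : EuclideanSpace ℝ (Fin (2 * n))) :
    symmDeriv z q (chartDeriv z (z.symm q) v) = v := by
  have hinj : Function.Injective (symmDeriv z q) := fun a b hab => by
    have h1 : chartDeriv z (z.symm q) (symmDeriv z q a) = chartDeriv z (z.symm q) (symmDeriv z q b) := by
      rw [hab]
    rw [hz.chartDeriv_symmDeriv hq, hz.chartDeriv_symmDeriv hq] at h1
    exact h1
  have hsurj : Function.Surjective (symmDeriv z q) :=
    (LinearMap.injective_iff_surjective_of_finrank_eq_finrank
      (f := (symmDeriv z q : Cn n →ₗ[ℝ] EuclideanSpace ℝ (Fin (2 * n)))) finrank_Cn_eq.symm).1 hinj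
  obtain ⟨ξ, rfl⟩ := hsurj v
  rw [hz.chartDeriv_symmDeriv hq]

theorem IsHolomorphicChart.symmDeriv_I_smul (hz : IsHolomorphicChart J z) {q : Cn n}
    (hq : q ∈ z.target) (ξ : Cn n) :
    symmDeriv z q (Complex.I • ξ) = J (z.symm q) (symmDeriv z q ξ) := by
  have h1 := hz.mfderiv_J (z.symm q) (z.map_target hq) (symmDeriv z q ξ)
  rw [hz.chartDeriv_symmDeriv hq] at h1
  rw [← h1]
  exact hz.symmDeriv_chartDeriv hq _

theorem IsHolomorphicChart.symmDeriv_eq_zero (hz : IsHolomorphicChart J z) {q : Cn n}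
    (hq : q ∈ z.target) {ξ : Cn n} (h : symmDeriv z q ξ = 0) : ξ = 0 := by
  rw [← hz.chartDeriv_symmDeriv hq ξ, h]
  exact map_zero _

variable {S : ComplexStructure n M}

theorem apply_comm_of_alternating {E : Type*} [AddCommGroup E] [Module ℝ E] [TopologicalSpace E]
    {B : E →L[ℝ] E →L[ℝ] ℝ} {T : E →L[ℝ] E} (hB : ∀ v, B v v = 0) (hT : ∀ v, T (T v) = -v)
    (hBT : ∀ v w, B (T v) (T w) = B v w) (v w : E) : B v (T w) = B w (T v) := by
  have h1 := hB (T v + w)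
  have h2 := hB (T v)
  have h3 := hB w
  have h4 := hBT v (T w)
  rw [hT, map_neg] at h4
  simp only [map_add, _root_.add_apply, h2, h3] at h1
  linarith

theorem Real11Form.formB_eq (b : Real11Form S) (hz : IsHolomorphicChart S.J z) {q : Cn n}
    (hq : q ∈ z.target) (ξ η : Cn n) : formB b.toFun z q ξ η
      = b.toFun (z.symm q) (symmDeriv z q η) (S.J (z.symm q) (symmDeriv z q ξ)) := by
  rw [formB_apply, hz.symmDeriv_I_smul hq]

theorem Real11Form.formB_symm (b : Real11Form S) (hz : IsHolomorphicChart S.J z) {q : Cn n}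
    (hq : q ∈ z.target) (ξ η : Cn n) : formB b.toFun z q ξ η = formB b.toFun z q η ξ := by
  rw [b.formB_eq hz hq, b.formB_eq hz hq]
  exact apply_comm_of_alternating (b.alternating _) (S.J_sq _) (b.invariant _) _ _

open Matrix
open scoped ComplexOrder

theorem Real11Form.isHermitian (b : Real11Form S) (hz : IsHolomorphicChart S.J z) {q : Cn n}
    (hq : q ∈ z.target) : (formMatrix b.toFun z q).IsHermitian := by
  rw [formMatrix_eq]
  exact matForm_isHermitian (b.formB_symm hz hq)

theorem Real11Form.IsHermitianMetric.posDef {ω₀ : Real11Form S} (hω : ω₀.IsHermitianMetric)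
    (hz : IsHolomorphicChart S.J z) {q : Cn n} (hq : q ∈ z.target) :
    (formMatrix ω₀.toFun z q).PosDef := by
  have hpos : ∀ ξ : Cn n, ξ ≠ 0 → 0 < formB ω₀.toFun z q ξ ξ := fun ξ hξ => by
    rw [ω₀.formB_eq hz hq]
    exact hω _ _ fun h => hξ (hz.symmDeriv_eq_zero hq h)
  refine PosDef.of_dotProduct_mulVec_pos (ω₀.isHermitian hz hq) fun x hx => ?_
  set ξ : Cn n := WithLp.toLp 2 x with hξ
  have hξ0 : ξ ≠ 0 := fun h => hx (by ext k; exact congrArg (fun v : Cn n => v k) h)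
  have h1 : star x ⬝ᵥ (formMatrix ω₀.toFun z q *ᵥ x) = sesq (formMatrix ω₀.toFun z q) ξ ξ := by
    simp only [sesq, dotProduct, mulVec, Finset.mul_sum]
    exact Finset.sum_congr rfl fun k _ => Finset.sum_congr rfl fun j _ => by simp [hξ, mul_assoc]
  have hI : Complex.I • ξ ≠ 0 := smul_ne_zero Complex.I_ne_zero hξ0
  have h2 : sesq (formMatrix ω₀.toFun z q) ξ ξ = ((1 / 4 * (formB ω₀.toFun z q ξ ξ
      + formB ω₀.toFun z q (Complex.I • ξ) (Complex.I • ξ)) : ℝ) : ℂ) := by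
    rw [formMatrix_eq, sesq_matForm, ω₀.formB_symm hz hq (Complex.I • ξ) ξ, sub_self]
    push_cast
    ring
  rw [h1, h2, Complex.zero_lt_real]
  have := hpos ξ hξ0
  have := hpos _ hI
  positivity

end Forms

/-! ### The complex Hessian -/

section Hessian

variable {n : ℕ} {Ω : Set (Cn n)} {u : Cn n → ℝ} {q : Cn n}

theorem fderivWithin_ofReal (hΩ : UniqueDiffOn ℝ Ω) (hu : DifferentiableOn ℝ u Ω) {y : Cn n} (hy : y ∈ Ω)
    (ξ : Cn n) : fderivWithin ℝ (fun w => (u w : ℂ)) Ω y ξ = (fderivWithin ℝ u Ω y ξ : ℂ) := by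
  have h1 := Complex.ofRealCLM.hasFDerivAt.comp_hasFDerivWithinAt y (hu y hy).hasFDerivWithinAt
  have h2 := h1.fderivWithin (hΩ y hy)
  exact congrArg (fun L => L ξ) h2

theorem dz_eq (hΩ : UniqueDiffOn ℝ Ω) (hu : DifferentiableOn ℝ u Ω) {y : Cn n} (hy : y ∈ Ω) (j : Fin n) :
    Cn.dz Ω j (fun w => (u w : ℂ)) y
      = (1 / 2) * ((fderivWithin ℝ u Ω y (Cn.dx j) : ℂ) - Complex.I * fderivWithin ℝ u Ω y (Cn.dy j)) := by
  rw [Cn.dz, fderivWithin_ofReal hΩ hu hy, fderivWithin_ofReal hΩ hu hy]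

theorem dzbar_eq (hΩ : UniqueDiffOn ℝ Ω) (hu : DifferentiableOn ℝ u Ω) {y : Cn n} (hy : y ∈ Ω) (j : Fin n) :
    Cn.dzbar Ω j (fun w => (u w : ℂ)) y
      = (1 / 2) * ((fderivWithin ℝ u Ω y (Cn.dx j) : ℂ) + Complex.I * fderivWithin ℝ u Ω y (Cn.dy j)) := by
  rw [Cn.dzbar, fderivWithin_ofReal hΩ hu hy, fderivWithin_ofReal hΩ hu hy]

/-- The complex Hessian in terms of the real second derivative. -/
theorem hess_eq (hΩ : UniqueDiffOn ℝ Ω) (hu : ContDiffOn ℝ 2 u Ω) (hq : q ∈ Ω) :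
    Cn.hess Ω u q = matForm (D2w Ω u q) := by
  have hud := hu.differentiableOn (by norm_num)
  have h2 : ∀ ζ, HasFDerivWithinAt (fun y => fderivWithin ℝ u Ω y ζ) ((D2w Ω u q).flip ζ) Ω q := by
    intro ζ
    have h2 : DifferentiableWithinAt ℝ (fderivWithin ℝ u Ω) Ω q :=
      (hu.fderivWithin hΩ (m := 1) (by norm_num)).differentiableOn (by norm_num) q hq
    simpa using h2.hasFDerivWithinAt.clm_apply (hasFDerivWithinAt_const ζ q Ω)
  have h3 : ∀ j, HasFDerivWithinAt (fun y => Cn.dz Ω j (fun w => (u w : ℂ)) y)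
      (((1 / 2 : ℂ)) • (Complex.ofRealCLM.comp ((D2w Ω u q).flip (Cn.dx j))
        - Complex.I • Complex.ofRealCLM.comp ((D2w Ω u q).flip (Cn.dy j)))) Ω q := by
    intro j
    have h4 := ((Complex.ofRealCLM.hasFDerivAt.comp_hasFDerivWithinAt q (h2 (Cn.dx j))).sub
      ((Complex.ofRealCLM.hasFDerivAt.comp_hasFDerivWithinAt q (h2 (Cn.dy j))).const_smul
        Complex.I)).const_smul (1 / 2 : ℂ)
    refine h4.congr (fun y hy => ?_) ?_
    · rw [dz_eq hΩ hud hy]; rfl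
    · rw [dz_eq hΩ hud hq]; rfl
  ext k j
  simp only [Cn.hess, Matrix.of_apply, Cn.dzbar, (h3 j).fderivWithin (hΩ q hq), matForm]
  apply Complex.ext
  · simp; ring
  · simp; ring

end Hessian

/-! ### Change of holomorphic coordinates -/

section ComplexHessianComp

variable {n : ℕ} {Ω Ω' : Set (Cn n)} {Φ : Cn n → Cn n} {U : Cn n → ℝ} {q : Cn n}

theorem D2w_comp (hΩ : UniqueDiffOn ℝ Ω) (hΩ' : UniqueDiffOn ℝ Ω') (hΦ : ContDiffOn ℝ 2 Φ Ω)
    (hmaps : MapsTo Φ Ω Ω') (hU : ContDiffOn ℝ 2 U Ω') (hq : q ∈ Ω) (ξ η : Cn n) :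
    D2w Ω (U ∘ Φ) q ξ η = D2w Ω' U (Φ q) (fderivWithin ℝ Φ Ω q ξ) (fderivWithin ℝ Φ Ω q η)
      + fderivWithin ℝ U Ω' (Φ q) (fderivWithin ℝ (fderivWithin ℝ Φ Ω) Ω q ξ η) := by
  have hΦd := hΦ.differentiableOn (by norm_num)
  have hUd := hU.differentiableOn (by norm_num)
  have h1 : ∀ y ∈ Ω, fderivWithin ℝ (U ∘ Φ) Ω y
      = (fderivWithin ℝ U Ω' (Φ y)).comp (fderivWithin ℝ Φ Ω y) := fun y hy =>
    fderivWithin_comp y (hUd _ (hmaps hy)) (hΦd y hy) hmaps (hΩ y hy)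
  have h2 : HasFDerivWithinAt (fderivWithin ℝ Φ Ω) (fderivWithin ℝ (fderivWithin ℝ Φ Ω) Ω q) Ω q :=
    ((hΦ.fderivWithin hΩ (m := 1) (by norm_num)).differentiableOn (by norm_num) q hq).hasFDerivWithinAt
  have h3 : HasFDerivWithinAt (fderivWithin ℝ U Ω') (D2w Ω' U (Φ q)) Ω' (Φ q) :=
    ((hU.fderivWithin hΩ' (m := 1) (by norm_num)).differentiableOn (by norm_num) _
      (hmaps hq)).hasFDerivWithinAt
  have h4 := (h3.comp q (hΦd q hq).hasFDerivWithinAt hmaps).clm_comp h2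
  have h5 := (h4.congr h1 (h1 q hq)).fderivWithin (hΩ q hq)
  rw [D2w, h5]
  simp [add_comm]

/-- The complex Hessian is invariant under holomorphic changes of coordinates: the first derivative
of `U` enters through the `(1,1)`-part of the second derivative of `Φ`, which vanishes. -/
theorem sesq_matForm_D2w_comp (hΩ : UniqueDiffOn ℝ Ω) (hcl : Ω ⊆ closure (interior Ω))
    (hΩ' : UniqueDiffOn ℝ Ω') (hΦ : ContDiffOn ℝ 2 Φ Ω) (hmaps : MapsTo Φ Ω Ω')
    (hU : ContDiffOn ℝ 2 U Ω')
    (hI : ∀ y ∈ Ω, ∀ ξ, fderivWithin ℝ Φ Ω y (Complex.I • ξ) = Complex.I • fderivWithin ℝ Φ Ω y ξ)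
    (hq : q ∈ Ω) (ξ η : Cn n) :
    sesq (matForm (D2w Ω (U ∘ Φ) q)) ξ η
      = sesq (matForm (D2w Ω' U (Φ q))) (fderivWithin ℝ Φ Ω q ξ) (fderivWithin ℝ Φ Ω q η) := by
  set T := fderivWithin ℝ (fderivWithin ℝ Φ Ω) Ω q with hT
  have h2 : HasFDerivWithinAt (fderivWithin ℝ Φ Ω) T Ω q :=
    ((hΦ.fderivWithin hΩ (m := 1) (by norm_num)).differentiableOn (by norm_num) q hq).hasFDerivWithinAt
  have hTI : ∀ a b, T a (Complex.I • b) = Complex.I • T a b := by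
    intro a b
    have h3 : HasFDerivWithinAt (fun y => fderivWithin ℝ Φ Ω y (Complex.I • b))
        (T.flip (Complex.I • b)) Ω q := by
      simpa using h2.clm_apply (hasFDerivWithinAt_const (Complex.I • b) q Ω)
    have h4 : HasFDerivWithinAt (fun y => fderivWithin ℝ Φ Ω y b) (T.flip b) Ω q := by
      simpa using h2.clm_apply (hasFDerivWithinAt_const b q Ω)
    have h5 := (h4.const_smul Complex.I).congr (fun y hy => hI y hy b) (hI q hq b)
    exact congrArg (fun L => L a) ((hΩ q hq).eq h3 h5)
  have hTs : ∀ a b, T a b = T b a := fun a b =>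
    ContDiffWithinAt.isSymmSndFDerivWithinAt (hΦ q hq) (by simp) hΩ (hcl hq) hq a b
  have hTII : ∀ a b, T (Complex.I • a) b = Complex.I • T a b := fun a b => by
    rw [hTs, hTI, hTs]
  rw [sesq_matForm, sesq_matForm]
  simp only [D2w_comp hΩ hΩ' hΦ hmaps hU hq, hI q hq, ← hT, hTI, hTII, smul_I_I, map_neg]
  apply Complex.ext
  · simp only [Complex.mul_re, Complex.add_re, Complex.ofReal_re]
    simp
    ring
  · simp

end ComplexHessianComp

section ChartChange

variable {n : ℕ} [NeZero n] {M : Type*} [TopologicalSpace M]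
  [ChartedSpace (EuclideanHalfSpace (2 * n)) M]
  {J : ∀ x : M, TangentSpace (𝓡∂ (2 * n)) x →L[ℝ] TangentSpace (𝓡∂ (2 * n)) x}
  {z z₀ : PartialEquiv M (Cn n)} {q : Cn n} {s : Set M}

theorem IsHolomorphicChart.restr_target_eventuallyEq (hz : IsHolomorphicChart J z) (hs : IsOpen s)
    (hq : q ∈ z.target) (hqs : z.symm q ∈ s) : (z.restr s).target =ᶠ[𝓝 q] z.target := by
  have h1 : ∀ᶠ y in 𝓝[z.target] q, z.symm y ∈ s := hz.continuousOn_symm q hq (hs.mem_nhds hqs)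
  rw [eventually_nhdsWithin_iff] at h1
  filter_upwards [h1] with y hy
  exact propext ⟨fun h => h.1, fun h => ⟨h, hy h⟩⟩

theorem IsHolomorphicChart.symmDeriv_restr (hz : IsHolomorphicChart J z) (hs : IsOpen s)
    (hq : q ∈ z.target) (hqs : z.symm q ∈ s) : symmDeriv (z.restr s) q = symmDeriv z q :=
  mfderivWithin_congr_set (hz.restr_target_eventuallyEq hs hq hqs)

theorem IsHolomorphicChart.D2w_restr (hz : IsHolomorphicChart J z) (hs : IsOpen s)
    (hq : q ∈ z.target) (hqs : z.symm q ∈ s) (f : Cn n → ℝ) :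
    D2w (z.restr s).target f q = D2w z.target f q := by
  have h1 := hz.restr_target_eventuallyEq hs hq hqs
  rw [D2w, fderivWithin_congr_set h1,
    (fderivWithin_eventually_congr_set h1).fderivWithin_eq_of_nhds]

theorem IsHolomorphicChart.contDiffOn_comp (hz : IsHolomorphicChart J z) {k : ℕ∞} {f : M → ℝ}
    (hf : ContMDiff (𝓡∂ (2 * n)) 𝓘(ℝ, ℝ) k f) : ContDiffOn ℝ k (f ∘ z.symm) z.target := by
  rw [← contMDiffOn_iff_contDiffOn]
  exact hf.comp_contMDiffOn (hz.contMDiffOn_symm.of_le (by exact_mod_cast le_top))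

variable [IsManifold (𝓡∂ (2 * n)) ∞ M]

theorem IsHolomorphicChart.subset_closure_interior (hz : IsHolomorphicChart J z) :
    z.target ⊆ closure (interior z.target) := by
  intro q hq
  have h1 := (hz.restr (chartAt (EuclideanHalfSpace (2 * n)) (z.symm q)).open_source).halfSpaceModel
    (z.symm q) inter_subset_right
  exact closure_mono (interior_mono inter_subset_left)
    (h1.boundaryRegion.subset_closure_interior ⟨hq, mem_chart_source _ _⟩)

/-- The derivative of a transition map as a composition of differentials on `M`. -/
theorem IsHolomorphicChart.fderivWithin_transition (hz : IsHolomorphicChart J z)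
    (hz₀ : IsHolomorphicChart J z₀) (hsub : z.source ⊆ z₀.source) (hq : q ∈ z.target) (ξ : Cn n) :
    fderivWithin ℝ (z₀ ∘ z.symm) z.target q ξ = chartDeriv z₀ (z.symm q) (symmDeriv z q ξ) := by
  have h1 := mfderiv_comp_mfderivWithin q (hz₀.mdifferentiableAt (hsub (z.map_target hq)))
    (hz.mdifferentiableWithinAt_symm hq) (hz.uniqueDiffOn q hq).uniqueMDiffWithinAt
  rw [mfderivWithin_eq_fderivWithin] at h1
  rw [h1]
  rfl

theorem IsHolomorphicChart.symmDeriv_transition (hz₀ : IsHolomorphicChart J z₀) {x : M}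
    (hx : x ∈ z₀.source) (v : EuclideanSpace ℝ (Fin (2 * n))) :
    symmDeriv z₀ (z₀ x) (chartDeriv z₀ x v) = v := by
  have h1 := hz₀.symmDeriv_chartDeriv (z₀.map_source hx) v
  rwa [z₀.left_inv hx] at h1

variable {S : ComplexStructure n M}

theorem gMatrix_eq (χ : Real11Form S) (hz : IsHolomorphicChart S.J z) {u : M → ℝ}
    (hu : ContMDiff (𝓡∂ (2 * n)) 𝓘(ℝ, ℝ) 2 u) (hq : q ∈ z.target) :
    gMatrix χ u z q = gForm z.target (formMatrix χ.toFun z) (u ∘ z.symm) q := by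
  rw [gMatrix, gForm, hess_eq hz.uniqueDiffOn (hz.contDiffOn_comp (k := 2) hu) hq]

theorem IsHolomorphicChart.transition_I_smul (hz : IsHolomorphicChart J z)
    (hz₀ : IsHolomorphicChart J z₀) (hq : q ∈ z.target) (hq₀ : z.symm q ∈ z₀.source) (ξ : Cn n) :
    chartDeriv z₀ (z.symm q) (symmDeriv z q (Complex.I • ξ))
      = Complex.I • chartDeriv z₀ (z.symm q) (symmDeriv z q ξ) := by
  rw [hz.symmDeriv_I_smul hq]
  exact hz₀.mfderiv_J _ hq₀ _

theorem formB_transition (b : Real11Form S) (hz : IsHolomorphicChart S.J z)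
    (hz₀ : IsHolomorphicChart S.J z₀) (hq : q ∈ z.target) (hq₀ : z.symm q ∈ z₀.source) (ξ η : Cn n) :
    formB b.toFun z₀ (z₀ (z.symm q)) (chartDeriv z₀ (z.symm q) (symmDeriv z q ξ))
      (chartDeriv z₀ (z.symm q) (symmDeriv z q η)) = formB b.toFun z q ξ η := by
  rw [b.formB_eq hz₀ (z₀.map_source hq₀), b.formB_eq hz hq]
  have h1 : ∀ ζ, symmDeriv z₀ (z₀ (z.symm q)) (chartDeriv z₀ (z.symm q) (symmDeriv z q ζ))
      = symmDeriv z q ζ := fun ζ => hz₀.symmDeriv_transition hq₀ _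
  rw [h1, h1, z₀.left_inv hq₀]

theorem sesq_formMatrix_transition (b : Real11Form S) (hz : IsHolomorphicChart S.J z)
    (hz₀ : IsHolomorphicChart S.J z₀) (hq : q ∈ z.target) (hq₀ : z.symm q ∈ z₀.source) (ξ η : Cn n) :
    sesq (formMatrix b.toFun z₀ (z₀ (z.symm q))) (chartDeriv z₀ (z.symm q) (symmDeriv z q ξ))
      (chartDeriv z₀ (z.symm q) (symmDeriv z q η)) = sesq (formMatrix b.toFun z q) ξ η := by
  rw [formMatrix_eq, formMatrix_eq, sesq_matForm, sesq_matForm]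
  simp only [← hz.transition_I_smul hz₀ hq hq₀, formB_transition b hz hz₀ hq hq₀]

/-- The form `χ + i∂∂̄u` transforms as a tensor under a change of holomorphic coordinates. -/
theorem sesq_gMatrix_transition (χ : Real11Form S) (hz : IsHolomorphicChart S.J z)
    (hz₀ : IsHolomorphicChart S.J z₀) {u : M → ℝ} (hu : ContMDiff (𝓡∂ (2 * n)) 𝓘(ℝ, ℝ) 2 u)
    (hq : q ∈ z.target) (hq₀ : z.symm q ∈ z₀.source) (ξ η : Cn n) :
    sesq (gMatrix χ u z₀ (z₀ (z.symm q))) (chartDeriv z₀ (z.symm q) (symmDeriv z q ξ))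
      (chartDeriv z₀ (z.symm q) (symmDeriv z q η)) = sesq (gMatrix χ u z q) ξ η := by
  rw [gMatrix_eq χ hz₀ hu (z₀.map_source hq₀), gMatrix_eq χ hz hu hq, gForm, gForm, sesq_add, sesq_add,
    sesq_formMatrix_transition χ hz hz₀ hq hq₀, ← hz.D2w_restr hz₀.isOpen_source hq hq₀]
  congr 1
  set zr := z.restr z₀.source with hzr
  have hr : IsHolomorphicChart S.J zr := hz.restr hz₀.isOpen_source
  have hqr : q ∈ zr.target := ⟨hq, hq₀⟩
  have hsub : zr.source ⊆ z₀.source := inter_subset_right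
  have hΦ : ContDiffOn ℝ 2 (z₀ ∘ zr.symm) zr.target := by
    rw [← contMDiffOn_iff_contDiffOn]
    exact (hz₀.contMDiffOn.comp hr.contMDiffOn_symm fun y hy => hsub (zr.map_target hy)).of_le
      (WithTop.coe_le_coe.2 (le_top : (2 : ℕ∞) ≤ ⊤))
  have hmaps : MapsTo (z₀ ∘ zr.symm) zr.target z₀.target := fun y hy =>
    z₀.map_source (hsub (zr.map_target hy))
  have hD : ∀ y ∈ zr.target, ∀ ζ, fderivWithin ℝ (z₀ ∘ zr.symm) zr.target y ζ
      = chartDeriv z₀ (zr.symm y) (symmDeriv zr y ζ) := fun y hy ζ =>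
    hr.fderivWithin_transition hz₀ hsub hy ζ
  have h1 := sesq_matForm_D2w_comp hr.uniqueDiffOn hr.subset_closure_interior hz₀.uniqueDiffOn hΦ hmaps
    (hz₀.contDiffOn_comp (k := 2) hu) (fun y hy ζ => by
      rw [hD y hy, hD y hy, hr.transition_I_smul hz₀ hy (hsub (zr.map_target hy))]) hqr ξ η
  have h2 : D2w zr.target ((u ∘ z₀.symm) ∘ z₀ ∘ zr.symm) q = D2w zr.target (u ∘ z.symm) q := by
    have h3 : ∀ y ∈ zr.target, ((u ∘ z₀.symm) ∘ z₀ ∘ zr.symm) y = (u ∘ z.symm) y := fun y hy =>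
      congrArg u (z₀.left_inv (hsub (zr.map_target hy)))
    exact fderivWithin_congr (fun y hy => fderivWithin_congr h3 (h3 y hy)) (fderivWithin_congr h3 (h3 q hqr))
  rw [h2, hD q hqr, hD q hqr, hz.symmDeriv_restr hz₀.isOpen_source hq hq₀] at h1
  exact h1.symm

end ChartChange

/-! ### The gradient -/

section Gradient

variable {n : ℕ}

open Matrix
open scoped ComplexOrder

/-- The vector with components `s` in the frame `P`. -/
def frameVec (P : Matrix (Fin n) (Fin n) ℂ) (s : Fin n → ℂ) : Cn n := ∑ i, s i • colVec P i

theorem frameVec_apply (P : Matrix (Fin n) (Fin n) ℂ) (s : Fin n → ℂ) (k : Fin n) :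
    frameVec P s k = (P *ᵥ s) k := by
  simp [frameVec, colVec, mulVec, dotProduct, mul_comm]

theorem sesq_frameVec {W P : Matrix (Fin n) (Fin n) ℂ} (hP : Pᴴ * W * P = 1) (s : Fin n → ℂ) :
    (sesq W (frameVec P s) (frameVec P s)).re = ∑ i, ((s i).re ^ 2 + (s i).im ^ 2) := by
  have h1 : sesq W (frameVec P s) (frameVec P s) = star (P *ᵥ s) ⬝ᵥ (W *ᵥ (P *ᵥ s)) := by
    simp only [sesq, dotProduct, mulVec, Finset.mul_sum, frameVec_apply]
    exact Finset.sum_congr rfl fun k _ => by simp [mulVec, dotProduct, mul_assoc]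
  rw [h1, star_mulVec, ← dotProduct_mulVec, mulVec_mulVec, mulVec_mulVec, hP,
    one_mulVec, dotProduct, Complex.re_sum]
  refine Finset.sum_congr rfl fun i _ => ?_
  simp
  ring

theorem apply_frameVec (L : Cn n →L[ℝ] ℝ) (P : Matrix (Fin n) (Fin n) ℂ) (s : Fin n → ℂ) :
    L (frameVec P s)
      = ∑ i, ((s i).re * L (colVec P i) + (s i).im * L (Complex.I • colVec P i)) := by
  rw [frameVec, map_sum]
  refine Finset.sum_congr rfl fun i _ => ?_
  conv_lhs => rw [← Complex.re_add_im (s i), add_smul, mul_smul]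
  rw [map_add]
  exact congrArg₂ (· + ·) (map_smul L (s i).re (colVec P i)) (map_smul L (s i).im _)

theorem exists_frameVec {W P : Matrix (Fin n) (Fin n) ℂ} (hP : Pᴴ * W * P = 1) (ξ : Cn n) :
    ∃ s, frameVec P s = ξ := ⟨_, sum_sesq_smul_colVec hP ξ⟩

/-- The square of a covector, `W^{j k̄} L_j L_{k̄}`, computed in an orthonormal frame. -/
theorem sum_inv_mul_eq_Gam {W P : Matrix (Fin n) (Fin n) ℂ} (hP : Pᴴ * W * P = 1) (L : Cn n →L[ℝ] ℝ) :
    (∑ j, ∑ k, W⁻¹ j k * ((1 / 2) * ((L (Cn.dx j) : ℂ) - Complex.I * L (Cn.dy j)))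
      * ((1 / 2) * ((L (Cn.dx k) : ℂ) + Complex.I * L (Cn.dy k)))).re
      = Gam (fun _ => 1) (colVec P) L L := by
  set a : Fin n → ℂ := fun j => (1 / 2) * ((L (Cn.dx j) : ℂ) - Complex.I * L (Cn.dy j)) with ha
  have hconj : ∀ k, (1 / 2) * ((L (Cn.dx k) : ℂ) + Complex.I * L (Cn.dy k)) = (starRingEnd ℂ) (a k) := by
    intro k
    simp only [ha]
    apply Complex.ext <;> simp
  have hW : W⁻¹ = P * Pᴴ := by
    refine inv_eq_left_inv ?_
    rw [Matrix.mul_assoc]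
    exact mul_eq_one_comm.1 hP
  have hb : ∀ i, ∑ j, P j i * a j
      = (1 / 2) * ((L (colVec P i) : ℂ) - Complex.I * L (Complex.I • colVec P i)) := by
    intro i
    have h1 : L (colVec P i) = ∑ j, ((P j i).re * L (Cn.dx j) + (P j i).im * L (Cn.dy j)) := by
      conv_lhs => rw [eq_sum_dx_dy (colVec P i)]
      simp [colVec]
    have h2 : L (Complex.I • colVec P i)
        = ∑ j, (-(P j i).im * L (Cn.dx j) + (P j i).re * L (Cn.dy j)) := by
      conv_lhs => rw [eq_sum_dx_dy (Complex.I • colVec P i)]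
      simp [colVec]
    rw [h1, h2]
    push_cast
    rw [Finset.mul_sum, ← Finset.sum_sub_distrib, Finset.mul_sum]
    refine Finset.sum_congr rfl fun j _ => ?_
    simp only [ha]
    apply Complex.ext <;> simp <;> ring
  have h3 : ∑ j, ∑ k, W⁻¹ j k * a j * (starRingEnd ℂ) (a k)
      = ∑ i, (∑ j, P j i * a j) * (starRingEnd ℂ) (∑ j, P j i * a j) := by
    simp only [hW, mul_apply, conjTranspose_apply, Finset.sum_mul, map_sum, map_mul, Finset.mul_sum]
    rw [Finset.sum_comm_cycle]
    refine Finset.sum_congr rfl fun i _ => Finset.sum_comm.trans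
      (Finset.sum_congr rfl fun j _ => Finset.sum_congr rfl fun k _ => ?_)
    simp
    ring
  simp only [hconj]
  rw [h3, Complex.re_sum, Gam, Finset.mul_sum]
  refine Finset.sum_congr rfl fun i _ => ?_
  rw [hb]
  simp
  ring

theorem exists_orthonormal_frame {W : Matrix (Fin n) (Fin n) ℂ} (hW : W.PosDef) :
    ∃ P : Matrix (Fin n) (Fin n) ℂ, Pᴴ * W * P = 1 := by
  obtain ⟨P, _, h, _⟩ := exists_simultaneous_diagonalization hW hW.isHermitian
  exact ⟨P, h⟩

variable {W P : Matrix (Fin n) (Fin n) ℂ} (hP : Pᴴ * W * P = 1) (L : Cn n →L[ℝ] ℝ)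
include hP

/-- The Cauchy-Schwarz inequality for a covector. -/
theorem sq_apply_le_Gam (ξ : Cn n) :
    L ξ ^ 2 ≤ 4 * Gam (fun _ => 1) (colVec P) L L * (sesq W ξ ξ).re := by
  obtain ⟨s, rfl⟩ := exists_frameVec hP ξ
  rw [sesq_frameVec hP, apply_frameVec, Gam]
  have h1 := Finset.sum_mul_sq_le_sq_mul_sq (Finset.univ : Finset (Fin n × Bool))
    (fun i => if i.2 then (s i.1).re else (s i.1).im)
    (fun i => if i.2 then L (colVec P i.1) else L (Complex.I • colVec P i.1))
  simp only [Fintype.sum_prod_type, Fintype.sum_bool, if_true, if_false, Bool.false_eq_true] at h1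
  refine h1.trans (le_of_eq ?_)
  simp only [one_mul, pow_two]
  ring

/-- Equality holds in the Cauchy-Schwarz inequality for a suitable vector. -/
theorem Gam_le_of_forall_sq_le {A : ℝ} (hA : 0 ≤ A)
    (h : ∀ ξ, L ξ ^ 2 ≤ 4 * A * (sesq W ξ ξ).re) : Gam (fun _ => 1) (colVec P) L L ≤ A := by
  have h1 := h (frameVec P fun i => ⟨L (colVec P i), L (Complex.I • colVec P i)⟩)
  rw [sesq_frameVec hP, apply_frameVec] at h1
  set g := Gam (fun _ => 1) (colVec P) L L with hg
  have h2 : ∑ i, (L (colVec P i) ^ 2 + L (Complex.I • colVec P i) ^ 2) = 4 * g := by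
    rw [hg, Gam]
    simp only [one_mul, pow_two]
    ring
  simp only [← pow_two, h2] at h1
  by_contra! h3
  nlinarith

end Gradient

section GradientBound

variable {n : ℕ} [NeZero n] {M : Type*} [TopologicalSpace M]
  [ChartedSpace (EuclideanHalfSpace (2 * n)) M] [IsManifold (𝓡∂ (2 * n)) ∞ M]
  {S : ComplexStructure n M} {z z₀ : PartialEquiv M (Cn n)} {q : Cn n} {ω₀ : Real11Form S} {u : M → ℝ}

open Matrix
open scoped ComplexOrder

theorem gradSq_eq_Gam (hz : IsHolomorphicChart S.J z) (hu : ContMDiff (𝓡∂ (2 * n)) 𝓘(ℝ, ℝ) 1 u)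
    (hq : q ∈ z.target) {P : Matrix (Fin n) (Fin n) ℂ} (hP : Pᴴ * formMatrix ω₀.toFun z q * P = 1) :
    gradSq ω₀ u z q = Gam (fun _ => 1) (colVec P) (fderivWithin ℝ (u ∘ z.symm) z.target q)
      (fderivWithin ℝ (u ∘ z.symm) z.target q) := by
  have hd : DifferentiableOn ℝ (u ∘ z.symm) z.target :=
    (hz.contDiffOn_comp (k := 1) hu).differentiableOn (by simp)
  rw [← sum_inv_mul_eq_Gam hP, gradSq]
  congr 1
  refine Finset.sum_congr rfl fun j _ => Finset.sum_congr rfl fun k _ => ?_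
  rw [← dz_eq hz.uniqueDiffOn hd hq, ← dzbar_eq hz.uniqueDiffOn hd hq]
  rfl

theorem sq_fderivWithin_le (hω : ω₀.IsHermitianMetric) (hz : IsHolomorphicChart S.J z)
    (hu : ContMDiff (𝓡∂ (2 * n)) 𝓘(ℝ, ℝ) 1 u) (hq : q ∈ z.target) (ξ : Cn n) :
    fderivWithin ℝ (u ∘ z.symm) z.target q ξ ^ 2
      ≤ 4 * gradSq ω₀ u z q * (sesq (formMatrix ω₀.toFun z q) ξ ξ).re := by
  obtain ⟨P, hP⟩ := exists_orthonormal_frame (hω.posDef hz hq)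
  rw [gradSq_eq_Gam hz hu hq hP]
  exact sq_apply_le_Gam hP _ ξ

theorem gradSq_nonneg (hω : ω₀.IsHermitianMetric) (hz : IsHolomorphicChart S.J z)
    (hu : ContMDiff (𝓡∂ (2 * n)) 𝓘(ℝ, ℝ) 1 u) (hq : q ∈ z.target) : 0 ≤ gradSq ω₀ u z q := by
  obtain ⟨P, hP⟩ := exists_orthonormal_frame (hω.posDef hz hq)
  rw [gradSq_eq_Gam hz hu hq hP]
  exact Gam_self_nonneg (fun _ => zero_le_one) _

theorem fderivWithin_transition_apply (hz : IsHolomorphicChart S.J z) (hz₀ : IsHolomorphicChart S.J z₀)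
    (hu : ContMDiff (𝓡∂ (2 * n)) 𝓘(ℝ, ℝ) 1 u) (hq : q ∈ z.target) (hq₀ : z.symm q ∈ z₀.source)
    (ξ : Cn n) : fderivWithin ℝ (u ∘ z₀.symm) z₀.target (z₀ (z.symm q))
      (chartDeriv z₀ (z.symm q) (symmDeriv z q ξ)) = fderivWithin ℝ (u ∘ z.symm) z.target q ξ := by
  have key : ∀ {z' : PartialEquiv M (Cn n)}, IsHolomorphicChart S.J z' → ∀ {q'}, q' ∈ z'.target →
      ∀ ζ, (fderivWithin ℝ (u ∘ z'.symm) z'.target q' ζ : ℝ)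
        = mfderiv (𝓡∂ (2 * n)) 𝓘(ℝ, ℝ) u (z'.symm q') (symmDeriv z' q' ζ) := by
    intro z' hz' q' hq' ζ
    have h1 := mfderiv_comp_mfderivWithin q' (hu.mdifferentiable (by simp) (z'.symm q'))
      (hz'.mdifferentiableWithinAt_symm hq') (hz'.uniqueDiffOn q' hq').uniqueMDiffWithinAt
    rw [mfderivWithin_eq_fderivWithin] at h1
    rw [h1]
    rfl
  have h2 := hz₀.symmDeriv_transition hq₀ (symmDeriv z q ξ)
  rw [key hz₀ (z₀.map_source hq₀), key hz hq, h2, z₀.left_inv hq₀]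

/-- `|∇u|²` does not depend on the coordinates. -/
theorem gradSq_le_transition (hω : ω₀.IsHermitianMetric) (hz : IsHolomorphicChart S.J z)
    (hz₀ : IsHolomorphicChart S.J z₀) (hu : ContMDiff (𝓡∂ (2 * n)) 𝓘(ℝ, ℝ) 1 u) (hq : q ∈ z.target)
    (hq₀ : z.symm q ∈ z₀.source) : gradSq ω₀ u z q ≤ gradSq ω₀ u z₀ (z₀ (z.symm q)) := by
  obtain ⟨P, hP⟩ := exists_orthonormal_frame (hω.posDef hz hq)
  rw [gradSq_eq_Gam hz hu hq hP]
  refine Gam_le_of_forall_sq_le hP _ (gradSq_nonneg hω hz₀ hu (z₀.map_source hq₀)) fun ξ => ?_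
  rw [← fderivWithin_transition_apply hz hz₀ hu hq hq₀, ← sesq_formMatrix_transition ω₀ hz hz₀ hq hq₀]
  exact sq_fderivWithin_le hω hz₀ hu (z₀.map_source hq₀) _

theorem continuousOn_gradSq (hω : ω₀.IsHermitianMetric) (hz : IsHolomorphicChart S.J z)
    (hu : ContMDiff (𝓡∂ (2 * n)) 𝓘(ℝ, ℝ) 1 u) : ContinuousOn (gradSq ω₀ u z) z.target := by
  have hc := hz.contDiffOn_comp (k := 1) hu
  have hd : DifferentiableOn ℝ (u ∘ z.symm) z.target := hc.differentiableOn (by simp)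
  have hc' : ∀ ξ, ContinuousOn (fun q => (fderivWithin ℝ (u ∘ z.symm) z.target q ξ : ℂ)) z.target :=
    fun ξ => Complex.continuous_ofReal.comp_continuousOn
      ((hc.continuousOn_fderivWithin hz.uniqueDiffOn (by simp)).clm_apply continuousOn_const)
  have hinv : ∀ j k, ContinuousOn (fun q => (formMatrix ω₀.toFun z q)⁻¹ j k) z.target := by
    have h1 : ContinuousOn (fun q => formMatrix ω₀.toFun z q) z.target :=
      continuousOn_pi.2 fun k => continuousOn_pi.2 fun j => (ω₀.smooth z hz k j).continuousOn
    have h2 : ContinuousOn (fun q => (formMatrix ω₀.toFun z q)⁻¹) z.target := by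
      intro q hq
      have h3 : (formMatrix ω₀.toFun z q).det ≠ 0 := (hω.posDef hz hq).det_pos.ne'
      have h4 : ContinuousAt Ring.inverse (formMatrix ω₀.toFun z q).det :=
        NormedRing.inverse_continuousAt (Units.mk0 _ h3)
      exact (continuousAt_matrix_inv _ h4).comp_continuousWithinAt (h1 q hq)
    exact fun j k => (continuousOn_pi.1 (continuousOn_pi.1 h2 j)) k
  refine Complex.continuous_re.comp_continuousOn (continuousOn_finsetSum _ fun j _ =>
    continuousOn_finsetSum _ fun k _ => ?_)
  refine ((hinv j k).mul ?_).mul ?_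
  · refine ((hc' (Cn.dx j)).sub ((continuousOn_const (c := Complex.I)).mul (hc' (Cn.dy j)))).const_smul (1 / 2 : ℂ)
      |>.congr fun q hq => ?_
    rw [show (fun w => (u (z.symm w) : ℂ)) = fun w => (((u ∘ z.symm) w : ℝ) : ℂ) from rfl,
      dz_eq hz.uniqueDiffOn hd hq]
    rfl
  · refine ((hc' (Cn.dx k)).add ((continuousOn_const (c := Complex.I)).mul (hc' (Cn.dy k)))).const_smul (1 / 2 : ℂ)
      |>.congr fun q hq => ?_
    rw [show (fun w => (u (z.symm w) : ℂ)) = fun w => (((u ∘ z.symm) w : ℝ) : ℂ) from rfl,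
      dzbar_eq hz.uniqueDiffOn hd hq]
    rfl

variable [CompactSpace M]

theorem gradSq_le_gradBound (hω : ω₀.IsHermitianMetric) (hz : IsHolomorphicChart S.J z)
    (hu : ContMDiff (𝓡∂ (2 * n)) 𝓘(ℝ, ℝ) 1 u) (hq : q ∈ z.target) :
    gradSq ω₀ u z q + 1 ≤ gradBound ω₀ u := by
  have hloc : ∀ x : M, ∃ N ∈ 𝓝 x, ∃ A : ℝ, ∀ z : PartialEquiv M (Cn n), IsHolomorphicChart S.J z →
      ∀ q ∈ z.target, z.symm q ∈ N → gradSq ω₀ u z q ≤ A := by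
    intro x
    obtain ⟨z₀, hz₀, hx⟩ := S.exists_chart x
    have h1 : ContinuousAt (gradSq ω₀ u z₀ ∘ z₀) x :=
      ((continuousOn_gradSq hω hz₀ hu).comp hz₀.continuousOn z₀.mapsTo).continuousAt
        (hz₀.isOpen_source.mem_nhds hx)
    refine ⟨z₀.source ∩ {y | gradSq ω₀ u z₀ (z₀ y) < gradSq ω₀ u z₀ (z₀ x) + 1},
      Filter.inter_mem (hz₀.isOpen_source.mem_nhds hx) (h1.eventually_lt_const (lt_add_one _)),
      gradSq ω₀ u z₀ (z₀ x) + 1, fun z hz q hq hqN => ?_⟩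
    exact (gradSq_le_transition hω hz hz₀ hu hq hqN.1).trans (le_of_lt hqN.2)
  choose N hN A hA using hloc
  obtain ⟨t, ht⟩ := CompactSpace.elim_nhds_subcover N hN
  refine add_le_add (le_csSup (a := gradSq ω₀ u z q) ⟨∑ x ∈ t, |A x|, ?_⟩ ⟨z, hz, q, hq, rfl⟩) le_rfl
  rintro r ⟨z, hz, q, hq, rfl⟩
  have h1 : z.symm q ∈ ⋃ x ∈ t, N x := by rw [ht]; trivial
  simp only [mem_iUnion, exists_prop] at h1
  obtain ⟨x, hx, hxN⟩ := h1
  exact (hA x z hz q hq hxN).trans ((le_abs_self _).trans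
    (Finset.single_le_sum (f := fun x => |A x|) (fun _ _ => abs_nonneg _) hx))

end GradientBound

/-! ### Comparison and bounds on a connected component -/

theorem D2_sub_const {n : ℕ} {f : Cn n → ℝ} (c : ℝ) (y : Cn n) : D2 (fun z => f z - c) y = D2 f y := by
  have h1 : fderiv ℝ (fun z => f z - c) = fderiv ℝ f := funext fun z => fderiv_sub_const c
  rw [D2, h1]

section SmallCharts

variable {n p : ℕ} [NeZero n] {M : Type*} [TopologicalSpace M]
  [ChartedSpace (EuclideanHalfSpace (2 * n)) M] {S : ComplexStructure n M}

variable (S) in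
theorem exists_small_chart (x : M) {N : Set M} (hN : N ∈ 𝓝 x) : ∃ z : PartialEquiv M (Cn n),
    IsHolomorphicChart S.J z ∧ x ∈ z.source ∧ z.source ⊆ N ∧
      z.source ⊆ (chartAt (EuclideanHalfSpace (2 * n)) x).source := by
  obtain ⟨z, hz, hx⟩ := S.exists_chart x
  refine ⟨z.restr (interior N ∩ (chartAt (EuclideanHalfSpace (2 * n)) x).source),
    hz.restr (isOpen_interior.inter (chartAt _ x).open_source),
    ⟨hx, mem_interior_iff_mem_nhds.2 hN, mem_chart_source _ x⟩,
    fun y hy => interior_subset hy.2.1, fun y hy => hy.2.2⟩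

variable {z : PartialEquiv M (Cn n)} {q : Cn n} {ω₀ χ : Real11Form S} {u v ψ : M → ℝ} {x : M}

/-- The defining function of the boundary in a coordinate system `z`: the first coordinate of the
chart of the smooth structure at `x`. -/
def bdryCoord (x : M) (z : PartialEquiv M (Cn n)) (q : Cn n) : ℝ :=
  extChartAt (𝓡∂ (2 * n)) x (z.symm q) 0

variable [IsManifold (𝓡∂ (2 * n)) ∞ M]

theorem bdryCoord_eq_zero_iff (hsub : z.source ⊆ (chartAt (EuclideanHalfSpace (2 * n)) x).source)
    (hq : q ∈ z.target) : bdryCoord x z q = 0 ↔ z.symm q ∈ (𝓡∂ (2 * n)).boundary M :=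
  (isBoundaryPoint_iff_coord x (hsub (z.map_target hq))).symm

theorem IsHolomorphicChart.boundaryRegion (hz : IsHolomorphicChart S.J z)
    (hsub : z.source ⊆ (chartAt (EuclideanHalfSpace (2 * n)) x).source) :
    BoundaryRegion z.target (bdryCoord x z) :=
  (hz.halfSpaceModel x hsub).boundaryRegion

theorem IsHolomorphicChart.target_mem_nhds (hz : IsHolomorphicChart S.J z)
    (hsub : z.source ⊆ (chartAt (EuclideanHalfSpace (2 * n)) x).source) (hq : q ∈ z.target)
    (hint : z.symm q ∉ (𝓡∂ (2 * n)).boundary M) : z.target ∈ 𝓝 q :=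
  (hz.boundaryRegion hsub).mem_nhds q hq (lt_of_le_of_ne ((hz.boundaryRegion hsub).nonneg q hq)
    fun h => hint ((bdryCoord_eq_zero_iff hsub hq).1 h.symm))

theorem IsAdmissible.inCone (h : IsAdmissible p ω₀ χ u) (hz : IsHolomorphicChart S.J z)
    (hu : ContMDiff (𝓡∂ (2 * n)) 𝓘(ℝ, ℝ) 2 u) (hq : q ∈ z.target) :
    InCone p (realEigenvalues ((formMatrix ω₀.toFun z q)⁻¹
      * gForm z.target (formMatrix χ.toFun z) (u ∘ z.symm) q)) := by
  rw [← gMatrix_eq χ hz hu hq]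
  exact h z hz q hq

theorem IsHolomorphicChart.regionData (hz : IsHolomorphicChart S.J z)
    (hsub : z.source ⊆ (chartAt (EuclideanHalfSpace (2 * n)) x).source) (hω : ω₀.IsHermitianMetric)
    (hv : ContMDiff (𝓡∂ (2 * n)) 𝓘(ℝ, ℝ) ∞ v) (hv_adm : IsAdmissible p ω₀ χ v) :
    RegionData p z.target (bdryCoord x z) (formMatrix ω₀.toFun z) (formMatrix χ.toFun z)
      (v ∘ z.symm) where
  toBoundaryRegion := hz.boundaryRegion hsub
  contDiffOn_W := ω₀.smooth z hz
  posDef _ hy := hω.posDef hz hy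
  contDiffOn_X := χ.smooth z hz
  isHermitian _ hy := χ.isHermitian hz hy
  contDiffOn_v := hz.contDiffOn_comp hv
  cone _ hy := hv_adm.inCone hz (hv.of_le (by norm_cast)) hy

variable (S) in
/-- Around an interior point of an open set there are coordinates that contain a closed ball. -/
theorem exists_chart_closedBall {Y : Set M} (hY : IsOpen Y) {x : M} (hx : x ∈ Y)
    (hxb : x ∉ (𝓡∂ (2 * n)).boundary M) : ∃ z : PartialEquiv M (Cn n), IsHolomorphicChart S.J z ∧
      x ∈ z.source ∧ z.source ⊆ Y ∧ z.source ⊆ (chartAt (EuclideanHalfSpace (2 * n)) x).source ∧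
      ∃ ρ : ℝ, 0 < ρ ∧ Metric.closedBall (z x) (3 * ρ) ⊆ interior z.target := by
  obtain ⟨z, hz, hxz, hzY, hsub⟩ := exists_small_chart S x (hY.mem_nhds hx)
  have h1 := hz.target_mem_nhds hsub (z.map_source hxz) (by rwa [z.left_inv hxz])
  obtain ⟨r, hr, hball⟩ := Metric.nhds_basis_closedBall.mem_iff.1 (interior_mem_nhds.2 h1)
  exact ⟨z, hz, hxz, hzY, hsub, r / 3, by positivity, by rwa [mul_div_cancel₀ r three_ne_zero]⟩

end SmallCharts

section Propagation

variable {n : ℕ} [NeZero n] {M : Type*} [TopologicalSpace M]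
  [ChartedSpace (EuclideanHalfSpace (2 * n)) M] {S : ComplexStructure n M}

/-- Almost supersolutions on a connected set that are bounded below by positive constants near its
boundary points are so near all of its points. -/
theorem IsPreconnected.eventually_ge {Y : Set M} (hY : IsPreconnected Y) {ι : Type*} {lf : Filter ι}
    {f : ι → M → ℝ} {x₀ : M} (hx₀ : x₀ ∈ Y) (hx₀b : x₀ ∈ (𝓡∂ (2 * n)).boundary M)
    (hbd : ∀ x ∈ Y, x ∈ (𝓡∂ (2 * n)).boundary M →
      ∃ N ∈ 𝓝 x, ∃ c : ℝ, 0 < c ∧ ∀ᶠ i in lf, ∀ y ∈ N, c ≤ f i y)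
    (hint : ∀ x ∈ Y, x ∉ (𝓡∂ (2 * n)).boundary M → ∃ z : PartialEquiv M (Cn n),
      IsHolomorphicChart S.J z ∧ x ∈ z.source ∧ ∃ ρ : ℝ, 0 < ρ ∧
        Metric.closedBall (z x) (3 * ρ) ⊆ interior z.target ∧ ∃ (ε : ι → ℝ)
          (W : Cn n → Matrix (Fin n) (Fin n) ℂ) (c₀ C₀ : ℝ), Filter.Tendsto ε lf (𝓝 0) ∧
          AlmostSupersolutions (fun i => f i ∘ z.symm) ε (z x) (3 * ρ) W c₀ C₀) :
    ∀ x ∈ Y, ∃ N ∈ 𝓝 x, ∃ c : ℝ, 0 < c ∧ ∀ᶠ i in lf, ∀ y ∈ N, c ≤ f i y := by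
  set G : Set M := {x | ∃ N ∈ 𝓝 x, ∃ c : ℝ, 0 < c ∧ ∀ᶠ i in lf, ∀ y ∈ N, c ≤ f i y} with hG
  have hGo : IsOpen G := by
    rw [isOpen_iff_mem_nhds]
    rintro x ⟨N, hN, h⟩
    filter_upwards [eventually_mem_nhds_iff.2 hN] with y hy using ⟨N, hy, h⟩
  refine hY.subset_of_closure_inter_subset hGo ⟨x₀, hx₀, hbd x₀ hx₀ hx₀b⟩ ?_
  rintro x ⟨hxG, hxY⟩
  by_cases hxb : x ∈ (𝓡∂ (2 * n)).boundary M
  · exact hbd x hxY hxb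
  obtain ⟨z, hz, hx, ρ, hρ, hball, ε, W, c₀, C₀, hε, hf⟩ := hint x hxY hxb
  have hnear : ∀ {b : Cn n} {y : M}, y ∈ z.source → z y ∈ Metric.ball b ρ →
      {y ∈ z.source | z y ∈ Metric.ball b ρ} ∈ 𝓝 y := fun {b y} hy hyb =>
    Filter.inter_mem (hz.isOpen_source.mem_nhds hy) ((hz.continuousOn.continuousAt
      (hz.isOpen_source.mem_nhds hy)).preimage_mem_nhds (Metric.isOpen_ball.mem_nhds hyb))
  -- a good point `b` within `ρ` of `x`, so that the ball around `b` on which the bound holds covers `x`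
  obtain ⟨b, ⟨hbs, hbρ⟩, N, hN, m, hm, hfN⟩ :=
    mem_closure_iff_nhds.1 hxG _ (hnear hx (Metric.mem_ball_self hρ))
  have hbt : z.target ∈ 𝓝 (z b) := mem_interior_iff_mem_nhds.1
    (hball (Metric.closedBall_subset_closedBall (by linarith) (Metric.ball_subset_closedBall hbρ)))
  have hsymm : ContinuousAt z.symm (z b) := hz.continuousOn_symm.continuousAt hbt
  have hN' : z.symm ⁻¹' N ∈ 𝓝 (z b) := hsymm.preimage_mem_nhds (by rwa [z.left_inv hbs])
  obtain ⟨s, hs, hsN⟩ := Metric.nhds_basis_closedBall.mem_iff.1 hN'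
  obtain ⟨c, hc, hcf⟩ := hf.eventually_ge hρ hε hbρ hs hm (hfN.mono fun i hi y hy => hi _ (hsN hy))
  refine ⟨_, hnear hx (b := z b) (Metric.mem_ball_comm.1 hbρ), c, hc, hcf.mono fun i hi y hy => ?_⟩
  have h1 := hi (z y) (Metric.ball_subset_closedBall hy.2)
  rwa [Function.comp_apply, z.left_inv hy.1] at h1

end Propagation

section Comparison

variable {n p : ℕ} [NeZero n] {M : Type*} [TopologicalSpace M] [CompactSpace M]
  [ChartedSpace (EuclideanHalfSpace (2 * n)) M] [IsManifold (𝓡∂ (2 * n)) ∞ M]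
  {S : ComplexStructure n M} {ω₀ χ : Real11Form S} {u v ψ : M → ℝ} {x₀ : M}

/-- The comparison principle: on a connected component with boundary a solution lies above a
subsolution with the same boundary values. -/
theorem le_of_isSolution (hp : 1 ≤ p) (hpn : p ≤ n) (hω : ω₀.IsHermitianMetric)
    (hv : ContMDiff (𝓡∂ (2 * n)) 𝓘(ℝ, ℝ) ∞ v) (hv_adm : IsAdmissible p ω₀ χ v)
    (hψ : Continuous ψ) (hv_sub : IsSubsolution p ω₀ χ ψ v)
    (hu : ContMDiff (𝓡∂ (2 * n)) 𝓘(ℝ, ℝ) 2 u) (hu_adm : IsAdmissible p ω₀ χ u)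
    (hu_sol : IsSolution p ω₀ χ ψ u) (huv : ∀ x ∈ (𝓡∂ (2 * n)).boundary M, u x = v x)
    (hx₀ : x₀ ∈ (𝓡∂ (2 * n)).boundary M) : ∀ y ∈ connectedComponent x₀, v y ≤ u y := by
  have : LocallyConnectedSpace M := ChartedSpace.locallyConnectedSpace (EuclideanHalfSpace (2 * n)) M
  have hYo : IsOpen (connectedComponent x₀) := isOpen_connectedComponent
  have hYc : IsCompact (connectedComponent x₀) := isClosed_connectedComponent.isCompact
  have hw : Continuous fun y => u y - v y := hu.continuous.sub hv.continuous
  obtain ⟨y₀, hy₀, hmin⟩ := hYc.exists_isMinOn ⟨x₀, mem_connectedComponent⟩ hw.continuousOn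
  by_contra! hcon
  obtain ⟨y₁, hy₁, hlt⟩ := hcon
  set m := u y₀ - v y₀ with hm
  have hm0 : m < 0 := lt_of_le_of_lt (hmin hy₁) (by simpa using hlt)
  -- for a single function, positivity of `u - v - m` would spread from the boundary to its zero `y₀`
  have hgood := isPreconnected_connectedComponent.eventually_ge (S := S) (lf := pure ())
    (f := fun (_ : Unit) y => u y - v y - m) (x₀ := x₀) mem_connectedComponent hx₀ ?_ ?_
  · obtain ⟨N, hN, c, hc, hev⟩ := hgood y₀ hy₀
    have h1 := (Filter.eventually_pure.1 hev) y₀ (mem_of_mem_nhds hN)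
    simp only [hm, sub_self] at h1
    linarith
  · intro x _ hxb
    have h1 : ∀ᶠ y in 𝓝 x, m / 2 < u y - v y :=
      hw.continuousAt.eventually (lt_mem_nhds (by simp only [huv x hxb]; linarith))
    exact ⟨_, h1, -m / 2, by linarith, Filter.eventually_pure.2 fun y hy => by
      have : m / 2 < u y - v y := hy
      linarith⟩
  · intro x hx hxb
    obtain ⟨z, hz, hxz, hzY, hsub, ρ, hρ, hball⟩ := exists_chart_closedBall S hYo hx hxb
    have hD := hz.regionData hsub hω hv hv_adm
    have hu2 : ContDiffOn ℝ 2 (u ∘ z.symm) z.target := hz.contDiffOn_comp (k := 2) hu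
    have hv2 : ContDiffOn ℝ 2 (v ∘ z.symm) z.target := hD.contDiffOn_v.of_le (by norm_cast)
    have hKt : Metric.closedBall (z x) (3 * ρ) ⊆ z.target := hball.trans interior_subset
    have hK := isCompact_closedBall (z x) (3 * ρ)
    have hW : ∀ k j, ContinuousOn (fun q => formMatrix ω₀.toFun z q k j) (Metric.closedBall (z x) (3 * ρ)) :=
      fun k j => (hD.contDiffOn_W k j).continuousOn.mono hKt
    obtain ⟨ε, hε, htr⟩ := exists_trace_lower_bound (p := p) hK hW (G := gForm z.target (formMatrix χ.toFun z)
      (u ∘ z.symm)) (fun k j => (continuousOn_gForm hD.uniqueDiffOn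
        (fun k j => (hD.contDiffOn_X k j).continuousOn) hu2 k j).mono hKt)
      (fun y hy => hD.posDef y (hKt hy))
      (fun y hy => hD.gForm_isHermitian (hKt hy) (hD.isHermitian y (hKt hy)) hu2)
      (fun y hy => hu_adm.inCone hz hu (hKt hy))
    obtain ⟨c₁, hc₁⟩ := (isCompact_range hψ).bddAbove
    -- for a fixed `u` the linearized operator is uniformly elliptic on the ball
    set F₀ : ℝ := p * ((n.choose p : ℝ) * ε⁻¹) with hF₀
    obtain ⟨a, ha, hlow⟩ := exists_wt_lower_bound n p hp hpn F₀ c₁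
    refine ⟨z, hz, hxz, ρ, hρ, hball, fun _ => 0, formMatrix ω₀.toFun z, a, F₀, tendsto_const_nhds,
      ⟨ha, fun y hy => hD.posDef y (hKt hy), hW, fun _ y hy => ?_, fun _ y hy => ?_, fun _ y hy => ?_⟩⟩
    · have h1 := mem_interior_iff_mem_nhds.1 (hball hy)
      exact ((hu2.contDiffAt h1).sub (hv2.contDiffAt h1)).sub contDiffAt_const
    · exact sub_nonneg.2 (hmin (hzY (z.map_target (hKt hy))))
    · have hyt := hKt hy
      have hyn := mem_interior_iff_mem_nhds.1 (hball hy)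
      obtain ⟨P, l, hP⟩ := hD.exists_isEigenframe hu2 hyt (hu_adm.inCone hz hu hyt)
      have hsol : sumProduct p (realEigenvalues ((formMatrix ω₀.toFun z y)⁻¹
          * gForm z.target (formMatrix χ.toFun z) (u ∘ z.symm) y)) = ψ (z.symm y) := by
        rw [← gMatrix_eq χ hz hu hyt]
        exact hu_sol z hz y hyt
      have hsum : ∑ i, wt p l i ≤ F₀ := by
        rw [sum_wt, hF₀]
        have h1 : ∀ I ∈ Finset.powersetCard p (Finset.univ : Finset (Fin n)), (∑ k ∈ I, l k)⁻¹ ≤ ε⁻¹ := by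
          intro I hI
          have h2 := htr y hy P hP.orth I hI
          simp only [hP.sesq_self] at h2
          exact inv_anti₀ hε h2
        have h3 := Finset.sum_le_sum h1
        simp only [Finset.sum_const, Finset.card_powersetCard, Finset.card_univ, Fintype.card_fin,
          nsmul_eq_mul] at h3
        gcongr
      refine ⟨P, wt p l, hP.orth, fun k => ⟨?_, ?_⟩, ?_⟩
      · refine hlow l hP.pos ?_ hsum k
        rw [← hP.sumProduct_eq, hsol]
        exact hc₁ (mem_range_self _)
      · exact (Finset.single_le_sum (fun i _ => wt_nonneg hP.pos i) (Finset.mem_univ k)).trans hsum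
      · have h1 : D2 ((fun y => u y - v y - m) ∘ z.symm) y
            = D2 (fun q => (u ∘ z.symm) q - (v ∘ z.symm) q) y := D2_sub_const m y
        rw [h1]
        refine hP.Lop_nonpos (hD.gForm_isHermitian hyt (hD.isHermitian y hyt) hv2) (hD.cone y hyt) ?_
          (hD.matForm_sub_eq hu2 hyt hyn)
        rw [hsol, ← gMatrix_eq χ hz (hv.of_le (by norm_cast)) hyt]
        exact hv_sub z hz y hyt

/-- A bound from above for admissible functions with given boundary values. Otherwise functions
with arbitrarily large maxima `m` would, after division by `m`, be almost superharmonic for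
`1 - (u - v) / m`, which is bounded below near the boundary but vanishes at the maxima. -/
theorem exists_le_add (hp : 1 ≤ p) (hpn : p ≤ n) (hω : ω₀.IsHermitianMetric)
    (hv : ContMDiff (𝓡∂ (2 * n)) 𝓘(ℝ, ℝ) ∞ v) (hv_adm : IsAdmissible p ω₀ χ v)
    (hx₀ : x₀ ∈ (𝓡∂ (2 * n)).boundary M) : ∃ c : ℝ, ∀ u : M → ℝ,
      ContMDiff (𝓡∂ (2 * n)) 𝓘(ℝ, ℝ) 2 u → IsAdmissible p ω₀ χ u →
      (∀ x ∈ (𝓡∂ (2 * n)).boundary M, u x = v x) → ∀ y ∈ connectedComponent x₀, u y ≤ v y + c := by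
  have : LocallyConnectedSpace M := ChartedSpace.locallyConnectedSpace (EuclideanHalfSpace (2 * n)) M
  have hYo : IsOpen (connectedComponent x₀) := isOpen_connectedComponent
  have hYc : IsCompact (connectedComponent x₀) := isClosed_connectedComponent.isCompact
  by_contra! hcon
  choose u hu hu_adm huv b hb hbu using fun k : ℕ => hcon (k + 1)
  have hw : ∀ k, Continuous fun y => u k y - v y := fun k => (hu k).continuous.sub hv.continuous
  choose a ha hmax using fun k => hYc.exists_isMaxOn ⟨x₀, mem_connectedComponent⟩ (hw k).continuousOn
  set m : ℕ → ℝ := fun k => u k (a k) - v (a k) with hm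
  have hmk : ∀ k : ℕ, (k + 1 : ℝ) ≤ m k := fun k => by
    have h1 : u k (b k) - v (b k) ≤ m k := hmax k (hb k)
    linarith [hbu k]
  have hm1 : ∀ k, 1 ≤ m k := fun k => le_trans (by linarith [(Nat.cast_nonneg k : (0 : ℝ) ≤ k)]) (hmk k)
  have hmle : ∀ k, ∀ y ∈ connectedComponent x₀, u k y - v y ≤ m k := fun k y hy => hmax k hy
  have hgood := isPreconnected_connectedComponent.eventually_ge (S := S) (lf := Filter.atTop)
    (f := fun (k : ℕ) y => 1 - (m k)⁻¹ * (u k y - v y)) (x₀ := x₀) mem_connectedComponent hx₀ ?_ ?_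
  · have hev : ∀ᶠ k in Filter.atTop, ∀ y ∈ connectedComponent x₀, 0 < 1 - (m k)⁻¹ * (u k y - v y) := by
      refine hYc.induction_on (p := fun s => ∀ᶠ k in Filter.atTop, ∀ y ∈ s,
        0 < 1 - (m k)⁻¹ * (u k y - v y)) (by simp) (fun s t hst h => h.mono fun k hk y hy => hk y (hst hy))
        (fun s t hs ht => ?_) fun x hx => ?_
      · filter_upwards [hs, ht] with k h1 h2 y hy using hy.elim (h1 y) (h2 y)
      · obtain ⟨N, hN, c, hc, h⟩ := hgood x hx
        exact ⟨N, mem_nhdsWithin_of_mem_nhds hN, h.mono fun k hk y hy => hc.trans_le (hk y hy)⟩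
    obtain ⟨k, hk⟩ := hev.exists
    have h1 := hk (a k) (ha k)
    have h2 : (m k)⁻¹ * m k = 1 := inv_mul_cancel₀ (by linarith [hm1 k])
    rw [show u k (a k) - v (a k) = m k from rfl, h2] at h1
    linarith
  · intro x hx hxb
    obtain ⟨z, hz, hxz, hzY, hsub⟩ := exists_small_chart S x (hYo.mem_nhds hx)
    have hD := hz.regionData hsub hω hv hv_adm
    have hq := z.map_source hxz
    have hd : bdryCoord x z (z x) = 0 := (bdryCoord_eq_zero_iff hsub hq).2 (by rwa [z.left_inv hxz])
    obtain ⟨s, hs, C, hC, hgrow⟩ := hD.exists_linear_growth hp hpn hq hd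
    have hlim : ContinuousAt (fun y => 2 * C * (bdryCoord x z (z y) + ‖z y - z x‖ ^ 2)) x := by
      have h1 := hz.continuousOn.continuousAt (hz.isOpen_source.mem_nhds hxz)
      have h2 : ContinuousAt (fun y => bdryCoord x z (z y)) x :=
        (hD.contDiffOn.continuousOn.comp hz.continuousOn z.mapsTo).continuousAt
          (hz.isOpen_source.mem_nhds hxz)
      fun_prop
    have hev : ∀ᶠ y in 𝓝 x, 2 * C * (bdryCoord x z (z y) + ‖z y - z x‖ ^ 2) < 1 / 2 := by
      refine hlim.eventually_lt_const ?_
      simp [hd]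
    have hball : ∀ᶠ y in 𝓝 x, z y ∈ Metric.closedBall (z x) s :=
      (hz.continuousOn.continuousAt (hz.isOpen_source.mem_nhds hxz)).eventually
        (Metric.closedBall_mem_nhds _ hs)
    refine ⟨_, Filter.inter_mem (hz.isOpen_source.mem_nhds hxz) (Filter.inter_mem hev hball), 1 / 2,
      by norm_num, Filter.Eventually.of_forall fun k y hy => ?_⟩
    obtain ⟨hys, hy1, hy2⟩ := hy
    have h1 := hgrow (u k ∘ z.symm) (m k) (hz.contDiffOn_comp (k := 2) (hu k))
      (fun y hy => (hu_adm k).inCone hz (hu k) hy) (by linarith [hm1 k])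
      (fun y hy => by
        have := hmle k (z.symm y) (hzY (z.map_target hy))
        simp only [Function.comp_apply]
        linarith)
      (fun y hy hdy => huv k _ ((bdryCoord_eq_zero_iff hsub hy).1 hdy))
      (z x) ⟨hq, Metric.mem_closedBall_self hs.le⟩ hd (z y) ⟨z.map_source hys, hy2⟩
    simp only [Function.comp_apply, z.left_inv hys] at h1
    have h2 : 0 ≤ bdryCoord x z (z y) + ‖z y - z x‖ ^ 2 :=
      add_nonneg (hD.nonneg _ (z.map_source hys)) (by positivity)
    have h3 : u k y - v y ≤ m k * (1 / 2) := by
      refine h1.trans ?_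
      have h4 : C * (m k + 1) * (bdryCoord x z (z y) + ‖z y - z x‖ ^ 2)
          ≤ m k * (2 * C * (bdryCoord x z (z y) + ‖z y - z x‖ ^ 2)) := by
        have h5 : 0 ≤ C * (bdryCoord x z (z y) + ‖z y - z x‖ ^ 2) := by positivity
        nlinarith [hm1 k]
      refine h4.trans (mul_le_mul_of_nonneg_left (le_of_lt hy1) (by linarith [hm1 k]))
    have hmpos : 0 < m k := by linarith [hm1 k]
    have h4 : (m k)⁻¹ * (u k y - v y) ≤ 1 / 2 := by
      rw [inv_mul_le_iff₀ hmpos]; exact h3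
    linarith
  · intro x hx hxb
    obtain ⟨z, hz, hxz, hzY, hsub, ρ, hρ, hball⟩ := exists_chart_closedBall S hYo hx hxb
    have hD := hz.regionData hsub hω hv hv_adm
    have hv2 : ContDiffOn ℝ 2 (v ∘ z.symm) z.target := hD.contDiffOn_v.of_le (by norm_cast)
    have hu2 : ∀ k, ContDiffOn ℝ 2 (u k ∘ z.symm) z.target := fun k => hz.contDiffOn_comp (k := 2) (hu k)
    have hKt : Metric.closedBall (z x) (3 * ρ) ⊆ z.target := hball.trans interior_subset
    have hK := isCompact_closedBall (z x) (3 * ρ)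
    obtain ⟨C, hC, hLop⟩ := hD.exists_Lop_one_ge hp hpn hK hKt
    refine ⟨z, hz, hxz, ρ, hρ, hball, fun k => (m k)⁻¹ * C, formMatrix ω₀.toFun z, 1, 1, ?_,
      ⟨one_pos, fun y hy => hD.posDef y (hKt hy), fun k j => (hD.contDiffOn_W k j).continuousOn.mono hKt,
        fun k y hy => ?_, fun k y hy => ?_, fun k y hy => ?_⟩⟩
    · have h1 : Filter.Tendsto m Filter.atTop Filter.atTop :=
        Filter.tendsto_atTop_mono (fun k => (by linarith [hmk k] : (k : ℝ) ≤ m k))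
          tendsto_natCast_atTop_atTop
      simpa using h1.inv_tendsto_atTop.mul_const C
    · have h1 := mem_interior_iff_mem_nhds.1 (hball hy)
      exact contDiffAt_const.sub (contDiffAt_const.mul (((hu2 k).contDiffAt h1).sub (hv2.contDiffAt h1)))
    · have hmpos : 0 < m k := by linarith [hm1 k]
      have h1 : (m k)⁻¹ * (u k (z.symm y) - v (z.symm y)) ≤ 1 := by
        rw [inv_mul_le_iff₀ hmpos, mul_one]
        exact hmle k _ (hzY (z.map_target (hKt hy)))
      exact sub_nonneg.2 h1
    · have hyn := mem_interior_iff_mem_nhds.1 (hball hy)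
      obtain ⟨P, hP, hPL⟩ := hLop (u k ∘ z.symm) (hu2 k) (fun y hy => (hu_adm k).inCone hz (hu k) hy)
        y hy hyn
      refine ⟨P, fun _ => 1, hP, fun _ => ⟨le_rfl, le_rfl⟩, ?_⟩
      have hc : ContDiffAt ℝ 2 (fun q => (u k ∘ z.symm) q - (v ∘ z.symm) q) y :=
        ((hu2 k).contDiffAt hyn).sub (hv2.contDiffAt hyn)
      have h1 : D2 ((fun y => 1 - (m k)⁻¹ * (u k y - v y)) ∘ z.symm) y
          = -((m k)⁻¹ • D2 (fun q => (u k ∘ z.symm) q - (v ∘ z.symm) q) y) := by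
        rw [← D2_const_mul hc]
        have h2 : (fun y => 1 - (m k)⁻¹ * (u k y - v y)) ∘ z.symm
            = fun q => 1 - (m k)⁻¹ * ((u k ∘ z.symm) q - (v ∘ z.symm) q) := rfl
        rw [h2, D2_sub contDiffAt_const (contDiffAt_const.mul hc)]
        have h3 : D2 (fun _ : Cn n => (1 : ℝ)) y = 0 := by
          have : fderiv ℝ (fun _ : Cn n => (1 : ℝ)) = fun _ => 0 := funext fun _ => fderiv_const_apply 1
          rw [D2, this, fderiv_fun_const]
          rfl
        rw [h3, zero_sub]
      have hmpos : 0 < m k := by linarith [hm1 k]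
      rw [h1, ← neg_one_smul ℝ, Lop_smul, Lop_smul]
      have := mul_le_mul_of_nonneg_left hPL (inv_pos.2 hmpos).le
      linarith

end Comparison

/-! ### The `C²` norm of the right-hand side -/

section C2Norm

variable {n p : ℕ} [NeZero n] {M : Type*} [TopologicalSpace M]
  [ChartedSpace (EuclideanHalfSpace (2 * n)) M]
  {S : ComplexStructure n M} {z : PartialEquiv M (Cn n)} {q : Cn n} {ω₀ χ : Real11Form S} {u v ψ : M → ℝ}

theorem formMatrix_restr (b : Real11Form S) (hz : IsHolomorphicChart S.J z) {s : Set M} (hs : IsOpen s)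
    (hq : q ∈ z.target) (hqs : z.symm q ∈ s) :
    formMatrix b.toFun (z.restr s) q = formMatrix b.toFun z q := by
  rw [formMatrix_eq, formMatrix_eq]
  congr 1
  ext ξ η
  rw [formB_apply, formB_apply, hz.symmDeriv_restr hs hq hqs]
  rfl

variable (S) in
/-- Small coordinates in which the coefficients of the metric are bounded on the whole chart. -/
theorem exists_small_chart_bounded (ω₀ : Real11Form S) (x : M) {N : Set M} (hN : N ∈ 𝓝 x) :
    ∃ z : PartialEquiv M (Cn n), IsHolomorphicChart S.J z ∧ x ∈ z.source ∧ z.source ⊆ N ∧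
      z.source ⊆ (chartAt (EuclideanHalfSpace (2 * n)) x).source ∧
      ∃ C : ℝ, 1 ≤ C ∧ ∀ q ∈ z.target, ∀ k j, ‖formMatrix ω₀.toFun z q k j‖ ≤ C := by
  obtain ⟨z, hz, hx, hzN, hsub⟩ := exists_small_chart S x hN
  have h1 : ∀ k j, ContinuousAt (fun y => ‖formMatrix ω₀.toFun z (z y) k j‖) x := fun k j =>
    (((ω₀.smooth z hz k j).continuousOn.comp hz.continuousOn z.mapsTo).continuousAt
      (hz.isOpen_source.mem_nhds hx)).norm
  set C : ℝ := ∑ k, ∑ j, ‖formMatrix ω₀.toFun z (z x) k j‖ + 1 with hC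
  have h2 : ∀ᶠ y in 𝓝 x, ∀ k j, ‖formMatrix ω₀.toFun z (z y) k j‖ < C := by
    refine Filter.eventually_all.2 fun k => Filter.eventually_all.2 fun j =>
      (h1 k j).eventually_lt_const ?_
    have h3 : ‖formMatrix ω₀.toFun z (z x) k j‖ ≤ ∑ j, ‖formMatrix ω₀.toFun z (z x) k j‖ :=
      Finset.single_le_sum (f := fun j => ‖formMatrix ω₀.toFun z (z x) k j‖)
        (fun _ _ => norm_nonneg _) (Finset.mem_univ j)
    have h4 : ∑ j, ‖formMatrix ω₀.toFun z (z x) k j‖ ≤ ∑ k, ∑ j, ‖formMatrix ω₀.toFun z (z x) k j‖ :=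
      Finset.single_le_sum (f := fun k => ∑ j, ‖formMatrix ω₀.toFun z (z x) k j‖)
        (fun _ _ => Finset.sum_nonneg fun _ _ => norm_nonneg _) (Finset.mem_univ k)
    linarith
  obtain ⟨s, hs, hso, hxs⟩ := mem_nhds_iff.1 h2
  refine ⟨z.restr s, hz.restr hso, ⟨hx, hxs⟩, fun y hy => hzN hy.1, fun y hy => hsub hy.1, C,
    le_add_of_nonneg_left (by positivity), fun q hq k j => ?_⟩
  rw [formMatrix_restr ω₀ hz hso hq.1 hq.2]
  have h3 := hs hq.2 k j
  rw [z.right_inv hq.1] at h3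
  exact h3.le

variable [IsManifold (𝓡∂ (2 * n)) ∞ M]

theorem FiniteChartCover.norm_iteratedFDerivWithin_le (𝒰 : FiniteChartCover S) {f : M → ℝ}
    (hf : ContMDiff (𝓡∂ (2 * n)) 𝓘(ℝ, ℝ) ∞ f) {a : Fin 𝒰.size} {x : M} (hx : x ∈ 𝒰.core a) {m : ℕ}
    (hm : m ≤ 2) : ‖iteratedFDerivWithin ℝ m (f ∘ (𝒰.chart a).symm) (𝒰.chart a).target (𝒰.chart a x)‖
      ≤ 𝒰.c2Norm f := by
  have hbd : ∀ (a : Fin 𝒰.size) (m : ℕ), ∃ B : ℝ, ∀ x ∈ 𝒰.core a, ‖iteratedFDerivWithin ℝ m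
      (f ∘ (𝒰.chart a).symm) (𝒰.chart a).target (𝒰.chart a x)‖ ≤ B := fun a m => by
    have hz := 𝒰.isHolomorphicChart a
    have h1 := (hz.contDiffOn_comp hf).continuousOn_iteratedFDerivWithin (m := m) (by norm_cast; exact le_top)
      hz.uniqueDiffOn
    exact (𝒰.isCompact_core a).exists_bound_of_continuousOn (h1.comp
      (hz.continuousOn.mono (𝒰.core_subset a)) fun x hx => (𝒰.chart a).map_source (𝒰.core_subset a hx))
  choose B hB using hbd
  refine le_csSup ⟨∑ a, ∑ m ∈ Finset.range 3, |B a m|, ?_⟩ ⟨a, x, hx, m, hm, rfl⟩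
  rintro r ⟨a, x, hx, m, hm, rfl⟩
  have h1 : |B a m| ≤ ∑ m ∈ Finset.range 3, |B a m| :=
    Finset.single_le_sum (f := fun m => |B a m|) (fun _ _ => abs_nonneg _) (by simp; omega)
  have h2 : ∑ m ∈ Finset.range 3, |B a m| ≤ ∑ a, ∑ m ∈ Finset.range 3, |B a m| :=
    Finset.single_le_sum (f := fun a => ∑ m ∈ Finset.range 3, |B a m|)
      (fun _ _ => Finset.sum_nonneg fun _ _ => abs_nonneg _) (Finset.mem_univ a)
  exact ((hB a m x hx).trans (le_abs_self _)).trans (h1.trans h2)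

/-- A bound on the `C²` norm bounds a function and its gradient. -/
theorem FiniteChartCover.exists_bounds (𝒰 : FiniteChartCover S) (hω : ω₀.IsHermitianMetric) (Λ : ℝ) :
    ∃ A : ℝ, 0 ≤ A ∧ ∀ f : M → ℝ, ContMDiff (𝓡∂ (2 * n)) 𝓘(ℝ, ℝ) ∞ f → 𝒰.c2Norm f ≤ Λ →
      (∀ x, |f x| ≤ Λ) ∧ ∀ z : PartialEquiv M (Cn n), IsHolomorphicChart S.J z →
        ∀ q ∈ z.target, gradSq ω₀ f z q ≤ A := by
  have hc : ∀ a : Fin 𝒰.size, ∃ c : ℝ, 0 < c ∧ ∀ x ∈ 𝒰.core a, ∀ ξ,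
      c * ‖ξ‖ ^ 2 ≤ (sesq (formMatrix ω₀.toFun (𝒰.chart a) (𝒰.chart a x)) ξ ξ).re := fun a => by
    have hz := 𝒰.isHolomorphicChart a
    have hsub : 𝒰.chart a '' 𝒰.core a ⊆ (𝒰.chart a).target := by
      rintro _ ⟨x, hx, rfl⟩
      exact (𝒰.chart a).map_source (𝒰.core_subset a hx)
    obtain ⟨c, hc, h⟩ := exists_sesq_lower_bound
      ((𝒰.isCompact_core a).image_of_continuousOn (hz.continuousOn.mono (𝒰.core_subset a)))
      (W := formMatrix ω₀.toFun (𝒰.chart a)) (fun k j => (ω₀.smooth _ hz k j).continuousOn.mono hsub)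
      (fun y hy => hω.posDef hz (hsub hy))
    exact ⟨c, hc, fun x hx => h _ (mem_image_of_mem _ hx)⟩
  choose c hc hcW using hc
  refine ⟨∑ a, Λ ^ 2 * (c a)⁻¹, Finset.sum_nonneg fun a _ => by
    have := hc a
    positivity, fun f hf hΛ => ⟨fun x => ?_, fun z hz q hq => ?_⟩⟩
  · obtain ⟨a, ha⟩ := mem_iUnion.1 (𝒰.cover.symm ▸ mem_univ x : x ∈ ⋃ a, 𝒰.core a)
    have h1 := (𝒰.norm_iteratedFDerivWithin_le hf ha (m := 0) (by norm_num)).trans hΛ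
    rwa [norm_iteratedFDerivWithin_zero, Function.comp_apply,
      (𝒰.chart a).left_inv (𝒰.core_subset a ha)] at h1
  · obtain ⟨a, ha⟩ := mem_iUnion.1 (𝒰.cover.symm ▸ mem_univ (z.symm q) : z.symm q ∈ ⋃ a, 𝒰.core a)
    have hza := 𝒰.isHolomorphicChart a
    have hsrc := 𝒰.core_subset a ha
    have hf1 : ContMDiff (𝓡∂ (2 * n)) 𝓘(ℝ, ℝ) 1 f := hf.of_le (by norm_cast)
    refine (gradSq_le_transition hω hz hza hf1 hq hsrc).trans ?_
    have htgt := (𝒰.chart a).map_source hsrc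
    have h1 := (𝒰.norm_iteratedFDerivWithin_le hf ha (m := 1) (by norm_num)).trans hΛ
    rw [norm_iteratedFDerivWithin_one _ (hza.uniqueDiffOn _ htgt)] at h1
    have h2 : gradSq ω₀ f (𝒰.chart a) (𝒰.chart a (z.symm q)) ≤ Λ ^ 2 * (c a)⁻¹ := by
      obtain ⟨P, hP⟩ := exists_orthonormal_frame (hω.posDef hza htgt)
      rw [gradSq_eq_Gam hza hf1 htgt hP]
      have hca := hc a
      refine Gam_le_of_forall_sq_le hP _ (by positivity) fun ξ => ?_
      set L := fderivWithin ℝ (f ∘ (𝒰.chart a).symm) (𝒰.chart a).target (𝒰.chart a (z.symm q))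
      have h3 : L ξ ^ 2 ≤ Λ ^ 2 * ‖ξ‖ ^ 2 := by
        rw [← mul_pow, ← sq_abs]
        exact pow_le_pow_left₀ (abs_nonneg _) ((L.le_opNorm ξ).trans (by gcongr)) 2
      have h4 : ‖ξ‖ ^ 2 ≤ (c a)⁻¹ * (sesq (formMatrix ω₀.toFun (𝒰.chart a) (𝒰.chart a (z.symm q))) ξ ξ).re := by
        rw [le_inv_mul_iff₀ hca]
        exact hcW a _ ha ξ
      have h5 := mul_le_mul_of_nonneg_left h4 (sq_nonneg Λ)
      nlinarith [mul_nonneg (sq_nonneg Λ) (sq_nonneg ‖ξ‖)]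
    refine h2.trans (Finset.single_le_sum (f := fun a => Λ ^ 2 * (c a)⁻¹) (fun a _ => ?_) (Finset.mem_univ a))
    have := hc a
    positivity

/-- A bound on `|∇u|²` bounds the coordinate derivatives. -/
theorem norm_fderivWithin_le (hω : ω₀.IsHermitianMetric) (hz : IsHolomorphicChart S.J z)
    (hu : ContMDiff (𝓡∂ (2 * n)) 𝓘(ℝ, ℝ) 1 u) (hq : q ∈ z.target) {C A : ℝ} (hC : 0 ≤ C)
    (hW : ∀ k j, ‖formMatrix ω₀.toFun z q k j‖ ≤ C) (hA : gradSq ω₀ u z q ≤ A) :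
    ‖fderivWithin ℝ (u ∘ z.symm) z.target q‖ ≤ 2 * n * Real.sqrt C * Real.sqrt A := by
  have hg := gradSq_nonneg hω hz hu hq
  have hA0 := hg.trans hA
  refine ContinuousLinearMap.opNorm_le_bound _ (by positivity) fun ξ => ?_
  have h1 := sq_fderivWithin_le hω hz hu hq ξ
  have h2 : (sesq (formMatrix ω₀.toFun z q) ξ ξ).re ≤ n ^ 2 * C * ‖ξ‖ * ‖ξ‖ :=
    ((le_abs_self _).trans (Complex.abs_re_le_norm _)).trans (norm_sesq_le hW ξ ξ)
  refine abs_le_of_sq_le_sq ?_ (by positivity)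
  refine h1.trans ?_
  have h3 : (2 * n * Real.sqrt C * Real.sqrt A * ‖ξ‖) ^ 2 = 4 * A * (n ^ 2 * C * ‖ξ‖ * ‖ξ‖) := by
    rw [mul_pow, mul_pow, mul_pow, Real.sq_sqrt hC, Real.sq_sqrt hA0]
    ring
  rw [h3]
  calc _ ≤ 4 * gradSq ω₀ u z q * (n ^ 2 * C * ‖ξ‖ * ‖ξ‖) := by gcongr
    _ ≤ _ := by gcongr

end C2Norm

section LocalEstimate

variable {n p : ℕ} [NeZero n] {M : Type*} [TopologicalSpace M] [CompactSpace M]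
  [ChartedSpace (EuclideanHalfSpace (2 * n)) M] [IsManifold (𝓡∂ (2 * n)) ∞ M]
  {S : ComplexStructure n M} {ω₀ χ : Real11Form S} {v : M → ℝ} {x₀ : M}

theorem one_le_gradBound (hω : ω₀.IsHermitianMetric) {u : M → ℝ}
    (hu : ContMDiff (𝓡∂ (2 * n)) 𝓘(ℝ, ℝ) 1 u) (x : M) : 1 ≤ gradBound ω₀ u := by
  obtain ⟨z, hz, hx⟩ := S.exists_chart x
  linarith [gradSq_le_gradBound hω hz hu (z.map_source hx), gradSq_nonneg hω hz hu (z.map_source hx)]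

/-- The solutions of the Dirichlet problem to which the estimates apply. -/
structure IsDirichletSolution (p : ℕ) (ω₀ χ : Real11Form S) (𝒰 : FiniteChartCover S) (v : M → ℝ)
    (Λ c₀ : ℝ) (ψ u : M → ℝ) : Prop where
  contMDiff_rhs : ContMDiff (𝓡∂ (2 * n)) 𝓘(ℝ, ℝ) ∞ ψ
  le_rhs : ∀ x, c₀ ≤ ψ x
  c2Norm_le : 𝒰.c2Norm (fun x => ψ x ^ (1 / (n.choose p : ℝ))) ≤ Λ
  isSubsolution : IsSubsolution p ω₀ χ ψ v
  contMDiff : ContMDiff (𝓡∂ (2 * n)) 𝓘(ℝ, ℝ) 4 u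
  isAdmissible : IsAdmissible p ω₀ χ u
  isSolution : IsSolution p ω₀ χ ψ u
  eq_of_boundary : ∀ x ∈ (𝓡∂ (2 * n)).boundary M, u x = v x

/-- In suitable coordinates around a boundary point, all solutions are local solutions with uniform
constants. -/
theorem exists_localSolution (hp : 1 ≤ p) (hpn : p ≤ n) (hω : ω₀.IsHermitianMetric)
    (hv : ContMDiff (𝓡∂ (2 * n)) 𝓘(ℝ, ℝ) ∞ v) (hv_adm : IsAdmissible p ω₀ χ v)
    (𝒰 : FiniteChartCover S) (Λ : ℝ) {c₀ : ℝ} (hc₀ : 0 < c₀)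
    (hx₀ : x₀ ∈ (𝓡∂ (2 * n)).boundary M) : ∃ z : PartialEquiv M (Cn n), IsHolomorphicChart S.J z ∧
      x₀ ∈ z.source ∧ z.source ⊆ (chartAt (EuclideanHalfSpace (2 * n)) x₀).source ∧ ∃ c B : ℝ, 0 < B ∧
      ∀ ψ u, IsDirichletSolution p ω₀ χ 𝒰 v Λ c₀ ψ u →
        LocalSolution p z.target (bdryCoord x₀ z) (formMatrix ω₀.toFun z) (formMatrix χ.toFun z)
          (v ∘ z.symm) c (B * Real.sqrt (gradBound ω₀ u)) (u ∘ z.symm) (ψ ∘ z.symm) := by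
  have : LocallyConnectedSpace M := ChartedSpace.locallyConnectedSpace (EuclideanHalfSpace (2 * n)) M
  obtain ⟨z, hz, hx, hzY, hsub, C, hC, hW⟩ := exists_small_chart_bounded S ω₀ x₀
    (isOpen_connectedComponent.mem_nhds (mem_connectedComponent (x := x₀)))
  obtain ⟨A, hA, hbounds⟩ := 𝒰.exists_bounds hω Λ
  obtain ⟨c₁, hc₁⟩ := exists_le_add hp hpn hω hv hv_adm hx₀
  set m := n.choose p with hm
  have hm0 : m ≠ 0 := (Nat.choose_pos hpn).ne'
  set D : ℝ := m * |Λ| ^ (m - 1) * (2 * n * Real.sqrt C * Real.sqrt A) with hD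
  have hD0 : 0 ≤ D := by positivity
  have hn : (1 : ℝ) ≤ n := by exact_mod_cast Nat.one_le_iff_ne_zero.2 (NeZero.ne n)
  have hsC : 1 ≤ Real.sqrt C := Real.one_le_sqrt.2 hC
  refine ⟨z, hz, hx, hsub, |c₁| + D + |Λ| ^ m + c₀⁻¹, 2 * n * Real.sqrt C, by positivity,
    fun ψ u h => ?_⟩
  have hci : 0 < c₀⁻¹ := inv_pos.2 hc₀
  have hΛm : 0 ≤ |Λ| ^ m := by positivity
  have hψpos : ∀ x, 0 < ψ x := fun x => hc₀.trans_le (h.le_rhs x)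
  have hu1 : ContMDiff (𝓡∂ (2 * n)) 𝓘(ℝ, ℝ) 1 u := h.contMDiff.of_le (by norm_num)
  have hu2 : ContMDiff (𝓡∂ (2 * n)) 𝓘(ℝ, ℝ) 2 u := h.contMDiff.of_le (by norm_num)
  set f : M → ℝ := fun x => ψ x ^ (1 / (n.choose p : ℝ)) with hf
  have hf_smooth : ContMDiff (𝓡∂ (2 * n)) 𝓘(ℝ, ℝ) ∞ f := fun x =>
    (Real.contDiffAt_rpow_const_of_ne (hψpos x).ne').contMDiffAt.comp x (h.contMDiff_rhs x)
  have hfm : ∀ x, f x ^ m = ψ x := fun x => by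
    simp only [hf, one_div]
    exact Real.rpow_inv_natCast_pow (hψpos x).le hm0
  obtain ⟨hfΛ, hfA⟩ := hbounds f hf_smooth h.c2Norm_le
  have hfΛ' : ∀ x, |f x| ≤ |Λ| := fun x => (hfΛ x).trans (le_abs_self Λ)
  have hK1 := one_le_gradBound hω hu1 x₀
  have hψd : ContDiffOn ℝ ∞ (ψ ∘ z.symm) z.target := hz.contDiffOn_comp h.contMDiff_rhs
  have hcomp := le_of_isSolution hp hpn hω hv hv_adm h.contMDiff_rhs.continuous h.isSubsolution hu2
    h.isAdmissible h.isSolution h.eq_of_boundary hx₀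
  refine ⟨hz.contDiffOn_comp (k := 4) h.contMDiff, fun y hy => h.isAdmissible.inCone hz hu2 hy,
    fun y hy => ?_, hψd.differentiableOn (by simp), fun y _ => hψpos _, fun y _ => ?_, fun y _ => ?_,
    fun y hy => ?_, ?_, fun y hy => ?_, fun y hy => hcomp _ (hzY (z.map_target hy)),
    fun y hy hdy => h.eq_of_boundary _ ((bdryCoord_eq_zero_iff hsub hy).1 hdy), fun y hy => ?_⟩
  · rw [← gMatrix_eq χ hz hu2 hy]
    exact h.isSolution z hz y hy
  · have h1 : (ψ (z.symm y))⁻¹ ≤ c₀⁻¹ := inv_anti₀ hc₀ (h.le_rhs _)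
    simp only [Function.comp_apply]
    linarith [abs_nonneg c₁]
  · have h1 : ψ (z.symm y) ≤ |Λ| ^ m := by
      rw [← hfm]
      exact (le_abs_self _).trans ((abs_pow _ _).le.trans (pow_le_pow_left₀ (abs_nonneg _) (hfΛ' _) m))
    simp only [Function.comp_apply]
    linarith [abs_nonneg c₁]
  -- the derivative of `ψ` is bounded through that of the root `f`, whose `C²` norm is controlled
  · have h1 : ψ ∘ z.symm = fun q => (f ∘ z.symm) q ^ m := funext fun q => (hfm _).symm
    have hfd : HasFDerivWithinAt (f ∘ z.symm) (fderivWithin ℝ (f ∘ z.symm) z.target y) z.target y :=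
      ((hz.contDiffOn_comp hf_smooth).differentiableOn (by simp) y hy).hasFDerivWithinAt
    have hd := ((hasDerivAt_pow m ((f ∘ z.symm) y)).comp_hasFDerivWithinAt y hfd).fderivWithin
      (hz.uniqueDiffOn y hy)
    rw [h1, show (fun q => (f ∘ z.symm) q ^ m) = (fun t => t ^ m) ∘ (f ∘ z.symm) from rfl, hd, norm_smul]
    have h2 := norm_fderivWithin_le hω hz (hf_smooth.of_le (by norm_cast)) hy (by linarith) (hW y hy)
      (hfA z hz y hy)
    have h3 : ‖m * (f ∘ z.symm) y ^ (m - 1)‖ ≤ m * |Λ| ^ (m - 1) := by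
      rw [norm_mul, norm_pow]
      simp only [RCLike.norm_natCast, Function.comp_apply, Real.norm_eq_abs]
      exact mul_le_mul_of_nonneg_left (pow_le_pow_left₀ (abs_nonneg _) (hfΛ' _) _) (Nat.cast_nonneg m)
    have h4 := mul_le_mul h3 h2 (norm_nonneg _) (by positivity)
    linarith [abs_nonneg c₁]
  · have h1 : 1 ≤ Real.sqrt (gradBound ω₀ u) := Real.one_le_sqrt.2 hK1
    have h2 : 1 ≤ (n : ℝ) * Real.sqrt C := one_le_mul_of_one_le_of_one_le hn hsC
    nlinarith
  · exact norm_fderivWithin_le hω hz hu1 hy (by linarith) (hW y hy)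
      (by linarith [gradSq_le_gradBound hω hz hu1 hy])
  · have h1 := hc₁ u hu2 h.isAdmissible h.eq_of_boundary _ (hzY (z.map_target hy))
    have h2 := le_abs_self c₁
    simp only [Function.comp_apply]
    linarith

end LocalEstimate

/-! ### The estimate in adapted coordinates -/

section Sesquilinear

variable {n : ℕ}

theorem sesq_dx (A : Matrix (Fin n) (Fin n) ℂ) (k j : Fin n) : sesq A (Cn.dx k) (Cn.dx j) = A k j := by
  simp [sesq, Cn.dx]

theorem norm_sesq_matForm_le {B : Cn n →L[ℝ] Cn n →L[ℝ] ℝ} {ξ η : Cn n} {a : ℝ}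
    (h : ∀ ζ ∈ ({ξ, Complex.I • ξ} : Set (Cn n)), ∀ τ ∈ ({η, Complex.I • η} : Set (Cn n)), |B ζ τ| ≤ a) :
    ‖sesq (matForm B) ξ η‖ ≤ a := by
  have h1 := h ξ (by simp) η (by simp)
  have h2 := h ξ (by simp) (Complex.I • η) (by simp)
  have h3 := h (Complex.I • ξ) (by simp) η (by simp)
  have h4 := h (Complex.I • ξ) (by simp) (Complex.I • η) (by simp)
  rw [sesq_matForm, norm_mul]
  have h5 : ‖(((B ξ η + B (Complex.I • ξ) (Complex.I • η) : ℝ) : ℂ)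
      + Complex.I * ((B (Complex.I • ξ) η - B ξ (Complex.I • η) : ℝ) : ℂ))‖ ≤ 4 * a := by
    refine (norm_add_le _ _).trans ?_
    rw [norm_mul, Complex.norm_I, one_mul, Complex.norm_real, Complex.norm_real, Real.norm_eq_abs,
      Real.norm_eq_abs]
    have h6 := abs_add_le (B ξ η) (B (Complex.I • ξ) (Complex.I • η))
    have h7 := abs_sub (B (Complex.I • ξ) η) (B ξ (Complex.I • η))
    linarith
  have h6 : ‖(1 / 4 : ℂ)‖ = 1 / 4 := by norm_num
  rw [h6]
  linarith

end Sesquilinear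

section Adapted

variable {n p : ℕ} [NeZero n] {M : Type*} [TopologicalSpace M]
  [ChartedSpace (EuclideanHalfSpace (2 * n)) M]
  {S : ComplexStructure n M} {ω₀ χ : Real11Form S} {v : M → ℝ} {x x₀ : M} {z z₀ : PartialEquiv M (Cn n)}
  {ρ : Cn n → ℝ}

theorem IsAdaptedBoundaryChart.symm_zero (h : IsAdaptedBoundaryChart ω₀ x z ρ) : z.symm 0 = x := by
  rw [← h.map_eq_zero, z.left_inv h.mem_source]

theorem IsAdaptedBoundaryChart.zero_mem (h : IsAdaptedBoundaryChart ω₀ x z ρ) : (0 : Cn n) ∈ z.target := by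
  rw [← h.map_eq_zero]
  exact z.map_source h.mem_source

variable [IsManifold (𝓡∂ (2 * n)) ∞ M]

/-- In adapted coordinates, the vectors without component along `∂/∂xⁿ` are tangential. Both defining
functions are nonnegative inside, up to sign, so their differentials are proportional. -/
theorem IsAdaptedBoundaryChart.fderivWithin_bdryCoord_eq_zero (h : IsAdaptedBoundaryChart ω₀ x z ρ)
    (hz₀ : IsHolomorphicChart S.J z₀)
    (hsub : z₀.source ⊆ (chartAt (EuclideanHalfSpace (2 * n)) x₀).source) (hx : x ∈ z₀.source) {ξ : Cn n}
    (hξ : (ξ (lastIndex n)).re = 0) :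
    fderivWithin ℝ (bdryCoord x₀ z₀) z₀.target (z₀ x) (chartDeriv z₀ x (symmDeriv z 0 ξ)) = 0 := by
  have hz := h.isHolomorphicChart
  have hx0 := h.symm_zero
  set zr := z.restr z₀.source with hzr
  have hr : IsHolomorphicChart S.J zr := hz.restr hz₀.isOpen_source
  have hr0 : (0 : Cn n) ∈ zr.target := ⟨h.zero_mem, show z.symm 0 ∈ z₀.source by rwa [hx0]⟩
  have hrsub : zr.source ⊆ z₀.source := inter_subset_right
  have hreg := hr.boundaryRegion (hrsub.trans hsub)
  have hreg₀ := hz₀.boundaryRegion hsub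
  have hbd : z.symm 0 ∈ (𝓡∂ (2 * n)).boundary M := by rw [hx0]; exact h.mem_boundary
  have hd0 : bdryCoord x₀ zr 0 = 0 := (bdryCoord_eq_zero_iff (hrsub.trans hsub) hr0).2 hbd
  -- the two defining functions are related by the transition map
  have hchain : ∀ ζ, fderivWithin ℝ (bdryCoord x₀ zr) zr.target 0 ζ
      = fderivWithin ℝ (bdryCoord x₀ z₀) z₀.target (z₀ x) (chartDeriv z₀ x (symmDeriv z 0 ζ)) := by
    intro ζ
    have hmaps : MapsTo (z₀ ∘ zr.symm) zr.target z₀.target := fun y hy =>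
      z₀.map_source (hrsub (zr.map_target hy))
    have hd : DifferentiableWithinAt ℝ (z₀ ∘ zr.symm) zr.target 0 := by
      have h1 : ContDiffOn ℝ ∞ (z₀ ∘ zr.symm) zr.target := by
        rw [← contMDiffOn_iff_contDiffOn]
        exact hz₀.contMDiffOn.comp hr.contMDiffOn_symm fun y hy => hrsub (zr.map_target hy)
      exact h1.differentiableOn (by simp) 0 hr0
    have h2 : ∀ y ∈ zr.target, bdryCoord x₀ zr y = (bdryCoord x₀ z₀ ∘ z₀ ∘ zr.symm) y := fun y hy => by
      simp only [bdryCoord, Function.comp_apply, z₀.left_inv (hrsub (zr.map_target hy))]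
    rw [fderivWithin_congr h2 (h2 0 hr0), fderivWithin_comp 0
      (hreg₀.contDiffOn.differentiableOn (by simp) _ (hmaps hr0)) hd hmaps (hr.uniqueDiffOn 0 hr0),
      ContinuousLinearMap.comp_apply, hr.fderivWithin_transition hz₀ hrsub hr0,
      hz.symmDeriv_restr hz₀.isOpen_source h.zero_mem hr0.2]
    change fderivWithin ℝ (bdryCoord x₀ z₀) z₀.target (z₀ (z.symm 0))
      (chartDeriv z₀ (z.symm 0) (symmDeriv z 0 ζ)) = _
    rw [hx0]
  rw [← hchain]
  set R : Cn n →L[ℝ] ℝ := Complex.reCLM.comp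
    ((EuclideanSpace.proj (lastIndex n) : Cn n →L[ℂ] ℂ).restrictScalars ℝ) with hR
  have hR_apply : ∀ ζ : Cn n, R ζ = (ζ (lastIndex n)).re := fun ζ => rfl
  have hρ : HasFDerivWithinAt (fun q => -ρ q) R zr.target 0 := by
    have h1 : HasFDerivWithinAt (fun q => ρ q + (q (lastIndex n)).re) (0 : Cn n →L[ℝ] ℝ) z.target 0 := by
      refine Asymptotics.IsBigO.hasFDerivWithinAt (n := 2) ?_ h.zero_mem (by norm_num)
      simpa using h.expansion
    have h2 := (R.hasFDerivWithinAt.sub h1).mono (inter_subset_left : zr.target ⊆ z.target)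
    simp only [sub_zero] at h2
    refine h2.congr (fun y _ => ?_) ?_ <;> simp [hR_apply]
  have hmin : IsLocalMinOn (fun q => -ρ q) zr.target 0 := by
    refine Filter.eventually_of_mem self_mem_nhdsWithin fun y hy => ?_
    have h1 : ρ 0 = 0 := (h.eq_zero_iff 0 h.zero_mem).2 hbd
    have h2 := h.nonpos y hy.1
    simp only [h1]
    linarith
  have hfirst := hreg.deriv_nonneg 0 hr0 hd0 _ R hρ hmin
  set L := fderivWithin ℝ (bdryCoord x₀ zr) zr.target 0 with hL
  have hRlast : R (Cn.dx (lastIndex n)) = 1 := by simp [hR_apply, Cn.dx]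
  -- a tangential vector on the inner side could be rescaled to offset a vector pointing outwards
  have key : ∀ ζ, R ζ = 0 → L ζ ≤ 0 := by
    intro ζ hζ
    by_contra! hpos
    have h1 := hfirst ((L (Cn.dx (lastIndex n)) / L ζ) • ζ - Cn.dx (lastIndex n)) (by
      rw [map_sub, map_smul, smul_eq_mul, div_mul_cancel₀ _ hpos.ne', sub_self])
    rw [map_sub, map_smul, hζ, hRlast] at h1
    norm_num at h1
  refine le_antisymm (key ξ hξ) ?_
  have h1 := key (-ξ) (by rw [map_neg, hR_apply, hξ, neg_zero])
  rw [map_neg] at h1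
  linarith

/-- Unitary coordinates at a point have bounded transition matrices to fixed coordinates. -/
theorem IsAdaptedBoundaryChart.norm_transition_le (h : IsAdaptedBoundaryChart ω₀ x z ρ)
    (hz₀ : IsHolomorphicChart S.J z₀) (hx : x ∈ z₀.source) {a : ℝ} (ha : 0 < a)
    (hlow : ∀ ξ, a * ‖ξ‖ ^ 2 ≤ (sesq (formMatrix ω₀.toFun z₀ (z₀ x)) ξ ξ).re) (j : Fin n) :
    ‖chartDeriv z₀ x (symmDeriv z 0 (Cn.dx j))‖ ≤ 1 + a⁻¹ := by
  have hx0 := h.symm_zero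
  have h1 := sesq_formMatrix_transition ω₀ h.isHolomorphicChart hz₀ h.zero_mem (by rwa [hx0])
    (Cn.dx j) (Cn.dx j)
  rw [h.unitary, sesq_dx, Matrix.one_apply_eq, hx0] at h1
  have h2 := hlow (chartDeriv z₀ x (symmDeriv z 0 (Cn.dx j)))
  rw [h1, Complex.one_re] at h2
  have h3 : ‖chartDeriv z₀ x (symmDeriv z 0 (Cn.dx j))‖ ^ 2 ≤ a⁻¹ := by
    rw [← one_div, le_div_iff₀ ha]
    linarith
  have h4 : 0 < a⁻¹ := inv_pos.2 ha
  nlinarith [norm_nonneg (chartDeriv z₀ x (symmDeriv z 0 (Cn.dx j)))]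

variable [CompactSpace M]

/-- The mixed normal-tangential estimate near a boundary point. -/
theorem exists_mixed_estimate_of_boundary (hp : 1 ≤ p) (hpn : p ≤ n) (hω : ω₀.IsHermitianMetric)
    (hv : ContMDiff (𝓡∂ (2 * n)) 𝓘(ℝ, ℝ) ∞ v) (hv_adm : IsAdmissible p ω₀ χ v)
    (𝒰 : FiniteChartCover S) (Λ : ℝ) {c₀ : ℝ} (hc₀ : 0 < c₀)
    (hx₀ : x₀ ∈ (𝓡∂ (2 * n)).boundary M) : ∃ N ∈ 𝓝 x₀, ∃ C : ℝ, ∀ ψ u,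
      IsDirichletSolution p ω₀ χ 𝒰 v Λ c₀ ψ u → ∀ x ∈ N, ∀ (z : PartialEquiv M (Cn n)) (ρ : Cn n → ℝ),
        IsAdaptedBoundaryChart ω₀ x z ρ → ∀ i : Fin n, i ≠ lastIndex n →
          ‖gMatrix χ u z 0 (lastIndex n) i‖ ≤ C * Real.sqrt (gradBound ω₀ u) := by
  obtain ⟨z₀, hz₀, hxz₀, hsub, c, B, hB, hloc⟩ := exists_localSolution hp hpn hω hv hv_adm 𝒰 Λ hc₀ hx₀
  have hD := hz₀.regionData hsub hω hv hv_adm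
  have hq₀ := z₀.map_source hxz₀
  have hd₀ : bdryCoord x₀ z₀ (z₀ x₀) = 0 :=
    (bdryCoord_eq_zero_iff hsub hq₀).2 (by rwa [z₀.left_inv hxz₀])
  obtain ⟨s, hs, A, hA, hhess⟩ := hD.exists_hessian_bound hp hpn hq₀ hd₀ c
  obtain ⟨r, hr, hK⟩ := hD.locallyCompact _ hq₀
  obtain ⟨a, ha, hlow⟩ := exists_sesq_lower_bound hK
    (fun k j => (hD.contDiffOn_W k j).continuousOn.mono inter_subset_left) (fun y hy => hD.posDef y hy.1)
  obtain ⟨E, hE1, hE⟩ := exists_entries_bound hK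
    (fun k j => (hD.contDiffOn_X k j).continuousOn.mono inter_subset_left)
  have hball : ∀ t : ℝ, 0 < t → ∀ᶠ x in 𝓝 x₀, z₀ x ∈ Metric.closedBall (z₀ x₀) t := fun t ht =>
    (hz₀.continuousOn.continuousAt (hz₀.isOpen_source.mem_nhds hxz₀)).eventually
      (Metric.closedBall_mem_nhds _ ht)
  set T : ℝ := 1 + a⁻¹ with hT
  have hT0 : 0 < T := by positivity
  refine ⟨_, Filter.inter_mem (hz₀.isOpen_source.mem_nhds hxz₀) (Filter.inter_mem (hball s hs) (hball r hr)),
    n ^ 2 * E * T * T + A * B * T * T, fun ψ u hu x hxN z ρ h i hi => ?_⟩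
  obtain ⟨hx, hxs, hxr⟩ := hxN
  have hz := h.isHolomorphicChart
  have hx0 := h.symm_zero
  have hu1 : ContMDiff (𝓡∂ (2 * n)) 𝓘(ℝ, ℝ) 1 u := hu.contMDiff.of_le (by norm_num)
  have hu2 : ContMDiff (𝓡∂ (2 * n)) 𝓘(ℝ, ℝ) 2 u := hu.contMDiff.of_le (by norm_num)
  have hq := z₀.map_source hx
  have hd : bdryCoord x₀ z₀ (z₀ x) = 0 :=
    (bdryCoord_eq_zero_iff hsub hq).2 (by rw [z₀.left_inv hx]; exact h.mem_boundary)
  set κ := Real.sqrt (gradBound ω₀ u) with hκ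
  have hκ1 : 1 ≤ κ := Real.one_le_sqrt.2 (one_le_gradBound hω hu1 x)
  obtain ⟨D, hDdef⟩ : ∃ D : Cn n → Cn n, ∀ ξ, D ξ = chartDeriv z₀ x (symmDeriv z 0 ξ) := ⟨_, fun _ => rfl⟩
  have hDI : ∀ ξ, D (Complex.I • ξ) = Complex.I • D ξ := fun ξ => by
    have h1 := hz.transition_I_smul hz₀ h.zero_mem (by rwa [hx0]) ξ
    rw [hx0] at h1
    rw [hDdef, hDdef, h1]
  have hDn : ∀ j, ‖D (Cn.dx j)‖ ≤ T := fun j => by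
    rw [hDdef]
    exact h.norm_transition_le hz₀ hx ha (hlow _ ⟨hq, hxr⟩) j
  have htan : ∀ ξ : Cn n, (ξ (lastIndex n)).re = 0 →
      fderivWithin ℝ (bdryCoord x₀ z₀) z₀.target (z₀ x) (D ξ) = 0 := fun ξ hξ => by
    rw [hDdef]
    exact h.fderivWithin_bdryCoord_eq_zero hz₀ hsub hx hξ
  -- the entry of `g` in adapted coordinates is a value of the sesquilinear form of the fixed chart
  have hg := sesq_gMatrix_transition χ hz hz₀ hu2 h.zero_mem (by rwa [hx0]) (Cn.dx (lastIndex n)) (Cn.dx i)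
  rw [sesq_dx, hx0, ← hDdef, ← hDdef, gMatrix_eq χ hz₀ hu2 hq, gForm, sesq_add] at hg
  rw [← hg]
  have hi1 : ((Cn.dx i : Cn n) (lastIndex n)).re = 0 := by simp [Cn.dx, Ne.symm hi]
  have hi2 : ((Complex.I • Cn.dx i : Cn n) (lastIndex n)).re = 0 := by simp [Cn.dx, Ne.symm hi]
  have hX : ‖sesq (formMatrix χ.toFun z₀ (z₀ x)) (D (Cn.dx (lastIndex n))) (D (Cn.dx i))‖
      ≤ n ^ 2 * E * T * T := by
    refine (norm_sesq_le (hE _ ⟨hq, hxr⟩) _ _).trans ?_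
    gcongr
    · exact hDn _
    · exact hDn _
  have hH : ‖sesq (matForm (D2w z₀.target (u ∘ z₀.symm) (z₀ x))) (D (Cn.dx (lastIndex n))) (D (Cn.dx i))‖
      ≤ A * (B * κ) * T * T := by
    refine norm_sesq_matForm_le fun ζ hζ τ hτ => ?_
    have hζn : ‖ζ‖ ≤ T := by
      rcases hζ with rfl | rfl
      · exact hDn _
      · rw [norm_I_smul]
        exact hDn _
    have hτn : ‖τ‖ ≤ T := by
      rcases hτ with rfl | rfl
      · exact hDn _
      · rw [norm_I_smul]
        exact hDn _
    have hτt : fderivWithin ℝ (bdryCoord x₀ z₀) z₀.target (z₀ x) τ = 0 := by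
      rcases hτ with rfl | rfl
      · exact htan _ hi1
      · rw [← hDI]
        exact htan _ hi2
    refine (hhess _ _ _ (hloc ψ u hu) (z₀ x) ⟨hq, hxs⟩ hd τ ζ hτt).trans ?_
    gcongr
  have hE0 : 0 ≤ n ^ 2 * E * T * T := by positivity
  calc _ ≤ n ^ 2 * E * T * T + A * (B * κ) * T * T := (norm_add_le _ _).trans (add_le_add hX hH)
    _ ≤ n ^ 2 * E * T * T * κ + A * (B * κ) * T * T := by
        exact add_le_add (le_mul_of_one_le_right hE0 hκ1) le_rfl
    _ = _ := by ring

/-- The mixed normal-tangential estimate on the whole boundary: by compactness, finitely many of the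
local estimates suffice. -/
theorem exists_mixed_estimate (hp : 1 ≤ p) (hpn : p ≤ n) (hω : ω₀.IsHermitianMetric)
    (hv : ContMDiff (𝓡∂ (2 * n)) 𝓘(ℝ, ℝ) ∞ v) (hv_adm : IsAdmissible p ω₀ χ v)
    (𝒰 : FiniteChartCover S) (Λ : ℝ) {c₀ : ℝ} (hc₀ : 0 < c₀) : ∃ C : ℝ, ∀ ψ u,
      IsDirichletSolution p ω₀ χ 𝒰 v Λ c₀ ψ u → ∀ (x : M) (z : PartialEquiv M (Cn n)) (ρ : Cn n → ℝ),
        IsAdaptedBoundaryChart ω₀ x z ρ → ∀ i : Fin n, i ≠ lastIndex n →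
          ‖gMatrix χ u z 0 (lastIndex n) i‖ ≤ C * Real.sqrt (gradBound ω₀ u) := by
  have hloc : ∀ x₀ : M, ∃ N ∈ 𝓝 x₀, ∃ C : ℝ, ∀ ψ u, IsDirichletSolution p ω₀ χ 𝒰 v Λ c₀ ψ u →
      ∀ x ∈ N, ∀ (z : PartialEquiv M (Cn n)) (ρ : Cn n → ℝ), IsAdaptedBoundaryChart ω₀ x z ρ →
        ∀ i : Fin n, i ≠ lastIndex n →
          ‖gMatrix χ u z 0 (lastIndex n) i‖ ≤ C * Real.sqrt (gradBound ω₀ u) := by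
    intro x₀
    by_cases hx₀ : x₀ ∈ (𝓡∂ (2 * n)).boundary M
    · exact exists_mixed_estimate_of_boundary hp hpn hω hv hv_adm 𝒰 Λ hc₀ hx₀
    · refine ⟨((𝓡∂ (2 * n)).boundary M)ᶜ, ?_, 0, fun ψ u _ x hx z ρ h => absurd h.mem_boundary hx⟩
      exact (ModelWithCorners.isClosed_boundary (I := 𝓡∂ (2 * n)) (M := M) (n := ∞)
        (by simp)).isOpen_compl.mem_nhds hx₀
  choose N hN C hC using hloc
  obtain ⟨t, ht⟩ := CompactSpace.elim_nhds_subcover N hN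
  refine ⟨∑ x ∈ t, |C x|, fun ψ u hu x z ρ h i hi => ?_⟩
  have h1 : x ∈ ⋃ x ∈ t, N x := by rw [ht]; trivial
  simp only [mem_iUnion, exists_prop] at h1
  obtain ⟨x₁, hx₁, hxN⟩ := h1
  refine (hC x₁ ψ u hu x hxN z ρ h i hi).trans ?_
  gcongr
  exact (le_abs_self _).trans (Finset.single_le_sum (f := fun x => |C x|) (fun _ _ => abs_nonneg _) hx₁)

end Adapted

end

theorem mainTheorem3 {n : ℕ} [NeZero n] (hn : 2 ≤ n) {p : ℕ} (hp : 1 ≤ p) (hpn : p ≤ n)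
    {M : Type*} [TopologicalSpace M] [T2Space M] [CompactSpace M]
    [ChartedSpace (EuclideanHalfSpace (2 * n)) M] [IsManifold (𝓡∂ (2 * n)) ∞ M]
    (S : ComplexStructure n M)
    (ω₀ : Real11Form S) (hω₀ : ω₀.IsHermitianMetric) (χ : Real11Form S)
    (𝒰 : FiniteChartCover S)
    (φ : (𝓡∂ (2 * n)).boundary M → ℝ)
    (v : M → ℝ) (hv : ContMDiff (𝓡∂ (2 * n)) 𝓘(ℝ, ℝ) ∞ v) (hv_adm : IsAdmissible p ω₀ χ v)
    (hv_bdry : ∀ x : (𝓡∂ (2 * n)).boundary M, v x = φ x)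
    (Λ c₀ : ℝ) (hc₀ : 0 < c₀) :
    ∃ C : ℝ, ∀ ψ : M → ℝ, ContMDiff (𝓡∂ (2 * n)) 𝓘(ℝ, ℝ) ∞ ψ → (∀ x, c₀ ≤ ψ x) →
      𝒰.c2Norm (fun x => ψ x ^ (1 / (n.choose p : ℝ))) ≤ Λ →
      IsSubsolution p ω₀ χ ψ v →
      ∀ u : M → ℝ, ContMDiff (𝓡∂ (2 * n)) 𝓘(ℝ, ℝ) 4 u → IsAdmissible p ω₀ χ u →
        IsSolution p ω₀ χ ψ u → (∀ x : (𝓡∂ (2 * n)).boundary M, u x = φ x) →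
        ∀ (x : M) (z : PartialEquiv M (Cn n)) (ρ : Cn n → ℝ), IsAdaptedBoundaryChart ω₀ x z ρ →
          ∀ i : Fin n, i ≠ lastIndex n →
            ‖gMatrix χ u z 0 (lastIndex n) i‖ ≤ C * Real.sqrt (gradBound ω₀ u) := by
  obtain ⟨C, hC⟩ := exists_mixed_estimate hp hpn hω₀ hv hv_adm 𝒰 Λ hc₀
  exact ⟨C, fun ψ hψ hψc hψΛ hsub u hu hu_adm hu_sol hu_bdry x z ρ h i hi =>
    hC ψ u ⟨hψ, hψc, hψΛ, hsub, hu, hu_adm, hu_sol, fun x hx =>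
      (hu_bdry ⟨x, hx⟩).trans (hv_bdry ⟨x, hx⟩).symm⟩ x z ρ h i hi⟩
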